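/- Let $N\ge 1$. The Yangian $Y(\mathfrak{gl}_N)$ is the unital associative $\mathbb C$-algebra with generators $T_{ab}^{\{s\}}$ ($1\le a,b\le N$, $s\ge 1$), series $T_{ab}(u)=\delta_{ab}+\sum_{s\ge1}T_{ab}^{\{s\}}u^{-s}$, relations $$(u-v)\,[T_{ab}(u),T_{cd}(v)]=T_{cb}(v)T_{ad}(u)-T_{cb}(u)T_{ad}(v),$$ and coproduct $\Delta(T_{ab}(u))=\sum_{c=1}^N T_{cb}(u)\otimes T_{ac}(u)$. A vector $v$ of a $Y(\mathfrak{gl}_N)$-module is a weight singular vector if $T_{ba}(u)v=0$ for all $a<b$ and $T_{aa}(u)v=\langle T_{aa}(u)v\rangle\,v$ with $\langle T_{aa}(u)v\rangle\in\mathbb C[[u^{-1}]]$ for all $a$. Let $R(u)=u+\sum_{a,b}E_{ab}\otimes E_{ba}$ and $T(u)=\sum_{a,b}E_{ab}\otimes T_{ab}(u)$. For $\xi=(\xi^1,\dots,\xi^{N-1})\in\mathbb Z_{\ge0}^{N-1}$ put $|\xi|=\sum_a\xi^a$, $\xi^{<a}=\sum_{b<a}\xi^b$, and let $t=(t^1_1,\dots,t^1_{\xi^1};\dots;t^{N-1}_1,\dots,t^{N-1}_{\xi^{N-1}})$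 be variables. Set $$\widehat{\mathbb B}_\xi(t)=(\mathrm{tr}^{\otimes|\xi|}\otimes\mathrm{id})\Bigl(T^{(1,|\xi|+1)}(t^1_1)\cdots T^{(|\xi|,|\xi|+1)}(t^{N-1}_{\xi^{N-1}})\prod_{(a,i)<(b,j)}R^{(\xi^{<b}+j,\,\xi^{<a}+i)}(t^b_j-t^a_i)\;E_{21}^{\otimes\xi^1}\otimes\cdots\otimes E_{N,N-1}^{\otimes\xi^{N-1}}\otimes1\Bigr),$$ where the pairs $(a,i)$ are ordered lexicographically and the factor with $(a,i),(b,j)$ stands to the left of the factor with $(c,k),(d,l)$ if $(a,i)<(c,k)$, or $(a,i)=(c,k)$ and $(b,j)<(d,l)$; and $$\mathbb B_\xi(t)=\widehat{\mathbb B}_\xi(t)\prod_{a=1}^{N-1}\prod_{1\le i<j\le\xi^a}\frac1{t^a_j-t^a_i+1}\prod_{1\le a<b<N}\prod_{i=1}^{\xi^a}\prod_{j=1}^{\xi^b}\frac1{t^b_j-t^a_i}.$$ Set $W_k(t_1,\dots,t_k)=\prod_{1\le i<j\le k}\frac{t_i-t_j-1}{t_i-t_j}$ and $$\overline{\mathrm{Sym}}{}^\xi_t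 f(t)=\sum_{\sigma\in S_{\xi^1}\times\cdots\times S_{\xi^{N-1}}}\Bigl(f(t)\prod_{a=1}^{N-1}W_{\xi^a}(t^a_1,\dots,t^a_{\xi^a})\Bigr)\Big|_{t^a_i\mapsto t^a_{\sigma^a(i)}}.$$ For $\eta\le\xi$ (that is, $\eta^a\le\xi^a$ for all $a$) let $t_{[\eta]}$ consist of the $t^a_i$ with $i\le\eta^a$, and $t_{(\eta,\xi]}$ of the $t^a_i$ with $\eta^a<i\le\xi^a$. **Theorem.** Let $V_1,V_2$ be $Y(\mathfrak{gl}_N)$-modules, $v_1\in V_1$, $v_2\in V_2$ weight singular vectors, and $\xi^1,\dots,\xi^{N-1}$ nonnegative integers. Then, with $\mathbb B_\xi(t)$ on the left acting in $V_1\otimes V_2$ via $\Delta$, $$\mathbb B_\xi(t)(v_1\otimes v_2)=\sum_{\eta\le\xi}\ \prod_{a=1}^{N-1}\frac1{(\xi^a-\eta^a)!\,\eta^a!}\ \overline{\mathrm{Sym}}{}^\xi_t\Biggl[\prod_{a=1}^{N-2}\prod_{i=1}^{\eta^{a+1}}\prod_{j=\eta^a+1}^{\xi^a}\frac{t^{a+1}_i-t^a_j+1}{t^{a+1}_i-t^a_j}$$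 $$\times\prod_{a=1}^{N-1}\Bigl(\prod_{i=1}^{\eta^a}\langle T_{aa}(t^a_i)v_2\rangle\prod_{j=\eta^a+1}^{\xi^a}\langle T_{a+1,a+1}(t^a_j)v_1\rangle\Bigr)\ \mathbb B_\eta(t_{[\eta]})v_1\otimes\mathbb B_{\xi-\eta}(t_{(\eta,\xi]})v_2\Biggr].$$ The identity holds in $(V_1\otimes V_2)[[\,(t^a_i)^{-1}\,]]\otimes_{\mathcal R}\mathrm{Frac}\,\mathcal R$, where $\mathcal R=\mathbb C[[\,(t^a_i)^{-1}\,]]$ is the ring of power series in all the $(t^a_i)^{-1}$. -/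

import Mathlib

open scoped TensorProduct Nat

noncomputable section

namespace YangianBethe

/-! ## The Yangian `Y(gl_N)` -/

section Yangian

variable (N : ℕ)

/-- In the free algebra on symbols `T_{ab}^{(s+1)}`, the coefficient of `u^{-s}` of
`T_{ab}(u) = δ_{ab} + ∑_{s ≥ 1} T_{ab}^{(s)} u^{-s}`. -/
def freeT (a b : Fin N) : ℕ → FreeAlgebra ℂ (Fin N × Fin N × ℕ)
  | 0 => if a = b then 1 else 0
  | s + 1 => FreeAlgebra.ι ℂ (a, b, s)

/-- The defining relations
`(u - v) [T_{ab}(u), T_{cd}(v)] = T_{cb}(v) T_{ad}(u) - T_{cb}(u) T_{ad}(v)`,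
read off at the coefficients of `u^{-r} v^{-s}`, `r, s ≥ 0`
(at `u v^{-s}` and `u^{-r} v` both sides vanish, as `T_{ab}^{(0)} = δ_{ab}`). -/
inductive YangianRel :
    FreeAlgebra ℂ (Fin N × Fin N × ℕ) → FreeAlgebra ℂ (Fin N × Fin N × ℕ) → Prop
  | rel (a b c d : Fin N) (r s : ℕ) :
    YangianRel
      ((freeT N a b (r + 1) * freeT N c d s - freeT N c d s * freeT N a b (r + 1))
        - (freeT N a b r * freeT N c d (s + 1) - freeT N c d (s + 1) * freeT N a b r))
      (freeT N c b s * freeT N a d r - freeT N c b r * freeT N a d s)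

/-- The Yangian `Y(gl_N)` over `ℂ`. -/
def Yangian : Type := RingQuot (YangianRel N)

instance : Ring (Yangian N) := inferInstanceAs (Ring (RingQuot (YangianRel N)))

instance : Algebra ℂ (Yangian N) := inferInstanceAs (Algebra ℂ (RingQuot (YangianRel N)))

variable {N}

/-- The coefficient `T_{ab}^{(s)} ∈ Y(gl_N)` of `u^{-s}` in `T_{ab}(u)`; `T_{ab}^{(0)} = δ_{ab}`. -/
def Yangian.T (a b : Fin N) (s : ℕ) : Yangian N :=
  RingQuot.mkAlgHom ℂ (YangianRel N) (freeT N a b s)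

/-- The relations of the Yangian for a family of elements of an algebra, coefficientwise. -/
def SatisfiesRTT {A : Type*} [Ring A] (t : Fin N → Fin N → ℕ → A) : Prop :=
  ∀ (a b c d : Fin N) (r s : ℕ),
    (t a b (r + 1) * t c d s - t c d s * t a b (r + 1))
        - (t a b r * t c d (s + 1) - t c d (s + 1) * t a b r)
      = t c b s * t a d r - t c b r * t a d s

theorem Yangian.T_zero (a b : Fin N) : Yangian.T a b 0 = if a = b then 1 else 0 := by
  unfold Yangian.T freeT
  split_ifs
  · exact map_one _
  · exact map_zero _

theorem Yangian.T_rtt : SatisfiesRTT (Yangian.T (N := N)) := by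
  intro a b c d r s
  have h := RingQuot.mkAlgHom_rel ℂ (YangianRel.rel (N := N) a b c d r s)
  simp only [map_sub, map_mul] at h
  exact h

/-- The universal property of the Yangian. -/
def Yangian.lift {A : Type*} [Ring A] [Algebra ℂ A] (t : Fin N → Fin N → ℕ → A)
    (h0 : ∀ a b, t a b 0 = if a = b then 1 else 0) (h : SatisfiesRTT t) : Yangian N →ₐ[ℂ] A :=
  RingQuot.liftAlgHom ℂ
    ⟨FreeAlgebra.lift ℂ (fun p : Fin N × Fin N × ℕ => t p.1 p.2.1 (p.2.2 + 1)), by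
      have key : ∀ (a b : Fin N) (s : ℕ),
          FreeAlgebra.lift ℂ (fun p : Fin N × Fin N × ℕ => t p.1 p.2.1 (p.2.2 + 1))
            (freeT N a b s) = t a b s := by
        intro a b s
        cases s with
        | zero =>
          rw [h0]
          unfold freeT
          split_ifs
          · exact map_one _
          · exact map_zero _
        | succ s => simp [freeT]
      rintro _ _ ⟨a, b, c, d, r, s⟩
      simp only [map_sub, map_mul, key]
      exact h a b c d r s⟩

theorem Yangian.lift_T {A : Type*} [Ring A] [Algebra ℂ A] (t : Fin N → Fin N → ℕ → A)
    (h0 : ∀ a b, t a b 0 = if a = b then 1 else 0) (h : SatisfiesRTT t) (a b : Fin N) (s : ℕ) :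
    Yangian.lift t h0 h (Yangian.T a b s) = t a b s := by
  unfold Yangian.lift Yangian.T
  erw [RingQuot.liftAlgHom_mkAlgHom_apply]
  cases s with
  | zero =>
    rw [h0]
    unfold freeT
    split_ifs
    · exact map_one _
    · exact map_zero _
  | succ s => simp [freeT]

/-- The coefficient of `u^{-s}` in `∑_c T_{cb}(u) ⊗ T_{ac}(u)`. -/
def comulT (a b : Fin N) (s : ℕ) : Yangian N ⊗[ℂ] Yangian N :=
  ∑ c : Fin N, ∑ p ∈ Finset.HasAntidiagonal.antidiagonal s, Yangian.T c b p.1 ⊗ₜ[ℂ] Yangian.T a c p.2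

theorem comulT_zero (a b : Fin N) :
    comulT a b 0 = if a = b then 1 else 0 := by
  simp only [comulT, Finset.Nat.antidiagonal_zero, Finset.sum_singleton, Yangian.T_zero]
  split_ifs with h
  · subst h
    rw [Finset.sum_eq_single a]
    · simp [Algebra.TensorProduct.one_def]
    · intro c _ hc
      simp [hc]
    · simp
  · apply Finset.sum_eq_zero
    intro c _
    by_cases hc : c = b
    · subst hc
      simp [h]
    · simp [hc]

open PowerSeries in
/-- The relations of the Yangian as an identity of power series in `x = u⁻¹` (outer variable)
and `y = v⁻¹` (inner variable). -/
theorem satisfiesRTT_iff {A : Type*} [Ring A] (t : Fin N → Fin N → ℕ → A)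
    (h0 : ∀ a b, t a b 0 = if a = b then 1 else 0) :
    SatisfiesRTT t ↔ ∀ a b c d : Fin N,
      (C X - X) * (map C (mk (t a b)) * C (mk (t c d)))
          + C X * X * (map C (mk (t c b)) * C (mk (t a d)))
        = (C X - X) * (C (mk (t c d)) * map C (mk (t a b)))
          + C X * X * (C (mk (t c b)) * map C (mk (t a d)) : PowerSeries (PowerSeries A)) := by
  have e1 : ∀ (p q : ℕ → A) (m k : ℕ),
      coeff k (coeff m (map C (mk p) * C (mk q) : PowerSeries (PowerSeries A))) = p m * q k := by
    intro p q m k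
    rw [coeff_mul_C, coeff_map, coeff_mk, coeff_C_mul, coeff_mk]
  have e2 : ∀ (p q : ℕ → A) (m k : ℕ),
      coeff k (coeff m (C (mk q) * map C (mk p) : PowerSeries (PowerSeries A))) = q k * p m := by
    intro p q m k
    rw [coeff_C_mul, coeff_map, coeff_mk, coeff_mul_C, coeff_mk]
  have e3 : ∀ (F : PowerSeries (PowerSeries A)) (m : ℕ),
      coeff m ((C X : PowerSeries (PowerSeries A)) * F) = X * coeff m F :=
    fun F m => coeff_C_mul m F X
  constructor
  · intro h a b c d
    ext m k
    rcases m with _ | m <;> rcases k with _ | k <;>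
      simp only [sub_mul, map_add, map_sub, mul_assoc, e3, coeff_zero_X_mul,
        coeff_succ_X_mul, e1, e2, map_zero, mul_zero, h0]
    · split_ifs <;> simp
    · split_ifs <;> simp
    · have := h a b c d m k
      rw [← sub_eq_zero] at this ⊢
      rw [← this]
      abel
  · intro h a b c d r s
    have := congrArg (fun f => coeff (s + 1) (coeff (r + 1) f)) (h a b c d)
    simp only [sub_mul, map_add, map_sub, mul_assoc, e3,
      coeff_succ_X_mul, e1, e2] at this
    rw [← sub_eq_zero] at this ⊢
    rw [← this]
    abel

theorem comul_rtt_aux {ι S : Type*} [Fintype ι] [Ring S] (k m : S)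
    (kc : ∀ f, k * f = f * k) (mc : ∀ f, m * f = f * m) (Px Qx Py Qy : ι → ι → S)
    (c1 : ∀ a b c d, Qx a b * Py c d = Py c d * Qx a b)
    (c2 : ∀ a b c d, Qy a b * Px c d = Px c d * Qy a b)
    (A1 : ∀ a e c f, k * (Qx a e * Qy c f) + m * (Qx c e * Qy a f)
      = k * (Qy c f * Qx a e) + m * (Qy c e * Qx a f))
    (A2 : ∀ e b f d, k * (Px e b * Py f d) + m * (Px f b * Py e d)
      = k * (Py f d * Px e b) + m * (Py f b * Px e d)) (a b c d : ι) :
    k * ((∑ e, Px e b * Qx a e) * ∑ f, Py f d * Qy c f)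
        + m * ((∑ e, Px e b * Qx c e) * ∑ f, Py f d * Qy a f)
      = k * ((∑ f, Py f d * Qy c f) * ∑ e, Px e b * Qx a e)
        + m * ((∑ f, Py f b * Qy c f) * ∑ e, Px e d * Qx a e) := by
  calc k * ((∑ e, Px e b * Qx a e) * ∑ f, Py f d * Qy c f)
        + m * ((∑ e, Px e b * Qx c e) * ∑ f, Py f d * Qy a f)
      = ∑ e, ∑ f, (Px e b * Py f d) *
          (k * (Qx a e * Qy c f) + m * (Qx c e * Qy a f)) := by
        rw [Finset.sum_mul_sum, Finset.sum_mul_sum]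
        simp only [Finset.mul_sum, ← Finset.sum_add_distrib]
        refine Finset.sum_congr rfl fun e _ => Finset.sum_congr rfl fun f _ => ?_
        rw [mul_add, ← mul_assoc (Px e b * Py f d) k, ← kc, ← mul_assoc (Px e b * Py f d) m, ← mc]
        simp only [mul_assoc]
        rw [← mul_assoc (Qx a e) (Py f d), c1, ← mul_assoc (Qx c e) (Py f d), c1]
        simp only [mul_assoc]
    _ = ∑ e, ∑ f, ((Px e b * Py f d) * (k * (Qy c f * Qx a e))
          + (Px e b * Py f d) * (m * (Qy c e * Qx a f))) := by
        simp only [A1, mul_add]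
    _ = ∑ e, ∑ f, (k * (Px e b * Py f d) + m * (Px f b * Py e d)) * (Qy c f * Qx a e) := by
        simp only [Finset.sum_add_distrib, add_mul]
        congr 1
        · refine Finset.sum_congr rfl fun e _ => Finset.sum_congr rfl fun f _ => ?_
          rw [← mul_assoc _ k, ← kc]
        · rw [Finset.sum_comm]
          refine Finset.sum_congr rfl fun e _ => Finset.sum_congr rfl fun f _ => ?_
          rw [← mul_assoc _ m, ← mc]
    _ = ∑ e, ∑ f, (k * (Py f d * Px e b) * (Qy c f * Qx a e)
          + m * (Py f b * Px e d) * (Qy c f * Qx a e)) := by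
        simp only [A2, add_mul]
    _ = k * ((∑ f, Py f d * Qy c f) * ∑ e, Px e b * Qx a e)
        + m * ((∑ f, Py f b * Qy c f) * ∑ e, Px e d * Qx a e) := by
        rw [Finset.sum_mul_sum, Finset.sum_mul_sum, Finset.sum_comm]
        simp only [Finset.mul_sum, ← Finset.sum_add_distrib]
        refine Finset.sum_congr rfl fun f _ => Finset.sum_congr rfl fun e _ => ?_
        simp only [mul_assoc]
        rw [← mul_assoc (Qy c f) (Px e b), c2, ← mul_assoc (Qy c f) (Px e d), c2]
        simp only [mul_assoc]

open PowerSeries in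
theorem comulT_rtt : SatisfiesRTT (comulT (N := N)) := by
  rw [satisfiesRTT_iff _ comulT_zero]
  set P : Fin N → Fin N → ℕ → Yangian N ⊗[ℂ] Yangian N :=
    fun a b s => Yangian.T a b s ⊗ₜ 1 with hP
  set Q : Fin N → Fin N → ℕ → Yangian N ⊗[ℂ] Yangian N :=
    fun a b s => 1 ⊗ₜ Yangian.T a b s with hQ
  have P0 : ∀ a b, P a b 0 = if a = b then 1 else 0 := by
    intro a b
    simp only [hP, Yangian.T_zero]
    split_ifs <;> simp [Algebra.TensorProduct.one_def]
  have Q0 : ∀ a b, Q a b 0 = if a = b then 1 else 0 := by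
    intro a b
    simp only [hQ, Yangian.T_zero]
    split_ifs <;> simp [Algebra.TensorProduct.one_def]
  have hPr : SatisfiesRTT P := by
    intro a b c d r s
    simp only [hP, Algebra.TensorProduct.tmul_mul_tmul, mul_one, ← TensorProduct.sub_tmul]
    rw [Yangian.T_rtt a b c d r s]
  have hQr : SatisfiesRTT Q := by
    intro a b c d r s
    simp only [hQ, Algebra.TensorProduct.tmul_mul_tmul, mul_one, ← TensorProduct.tmul_sub]
    rw [Yangian.T_rtt a b c d r s]
  rw [satisfiesRTT_iff P P0] at hPr
  rw [satisfiesRTT_iff Q Q0] at hQr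
  have hPQ : ∀ a b c d r s, P a b r * Q c d s = Q c d s * P a b r := by
    intro a b c d r s
    simp [hP, hQ]
  have hD : ∀ a b, mk (comulT a b) = ∑ c : Fin N, mk (P c b) * mk (Q a c) := by
    intro a b
    ext s
    simp [comulT, coeff_mul, hP, hQ]
  set Px := fun a b => (map C (mk (P a b)) : PowerSeries (PowerSeries (Yangian N ⊗[ℂ] Yangian N)))
    with hPx
  set Qx := fun a b => (map C (mk (Q a b)) : PowerSeries (PowerSeries (Yangian N ⊗[ℂ] Yangian N)))
    with hQx
  set Py := fun a b => (C (mk (P a b)) : PowerSeries (PowerSeries (Yangian N ⊗[ℂ] Yangian N)))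
    with hPy
  set Qy := fun a b => (C (mk (Q a b)) : PowerSeries (PowerSeries (Yangian N ⊗[ℂ] Yangian N)))
    with hQy
  set k : PowerSeries (PowerSeries (Yangian N ⊗[ℂ] Yangian N)) := C X - X with hk
  set m : PowerSeries (PowerSeries (Yangian N ⊗[ℂ] Yangian N)) := C X * X with hm
  have yc : ∀ f : PowerSeries (PowerSeries (Yangian N ⊗[ℂ] Yangian N)), C X * f = f * C X := by
    intro f
    ext r s
    rw [coeff_C_mul, coeff_mul_C, (PowerSeries.commute_X _).eq]
  have xc : ∀ f : PowerSeries (PowerSeries (Yangian N ⊗[ℂ] Yangian N)), X * f = f * X :=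
    fun f => ((PowerSeries.commute_X f).eq).symm
  have kc : ∀ f, k * f = f * k := by
    intro f
    rw [hk, sub_mul, mul_sub, yc, xc]
  have mc : ∀ f, m * f = f * m := by
    intro f
    rw [hm, mul_assoc, xc, ← mul_assoc, yc, mul_assoc]
  have c1 : ∀ a b c d, Qx a b * Py c d = Py c d * Qx a b := by
    intro a b c d
    ext r s
    simp [hQx, hPy, coeff_C_mul, coeff_mul_C, hPQ]
  have c2 : ∀ a b c d, Qy a b * Px c d = Px c d * Qy a b := by
    intro a b c d
    ext r s
    simp [hQy, hPx, coeff_C_mul, coeff_mul_C, hPQ]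
  have hDx : ∀ a b, (map C (mk (comulT a b)) :
      PowerSeries (PowerSeries (Yangian N ⊗[ℂ] Yangian N))) = ∑ c, Px c b * Qx a c := by
    intro a b
    simp [hD, hPx, hQx]
  have hDy : ∀ a b, (C (mk (comulT a b)) :
      PowerSeries (PowerSeries (Yangian N ⊗[ℂ] Yangian N))) = ∑ c, Py c b * Qy a c := by
    intro a b
    simp [hD, hPy, hQy]
  intro a b c d
  simp only [hDx, hDy]
  exact comul_rtt_aux k m kc mc Px Qx Py Qy c1 c2 (fun a e c f => hQr a e c f)
    (fun e b f d => hPr e b f d) a b c d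

/-- The coproduct `Δ(T_{ab}(u)) = ∑_c T_{cb}(u) ⊗ T_{ac}(u)`. -/
def Yangian.comul : Yangian N →ₐ[ℂ] Yangian N ⊗[ℂ] Yangian N :=
  Yangian.lift comulT comulT_zero comulT_rtt

/-- The `Y(gl_N)`-module structure on `V₁ ⊗ V₂` given by the coproduct. -/
def tensorRep {V₁ V₂ : Type*} [AddCommGroup V₁] [Module ℂ V₁] [AddCommGroup V₂] [Module ℂ V₂]
    (ρ₁ : Yangian N →ₐ[ℂ] Module.End ℂ V₁) (ρ₂ : Yangian N →ₐ[ℂ] Module.End ℂ V₂) :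
    Yangian N →ₐ[ℂ] Module.End ℂ (V₁ ⊗[ℂ] V₂) :=
  (Module.endTensorEndAlgHom (R := ℂ) (S := ℂ) (A := ℂ) (M := V₁) (N := V₂)).comp
    ((Algebra.TensorProduct.map ρ₁ ρ₂).comp Yangian.comul)

/-- `v` is a weight singular vector of the `Y(gl_N)`-module given by `ρ`, with eigenvalues
`⟨T_{aa}(u) v⟩ = l a = ∑_s (l a)_s u^{-s}`. That is, `T_{ba}(u) v = 0` for `a < b` and
`T_{aa}(u) v = ⟨T_{aa}(u) v⟩ v`. -/
structure IsWeightSingular {V : Type*} [AddCommGroup V] [Module ℂ V]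
    (ρ : Yangian N →ₐ[ℂ] Module.End ℂ V) (v : V) (l : Fin N → PowerSeries ℂ) : Prop where
  singular : ∀ a b : Fin N, a < b → ∀ s : ℕ, ρ (Yangian.T b a s) v = 0
  eigen : ∀ (a : Fin N) (s : ℕ), ρ (Yangian.T a a s) v = PowerSeries.coeff s (l a) • v

end Yangian

/-! ## Series in several variables

`σ` is the set of names of the variables. The variable of the power series ring
`ℂ⟦σ⟧` with name `i` stands for `t_i⁻¹`. -/

section Series

variable (σ : Type*)

/-- The space `V⟦t_i⁻¹ : i ∈ σ⟧` of formal power series in the `t_i⁻¹` with coefficients in `V`. -/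
def VSeries (V : Type*) : Type _ := (σ →₀ ℕ) → V

instance (V : Type*) [AddCommGroup V] : AddCommGroup (VSeries σ V) :=
  inferInstanceAs (AddCommGroup ((σ →₀ ℕ) → V))

variable {σ}

@[ext]
theorem VSeries.ext {V : Type*} {f g : VSeries σ V} (h : ∀ m, f m = g m) : f = g := funext h

@[simp]
theorem VSeries.add_apply {V : Type*} [AddCommGroup V] (f g : VSeries σ V) (m : σ →₀ ℕ) :
    (f + g) m = f m + g m := rfl

@[simp]
theorem VSeries.zero_apply {V : Type*} [AddCommGroup V] (m : σ →₀ ℕ) :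
    (0 : VSeries σ V) m = 0 := rfl

open Classical in
/-- Cauchy product with respect to a pairing of coefficients. -/
def cauchy {A B C : Type*} [AddCommMonoid C] (β : A → B → C) (f : (σ →₀ ℕ) → A)
    (g : (σ →₀ ℕ) → B) : (σ →₀ ℕ) → C :=
  fun m => ∑ p ∈ Finset.HasAntidiagonal.antidiagonal m, β (f p.1) (g p.2)

theorem cauchy_assoc {A B C D E F : Type*} [AddCommMonoid C] [AddCommMonoid D] [AddCommMonoid F]
    (α : A → B → C) (β : C → E → F) (γ : B → E → D) (δ : A → D → F)
    (hβ0 : ∀ e, β 0 e = 0) (hβ : ∀ c c' e, β (c + c') e = β c e + β c' e)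
    (hδ0 : ∀ a, δ a 0 = 0) (hδ : ∀ a d d', δ a (d + d') = δ a d + δ a d')
    (h : ∀ a b e, β (α a b) e = δ a (γ b e))
    (f : (σ →₀ ℕ) → A) (g : (σ →₀ ℕ) → B) (k : (σ →₀ ℕ) → E) :
    cauchy β (cauchy α f g) k = cauchy δ f (cauchy γ g k) := by
  classical
  have h1 : ∀ (s : Finset ((σ →₀ ℕ) × (σ →₀ ℕ))) (x : (σ →₀ ℕ) × (σ →₀ ℕ) → C) (e : E),
      β (∑ p ∈ s, x p) e = ∑ p ∈ s, β (x p) e := fun s x e =>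
    map_sum ({ toFun := fun c => β c e, map_zero' := hβ0 e, map_add' := fun c c' => hβ c c' e } :
      C →+ F) x s
  have h2 : ∀ (s : Finset ((σ →₀ ℕ) × (σ →₀ ℕ))) (x : (σ →₀ ℕ) × (σ →₀ ℕ) → D) (a : A),
      δ a (∑ p ∈ s, x p) = ∑ p ∈ s, δ a (x p) := fun s x a =>
    map_sum ({ toFun := fun d => δ a d, map_zero' := hδ0 a, map_add' := hδ a } : D →+ F) x s
  funext n
  simp only [cauchy, h1, h2, Finset.sum_sigma', h]
  apply Finset.sum_nbij'
    (fun x : (_ : (σ →₀ ℕ) × (σ →₀ ℕ)) × ((σ →₀ ℕ) × (σ →₀ ℕ)) =>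
      ⟨(x.2.1, x.2.2 + x.1.2), (x.2.2, x.1.2)⟩)
    (fun x : (_ : (σ →₀ ℕ) × (σ →₀ ℕ)) × ((σ →₀ ℕ) × (σ →₀ ℕ)) =>
      ⟨(x.1.1 + x.2.1, x.2.2), (x.1.1, x.2.1)⟩)
  · rintro ⟨⟨i, j⟩, ⟨p, q⟩⟩ hx
    simp only [Finset.mem_sigma, Finset.HasAntidiagonal.mem_antidiagonal] at hx ⊢
    obtain ⟨rfl, rfl⟩ := hx
    simp [add_assoc]
  · rintro ⟨⟨i, j⟩, ⟨p, q⟩⟩ hx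
    simp only [Finset.mem_sigma, Finset.HasAntidiagonal.mem_antidiagonal] at hx ⊢
    obtain ⟨rfl, rfl⟩ := hx
    simp [add_assoc]
  · rintro ⟨⟨i, j⟩, ⟨p, q⟩⟩ hx
    simp only [Finset.mem_sigma, Finset.HasAntidiagonal.mem_antidiagonal] at hx
    obtain ⟨rfl, rfl⟩ := hx
    rfl
  · rintro ⟨⟨i, j⟩, ⟨p, q⟩⟩ hx
    simp only [Finset.mem_sigma, Finset.HasAntidiagonal.mem_antidiagonal] at hx
    obtain ⟨rfl, rfl⟩ := hx
    rfl
  · rintro ⟨⟨i, j⟩, ⟨p, q⟩⟩ hx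
    rfl

variable {A V : Type*} [Ring A] [AddCommGroup V] [Module A V]

/-- Power series with coefficients in `A` act on power series with coefficients in an `A`-module. -/
instance : SMul (MvPowerSeries σ A) (VSeries σ V) where
  smul f g := cauchy (fun a v => a • v) f g

theorem VSeries.smul_apply [DecidableEq σ] (f : MvPowerSeries σ A) (g : VSeries σ V)
    (m : σ →₀ ℕ) : (f • g) m
      = ∑ p ∈ Finset.HasAntidiagonal.antidiagonal m, MvPowerSeries.coeff p.1 f • g p.2 := by
  change cauchy (fun a v => a • v) f g m = _
  unfold cauchy
  rw [Subsingleton.elim (fun a b => Classical.propDecidable (a = b)) ‹DecidableEq σ›]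
  rfl

theorem mul_eq_cauchy (f g : MvPowerSeries σ A) : f * g = cauchy (fun a b => a * b) f g := by
  classical
  funext m
  change MvPowerSeries.coeff m (f * g) = _
  rw [MvPowerSeries.coeff_mul]
  unfold cauchy
  rw [Subsingleton.elim (fun a b => Classical.propDecidable (a = b)) (Classical.decEq σ)]
  rfl

instance : Module (MvPowerSeries σ A) (VSeries σ V) where
  one_smul g := by
    classical
    ext m
    rw [VSeries.smul_apply, Finset.sum_eq_single (0, m)]
    · simp
    · rintro ⟨p, q⟩ hp hne
      rw [Finset.HasAntidiagonal.mem_antidiagonal] at hp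
      have : p ≠ 0 := by
        rintro rfl
        exact hne (by simp_all)
      simp [MvPowerSeries.coeff_one, this]
    · intro h
      simp at h
  mul_smul f g k := by
    change cauchy (fun a v => a • v) (f * g) k
      = cauchy (fun a v => a • v) f (cauchy (fun a v => a • v) g k)
    rw [mul_eq_cauchy]
    exact cauchy_assoc _ _ _ _ (fun e => zero_smul _ e) (fun c c' e => add_smul c c' e)
      (fun a => smul_zero a) (fun a d d' => smul_add a d d') (fun a b e => mul_smul a b e) f g k
  smul_zero f := by
    classical
    ext m
    simp [VSeries.smul_apply]
  smul_add f g k := by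
    classical
    ext m
    simp [VSeries.smul_apply, Finset.sum_add_distrib]
  add_smul f g k := by
    classical
    ext m
    simp [VSeries.smul_apply, add_smul, Finset.sum_add_distrib]
  zero_smul g := by
    classical
    ext m
    simp [VSeries.smul_apply]

open Classical in
/-- The constant series `v`. -/
def constSeries (v : V) : VSeries σ V := fun m => if m = 0 then v else 0

open Classical in
/-- The series `∑_s c_s t_i^{-s}`. -/
def inVar (i : σ) (c : ℕ → A) : MvPowerSeries σ A :=
  fun m => if m = Finsupp.single i (m i) then c (m i) else 0

/-- `Y(gl_N)⟦σ⟧` is an algebra over `ℂ⟦σ⟧`. -/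
instance algebraSeries (N : ℕ) :
    Algebra (MvPowerSeries σ ℂ) (MvPowerSeries σ (Yangian N)) :=
  (MvPowerSeries.map (algebraMap ℂ (Yangian N))).toAlgebra' (by
    classical
    intro c x
    ext m
    simp only [MvPowerSeries.coeff_mul, MvPowerSeries.coeff_map]
    rw [← Finsupp.sum_antidiagonal_swap m fun i j =>
      algebraMap ℂ (Yangian N) (MvPowerSeries.coeff j c) * MvPowerSeries.coeff i x]
    exact Finset.sum_congr rfl fun p _ => Algebra.commutes _ _)

theorem algebraMap_series {N : ℕ} (c : MvPowerSeries σ ℂ) :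
    algebraMap (MvPowerSeries σ ℂ) (MvPowerSeries σ (Yangian N)) c
      = MvPowerSeries.map (algebraMap ℂ (Yangian N)) c := rfl

theorem map_algebraMap_smul {V : Type*} [AddCommGroup V] [Module ℂ V]
    (c : MvPowerSeries σ ℂ) (g : VSeries σ V) :
    MvPowerSeries.map (algebraMap ℂ (Module.End ℂ V)) c • g = c • g := by
  classical
  ext m
  simp [VSeries.smul_apply]

/-- For a `Y(gl_N)`-module `V`, the action of `Y(gl_N)⟦σ⟧` on `V⟦σ⟧`. -/
def seriesAct {N : ℕ} {V : Type*} [AddCommGroup V] [Module ℂ V]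
    (ρ : Yangian N →ₐ[ℂ] Module.End ℂ V) :
    MvPowerSeries σ (Yangian N) →ₐ[MvPowerSeries σ ℂ]
      Module.End (MvPowerSeries σ ℂ) (VSeries σ V) where
  toFun f :=
    { toFun := fun g => MvPowerSeries.map (ρ : Yangian N →+* Module.End ℂ V) f • g
      map_add' := smul_add _
      map_smul' := fun c g => by
        have hcomm : MvPowerSeries.map (ρ : Yangian N →+* Module.End ℂ V) f
            * MvPowerSeries.map (algebraMap ℂ (Module.End ℂ V)) c
            = MvPowerSeries.map (algebraMap ℂ (Module.End ℂ V)) c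
            * MvPowerSeries.map (ρ : Yangian N →+* Module.End ℂ V) f := by
          have h := congrArg (MvPowerSeries.map (ρ : Yangian N →+* Module.End ℂ V))
            (Algebra.commutes c f)
          rw [map_mul, map_mul] at h
          have hc : MvPowerSeries.map (ρ : Yangian N →+* Module.End ℂ V)
              (algebraMap (MvPowerSeries σ ℂ) (MvPowerSeries σ (Yangian N)) c)
              = MvPowerSeries.map (algebraMap ℂ (Module.End ℂ V)) c := by
            rw [algebraMap_series]
            ext m : 1
            simp
          rw [hc] at h
          exact h.symm
        rw [RingHom.id_apply, ← map_algebraMap_smul, ← map_algebraMap_smul, ← mul_smul,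
          ← mul_smul, hcomm] }
  map_one' := by
    ext g : 1
    simp
  map_mul' f g := by
    ext k : 1
    simp [mul_smul]
  map_zero' := by
    ext k : 1
    simp
  map_add' f g := by
    ext k : 1
    simp [add_smul]
  commutes' c := by
    ext k : 1
    change MvPowerSeries.map (ρ : Yangian N →+* Module.End ℂ V)
      (MvPowerSeries.map (algebraMap ℂ (Yangian N)) c) • k = c • k
    rw [← map_algebraMap_smul c k]
    congr 1
    ext m : 1
    simp

/-- The `ℂ⟦σ⟧`-bilinear pairing `V₁⟦σ⟧ × V₂⟦σ⟧ → (V₁ ⊗ V₂)⟦σ⟧`. -/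
def seriesPair (V₁ V₂ : Type*) [AddCommGroup V₁] [Module ℂ V₁] [AddCommGroup V₂] [Module ℂ V₂] :
    VSeries σ V₁ →ₗ[MvPowerSeries σ ℂ] VSeries σ V₂ →ₗ[MvPowerSeries σ ℂ]
      VSeries σ (V₁ ⊗[ℂ] V₂) :=
  LinearMap.mk₂ _
    (fun f g => (cauchy (fun v w => v ⊗ₜ[ℂ] w) f g : VSeries σ (V₁ ⊗[ℂ] V₂)))
    (fun f f' g => by
      ext m
      change cauchy (fun v w => v ⊗ₜ[ℂ] w) (f + f' : VSeries σ V₁) g m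
        = cauchy (fun v w => v ⊗ₜ[ℂ] w) f g m + cauchy (fun v w => v ⊗ₜ[ℂ] w) f' g m
      simp [cauchy, TensorProduct.add_tmul, Finset.sum_add_distrib])
    (fun c f g => cauchy_assoc (fun (a : ℂ) (v : V₁) => a • v) (fun v w => v ⊗ₜ[ℂ] w)
      (fun v w => v ⊗ₜ[ℂ] w) (fun (a : ℂ) (x : V₁ ⊗[ℂ] V₂) => a • x) (fun e => TensorProduct.zero_tmul _ e)
      (fun c c' e => TensorProduct.add_tmul c c' e) (fun a => smul_zero a)
      (fun a d d' => smul_add a d d') (fun a b e => (TensorProduct.smul_tmul' a b e).symm) c f g)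
    (fun f g g' => by
      ext m
      change cauchy (fun v w => v ⊗ₜ[ℂ] w) f (g + g' : VSeries σ V₂) m
        = cauchy (fun v w => v ⊗ₜ[ℂ] w) f g m + cauchy (fun v w => v ⊗ₜ[ℂ] w) f g' m
      simp [cauchy, TensorProduct.tmul_add, Finset.sum_add_distrib])
    (fun c f g => by
      have hsw : ∀ (c : MvPowerSeries σ ℂ) (g : VSeries σ V₂),
          (c • g : VSeries σ V₂) = cauchy (fun (v : V₂) (a : ℂ) => a • v) g c := by
        classical
        intro c g
        ext m
        change cauchy (fun (a : ℂ) (v : V₂) => a • v) c g m = _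
        exact (Finsupp.sum_antidiagonal_swap m fun i j => c j • g i).symm
      have hsw' : ∀ (c : MvPowerSeries σ ℂ) (g : VSeries σ (V₁ ⊗[ℂ] V₂)),
          (c • g : VSeries σ (V₁ ⊗[ℂ] V₂))
            = cauchy (fun (v : V₁ ⊗[ℂ] V₂) (a : ℂ) => a • v) g c := by
        classical
        intro c g
        ext m
        change cauchy (fun (a : ℂ) (v : V₁ ⊗[ℂ] V₂) => a • v) c g m = _
        exact (Finsupp.sum_antidiagonal_swap m fun i j => c j • g i).symm
      refine (congrArg (cauchy (fun v w => v ⊗ₜ[ℂ] w) f) (hsw c g)).trans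
        (Eq.trans ?_ (hsw' c _).symm)
      exact (cauchy_assoc _ _ _ _ (fun e => smul_zero e) (fun c c' e => smul_add e c c')
        (fun a => TensorProduct.tmul_zero _ a) (fun a d d' => TensorProduct.tmul_add a d d')
        (fun a b e => (TensorProduct.tmul_smul e a b).symm) f g c).symm)

end Series

/-! ## Expressions rational in the variables `t_i`

Everything is extended from `ℂ⟦σ⟧` to its field of fractions, which contains the `t_i` and
all rational functions of them. -/

section Fractions

variable (σ : Type*)

/-- The field of fractions of `ℂ⟦t_i⁻¹ : i ∈ σ⟧`. -/
abbrev RatSeries : Type _ := FractionRing (MvPowerSeries σ ℂ)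

/-- `V⟦t_i⁻¹ : i ∈ σ⟧`, localized at the nonzero elements of `ℂ⟦t_i⁻¹ : i ∈ σ⟧`. -/
abbrev VRat (V : Type*) [AddCommGroup V] [Module ℂ V] : Type _ :=
  RatSeries σ ⊗[MvPowerSeries σ ℂ] VSeries σ V

/-- `Y(gl_N)⟦t_i⁻¹ : i ∈ σ⟧`, localized at the nonzero elements of `ℂ⟦t_i⁻¹ : i ∈ σ⟧`. -/
abbrev YRat (N : ℕ) : Type _ :=
  RatSeries σ ⊗[MvPowerSeries σ ℂ] MvPowerSeries σ (Yangian N)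

variable {σ}

/-- The variable `t_i`. -/
def tvar (i : σ) : RatSeries σ :=
  (algebraMap (MvPowerSeries σ ℂ) (RatSeries σ) (MvPowerSeries.X i))⁻¹

/-- The scalar `l(t_i)` for a power series `l(u)` in `u⁻¹`. -/
def evalSeries (l : PowerSeries ℂ) (i : σ) : RatSeries σ :=
  algebraMap (MvPowerSeries σ ℂ) (RatSeries σ) (inVar i fun s => PowerSeries.coeff s l)

/-- The matrix `T(t_i)`. -/
def Tmat (N : ℕ) (i : σ) : Matrix (Fin N) (Fin N) (YRat σ N) :=
  fun a b => (1 : RatSeries σ) ⊗ₜ (inVar i fun s => Yangian.T a b s)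

/-- The action of the localized Yangian series on the localized series with coefficients in
a `Y(gl_N)`-module. -/
def act {N : ℕ} {V : Type*} [AddCommGroup V] [Module ℂ V] (ρ : Yangian N →ₐ[ℂ] Module.End ℂ V) :
    YRat σ N →ₐ[RatSeries σ] Module.End (RatSeries σ) (VRat σ V) :=
  (LinearMap.tensorProductEnd (MvPowerSeries σ ℂ) (RatSeries σ) (VSeries σ V)).comp
    (Algebra.TensorProduct.map (AlgHom.id (RatSeries σ) (RatSeries σ)) (seriesAct ρ))

/-- A vector of `V` regarded as a constant series. -/
def vec {V : Type*} [AddCommGroup V] [Module ℂ V] (v : V) : VRat σ V :=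
  (1 : RatSeries σ) ⊗ₜ constSeries v

/-- The tensor product of two vector-valued functions of the `t_i`. -/
def pair {V₁ V₂ : Type*} [AddCommGroup V₁] [Module ℂ V₁] [AddCommGroup V₂] [Module ℂ V₂]
    (x : VRat σ V₁) (y : VRat σ V₂) : VRat σ (V₁ ⊗[ℂ] V₂) :=
  (TensorProduct.lift (seriesPair (σ := σ) V₁ V₂)).baseChange (RatSeries σ)
    ((TensorProduct.AlgebraTensorModule.distribBaseChange (MvPowerSeries σ ℂ) (RatSeries σ)
      (VSeries σ V₁) (VSeries σ V₂)).symm (x ⊗ₜ y))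

end Fractions

/-! ## The vector-valued weight functions -/

section Bethe

/-- `M^{(p)}`: the matrix `M` with entries in `A` placed in the tensor factor `p` of
`End(ℂ^N)^{⊗ι} ⊗ A`. Elements of the latter are matrices with entries in `A` whose
rows and columns are indexed by `ι → Fin N`, the basis of `(ℂ^N)^{⊗ι}`. -/
def embed {ι A : Type*} {N : ℕ} [Fintype ι] [DecidableEq ι] [Zero A] (p : ι)
    (M : Matrix (Fin N) (Fin N) A) : Matrix (ι → Fin N) (ι → Fin N) A :=
  fun α β => if ∀ q, q ≠ p → α q = β q then M (α p) (β p) else 0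

/-- `R^{(p,q)}(u) = u + ∑_{a,b} E_{ab}^{(p)} E_{ba}^{(q)}`. -/
def Rmat {ι K A : Type*} {N : ℕ} [Fintype ι] [DecidableEq ι] [Field K] [Ring A] [Algebra K A]
    (p q : ι) (u : K) : Matrix (ι → Fin N) (ι → Fin N) A :=
  u • 1 + ∑ a : Fin N, ∑ b : Fin N,
    embed p (Matrix.single a b 1) * embed q (Matrix.single b a 1)

/-- The pairs `(x, y)` of entries of a list, `x` before `y`, ordered lexicographically. -/
def lexPairs {α : Type*} : List α → List (α × α)
  | [] => []
  | x :: l => l.map (fun y => (x, y)) ++ lexPairs l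

variable {n : ℕ}

/-- The index set `{(a, i) : 1 ≤ a ≤ n, 1 ≤ i ≤ ξ^a}`, where `N = n + 1`. -/
abbrev Pos (ξ : Fin n → ℕ) : Type := Σ a : Fin n, Fin (ξ a)

/-- The elements of `Pos ξ` in the order `(1,1), …, (1,ξ^1), …, (n,1), …, (n,ξ^n)`. -/
def positions (ξ : Fin n → ℕ) : List (Pos ξ) :=
  (List.finRange n).flatMap fun a => (List.finRange (ξ a)).map fun i => ⟨a, i⟩

variable {σ : Type*}

/-- The trace of
`T^{(1)}(t^1_1) ⋯ T^{(|ξ|)}(t^n_{ξ^n}) · ∏ R^{((b,j),(a,i))}(t^b_j - t^a_i)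
  · E_{21}^{⊗ξ^1} ⊗ ⋯ ⊗ E_{n+1,n}^{⊗ξ^n}`
over all matrix tensor factors, the product of `R` over `(a,i) < (b,j)`, in lexicographic order.
The collection of variables is given by their names `τ`, that is `t^a_i = t_{τ(a,i)}`.
The tensor product of elementary matrices is an elementary matrix. -/
def betheHat (ξ : Fin n → ℕ) (τ : Pos ξ → σ) : YRat σ (n + 1) :=
  Matrix.trace
    (((positions ξ).map fun p => embed p (Tmat (n + 1) (τ p))).prod
      * ((lexPairs (positions ξ)).map fun pq =>
          Rmat pq.2 pq.1 (tvar (τ pq.2) - tvar (τ pq.1))).prod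
      * Matrix.single (fun p : Pos ξ => p.1.succ) (fun p : Pos ξ => p.1.castSucc) 1)

/-- `𝔹_ξ(t)`, where `t^a_i = t_{τ(a,i)}`. -/
def bethe (ξ : Fin n → ℕ) (τ : Pos ξ → σ) : YRat σ (n + 1) :=
  ((∏ a : Fin n, ∏ i : Fin (ξ a), ∏ j ∈ Finset.univ.filter (fun j : Fin (ξ a) => i < j),
        1 / (tvar (τ ⟨a, j⟩) - tvar (τ ⟨a, i⟩) + 1))
    * ∏ a : Fin n, ∏ b ∈ Finset.univ.filter (fun b : Fin n => a < b),
        ∏ i : Fin (ξ a), ∏ j : Fin (ξ b), 1 / (tvar (τ ⟨b, j⟩) - tvar (τ ⟨a, i⟩)))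
    • betheHat ξ τ

/-- `W_k(t_1, …, t_k)`. -/
def W {K : Type*} [Field K] (k : ℕ) (t : Fin k → K) : K :=
  ∏ i : Fin k, ∏ j ∈ Finset.univ.filter (fun j : Fin k => i < j), (t i - t j - 1) / (t i - t j)

/-- The collection `t^a_i ↦ t^a_{π^a(i)}`. -/
def permute (ξ : Fin n → ℕ) (π : (a : Fin n) → Equiv.Perm (Fin (ξ a))) : Pos ξ → Pos ξ :=
  fun p => ⟨p.1, π p.1 p.2⟩

/-- `Sym^ξ_t f(t)`. -/
def Sym (ξ : Fin n → ℕ) {M : Type*} [AddCommMonoid M] (f : (Pos ξ → Pos ξ) → M) : M :=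
  ∑ π : (a : Fin n) → Equiv.Perm (Fin (ξ a)), f (permute ξ π)

/-- `Sym^ξ_t (f(t) ∏_a W_{ξ^a}(t^a_1, …, t^a_{ξ^a}))`. -/
def SymBar (ξ : Fin n → ℕ) {M : Type*} [AddCommGroup M] [Module (RatSeries (Pos ξ)) M]
    (f : (Pos ξ → Pos ξ) → M) : M :=
  Sym ξ fun τ => (∏ a : Fin n, W (ξ a) fun i => tvar (τ ⟨a, i⟩)) • f τ

/-- The index map of `t_{[η]}`, the first `η^a` variables of each colour `a`. -/
def lower {ξ η : Fin n → ℕ} (h : η ≤ ξ) : Pos η → Pos ξ :=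
  fun p => ⟨p.1, Fin.castLE (h p.1) p.2⟩

/-- The index map of `t_{(η,ξ]}`, the last `ξ^a - η^a` variables of each colour `a`. -/
def upper {ξ η : Fin n → ℕ} (h : η ≤ ξ) : Pos (ξ - η) → Pos ξ :=
  fun p => ⟨p.1, Fin.cast (Nat.add_sub_cancel' (h p.1)) (Fin.natAdd (η p.1) p.2)⟩

/-- `∏_{a=1}^{N-2} ∏_{i=1}^{η^{a+1}} ∏_{j=η^a+1}^{ξ^a} (t^{a+1}_i - t^a_j + 1)/(t^{a+1}_i - t^a_j)`,
where `b = a + 1` below. -/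
def crossFactor (ξ η : Fin n → ℕ) (τ : Pos ξ → σ) : RatSeries σ :=
  ∏ a : Fin n, ∏ b ∈ Finset.univ.filter (fun b : Fin n => (b : ℕ) = a + 1),
    ∏ i ∈ Finset.univ.filter (fun i : Fin (ξ b) => (i : ℕ) < η b),
      ∏ j ∈ Finset.univ.filter (fun j : Fin (ξ a) => η a ≤ (j : ℕ)),
        (tvar (τ ⟨b, i⟩) - tvar (τ ⟨a, j⟩) + 1) / (tvar (τ ⟨b, i⟩) - tvar (τ ⟨a, j⟩))

/-- `∏_{a=1}^{N-1} (∏_{i=1}^{η^a} ⟨T_{aa}(t^a_i) v₂⟩ ∏_{j=η^a+1}^{ξ^a} ⟨T_{a+1,a+1}(t^a_j) v₁⟩)`,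
where `l₁`, `l₂` are the eigenvalues on `v₁`, `v₂`. -/
def eigenFactor (ξ η : Fin n → ℕ) (l₁ l₂ : Fin (n + 1) → PowerSeries ℂ) (τ : Pos ξ → σ) :
    RatSeries σ :=
  ∏ a : Fin n,
    ((∏ i ∈ Finset.univ.filter (fun i : Fin (ξ a) => (i : ℕ) < η a),
        evalSeries (l₂ a.castSucc) (τ ⟨a, i⟩))
      * ∏ j ∈ Finset.univ.filter (fun j : Fin (ξ a) => η a ≤ (j : ℕ)),
        evalSeries (l₁ a.succ) (τ ⟨a, j⟩))

end Bethe

end YangianBethe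

end

noncomputable section

set_option linter.unusedSectionVars false
set_option linter.unusedSimpArgs false

namespace YangianBethe

/-! ## Matrices on tensor powers -/

section Lines

variable {ι κ : Type*} [Fintype ι] [DecidableEq ι] [Fintype κ] [DecidableEq κ] {N : ℕ} {A : Type*} [Ring A]

/-! Only a few properties of the matrices `T(t)` enter the proof: the RTT relations, the commutation
of the actions on `V₁` and `V₂`, and the triangularity of both actions on the vector. The coproduct
reads `T = T₂ T₁` as a product of matrices, with `T₁` acting on the first and `T₂` on the second
tensor factor. The formula is therefore proved for Bethe functions `gB` of products of two commuting
RTT families over an arbitrary algebra and for generic values of the variables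
(`gB_mul_eq_expansion`), by induction on the number of colours.

Lowering the rank (`gB_succ`). The RTT relations move the `R`-matrices of the first colour to the
left, where all labels are equal and each of them is a scalar, cancelled by the normalization. The
`R`-matrices between the first colour and the others multiply ("dress") the matrices of the other
colours. Thus a Bethe function is a row of entries `T_{0b}`, `b ≠ 0`, contracted with a Bethe
function of rank one less, whose coefficients are operators on the tensor power belonging to the
first colour.

Splitting the first colour (`gB_mul_eq_sum_split`). Each factor of the first colour has an
intermediate label between `T₂` and `T₁`. If it is `0`, then `T₁` contributes a creation entry and
`T₂` its entry `00`; otherwise `T₂` creates and `T₁` contributes an entry of its lower right block.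
The identity is resolved into projections fixing the set `I` of factors with label `0`, conjugated
by products of `R`-matrices which sort the factors (`resolution`). These products pass through all
RTT families and act trivially where all labels agree, so every summand may be taken with `I`
separated from its complement `J`. The block of `T₁` on `J` is moved to the vacuum, where it yields
eigenvalues; on the way it turns the dressed matrices into a product of two commuting RTT families
(`lineProd_mul_dressed`). Both are again triangular on the vacuum, so the induction hypothesis
applies. In each resulting term the two groups of factors decouple and give back Bethe functions of
`T₁` and `T₂` (`separated_eq_gB_mul_gB`). Dressing changes only the eigenvalue of label `0`, and
this change is the factor linking neighbouring colours.

Symmetrization (`sum_bool_eq_sum_perm`). The set `I` comes with the coefficient `∏ (x_i - x_j -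
1)/(x_i - x_j)` over `i ∈ I`, `j ∈ J`. The sum over `I` becomes a weighted sum over permutations
because the sum of `W` over all permutations of `m` variables is `m!`, a consequence of Lagrange
interpolation. -/

theorem mul_embed_apply {m : Type*} (X : Matrix m (ι → Fin N) A) (p : ι)
    (M : Matrix (Fin N) (Fin N) A) (α : m) (β : ι → Fin N) :
    (X * embed p M) α β = ∑ b, X α (Function.update β p b) * M b (β p) := by
  rw [Matrix.mul_apply]
  symm
  apply Fintype.sum_of_injective (fun b => Function.update β p b) (Function.update_injective β p)
  · intro γ hγ
    simp only [embed]
    rw [if_neg, mul_zero]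
    intro h
    apply hγ
    refine ⟨γ p, ?_⟩
    funext q
    by_cases hq : q = p
    · subst hq; simp
    · simp [hq, h q hq]
  · intro b
    simp only [embed]
    rw [if_pos]
    · simp
    · intro q hq
      simp [hq]

theorem embed_mul_apply {m : Type*} (X : Matrix (ι → Fin N) m A) (p : ι)
    (M : Matrix (Fin N) (Fin N) A) (α : ι → Fin N) (β : m) :
    (embed p M * X) α β = ∑ a, M (α p) a * X (Function.update α p a) β := by
  rw [Matrix.mul_apply]
  symm
  apply Fintype.sum_of_injective (fun b => Function.update α p b) (Function.update_injective α p)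
  · intro γ hγ
    simp only [embed]
    rw [if_neg, zero_mul]
    intro h
    apply hγ
    refine ⟨γ p, ?_⟩
    funext q
    by_cases hq : q = p
    · subst hq; simp
    · simp [hq, h q hq]
  · intro b
    simp only [embed]
    rw [if_pos]
    · simp
    · intro q hq
      simp [hq]

theorem embed_add (p : ι) (M M' : Matrix (Fin N) (Fin N) A) :
    embed p (M + M') = embed p M + embed p M' := by
  ext α β
  simp only [embed, Matrix.add_apply]
  split_ifs <;> simp

theorem embed_zero (p : ι) : embed p (0 : Matrix (Fin N) (Fin N) A) = 0 := by
  ext α β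
  simp [embed]

theorem embed_one (p : ι) : embed p (1 : Matrix (Fin N) (Fin N) A) = 1 := by
  ext α β
  simp only [embed, Matrix.one_apply]
  by_cases h : α = β
  · simp [h]
  · rw [if_neg h]
    split_ifs with h1 h2
    · exact absurd (funext fun q => if hq : q = p then hq ▸ h2 else h1 q hq) h
    · rfl
    · rfl

theorem embed_smul {K : Type*} [SMulZeroClass K A] (p : ι) (c : K) (M : Matrix (Fin N) (Fin N) A) :
    embed p (c • M) = c • embed p M := by
  ext α β
  simp only [embed, Matrix.smul_apply]
  split_ifs <;> simp

theorem embed_mul (p : ι) (M M' : Matrix (Fin N) (Fin N) A) :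
    embed p (M * M') = embed p M * embed p M' := by
  ext α β
  rw [embed_mul_apply]
  simp only [embed, Matrix.mul_apply]
  split_ifs with h
  · refine Finset.sum_congr rfl fun a _ => ?_
    rw [if_pos]
    · simp
    · intro q hq
      simp [hq, h q hq]
  · symm
    apply Finset.sum_eq_zero
    intro a _
    rw [if_neg, mul_zero]
    contrapose! h
    intro q hq
    simpa [hq] using h q hq

theorem embed_mul_embed_apply {p q : ι} (hpq : p ≠ q) (M M' : Matrix (Fin N) (Fin N) A)
    (α β : ι → Fin N) : (embed p M * embed q M') α β
      = if ∀ r, r ≠ p → r ≠ q → α r = β r then M (α p) (β p) * M' (α q) (β q) else 0 := by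
  rw [mul_embed_apply]
  simp only [embed]
  rw [Finset.sum_eq_single (α q)]
  · by_cases h : ∀ r, r ≠ p → r ≠ q → α r = β r
    · rw [if_pos h, if_pos]
      · simp [hpq]
      · intro r hr
        by_cases hrq : r = q
        · subst hrq; simp
        · simp [hrq, h r hr hrq]
    · rw [if_neg h, if_neg, zero_mul]
      contrapose! h
      intro r hr hrq
      simpa [hrq] using h r hr
  · intro b _ hb
    rw [if_neg, zero_mul]
    intro h
    exact hb (by simpa using (h q hpq.symm).symm)
  · simp

theorem embed_comm {p q : ι} (hpq : p ≠ q) {M M' : Matrix (Fin N) (Fin N) A}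
    (h : ∀ a b c d, M a b * M' c d = M' c d * M a b) :
    embed p M * embed q M' = embed q M' * embed p M := by
  ext α β
  rw [embed_mul_embed_apply hpq, embed_mul_embed_apply hpq.symm, h]
  congr 1
  simp only [eq_iff_iff]
  exact ⟨fun h r h1 h2 => h r h2 h1, fun h r h1 h2 => h r h2 h1⟩

theorem scalar_comm_embed (r : A) (p : ι) {M : Matrix (Fin N) (Fin N) A}
    (h : ∀ a b, r * M a b = M a b * r) :
    Matrix.scalar (ι → Fin N) r * embed p M = embed p M * Matrix.scalar (ι → Fin N) r := by
  ext α β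
  simp only [Matrix.scalar_apply, Matrix.diagonal_mul, Matrix.mul_diagonal, embed]
  split_ifs <;> simp [h]

/-- The operator `∏_{p ∈ l} T_p^{(p)}`. -/
def lineProd (l : List ι) (T : ι → Matrix (Fin N) (Fin N) A) :
    Matrix (ι → Fin N) (ι → Fin N) A :=
  (l.map fun p => embed p (T p)).prod

@[simp] theorem lineProd_nil (T : ι → Matrix (Fin N) (Fin N) A) : lineProd [] T = 1 := rfl

@[simp] theorem lineProd_cons (p : ι) (l : List ι) (T : ι → Matrix (Fin N) (Fin N) A) :
    lineProd (p :: l) T = embed p (T p) * lineProd l T := by simp [lineProd]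

@[simp] theorem lineProd_append (l l' : List ι) (T : ι → Matrix (Fin N) (Fin N) A) :
    lineProd (l ++ l') T = lineProd l T * lineProd l' T := by simp [lineProd]

/-- Distinct positions occupy distinct tensor factors, so no intermediate label is summed over: an
entry is one product of matrix entries, in the order of the list. -/
theorem lineProd_apply (l : List ι) (hl : l.Nodup) (T : ι → Matrix (Fin N) (Fin N) A)
    (α β : ι → Fin N) : lineProd l T α β
      = if ∀ q, q ∉ l → α q = β q then (l.map fun p => T p (α p) (β p)).prod else 0 := by
  induction l generalizing α with
  | nil =>
    simp only [lineProd_nil, Matrix.one_apply, List.not_mem_nil, not_false_eq_true, forall_const,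
      List.map_nil, List.prod_nil]
    congr 1
    exact propext funext_iff
  | cons p l ih =>
    rw [List.nodup_cons] at hl
    rw [lineProd_cons, embed_mul_apply]
    simp only [ih hl.2]
    rw [Finset.sum_eq_single (β p)]
    · have e : (∀ q, q ∉ l → Function.update α p (β p) q = β q) ↔ ∀ q, q ∉ p :: l → α q = β q := by
        constructor
        · intro h q hq
          simp only [List.mem_cons, not_or] at hq
          simpa [hq.1] using h q hq.2
        · intro h q hq
          by_cases hqp : q = p
          · subst hqp; simp
          · simpa [hqp] using h q (by simp [hqp, hq])
      simp only [e]
      split_ifs with h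
      · rw [List.map_cons, List.prod_cons]
        congr 2
        apply List.map_congr_left
        intro q hq
        rw [Function.update_of_ne]
        rintro rfl
        exact hl.1 hq
      · simp
    · intro b _ hb
      rw [if_neg, mul_zero]
      intro h
      exact hb (by simpa using h p hl.1)
    · simp

theorem lineProd_apply_of_complete (l : List ι) (hl : l.Nodup) (hc : ∀ p, p ∈ l)
    (T : ι → Matrix (Fin N) (Fin N) A) (α β : ι → Fin N) :
    lineProd l T α β = (l.map fun p => T p (α p) (β p)).prod := by
  rw [lineProd_apply l hl, if_pos]
  intro q hq
  exact absurd (hc q) hq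

theorem commute_list_prod {M : Type*} [Monoid M] (r : M) (l : List M)
    (h : ∀ x ∈ l, r * x = x * r) : r * l.prod = l.prod * r :=
  (Commute.list_prod_right l r h).eq

/-- `T' p` has to pass only matrices sitting in other tensor factors, and these have commuting
entries. This separates the two factors of the coproduct. -/
theorem lineProd_mul (l : List ι) (hl : l.Nodup) (T T' : ι → Matrix (Fin N) (Fin N) A)
    (h : ∀ p q a b c d, T p a b * T' q c d = T' q c d * T p a b) :
    lineProd l (fun p => T p * T' p) = lineProd l T * lineProd l T' := by
  induction l with
  | nil => simp
  | cons p l ih =>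
    rw [List.nodup_cons] at hl
    rw [lineProd_cons, lineProd_cons, lineProd_cons, ih hl.2, embed_mul]
    have : embed p (T' p) * lineProd l T = lineProd l T * embed p (T' p) := by
      apply commute_list_prod
      intro x hx
      obtain ⟨q, hq, rfl⟩ := List.mem_map.1 hx
      exact embed_comm (fun e : p = q => hl.1 (e.symm ▸ hq)) fun a b c d => (h q p c d a b).symm
    rw [mul_assoc, ← mul_assoc (embed p (T' p)), this]
    simp only [mul_assoc]

end Lines

/-! ## Permutation operators and `R`-matrices -/

section Perm

variable {ι κ : Type*} [Fintype ι] [DecidableEq ι] {N : ℕ}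

/-- The permutation of the tensor factors. -/
def permMat (N : ℕ) (A : Type*) [Ring A] :
    Equiv.Perm ι →* Matrix (ι → Fin N) (ι → Fin N) A where
  toFun σ := Matrix.of fun α β => if α = β ∘ ⇑σ⁻¹ then 1 else 0
  map_one' := by
    ext α β
    simp [Matrix.one_apply]
  map_mul' σ τ := by
    ext α β
    rw [Matrix.mul_apply, Finset.sum_eq_single (β ∘ ⇑τ⁻¹)]
    · simp [Function.comp_assoc]
    · intro γ _ hγ
      rw [Matrix.of_apply, Matrix.of_apply, if_neg hγ, mul_zero]
    · simp

variable {A : Type*} [Ring A]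

theorem permMat_mul_apply {m : Type*} (σ : Equiv.Perm ι) (X : Matrix (ι → Fin N) m A)
    (α : ι → Fin N) (β : m) : (permMat N A σ * X) α β = X (α ∘ ⇑σ) β := by
  rw [Matrix.mul_apply, Finset.sum_eq_single (α ∘ ⇑σ)]
  · simp [permMat, Function.comp_assoc]
  · intro γ _ hγ
    rw [show permMat N A σ α γ = 0 from if_neg ?_, zero_mul]
    rintro rfl
    exact hγ (by funext; simp)
  · simp

theorem mul_permMat_apply {m : Type*} (σ : Equiv.Perm ι) (X : Matrix m (ι → Fin N) A)
    (α : m) (β : ι → Fin N) : (X * permMat N A σ) α β = X α (β ∘ ⇑σ⁻¹) := by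
  rw [Matrix.mul_apply, Finset.sum_eq_single (β ∘ ⇑σ⁻¹)]
  · simp [permMat]
  · intro γ _ hγ
    rw [show permMat N A σ γ β = 0 from if_neg hγ, mul_zero]
  · simp

theorem permMat_apply (σ : Equiv.Perm ι) (α β : ι → Fin N) :
    permMat N A σ α β = if α = β ∘ ⇑σ⁻¹ then 1 else 0 := rfl

theorem permMat_mul_embed (σ : Equiv.Perm ι) (p : ι) (M : Matrix (Fin N) (Fin N) A) :
    permMat N A σ * embed p M = embed (σ p) M * permMat N A σ := by
  ext α β
  rw [permMat_mul_apply, mul_permMat_apply]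
  simp only [embed, Function.comp_apply, Equiv.Perm.inv_def, Equiv.symm_apply_apply]
  congr 1
  simp only [eq_iff_iff]
  constructor
  · intro h q hq
    have := h (σ.symm q) (fun e => hq (by rw [← e, Equiv.apply_symm_apply]))
    simpa using this
  · intro h q hq
    have := h (σ q) (fun e => hq (σ.injective e))
    simpa using this

/-- The sum is the flip of the factors `p` and `q`. Hence `R(u) = u + P`, and most identities for
`R`-matrices reduce to conjugation by `P` and `P² = 1`. -/
theorem sum_embed_single_eq {p q : ι} (hpq : p ≠ q) :
    (∑ a : Fin N, ∑ b : Fin N, embed p (Matrix.single a b 1) * embed q (Matrix.single b a 1)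
      : Matrix (ι → Fin N) (ι → Fin N) A) = permMat N A (Equiv.swap p q) := by
  ext α β
  simp only [Matrix.sum_apply, embed_mul_embed_apply hpq, permMat_apply]
  rw [Finset.sum_eq_single (α p), Finset.sum_eq_single (β p)]
  · have e : α = β ∘ ⇑(Equiv.swap p q)⁻¹ ↔
        (∀ r, r ≠ p → r ≠ q → α r = β r) ∧ α p = β q ∧ α q = β p := by
      rw [Equiv.swap_inv]
      constructor
      · rintro rfl
        refine ⟨fun r h1 h2 => ?_, ?_, ?_⟩
        · rw [Function.comp_apply, Equiv.swap_apply_of_ne_of_ne h1 h2]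
        · simp
        · simp
      · rintro ⟨h1, h2, h3⟩
        funext r
        by_cases hp : r = p
        · subst hp; rw [Function.comp_apply, Equiv.swap_apply_left, h2]
        · by_cases hq : r = q
          · subst hq; rw [Function.comp_apply, Equiv.swap_apply_right, h3]
          · rw [Function.comp_apply, Equiv.swap_apply_of_ne_of_ne hp hq, h1 r hp hq]
    by_cases h : ∀ r, r ≠ p → r ≠ q → α r = β r
    · by_cases h' : α p = β q ∧ α q = β p
      · rw [if_pos h, if_pos (e.2 ⟨h, h'⟩), ← h'.1, ← h'.2]
        simp
      · rw [if_pos h, if_neg fun h'' => h' (e.1 h'').2, Matrix.single_apply_same, one_mul,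
          Matrix.single_apply_of_ne _ _ _ _ _ fun h'' => h' ⟨h''.2, h''.1.symm⟩]
    · rw [if_neg h, if_neg fun h' => h (e.1 h').1]
  · intro b _ hb
    simp [Matrix.single_apply, hb]
  · simp
  · intro a _ ha
    simp [Matrix.single_apply, ha]
  · simp

variable {K : Type*} [Field K] [Algebra K A]

theorem Rmat_eq {p q : ι} (hpq : p ≠ q) (u : K) :
    (Rmat p q u : Matrix (ι → Fin N) (ι → Fin N) A) = u • 1 + permMat N A (Equiv.swap p q) := by
  rw [Rmat, sum_embed_single_eq hpq]

theorem Rmat_symm {p q : ι} (hpq : p ≠ q) (u : K) :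
    (Rmat p q u : Matrix (ι → Fin N) (ι → Fin N) A) = Rmat q p u := by
  rw [Rmat_eq hpq, Rmat_eq hpq.symm, Equiv.swap_comm]

theorem Rmat_mul_Rmat_neg {p q : ι} (hpq : p ≠ q) (u : K) :
    (Rmat p q u * Rmat p q (-u) : Matrix (ι → Fin N) (ι → Fin N) A) = (1 - u ^ 2) • 1 := by
  rw [Rmat_eq hpq, Rmat_eq hpq]
  have h : permMat N A (Equiv.swap p q) * permMat N A (Equiv.swap p q) = 1 := by
    rw [← map_mul, Equiv.swap_mul_self, map_one]
  simp only [add_mul, mul_add, h, smul_mul_assoc, mul_smul_comm, one_mul, mul_one]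
  module

/-- `R`-matrices have entries in `K`. So they commute with scalar matrices over the noncommutative
algebra `A`, and identities among them can be proved over `K`. -/
theorem Rmat_map_algebraMap (p q : ι) (u : K) :
    (Rmat p q u : Matrix (ι → Fin N) (ι → Fin N) K).map (algebraMap K A) = Rmat p q u := by
  ext α β
  simp only [Rmat, Matrix.map_apply, Matrix.add_apply, Matrix.smul_apply, map_add, Matrix.sum_apply,
    map_sum, Matrix.mul_apply, map_mul, Matrix.one_apply]
  congr 1
  · split_ifs <;> simp [Algebra.algebraMap_eq_smul_one]
  · refine Finset.sum_congr rfl fun a _ => Finset.sum_congr rfl fun b _ =>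
      Finset.sum_congr rfl fun γ _ => ?_
    simp only [embed, Matrix.single_apply]
    congr 1 <;> split_ifs <;> simp

theorem Rmat_comm_embed {p q r : ι} (hpq : p ≠ q) (hp : r ≠ p) (hq : r ≠ q) (u : K)
    (M : Matrix (Fin N) (Fin N) A) :
    Rmat p q u * embed r M = embed r M * Rmat p q u := by
  rw [Rmat_eq hpq, add_mul, mul_add, permMat_mul_embed, Equiv.swap_apply_of_ne_of_ne hp hq]
  simp

theorem Rmat_comm_Rmat {p q r s : ι} (hpq : p ≠ q) (hrs : r ≠ s) (h1 : p ≠ r) (h2 : p ≠ s)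
    (h3 : q ≠ r) (h4 : q ≠ s) (u w : K) :
    (Rmat p q u * Rmat r s w : Matrix (ι → Fin N) (ι → Fin N) A) = Rmat r s w * Rmat p q u := by
  rw [Rmat_eq hrs]
  have : permMat N A (Equiv.swap r s) * Rmat p q u = Rmat p q u * permMat N A (Equiv.swap r s) := by
    rw [Rmat_eq hpq]
    have := (Equiv.Perm.disjoint_swap_swap (x := p) (y := q) (z := r) (t := s)
      (by simp [*])).commute.eq
    rw [add_mul, mul_add, ← map_mul, ← map_mul, this]
    simp
  rw [add_mul, mul_add, this]
  simp

/-- The commutation relation of two matrices with difference of arguments `u`. -/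
def RTT (u : K) (M M' : Matrix (Fin N) (Fin N) A) : Prop :=
  ∀ a b c d, u • (M a b * M' c d - M' c d * M a b) = M' c b * M a d - M c b * M' a d

/-- Both sides vanish unless row and column labels agree away from `p` and `q`; the remaining
entries are the defining relation, with the two terms of `R = u + P` giving its two kinds of terms.
-/
theorem rtt_iff {p q : ι} (hpq : p ≠ q) (u : K) (M M' : Matrix (Fin N) (Fin N) A) :
    RTT u M M' ↔ Rmat p q u * (embed p M * embed q M') = embed q M' * embed p M * Rmat p q u := by
  have key : ∀ α β : ι → Fin N,
      (Rmat p q u * (embed p M * embed q M') : Matrix (ι → Fin N) (ι → Fin N) A) α β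
        = (embed q M' * embed p M * Rmat p q u : Matrix (ι → Fin N) (ι → Fin N) A) α β ↔
      ((∀ r, r ≠ p → r ≠ q → α r = β r) →
        u • (M (α p) (β p) * M' (α q) (β q)) + M (α q) (β p) * M' (α p) (β q)
          = u • (M' (α q) (β q) * M (α p) (β p)) + M' (α q) (β p) * M (α p) (β q)) := by
    intro α β
    rw [Rmat_eq hpq, add_mul, mul_add, Matrix.add_apply, Matrix.add_apply, permMat_mul_apply,
      mul_permMat_apply]
    simp only [smul_mul_assoc, one_mul, mul_smul_comm, mul_one, Matrix.smul_apply,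
      embed_mul_embed_apply hpq, embed_mul_embed_apply hpq.symm, Equiv.swap_inv,
      Function.comp_apply, Equiv.swap_apply_left, Equiv.swap_apply_right]
    have e1 : (∀ r, r ≠ p → r ≠ q → α (Equiv.swap p q r) = β r) ↔
        ∀ r, r ≠ p → r ≠ q → α r = β r :=
      forall_congr' fun r => forall_congr' fun h1 => forall_congr' fun h2 => by
        rw [Equiv.swap_apply_of_ne_of_ne h1 h2]
    have e2 : (∀ r, r ≠ q → r ≠ p → α r = β (Equiv.swap p q r)) ↔
        ∀ r, r ≠ p → r ≠ q → α r = β r :=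
      forall_congr' fun r => by
        constructor
        · intro h h1 h2; rw [h h2 h1, Equiv.swap_apply_of_ne_of_ne h1 h2]
        · intro h h1 h2; rw [h h2 h1, Equiv.swap_apply_of_ne_of_ne h2 h1]
    have e3 : (∀ r, r ≠ q → r ≠ p → α r = β r) ↔ ∀ r, r ≠ p → r ≠ q → α r = β r :=
      forall_congr' fun r => forall_comm
    simp only [e1, e2, e3]
    by_cases h : ∀ r, r ≠ p → r ≠ q → α r = β r
    · rw [if_pos h, if_pos h, if_pos h, if_pos h]
      exact ⟨fun h' _ => h', fun h' => h' h⟩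
    · rw [if_neg h, if_neg h, if_neg h, if_neg h]
      exact ⟨fun _ h' => absurd h' h, fun _ => rfl⟩
  constructor
  · intro h
    ext α β
    rw [key]
    intro _
    have := h (α p) (β p) (α q) (β q)
    rw [smul_sub] at this
    rw [← sub_eq_zero] at this ⊢
    rw [← this]
    abel
  · intro h a b c d
    -- The labels are `a`, `c` for rows and `b`, `d` for columns at `p`, `q`; at all other factors
    -- rows and columns carry the same label `c`, so the side condition holds.
    have h1 := (key (fun r => if r = p then a else c) (fun r => if r = p then b else if r = q then d else c)).1
      (by rw [h]) (fun r h1 h2 => by simp [h1, h2])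
    simp only [if_true, hpq.symm, if_false] at h1
    rw [smul_sub]
    rw [← sub_eq_zero] at h1 ⊢
    rw [← h1]
    abel

/-- The mechanism behind the coproduct: in matrix form the factors regroup into two RTT products,
and `R` passes through one after the other. Two auxiliary factors, indexed by `Fin 2`, suffice. -/
theorem RTT.mul {u : K} {M M' L L' : Matrix (Fin N) (Fin N) A} (h : RTT u M M') (h' : RTT u L L')
    (c1 : ∀ a b c d, M a b * L' c d = L' c d * M a b)
    (c2 : ∀ a b c d, M' a b * L c d = L c d * M' a b) : RTT u (M * L) (M' * L') := by
  obtain ⟨p, q, hpq⟩ : ∃ p q : Fin 2, p ≠ q := ⟨0, 1, by decide⟩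
  rw [rtt_iff hpq] at *
  rw [embed_mul, embed_mul]
  have e1 : embed q M' * embed p L = embed p L * embed q M' := embed_comm hpq.symm c2
  have e2 : embed p M * embed q L' = embed q L' * embed p M := embed_comm hpq c1
  calc Rmat p q u * (embed p M * embed p L * (embed q M' * embed q L'))
      = (Rmat p q u * (embed p M * embed q M')) * (embed p L * embed q L') := by
        simp only [mul_assoc]
        rw [← mul_assoc (embed p L), ← e1, mul_assoc]
    _ = embed q M' * embed p M * (Rmat p q u * (embed p L * embed q L')) := by
        rw [h]; simp only [mul_assoc]
    _ = _ := by
        rw [h']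
        simp only [mul_assoc]
        rw [← mul_assoc (embed p M), e2]
        simp only [mul_assoc]

end Perm

theorem list_prod_map_mul {α M : Type*} [Monoid M] (l : List α) (hl : l.Nodup) (f g : α → M)
    (h : ∀ x ∈ l, ∀ y ∈ l, x ≠ y → g x * f y = f y * g x) :
    (l.map fun x => f x * g x).prod = (l.map f).prod * (l.map g).prod := by
  induction l with
  | nil => simp
  | cons x l ih =>
    rw [List.nodup_cons] at hl
    simp only [List.map_cons, List.prod_cons]
    rw [ih hl.2 fun y hy y' hy' => h y (List.mem_cons_of_mem _ hy) y' (List.mem_cons_of_mem _ hy')]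
    have : g x * (l.map f).prod = (l.map f).prod * g x := by
      apply commute_list_prod
      intro m hm
      obtain ⟨y, hy, rfl⟩ := List.mem_map.1 hm
      exact h x List.mem_cons_self y (List.mem_cons_of_mem _ hy) fun e : x = y => hl.1 (e.symm ▸ hy)
    rw [mul_assoc, ← mul_assoc (g x), this]
    simp only [mul_assoc]

theorem list_prod_map_smul {K A α : Type*} [CommMonoid K] [Monoid A] [MulAction K A]
    [IsScalarTower K A A] [SMulCommClass K A A] (l : List α) (c : α → K) (f : α → A) :
    (l.map fun x => c x • f x).prod = (l.map c).prod • (l.map f).prod := by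
  induction l with
  | nil => simp
  | cons x l ih => simp only [List.map_cons, List.prod_cons, ih, smul_mul_smul_comm]

/-! ### Ordered products of `R`-matrices -/

section Rprod

variable {ι : Type*} [Fintype ι] [DecidableEq ι] {N : ℕ} {K : Type*} [Field K]

/-- The flip does nothing to equal labels, so `R(u)` acts as `u + 1`. This accounts for the
normalizing factors `1/(t_j - t_i + 1)` and, later, for the triviality of normalized `R`-matrices at
constant labels. -/
theorem Rmat_mul_apply_of_eq {A m : Type*} [Ring A] [Algebra K A] {p q : ι} (hpq : p ≠ q) (u : K)
    (M : Matrix (ι → Fin N) m A) (α : ι → Fin N) (β : m) (h : α p = α q) :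
    ((Rmat p q u : Matrix (ι → Fin N) (ι → Fin N) A) * M) α β = (u + 1) • M α β := by
  rw [Rmat_eq hpq, Matrix.add_mul, Matrix.add_apply, permMat_mul_apply]
  have : α ∘ ⇑(Equiv.swap p q) = α := by
    funext r
    rw [Function.comp_apply, Equiv.swap_apply_def]
    split_ifs with h1 h2
    · rw [h1, h]
    · rw [h2, h]
    · rfl
  rw [this, add_smul, one_smul]
  simp

theorem mul_Rmat_apply_of_eq {A m : Type*} [Ring A] [Algebra K A] {p q : ι} (hpq : p ≠ q) (u : K)
    (M : Matrix m (ι → Fin N) A) (α : m) (β : ι → Fin N) (h : β p = β q) :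
    (M * (Rmat p q u : Matrix (ι → Fin N) (ι → Fin N) A)) α β = (u + 1) • M α β := by
  rw [Rmat_eq hpq, Matrix.mul_add, Matrix.add_apply, mul_permMat_apply]
  have : β ∘ ⇑(Equiv.swap p q)⁻¹ = β := by
    funext r
    rw [Equiv.swap_inv, Function.comp_apply, Equiv.swap_apply_def]
    split_ifs with h1 h2
    · rw [h1, h]
    · rw [h2, h]
    · rfl
  rw [this, add_smul, one_smul]
  simp

/-- The matrix of the embedding of labels `a ↦ a + 1`. -/
def succMat (ι : Type*) [Fintype ι] (N : ℕ) (A : Type*) [Ring A] :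
    Matrix (ι → Fin (N + 1)) (ι → Fin N) A :=
  fun α β => if α = Fin.succ ∘ β then 1 else 0

theorem mul_succMat_apply {A m : Type*} [Ring A] (M : Matrix m (ι → Fin (N + 1)) A) (α : m)
    (β : ι → Fin N) : (M * succMat ι N A) α β = M α (Fin.succ ∘ β) := by
  rw [Matrix.mul_apply, Finset.sum_eq_single (Fin.succ ∘ β)]
  · simp [succMat]
  · intro γ _ h
    simp [succMat, h]
  · simp

theorem succMat_mul_apply {A m : Type*} [Ring A] (M : Matrix (ι → Fin N) m A)
    (α : ι → Fin N) (β : m) : (succMat ι N A * M) (Fin.succ ∘ α) β = M α β := by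
  rw [Matrix.mul_apply, Finset.sum_eq_single α]
  · simp [succMat]
  · intro γ _ h
    have : Fin.succ ∘ α ≠ Fin.succ ∘ γ := fun e => h (funext fun q => (Fin.succ_injective _ (congrFun e q)).symm)
    simp [succMat, this]
  · simp

theorem succMat_mul_apply_eq_zero {A m : Type*} [Ring A] (M : Matrix (ι → Fin N) m A)
    (α : ι → Fin (N + 1)) (β : m) (q : ι) (h : α q = 0) : (succMat ι N A * M) α β = 0 := by
  rw [Matrix.mul_apply]
  apply Finset.sum_eq_zero
  intro γ _
  have : α ≠ Fin.succ ∘ γ := fun e => Fin.succ_ne_zero (γ q) (by rw [← h, e]; rfl)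
  simp [succMat, this]

/-- Permuting tensor factors commutes with relabelling, so `R`-matrices of consecutive ranks are
intertwined. This is how the rank goes down. -/
theorem Rmat_mul_succMat {A : Type*} [Ring A] [Algebra K A] {p q : ι} (hpq : p ≠ q) (u : K) :
    (Rmat p q u : Matrix (ι → Fin (N + 1)) (ι → Fin (N + 1)) A) * succMat ι N A
      = succMat ι N A * (Rmat p q u : Matrix (ι → Fin N) (ι → Fin N) A) := by
  rw [Rmat_eq hpq, Rmat_eq hpq, Matrix.add_mul, Matrix.mul_add]
  congr 1
  · simp
  · ext α β
    rw [permMat_mul_apply, mul_permMat_apply]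
    simp only [succMat]
    congr 1
    rw [eq_iff_iff, Equiv.swap_inv]
    constructor
    · intro h
      funext r
      have := congrFun h (Equiv.swap p q r)
      simpa using this
    · rintro rfl
      funext r
      simp

/-- The product of the `R`-matrices over the pairs of entries of a list. -/
def Rprod (A : Type*) [Ring A] [Algebra K A] (l : List ι) (z : ι → K) :
    Matrix (ι → Fin N) (ι → Fin N) A :=
  ((lexPairs l).map fun pq => Rmat pq.2 pq.1 (z pq.2 - z pq.1)).prod

variable (A : Type*) [Ring A] [Algebra K A]

@[simp] theorem Rprod_nil (z : ι → K) : (Rprod A [] z : Matrix (ι → Fin N) (ι → Fin N) A) = 1 := rfl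

theorem Rprod_cons (x : ι) (l : List ι) (z : ι → K) :
    (Rprod A (x :: l) z : Matrix (ι → Fin N) (ι → Fin N) A)
      = (l.map fun y => Rmat y x (z y - z x)).prod * Rprod A l z := by
  simp [Rprod, lexPairs, Function.comp_def]

/-- `R`-matrices of disjoint pairs commute. This allows the lexicographic order to be rearranged
into pairs within `l`, mixed pairs grouped by their element of `l'`, and pairs within `l'`. -/
theorem Rprod_append (l l' : List ι) (hl : (l ++ l').Nodup) (z : ι → K) :
    (Rprod A (l ++ l') z : Matrix (ι → Fin N) (ι → Fin N) A)
      = Rprod A l z * (l'.map fun y => (l.map fun x => Rmat y x (z y - z x)).prod).prod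
        * Rprod A l' z := by
  induction l with
  | nil => simp
  | cons x l ih =>
    rw [List.cons_append, List.nodup_cons, List.mem_append, not_or] at hl
    have hd : ∀ a ∈ l, ∀ b ∈ l', a ≠ b := (List.nodup_append.1 hl.2).2.2
    rw [List.cons_append, Rprod_cons, ih hl.2, Rprod_cons, List.map_append, List.prod_append]
    have e1 : (l'.map fun y => Rmat y x (z y - z x)).prod * Rprod A l z
        = Rprod A l z * ((l'.map fun y => Rmat y x (z y - z x)).prod :
          Matrix (ι → Fin N) (ι → Fin N) A) := by
      clear ih
      induction l with
      | nil => simp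
      | cons w l ih =>
        simp only [List.mem_cons, not_or] at hl
        have h2 := hl.2
        rw [List.cons_append, List.nodup_cons, List.mem_append, not_or] at h2
        rw [Rprod_cons, mul_assoc, ← ih ⟨⟨hl.1.1.2, hl.1.2⟩, h2.2⟩
          fun a ha => hd a (List.mem_cons_of_mem _ ha)]
        rw [← mul_assoc, ← mul_assoc]
        congr 1
        apply commute_list_prod
        intro m hm
        obtain ⟨a, ha, rfl⟩ := List.mem_map.1 hm
        symm
        apply commute_list_prod
        intro m hm
        obtain ⟨b, hb, rfl⟩ := List.mem_map.1 hm
        have hxa : x ≠ a := fun e => hl.1.1.2 (e ▸ ha)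
        have hxb : x ≠ b := fun e => hl.1.2 (e ▸ hb)
        have hwb : w ≠ b := hd w List.mem_cons_self b hb
        have hab : a ≠ b := hd a (List.mem_cons_of_mem _ ha) b hb
        have hwa : w ≠ a := fun e => h2.1.1 (e ▸ ha)
        exact Rmat_comm_Rmat hwa.symm hxb.symm hab (Ne.symm hxa) hwb (Ne.symm hl.1.1.1) _ _
    have e2 : ((l'.map fun y => ((x :: l).map fun x => Rmat y x (z y - z x)).prod).prod :
          Matrix (ι → Fin N) (ι → Fin N) A)
        = (l'.map fun y => Rmat y x (z y - z x)).prod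
          * (l'.map fun y => (l.map fun x => Rmat y x (z y - z x)).prod).prod := by
      simp only [List.map_cons, List.prod_cons]
      apply list_prod_map_mul _ (List.nodup_append.1 hl.2).2.1
      intro y hy y' hy' hne
      symm
      apply commute_list_prod
      intro m hm
      obtain ⟨a, ha, rfl⟩ := List.mem_map.1 hm
      have hxa : x ≠ a := fun e => hl.1.1 (e ▸ ha)
      exact Rmat_comm_Rmat (ne_of_mem_of_not_mem hy' hl.1.2) (hd a ha y hy).symm hne.symm
        (hd a ha y' hy').symm (ne_of_mem_of_not_mem hy hl.1.2).symm hxa _ _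
    rw [e2]
    simp only [mul_assoc]
    rw [← mul_assoc _ (Rprod A l z), e1]
    simp only [mul_assoc]

/-- At equal labels each `R`-matrix contributes its scalar `z_y - z_x + 1`, the factor removed by
the normalization of the Bethe functions. -/
theorem Rprod_mul_apply {m : Type*} (l : List ι) (hl : l.Nodup) (z : ι → K)
    (M : Matrix (ι → Fin N) m A) (α : ι → Fin N) (β : m) (h : ∀ x ∈ l, ∀ y ∈ l, α x = α y) :
    ((Rprod A l z : Matrix (ι → Fin N) (ι → Fin N) A) * M) α β
      = ((lexPairs l).map fun pq => z pq.2 - z pq.1 + 1).prod • M α β := by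
  induction l with
  | nil => simp [lexPairs]
  | cons x l ih =>
    rw [List.nodup_cons] at hl
    have ih' := ih hl.2 fun y hy y' hy' => h y (List.mem_cons_of_mem _ hy) y' (List.mem_cons_of_mem _ hy')
    have key : ∀ l' : List ι, l' ⊆ l → ∀ M : Matrix (ι → Fin N) m A,
        ((l'.map fun y => (Rmat y x (z y - z x) : Matrix (ι → Fin N) (ι → Fin N) A)).prod * M) α β
          = (l'.map fun y => z y - z x + 1).prod • M α β := by
      intro l' hl' M
      induction l' with
      | nil => simp
      | cons y l' ihy =>
        have hy : y ∈ l := hl' List.mem_cons_self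
        rw [List.map_cons, List.prod_cons, Matrix.mul_assoc,
          Rmat_mul_apply_of_eq (ne_of_mem_of_not_mem hy hl.1) _ _ _ _
            (h y (List.mem_cons_of_mem _ hy) x List.mem_cons_self),
          ihy fun a ha => hl' (List.mem_cons_of_mem _ ha), List.map_cons, List.prod_cons, mul_smul]
    rw [Rprod_cons, Matrix.mul_assoc, key l (fun _ h => h), ih']
    simp [lexPairs, mul_smul, Function.comp_def]

variable {A}

/-- The `R`-matrices of all pairs together implement the reversal of the order of the `T`'s. The
first `T` is carried past all the others with its own `R`-matrices, and induction reverses the rest.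
-/
theorem lineProd_mul_Rprod (l : List ι) (hl : l.Nodup) (z : ι → K)
    (T : ι → Matrix (Fin N) (Fin N) A)
    (h : ∀ x ∈ l, ∀ y ∈ l, x ≠ y → RTT (z x - z y) (T x) (T y)) :
    lineProd l T * Rprod A l z = Rprod A l z * lineProd l.reverse T := by
  induction l with
  | nil => simp
  | cons x l ih =>
    rw [List.nodup_cons] at hl
    have ih' := ih hl.2 fun y hy y' hy' => h y (List.mem_cons_of_mem _ hy) y' (List.mem_cons_of_mem _ hy')
    -- Carrying `T_x` past `T_y` uses `R_{yx}` alone; that `R`-matrix commutes with the `T`'s after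
    -- `y`, and `T_y` commutes with the `R`-matrices after it.
    have key : ∀ l' : List ι, l' ⊆ l → l'.Nodup →
        embed x (T x) * lineProd l' T * (l'.map fun y => Rmat y x (z y - z x)).prod
          = (l'.map fun y => Rmat y x (z y - z x)).prod * lineProd l' T * embed x (T x) := by
      intro l' hl' hn
      induction l' with
      | nil => simp
      | cons y l' ihy =>
        have hy : y ∈ l := hl' List.mem_cons_self
        rw [List.nodup_cons] at hn
        have hyx : y ≠ x := fun e => hl.1 (e ▸ hy)
        have hr := (rtt_iff hyx _ _ _).1
          (h y (List.mem_cons_of_mem _ hy) x List.mem_cons_self hyx)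
        have c1 : lineProd l' T * Rmat y x (z y - z x) = Rmat y x (z y - z x) * lineProd l' T := by
          symm
          apply commute_list_prod
          intro m hm
          obtain ⟨w, hw, rfl⟩ := List.mem_map.1 hm
          exact Rmat_comm_embed hyx (ne_of_mem_of_not_mem hw hn.1)
            (ne_of_mem_of_not_mem (hl' (List.mem_cons_of_mem _ hw)) hl.1) _ _
        have c2 : embed y (T y) * (l'.map fun y => Rmat y x (z y - z x)).prod
            = (l'.map fun y => Rmat y x (z y - z x)).prod * embed y (T y) := by
          apply commute_list_prod
          intro m hm
          obtain ⟨w, hw, rfl⟩ := List.mem_map.1 hm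
          have hwx : w ≠ x := fun e => hl.1 (e ▸ hl' (List.mem_cons_of_mem _ hw))
          exact (Rmat_comm_embed hwx (ne_of_mem_of_not_mem hw hn.1).symm hyx _ _).symm
        have ih2 := ihy (fun a ha => hl' (List.mem_cons_of_mem _ ha)) hn.2
        rw [List.map_cons, List.prod_cons, lineProd_cons]
        calc _ = (embed x (T x) * embed y (T y)) * (lineProd l' T * Rmat y x (z y - z x))
              * (l'.map fun y => Rmat y x (z y - z x)).prod := by simp only [mul_assoc]
          _ = (embed x (T x) * embed y (T y) * Rmat y x (z y - z x)) * lineProd l' T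
              * (l'.map fun y => Rmat y x (z y - z x)).prod := by rw [c1]; simp only [mul_assoc]
          _ = Rmat y x (z y - z x) * embed y (T y) * (embed x (T x) * lineProd l' T
              * (l'.map fun y => Rmat y x (z y - z x)).prod) := by rw [← hr]; simp only [mul_assoc]
          _ = Rmat y x (z y - z x) * (embed y (T y)
              * (l'.map fun y => Rmat y x (z y - z x)).prod) * lineProd l' T * embed x (T x) := by
            rw [ih2]; simp only [mul_assoc]
          _ = _ := by rw [c2]; simp only [mul_assoc]
    have c3 : embed x (T x) * Rprod A l z = Rprod A l z * embed x (T x) := by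
      clear ih' key ih h
      induction l with
      | nil => simp
      | cons y l ih =>
        simp only [List.mem_cons, not_or, List.nodup_cons] at hl
        rw [Rprod_cons, mul_assoc, ← ih ⟨hl.1.2, hl.2.2⟩, ← mul_assoc, ← mul_assoc]
        congr 1
        apply commute_list_prod
        intro m hm
        obtain ⟨w, hw, rfl⟩ := List.mem_map.1 hm
        exact (Rmat_comm_embed (ne_of_mem_of_not_mem hw hl.2.1) (ne_of_mem_of_not_mem hw hl.1.2).symm hl.1.1 _ _).symm
    rw [lineProd_cons, Rprod_cons, ← mul_assoc, key l (fun _ h => h) hl.2, mul_assoc, c3,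
      List.reverse_cons, lineProd_append, lineProd_cons, lineProd_nil, mul_one,
      mul_assoc _ (lineProd l T), ← mul_assoc (lineProd l T), ih']
    simp only [mul_assoc]

end Rprod

/-! ## Change of tensor factors -/

section Change

variable {ι κ : Type*} [Fintype ι] [DecidableEq ι] [Fintype κ] [DecidableEq κ] {N : ℕ}
  {K A : Type*} [Field K] [Ring A] [Algebra K A]

open Classical in
/-- Operators on some of the tensor factors as operators on all of them. -/
def liftMat (f : κ → ι) (M : Matrix (κ → Fin N) (κ → Fin N) A) :
    Matrix (ι → Fin N) (ι → Fin N) A :=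
  fun α β => if ∀ q, (¬∃ k, f k = q) → α q = β q then M (α ∘ f) (β ∘ f) else 0

theorem liftMat_mul_apply {m : Type*} {f : κ → ι} (hf : Function.Injective f)
    (M : Matrix (κ → Fin N) (κ → Fin N) A) (X : Matrix (ι → Fin N) m A) (α : ι → Fin N) (β : m) :
    (liftMat f M * X) α β = ∑ δ, M (α ∘ f) δ * X (Function.extend f δ α) β := by
  rw [Matrix.mul_apply]
  symm
  apply Fintype.sum_of_injective fun δ : κ → Fin N => Function.extend f δ α
  · intro δ δ' h
    funext k
    have := congrFun h (f k)
    simpa [hf.extend_apply] using this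
  · intro γ hγ
    simp only [liftMat]
    rw [if_neg, zero_mul]
    intro h
    apply hγ
    refine ⟨γ ∘ f, ?_⟩
    funext q
    by_cases hq : ∃ k, f k = q
    · obtain ⟨k, rfl⟩ := hq
      simp [hf.extend_apply]
    · change Function.extend f (γ ∘ f) α q = _
      rw [Function.extend_apply' _ _ _ hq, h q hq]
  · intro δ
    simp only [liftMat]
    rw [if_pos]
    · congr 2
      funext k
      simp [hf.extend_apply]
    · intro q hq
      rw [Function.extend_apply' _ _ _ hq]

theorem liftMat_mul {f : κ → ι} (hf : Function.Injective f)
    (M M' : Matrix (κ → Fin N) (κ → Fin N) A) :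
    liftMat f (M * M') = liftMat f M * liftMat f M' := by
  ext α β
  rw [liftMat_mul_apply hf]
  simp only [liftMat, Matrix.mul_apply]
  split_ifs with h
  · refine Finset.sum_congr rfl fun δ _ => ?_
    rw [if_pos]
    · congr 2
      funext k
      simp [hf.extend_apply]
    · intro q hq
      rw [Function.extend_apply' _ _ _ hq, h q hq]
  · symm
    apply Finset.sum_eq_zero
    intro δ _
    rw [if_neg, mul_zero]
    contrapose! h
    intro q hq
    rw [← h q hq, Function.extend_apply' _ _ _ (by simpa using hq)]

theorem liftMat_one (f : κ → ι) : liftMat f (1 : Matrix (κ → Fin N) (κ → Fin N) A) = 1 := by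
  ext α β
  simp only [liftMat, Matrix.one_apply]
  by_cases h : α = β
  · simp [h]
  · rw [if_neg h]
    split_ifs with h1 h2
    · refine absurd (funext fun q => ?_) h
      by_cases hq : ∃ k, f k = q
      · obtain ⟨k, rfl⟩ := hq
        exact congrFun h2 k
      · exact h1 q hq
    · rfl
    · rfl

/-- `liftMat` as a homomorphism of algebras. -/
def liftHom {f : κ → ι} (hf : Function.Injective f) :
    Matrix (κ → Fin N) (κ → Fin N) A →ₐ[K] Matrix (ι → Fin N) (ι → Fin N) A :=
  AlgHom.ofLinearMap
    { toFun := liftMat f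
      map_add' := fun M M' => by
        ext α β
        simp only [liftMat, Matrix.add_apply]
        split_ifs <;> simp
      map_smul' := fun c M => by
        ext α β
        simp only [liftMat, Matrix.smul_apply, RingHom.id_apply]
        split_ifs <;> simp }
    (liftMat_one f) (liftMat_mul hf)

theorem liftHom_apply {f : κ → ι} (hf : Function.Injective f)
    (M : Matrix (κ → Fin N) (κ → Fin N) A) : liftHom (K := K) hf M = liftMat f M := rfl

theorem liftMat_embed {f : κ → ι} (hf : Function.Injective f) (p : κ)
    (M : Matrix (Fin N) (Fin N) A) : liftMat f (embed p M) = embed (f p) M := by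
  ext α β
  simp only [liftMat, embed, Function.comp_apply]
  rw [← ite_and]
  congr 1
  rw [eq_iff_iff]
  constructor
  · rintro ⟨h1, h2⟩ q hq
    by_cases hk : ∃ k, f k = q
    · obtain ⟨k, rfl⟩ := hk
      exact h2 k fun e => hq (congrArg f e)
    · exact h1 q hk
  · intro h
    exact ⟨fun q hq => h q fun e => hq ⟨p, e.symm⟩, fun k hk => h _ fun e => hk (hf e)⟩

theorem liftMat_scalar {f : κ → ι} (r : A) :
    liftMat f (Matrix.scalar (κ → Fin N) r) = Matrix.scalar (ι → Fin N) r := by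
  ext α β
  simp only [liftMat, Matrix.scalar_apply, Matrix.diagonal_apply]
  rw [← ite_and]
  congr 1
  rw [eq_iff_iff]
  constructor
  · rintro ⟨h1, h2⟩
    funext q
    by_cases hk : ∃ k, f k = q
    · obtain ⟨k, rfl⟩ := hk
      exact congrFun h2 k
    · exact h1 q hk
  · rintro rfl
    simp

/-- Operators on all tensor factors as matrices of operators on some of them. -/
def curryMat {P : Type*} (e : ι ⊕ κ ≃ P) (M : Matrix (P → Fin N) (P → Fin N) A) :
    Matrix (κ → Fin N) (κ → Fin N) (Matrix (ι → Fin N) (ι → Fin N) A) :=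
  fun β β' α α' => M (Sum.elim α β ∘ e.symm) (Sum.elim α' β' ∘ e.symm)

variable {P : Type*} [Fintype P] [DecidableEq P]

/-- Labels on all tensor factors as pairs of labels. -/
def curryEquiv (N : ℕ) (e : ι ⊕ κ ≃ P) : (κ → Fin N) × (ι → Fin N) ≃ (P → Fin N) where
  toFun c := Sum.elim c.2 c.1 ∘ e.symm
  invFun c := (c ∘ e ∘ Sum.inr, c ∘ e ∘ Sum.inl)
  left_inv c := by ext <;> simp
  right_inv c := by
    funext p
    obtain ⟨q, rfl⟩ := e.surjective p
    rcases q with q | q <;> simp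

theorem curryMat_mul (e : ι ⊕ κ ≃ P) (M M' : Matrix (P → Fin N) (P → Fin N) A) :
    curryMat e (M * M') = curryMat e M * curryMat e M' := by
  ext β β' α α'
  rw [Matrix.mul_apply, Matrix.sum_apply]
  simp only [Matrix.mul_apply, curryMat]
  rw [← (curryEquiv N e).sum_comp, Fintype.sum_prod_type]
  rfl

theorem curryMat_one (e : ι ⊕ κ ≃ P) :
    curryMat e (1 : Matrix (P → Fin N) (P → Fin N) A) = 1 := by
  ext β β' α α'
  have h : Sum.elim α β ∘ e.symm = Sum.elim α' β' ∘ e.symm ↔ (β, α) = (β', α') :=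
    (curryEquiv N e).injective.eq_iff (a := (β, α)) (b := (β', α'))
  simp only [curryMat, Matrix.one_apply, h, Prod.mk.injEq]
  by_cases h1 : β = β'
  · simp [h1, Matrix.one_apply]
  · simp [h1]

/-- `curryMat` as a homomorphism of algebras. -/
def curryHom (K : Type*) [Field K] [Algebra K A] (e : ι ⊕ κ ≃ P) :
    Matrix (P → Fin N) (P → Fin N) A →ₐ[K]
      Matrix (κ → Fin N) (κ → Fin N) (Matrix (ι → Fin N) (ι → Fin N) A) :=
  AlgHom.ofLinearMap
    { toFun := curryMat e
      map_add' := fun _ _ => rfl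
      map_smul' := fun _ _ => rfl }
    (curryMat_one e) (curryMat_mul e)

theorem curryHom_embed_inr (e : ι ⊕ κ ≃ P) (y : κ) (M : Matrix (Fin N) (Fin N) A) :
    curryHom K e (embed (e (Sum.inr y)) M) = embed y (M.map (Matrix.scalar (ι → Fin N))) := by
  ext β β' α α'
  change embed (e (Sum.inr y)) M (Sum.elim α β ∘ e.symm) (Sum.elim α' β' ∘ e.symm) = _
  simp only [embed, Function.comp_apply, Equiv.symm_apply_apply, Sum.elim_inr]
  have h : (∀ q, q ≠ e (Sum.inr y) → Sum.elim α β (e.symm q) = Sum.elim α' β' (e.symm q)) ↔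
      α = α' ∧ ∀ q, q ≠ y → β q = β' q := by
    constructor
    · intro h
      refine ⟨funext fun q => ?_, fun q hq => ?_⟩
      · simpa using h (e (Sum.inl q)) (by simp)
      · simpa using h (e (Sum.inr q)) (by simpa using hq)
    · rintro ⟨rfl, h⟩ q hq
      obtain ⟨q, rfl⟩ := e.surjective q
      rcases q with q | q
      · simp
      · simpa using h q fun e => hq (by rw [e])
  simp only [h]
  by_cases h1 : α = α' <;> by_cases h2 : ∀ q, q ≠ y → β q = β' q
  · rw [if_pos ⟨h1, h2⟩, if_pos h2]; simp [h1]
  · rw [if_neg (fun h => h2 h.2), if_neg h2]; rfl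
  · rw [if_neg (fun h => h1 h.1), if_pos h2]; simp [h1]
  · rw [if_neg (fun h => h1 h.1), if_neg h2]; rfl

theorem curryHom_embed_inl (e : ι ⊕ κ ≃ P) (x : ι) (M : Matrix (Fin N) (Fin N) A) :
    curryHom K e (embed (e (Sum.inl x)) M) = Matrix.scalar (κ → Fin N) (embed x M) := by
  ext β β' α α'
  change embed (e (Sum.inl x)) M (Sum.elim α β ∘ e.symm) (Sum.elim α' β' ∘ e.symm) = _
  simp only [embed, Function.comp_apply, Equiv.symm_apply_apply, Sum.elim_inl, Matrix.scalar_apply,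
    Matrix.diagonal_apply]
  have h : (∀ q, q ≠ e (Sum.inl x) → Sum.elim α β (e.symm q) = Sum.elim α' β' (e.symm q)) ↔
      β = β' ∧ ∀ q, q ≠ x → α q = α' q := by
    constructor
    · intro h
      refine ⟨funext fun q => ?_, fun q hq => ?_⟩
      · simpa using h (e (Sum.inr q)) (by simp)
      · simpa using h (e (Sum.inl q)) (by simpa using hq)
    · rintro ⟨rfl, h⟩ q hq
      obtain ⟨q, rfl⟩ := e.surjective q
      rcases q with q | q
      · simpa using h q fun e => hq (by rw [e])
      · simp
  simp only [h]
  by_cases h1 : β = β' <;> by_cases h2 : ∀ q, q ≠ x → α q = α' q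
  · rw [if_pos ⟨h1, h2⟩, if_pos h1]; simp only [embed, if_pos h2]
  · rw [if_neg (fun h => h2 h.2), if_pos h1]; simp only [embed, if_neg h2]
  · rw [if_neg (fun h => h1 h.1), if_neg h1]; rfl
  · rw [if_neg (fun h => h1 h.1), if_neg h1]; rfl

/-- The `R`-matrix between an additional tensor factor and the factor `x`, divided by its
argument, as a matrix with respect to the additional factor. -/
def Lmat (A : Type*) [Ring A] [Algebra K A] (x : ι) (u : K) :
    Matrix (Fin N) (Fin N) (Matrix (ι → Fin N) (ι → Fin N) A) :=
  fun a b => (if a = b then 1 else 0) + u⁻¹ • embed x (Matrix.single b a 1)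

theorem curryHom_Rmat_inr (e : ι ⊕ κ ≃ P) (y y' : κ) (u : K) :
    curryHom K e (Rmat (e (Sum.inr y)) (e (Sum.inr y')) u : Matrix (P → Fin N) (P → Fin N) A)
      = Rmat y y' u := by
  have h : ∀ a b : Fin N, ((Matrix.single a b (1 : A)).map (Matrix.scalar (ι → Fin N)))
      = Matrix.single a b 1 := by
    intro a b
    ext i j : 2
    simp only [Matrix.map_apply, Matrix.single_apply]
    split_ifs <;> simp
  simp only [Rmat, map_add, map_smul, map_one, map_sum, map_mul, curryHom_embed_inr, h]

theorem curryHom_Rmat_inl (e : ι ⊕ κ ≃ P) (y : κ) (x : ι) {u : K} (hu : u ≠ 0) :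
    curryHom K e (Rmat (e (Sum.inr y)) (e (Sum.inl x)) u : Matrix (P → Fin N) (P → Fin N) A)
      = u • embed y (Lmat A x u) := by
  simp only [Rmat, map_add, map_smul, map_one, map_sum, map_mul, curryHom_embed_inr,
    curryHom_embed_inl]
  rw [← embed_one y, ← embed_smul, ← embed_smul]
  refine Matrix.ext fun β β' => ?_
  simp only [Matrix.add_apply, Matrix.sum_apply, Matrix.scalar_apply, Matrix.mul_diagonal]
  simp only [embed, Matrix.map_apply, Matrix.single_apply, Matrix.smul_apply, Lmat]
  by_cases h : ∀ q, q ≠ y → β q = β' q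
  · simp only [if_pos h]
    rw [Finset.sum_eq_single (β y), Finset.sum_eq_single (β' y)]
    · simp only [and_self, if_true, Matrix.one_apply, smul_add, smul_smul, mul_inv_cancel₀ hu,
        one_smul, one_mul, map_one]
    · intro b _ hb
      simp [hb]
    · simp
    · intro a _ ha
      simp [ha]
    · simp
  · simp only [if_neg h, zero_mul, Finset.sum_const_zero, add_zero]

end Change

/-! ## Bethe functions for families of matrices -/

section Positions

variable {n : ℕ}

theorem mem_positions (ξ : Fin n → ℕ) (p : Pos ξ) : p ∈ positions ξ := by
  simp only [positions, List.mem_flatMap, List.mem_finRange, List.mem_map, true_and]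
  exact ⟨p.1, p.2, rfl⟩

theorem nodup_positions (ξ : Fin n → ℕ) : (positions ξ).Nodup := by
  unfold positions
  rw [List.nodup_flatMap]
  refine ⟨fun a _ => (List.nodup_finRange _).map fun i j h => ?_, ?_⟩
  · simpa using h
  · refine (List.nodup_finRange n).imp ?_
    intro a b hab p hp hq
    simp only [List.mem_map, List.mem_finRange, true_and] at hp hq
    obtain ⟨i, rfl⟩ := hp
    obtain ⟨j, hj⟩ := hq
    exact hab (congrArg Sigma.fst hj).symm

/-- The index of a variable of the first colour. -/
def headPos (ξ : Fin (n + 1) → ℕ) (i : Fin (ξ 0)) : Pos ξ := ⟨0, i⟩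

/-- The index of a variable of another colour. -/
def tailPos (ξ : Fin (n + 1) → ℕ) (p : Pos fun a => ξ a.succ) : Pos ξ := ⟨p.1.succ, p.2⟩

theorem headPos_injective (ξ : Fin (n + 1) → ℕ) : Function.Injective (headPos ξ) := by
  intro i j h
  simpa [headPos] using h

theorem tailPos_injective (ξ : Fin (n + 1) → ℕ) : Function.Injective (tailPos ξ) := by
  rintro ⟨a, i⟩ ⟨b, j⟩ h
  simp only [tailPos, Sigma.mk.injEq] at h
  obtain ⟨h1, h2⟩ := h
  obtain rfl := Fin.succ_injective _ h1
  rw [eq_of_heq h2]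

theorem headPos_ne_tailPos (ξ : Fin (n + 1) → ℕ) (i : Fin (ξ 0)) (p : Pos fun a => ξ a.succ) :
    headPos ξ i ≠ tailPos ξ p := fun h =>
  (Fin.succ_ne_zero p.1) (congrArg Sigma.fst h).symm

theorem positions_succ (ξ : Fin (n + 1) → ℕ) :
    positions ξ = (List.finRange (ξ 0)).map (headPos ξ)
      ++ (positions fun a => ξ a.succ).map (tailPos ξ) := by
  unfold positions
  rw [List.finRange_succ, List.flatMap_cons, List.map_flatMap, List.flatMap_map]
  simp only [List.map_map]
  rfl

/-- The variables of the first colour and the other variables. -/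
def posEquiv (ξ : Fin (n + 1) → ℕ) : Fin (ξ 0) ⊕ (Pos fun a => ξ a.succ) ≃ Pos ξ :=
  Equiv.ofBijective (Sum.elim (headPos ξ) (tailPos ξ)) (by
    constructor
    · exact (headPos_injective ξ).sumElim (tailPos_injective ξ) (headPos_ne_tailPos ξ)
    · rintro ⟨a, i⟩
      refine Fin.cases (fun i => ⟨Sum.inl i, rfl⟩) (fun a i => ⟨Sum.inr ⟨a, i⟩, rfl⟩) a i)

theorem posEquiv_inl (ξ : Fin (n + 1) → ℕ) (i : Fin (ξ 0)) :
    posEquiv ξ (Sum.inl i) = headPos ξ i := rfl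

theorem posEquiv_inr (ξ : Fin (n + 1) → ℕ) (p : Pos fun a => ξ a.succ) :
    posEquiv ξ (Sum.inr p) = tailPos ξ p := rfl

theorem lexPairs_map {α β : Type*} (f : α → β) (l : List α) :
    lexPairs (l.map f) = (lexPairs l).map (Prod.map f f) := by
  induction l with
  | nil => rfl
  | cons x l ih => simp [lexPairs, ih, Function.comp_def]

theorem prod_lexPairs_finRange {M : Type*} [CommMonoid M] (m : ℕ) (f : Fin m → Fin m → M) :
    ((lexPairs (List.finRange m)).map fun pq => f pq.1 pq.2).prod
      = ∏ i, ∏ j ∈ Finset.univ.filter (fun j => i < j), f i j := by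
  induction m with
  | zero => simp [lexPairs]
  | succ m ih =>
    rw [List.finRange_succ, lexPairs, lexPairs_map, Fin.prod_univ_succ, List.map_append,
      List.prod_append, List.map_map, List.map_map, List.map_map]
    congr 1
    · rw [Finset.prod_filter, Fin.prod_univ_succ]
      simp only [lt_irrefl, if_false, one_mul, Fin.succ_pos, if_true, Function.comp_def]
      rw [← List.ofFn_eq_map, List.prod_ofFn]
    · have := ih fun i j => f i.succ j.succ
      simp only [Function.comp_def, Prod.map_fst, Prod.map_snd]
      rw [this]
      refine Finset.prod_congr rfl fun i _ => ?_
      rw [Finset.prod_filter, Finset.prod_filter, Fin.prod_univ_succ]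
      simp

theorem prod_positions {M : Type*} [CommMonoid M] (ξ : Fin n → ℕ) (f : Pos ξ → M) :
    ((positions ξ).map f).prod = ∏ p, f p := by
  rw [← List.prod_toFinset f (nodup_positions ξ)]
  congr 1
  ext p
  simp [mem_positions]

end Positions

/-! ### Definition and formal properties of the Bethe functions -/

section GB

variable {n : ℕ} {K A : Type*} [Field K] [Ring A] [Algebra K A]

/-- The matrix element in the definition of the Bethe functions. -/
def gHat (ξ : Fin n → ℕ) (T : Pos ξ → Matrix (Fin (n + 1)) (Fin (n + 1)) A) (z : Pos ξ → K) : A :=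
  (lineProd (positions ξ) T * Rprod A (positions ξ) z :
    Matrix (Pos ξ → Fin (n + 1)) (Pos ξ → Fin (n + 1)) A) (fun p => p.1.castSucc) (fun p => p.1.succ)

/-- The normalization of the Bethe functions. -/
def gPre (ξ : Fin n → ℕ) (z : Pos ξ → K) : K :=
  (∏ a : Fin n, ∏ i : Fin (ξ a), ∏ j ∈ Finset.univ.filter (fun j : Fin (ξ a) => i < j),
      1 / (z ⟨a, j⟩ - z ⟨a, i⟩ + 1))
    * ∏ a : Fin n, ∏ b ∈ Finset.univ.filter (fun b : Fin n => a < b),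
        ∏ i : Fin (ξ a), ∏ j : Fin (ξ b), 1 / (z ⟨b, j⟩ - z ⟨a, i⟩)

/-- The Bethe function of a family of matrices. -/
def gB (ξ : Fin n → ℕ) (T : Pos ξ → Matrix (Fin (n + 1)) (Fin (n + 1)) A) (z : Pos ξ → K) : A :=
  gPre ξ z • gHat ξ T z

theorem bethe_eq_gB {σ : Type*} (ξ : Fin n → ℕ) (τ : Pos ξ → σ) :
    bethe ξ τ = gB ξ (fun p => Tmat (n + 1) (τ p)) (fun p => tvar (τ p)) := by
  unfold bethe gB gPre
  congr 1
  unfold betheHat gHat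
  rw [Matrix.trace_mul_single]
  simp only [MulOpposite.op_one, one_smul]
  rfl

theorem Rprod_map_algebraMap {ι : Type*} [Fintype ι] [DecidableEq ι] {N : ℕ} (l : List ι)
    (z : ι → K) : (Rprod K l z : Matrix (ι → Fin N) (ι → Fin N) K).map (algebraMap K A)
      = Rprod A l z := by
  unfold Rprod
  generalize lexPairs l = l'
  induction l' with
  | nil => simp [Matrix.map_one]
  | cons p l' ih =>
    simp only [List.map_cons, List.prod_cons]
    rw [Matrix.map_mul, ih, Rmat_map_algebraMap]

/-- The Bethe function is a `K`-linear combination of ordered products of entries of the `T p`.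
Naturality, intertwining and invariance all follow from this form, since the coefficients do not
depend on `T`. -/
theorem gHat_eq_sum (ξ : Fin n → ℕ) (T : Pos ξ → Matrix (Fin (n + 1)) (Fin (n + 1)) A)
    (z : Pos ξ → K) : gHat ξ T z = ∑ c : Pos ξ → Fin (n + 1),
      Rprod K (positions ξ) z c (fun p => p.1.succ) •
        ((positions ξ).map fun p => T p p.1.castSucc (c p)).prod := by
  unfold gHat
  rw [Matrix.mul_apply]
  refine Finset.sum_congr rfl fun c _ => ?_
  rw [lineProd_apply_of_complete _ (nodup_positions ξ) (mem_positions ξ), ← Rprod_map_algebraMap,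
    Matrix.map_apply, Algebra.smul_def, Algebra.commutes]

theorem map_gB {B : Type*} [Ring B] [Algebra K B] (f : A →ₐ[K] B) (ξ : Fin n → ℕ)
    (T : Pos ξ → Matrix (Fin (n + 1)) (Fin (n + 1)) A) (z : Pos ξ → K) :
    f (gB ξ T z) = gB ξ (fun p => (T p).map f) z := by
  simp only [gB, gHat_eq_sum, map_smul, map_sum, map_list_prod, List.map_map]
  rfl

/-- Since the coefficients are scalars, `r` can be passed through the entries one by one. Operators,
such as `R`-matrices or products of `T`'s, are later moved through whole Bethe functions in this
way. -/
theorem intertwine_gB (ξ : Fin n → ℕ) (r : A)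
    (T T' : Pos ξ → Matrix (Fin (n + 1)) (Fin (n + 1)) A) (z : Pos ξ → K)
    (h : ∀ p a b, r * T p a b = T' p a b * r) : r * gB ξ T z = gB ξ T' z * r := by
  simp only [gB, gHat_eq_sum, mul_smul_comm, smul_mul_assoc, Finset.mul_sum, Finset.sum_mul]
  congr 1
  refine Finset.sum_congr rfl fun c _ => ?_
  congr 1
  generalize positions ξ = l
  induction l with
  | nil => simp
  | cons p l ih =>
    simp only [List.map_cons, List.prod_cons]
    rw [← mul_assoc, h, mul_assoc, ih, mul_assoc]

/-- If the matrices in two families act in the same way on the relevant elements, then so do the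
Bethe functions. -/
theorem gB_mul_congr (ξ : Fin n → ℕ) (T T' : Pos ξ → Matrix (Fin (n + 1)) (Fin (n + 1)) A)
    (z : Pos ξ → K) (v : A) (G : List (Pos ξ) → A → Prop) (h0 : G [] v)
    (h : ∀ p l u, p ∉ l → G l u → ∀ a b, a ≠ Fin.last n →
      T p a b * u = T' p a b * u ∧ G (p :: l) (T p a b * u)) :
    gB ξ T z * v = gB ξ T' z * v := by
  simp only [gB, gHat_eq_sum, smul_mul_assoc, Finset.sum_mul]
  congr 1
  refine Finset.sum_congr rfl fun c _ => ?_
  congr 1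
  -- The factors act from the right end of the list; `G l` records what is known after the positions
  -- of `l` have been used. Rows are `castSucc` labels, hence never the last one.
  have key : ∀ l : List (Pos ξ), l.Nodup →
      (l.map fun p => T p p.1.castSucc (c p)).prod * v
        = (l.map fun p => T' p p.1.castSucc (c p)).prod * v
      ∧ G l ((l.map fun p => T p p.1.castSucc (c p)).prod * v) := by
    intro l hl
    induction l with
    | nil => simpa using h0
    | cons p l ih =>
      rw [List.nodup_cons] at hl
      obtain ⟨h1, h2⟩ := ih hl.2
      obtain ⟨h3, h4⟩ := h p l _ hl.1 h2 p.1.castSucc (c p) (Fin.castSucc_lt_last _).ne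
      simp only [List.map_cons, List.prod_cons, mul_assoc]
      exact ⟨by rw [h3, h1], h4⟩
  exact (key _ (nodup_positions ξ)).1

/-- The predicate `G'` follows the vector through successive applications of entries and may depend
on the positions already used; only its linear consequence `G` has to survive the final combination.
-/
theorem gB_invariant (ξ : Fin n → ℕ) (T : Pos ξ → Matrix (Fin (n + 1)) (Fin (n + 1)) A)
    (z : Pos ξ → K) (v : A) (G : Submodule K A) (G' : List (Pos ξ) → A → Prop) (h0 : G' [] v)
    (h : ∀ p l u, p ∉ l → G' l u → ∀ a b, G' (p :: l) (T p a b * u))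
    (hG : ∀ l u, G' l u → u ∈ G) :
    gB ξ T z * v ∈ G := by
  simp only [gB, gHat_eq_sum, smul_mul_assoc, Finset.sum_mul]
  refine G.smul_mem _ (G.sum_mem fun c _ => G.smul_mem _ ?_)
  have key : ∀ l : List (Pos ξ), l.Nodup →
      G' l ((l.map fun p => T p p.1.castSucc (c p)).prod * v) := by
    intro l hl
    induction l with
    | nil => simpa using h0
    | cons p l ih =>
      rw [List.nodup_cons] at hl
      simp only [List.map_cons, List.prod_cons, mul_assoc]
      exact h p l _ hl.1 (ih hl.2) _ _
  exact hG _ _ (key _ (nodup_positions ξ))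

/-- Of the two split-off products, one cancels the scalars of the `R`-matrices of the first colour,
the other the scalars lost when mixed `R`-matrices are rewritten through `Lmat`. -/
theorem gPre_succ (ξ : Fin (n + 1) → ℕ) (z : Pos ξ → K) :
    gPre ξ z = ((∏ i, ∏ j ∈ Finset.univ.filter (fun j => i < j),
        (z (headPos ξ j) - z (headPos ξ i) + 1))⁻¹
      * (∏ p, ∏ i, (z (tailPos ξ p) - z (headPos ξ i)))⁻¹) * gPre _ (z ∘ tailPos ξ) := by
  unfold gPre
  rw [Fin.prod_univ_succ, Fin.prod_univ_succ]
  have h1 : ∏ b ∈ Finset.univ.filter (fun b : Fin (n + 1) => 0 < b), ∏ i : Fin (ξ 0),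
      ∏ j : Fin (ξ b), 1 / (z ⟨b, j⟩ - z ⟨0, i⟩)
      = (∏ p, ∏ i, (z (tailPos ξ p) - z (headPos ξ i)))⁻¹ := by
    rw [Finset.prod_filter, Fin.prod_univ_succ]
    simp only [lt_irrefl, if_false, one_mul, Fin.succ_pos, if_true, one_div,
      ← Finset.prod_inv_distrib]
    rw [Fintype.prod_sigma]
    exact Finset.prod_congr rfl fun b _ => Finset.prod_comm
  have h2 : ∀ a : Fin n, ∏ b ∈ Finset.univ.filter (fun b : Fin (n + 1) => a.succ < b),
      ∏ i : Fin (ξ a.succ), ∏ j : Fin (ξ b), 1 / (z ⟨b, j⟩ - z ⟨a.succ, i⟩)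
      = ∏ b ∈ Finset.univ.filter (fun b : Fin n => a < b),
      ∏ i : Fin (ξ a.succ), ∏ j : Fin (ξ b.succ), 1 / (z ⟨b.succ, j⟩ - z ⟨a.succ, i⟩) := by
    intro a
    rw [Finset.prod_filter, Finset.prod_filter, Fin.prod_univ_succ]
    simp
  rw [h1, Finset.prod_congr rfl fun a _ => h2 a]
  simp only [one_div, Finset.prod_inv_distrib]
  unfold tailPos headPos
  simp only [Function.comp_apply]
  ring

/-- The product of the matrices `Lmat` for a list of tensor factors. -/
def Lprod {ι : Type*} [Fintype ι] [DecidableEq ι] {N : ℕ} (A : Type*) [Ring A] [Algebra K A]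
    (w : List ι) (x : ι → K) (s : K) :
    Matrix (Fin N) (Fin N) (Matrix (ι → Fin N) (ι → Fin N) A) :=
  (w.map fun i => Lmat A i (s - x i)).prod

/-- A matrix multiplied by the matrices `Lmat` for a list of tensor factors. -/
def dressed {ι : Type*} [Fintype ι] [DecidableEq ι] {N : ℕ} (w : List ι) (x : ι → K) (s : K)
    (T : Matrix (Fin N) (Fin N) A) :
    Matrix (Fin N) (Fin N) (Matrix (ι → Fin N) (ι → Fin N) A) :=
  T.map (Matrix.scalar (ι → Fin N)) * Lprod A w x s

/-- The nested form of the Bethe functions. -/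
def nested {ι : Type*} [Fintype ι] [DecidableEq ι] (w : List ι)
    (T : ι → Matrix (Fin (n + 2)) (Fin (n + 2)) A) (x : ι → K) (ξ : Fin n → ℕ)
    (T' : Pos ξ → Matrix (Fin (n + 1)) (Fin (n + 1)) A) (z : Pos ξ → K) : A :=
  ((lineProd w.reverse T * succMat ι (n + 1) A : Matrix (ι → Fin (n + 2)) (ι → Fin (n + 1)) A)
    * gB ξ (fun p => dressed w x (z p) (T' p)) z) (fun _ => 0) (fun _ => 0)

theorem lineProd_comm_Rprod {ι : Type*} [Fintype ι] [DecidableEq ι] {N : ℕ} (l l' : List ι)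
    (hl : (l ++ l').Nodup) (T : ι → Matrix (Fin N) (Fin N) A) (z : ι → K) :
    lineProd l' T * Rprod A l z = Rprod A l z * lineProd l' T := by
  induction l with
  | nil => simp
  | cons x l ih =>
    rw [List.cons_append, List.nodup_cons, List.mem_append, not_or] at hl
    have hd := (List.nodup_append.1 hl.2).2.2
    have : (l.map fun y => (Rmat y x (z y - z x) : Matrix (ι → Fin N) (ι → Fin N) A)).prod * lineProd l' T
        = lineProd l' T * (l.map fun y => Rmat y x (z y - z x)).prod := by
      apply commute_list_prod
      intro m hm
      obtain ⟨b, hb, rfl⟩ := List.mem_map.1 hm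
      symm
      apply commute_list_prod
      intro m hm
      obtain ⟨a, ha, rfl⟩ := List.mem_map.1 hm
      exact (Rmat_comm_embed (ne_of_mem_of_not_mem ha hl.1.1) (hd a ha b hb).symm
        (ne_of_mem_of_not_mem hb hl.1.2) _ _).symm
    rw [Rprod_cons, ← mul_assoc, ← this, mul_assoc, ih hl.2, mul_assoc]

theorem prod_Rmat_mul_succMat {ι α : Type*} [Fintype ι] [DecidableEq ι] {N : ℕ} (l : List α)
    (f g : α → ι) (u : α → K) (h : ∀ a ∈ l, f a ≠ g a) :
    ((l.map fun a => (Rmat (f a) (g a) (u a) :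
      Matrix (ι → Fin (N + 1)) (ι → Fin (N + 1)) A)).prod * succMat ι N A)
      = succMat ι N A * (l.map fun a => (Rmat (f a) (g a) (u a) :
      Matrix (ι → Fin N) (ι → Fin N) A)).prod := by
  induction l with
  | nil => simp
  | cons a l ih =>
    simp only [List.map_cons, List.prod_cons]
    rw [Matrix.mul_assoc, ih fun b hb => h b (List.mem_cons_of_mem _ hb), ← Matrix.mul_assoc,
      Rmat_mul_succMat (h a List.mem_cons_self), Matrix.mul_assoc]

theorem Rprod_mul_succMat {ι : Type*} [Fintype ι] [DecidableEq ι] {N : ℕ} (l : List ι)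
    (hl : l.Nodup) (z : ι → K) :
    (Rprod A l z : Matrix (ι → Fin (N + 1)) (ι → Fin (N + 1)) A) * succMat ι N A
      = succMat ι N A * (Rprod A l z : Matrix (ι → Fin N) (ι → Fin N) A) := by
  induction l with
  | nil => simp
  | cons x l ih =>
    rw [List.nodup_cons] at hl
    rw [Rprod_cons, Rprod_cons, Matrix.mul_assoc, ih hl.2, ← Matrix.mul_assoc,
      prod_Rmat_mul_succMat l (fun y => y) (fun _ => x) (fun y => z y - z x)
        fun a ha => ne_of_mem_of_not_mem ha hl.1, Matrix.mul_assoc]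

theorem embed_list_prod {ι : Type*} [Fintype ι] [DecidableEq ι] {N : ℕ} (p : ι)
    (l : List (Matrix (Fin N) (Fin N) A)) :
    embed p l.prod = (l.map (embed p)).prod := by
  induction l with
  | nil => simp [embed_one]
  | cons M l ih => simp [embed_mul, ih]

theorem scalar_comm_Lmat {ι : Type*} [Fintype ι] [DecidableEq ι] {N : ℕ} (r : A) (i : ι) (u : K)
    (a b : Fin N) : Matrix.scalar (ι → Fin N) r * Lmat A i u a b
      = Lmat A i u a b * Matrix.scalar (ι → Fin N) r := by
  unfold Lmat
  rw [mul_add, add_mul, mul_smul_comm, smul_mul_assoc, scalar_comm_embed]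
  · congr 1
    split_ifs <;> simp
  · intro c d
    rw [Matrix.single_apply]
    split_ifs <;> simp

theorem comm_matrix_list_prod {m : Type*} [Fintype m] [DecidableEq m] (r : A)
    (l : List (Matrix m m A)) (h : ∀ M ∈ l, ∀ a b, r * M a b = M a b * r) (a b : m) :
    r * l.prod a b = l.prod a b * r := by
  induction l generalizing a b with
  | nil =>
    simp only [List.prod_nil, Matrix.one_apply]
    split_ifs <;> simp
  | cons M l ih =>
    rw [List.prod_cons, Matrix.mul_apply, Finset.mul_sum, Finset.sum_mul]
    refine Finset.sum_congr rfl fun c _ => ?_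
    rw [← mul_assoc, h M List.mem_cons_self, mul_assoc,
      ih fun M hM => h M (List.mem_cons_of_mem _ hM), mul_assoc]

theorem scalar_comm_Lprod {ι : Type*} [Fintype ι] [DecidableEq ι] {N : ℕ} (r : A) (w : List ι)
    (x : ι → K) (s : K) (a b : Fin N) : Matrix.scalar (ι → Fin N) r * Lprod A w x s a b
      = Lprod A w x s a b * Matrix.scalar (ι → Fin N) r := by
  apply comm_matrix_list_prod
  intro M hM a b
  obtain ⟨i, -, rfl⟩ := List.mem_map.1 hM
  exact scalar_comm_Lmat _ _ _ _ _

end GB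

/-! ### The nested form: lowering the rank by one -/

section Nested

variable {n : ℕ} {K A : Type*} [Field K] [Ring A] [Algebra K A]

theorem map_prod_Rmat_curry (ξ : Fin (n + 1) → ℕ) (z : Pos ξ → K)
    (hz : ∀ i y, z (tailPos ξ y) - z (headPos ξ i) ≠ 0) (N : ℕ)
    (w : List (Fin (ξ 0))) (y : Pos fun a => ξ a.succ) :
    curryHom K (posEquiv ξ) (w.map fun i => (Rmat (tailPos ξ y) (headPos ξ i)
        (z (tailPos ξ y) - z (headPos ξ i)) : Matrix (Pos ξ → Fin N) (Pos ξ → Fin N) A)).prod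
      = (w.map fun i => z (tailPos ξ y) - z (headPos ξ i)).prod •
        embed y (Lprod A w (fun i => z (headPos ξ i)) (z (tailPos ξ y))) := by
  rw [map_list_prod, List.map_map, Lprod, embed_list_prod, List.map_map, ← list_prod_map_smul]
  congr 2
  funext i
  exact curryHom_Rmat_inl (posEquiv ξ) y i (hz i y)

theorem curry_Rprod (ξ : Fin (n + 1) → ℕ) (z : Pos ξ → K) (N : ℕ)
    (l : List (Pos fun a => ξ a.succ)) :
    curryHom K (posEquiv ξ) (Rprod A (l.map (tailPos ξ)) z : Matrix (Pos ξ → Fin N) (Pos ξ → Fin N) A)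
      = Rprod (Matrix (Fin (ξ 0) → Fin N) (Fin (ξ 0) → Fin N) A) l (z ∘ tailPos ξ) := by
  rw [Rprod, Rprod, lexPairs_map, List.map_map, map_list_prod, List.map_map]
  congr 2
  funext p
  exact curryHom_Rmat_inr (posEquiv ξ) p.2 p.1 _

/-- By RTT the `R`-matrices of the first colour come out on the left, where all first-colour labels
are `0` and they act by scalars. On the right all labels are successors, so the remaining
`R`-matrices can be replaced by those of rank one less. -/
theorem gHat_succ_aux (ξ : Fin (n + 1) → ℕ) (T : Pos ξ → Matrix (Fin (n + 2)) (Fin (n + 2)) A)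
    (z : Pos ξ → K)
    (hT : ∀ i j, i ≠ j →
      RTT (z (headPos ξ i) - z (headPos ξ j)) (T (headPos ξ i)) (T (headPos ξ j))) :
    gHat ξ T z
      = (∏ i, ∏ j ∈ Finset.univ.filter (fun j => i < j),
          (z (headPos ξ j) - z (headPos ξ i) + 1)) •
        ∑ c : Pos ξ → Fin (n + 1),
          (((List.finRange (ξ 0)).reverse.map fun i => T (headPos ξ i) 0 (c (headPos ξ i)).succ).prod
            * ((positions fun a => ξ a.succ).map fun y =>
              T (tailPos ξ y) y.1.castSucc.succ (c (tailPos ξ y)).succ).prod)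
          * (((positions fun a => ξ a.succ).map fun y => ((List.finRange (ξ 0)).map fun i =>
              (Rmat (tailPos ξ y) (headPos ξ i) (z (tailPos ξ y) - z (headPos ξ i)) :
                Matrix (Pos ξ → Fin (n + 1)) (Pos ξ → Fin (n + 1)) A)).prod).prod
            * Rprod A ((positions fun a => ξ a.succ).map (tailPos ξ)) z :
              Matrix (Pos ξ → Fin (n + 1)) (Pos ξ → Fin (n + 1)) A) c (fun p => p.1) := by
  set X := (List.finRange (ξ 0)).map (headPos ξ) with hX
  set Y := (positions fun a => ξ a.succ).map (tailPos ξ) with hY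
  have hXY : (X ++ Y).Nodup := by rw [← positions_succ]; exact nodup_positions ξ
  have hXn := (List.nodup_append.1 hXY).1
  have hYn := (List.nodup_append.1 hXY).2.1
  have hd := (List.nodup_append.1 hXY).2.2
  -- The matrices of the other colours commute with the `R`-matrices of the first colour, and
  -- pulling these out reverses the order of the first-colour `T`'s.
  have e1 : gHat ξ T z = (Rprod A X z * (lineProd (X.reverse ++ Y) T *
      ((Y.map fun y => (X.map fun x => Rmat y x (z y - z x)).prod).prod * Rprod A Y z)) :
      Matrix (Pos ξ → Fin (n + 2)) (Pos ξ → Fin (n + 2)) A)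
        (fun p => p.1.castSucc) (fun p => p.1.succ) := by
    unfold gHat
    rw [positions_succ, ← hX, ← hY, Rprod_append A X Y hXY]
    rw [lineProd_append, lineProd_append]
    simp only [mul_assoc]
    rw [← mul_assoc (lineProd Y T), lineProd_comm_Rprod X Y hXY, mul_assoc,
      ← mul_assoc (lineProd X T), lineProd_mul_Rprod X hXn]
    · simp only [mul_assoc]
    · intro x hx y hy hxy
      obtain ⟨i, -, rfl⟩ := List.mem_map.1 hx
      obtain ⟨j, -, rfl⟩ := List.mem_map.1 hy
      exact hT i j fun e => hxy (by rw [e])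
  rw [e1, Rprod_mul_apply A X hXn]
  · congr 1
    · rw [hX, lexPairs_map, List.map_map]
      exact prod_lexPairs_finRange _ fun i j => z (headPos ξ j) - z (headPos ξ i) + 1
    · have e2 : ∀ (N : ℕ), ((Y.map fun y => (X.map fun x => (Rmat y x (z y - z x) :
          Matrix (Pos ξ → Fin N) (Pos ξ → Fin N) A)).prod).prod
          = ((positions fun a => ξ a.succ).map fun y => ((List.finRange (ξ 0)).map fun i =>
              (Rmat (tailPos ξ y) (headPos ξ i) (z (tailPos ξ y) - z (headPos ξ i)) :
                Matrix (Pos ξ → Fin N) (Pos ξ → Fin N) A)).prod).prod) := by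
        intro N
        rw [hX, hY]
        simp only [List.map_map]
        rfl
      -- The relabelling matrix enters from the right and restricts every remaining `R`-matrix to
      -- nonzero labels.
      have e3 : ((Y.map fun y => (X.map fun x => (Rmat y x (z y - z x) :
          Matrix (Pos ξ → Fin (n + 2)) (Pos ξ → Fin (n + 2)) A)).prod).prod * Rprod A Y z)
            * succMat (Pos ξ) (n + 1) A
          = succMat (Pos ξ) (n + 1) A * ((Y.map fun y => (X.map fun x => (Rmat y x (z y - z x) :
          Matrix (Pos ξ → Fin (n + 1)) (Pos ξ → Fin (n + 1)) A)).prod).prod * Rprod A Y z) := by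
        rw [Matrix.mul_assoc, Rprod_mul_succMat Y hYn, ← Matrix.mul_assoc, ← Matrix.mul_assoc]
        congr 1
        have : ∀ l ⊆ Y, (l.map fun y => (X.map fun x => (Rmat y x (z y - z x) :
          Matrix (Pos ξ → Fin (n + 2)) (Pos ξ → Fin (n + 2)) A)).prod).prod
            * succMat (Pos ξ) (n + 1) A
          = succMat (Pos ξ) (n + 1) A * (l.map fun y => (X.map fun x => (Rmat y x (z y - z x) :
          Matrix (Pos ξ → Fin (n + 1)) (Pos ξ → Fin (n + 1)) A)).prod).prod := by
          intro l hl
          induction l with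
          | nil => simp
          | cons y l ih =>
            simp only [List.map_cons, List.prod_cons]
            rw [Matrix.mul_assoc, ih fun b hb => hl (List.mem_cons_of_mem _ hb),
              ← Matrix.mul_assoc, prod_Rmat_mul_succMat X (fun _ => y) (fun x => x)
                (fun x => z y - z x) fun x hx => (hd x hx y (hl List.mem_cons_self)).symm,
              Matrix.mul_assoc]
        exact this Y fun _ h => h
      rw [← e2]
      have e4 : (fun p : Pos ξ => p.1.succ) = Fin.succ ∘ (fun p : Pos ξ => p.1) := rfl
      rw [e4]
      refine (mul_succMat_apply (ι := Pos ξ) (lineProd (X.reverse ++ Y) T *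
        ((Y.map fun y => (X.map fun x => Rmat y x (z y - z x)).prod).prod * Rprod A Y z))
        _ _).symm.trans ?_
      rw [Matrix.mul_assoc, e3, ← Matrix.mul_assoc, Matrix.mul_apply]
      refine Finset.sum_congr rfl fun c _ => ?_
      congr 1
      rw [mul_succMat_apply, lineProd_apply_of_complete]
      · rw [List.map_append, List.prod_append, hX, hY, ← List.map_reverse, List.map_map,
          List.map_map]
        rfl
      · rw [List.nodup_append] at hXY ⊢
        simpa using hXY
      · intro p
        have := mem_positions ξ p
        rw [positions_succ] at this
        rw [List.mem_append] at this ⊢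
        simpa only [List.mem_reverse] using this
  · intro x hx y hy
    obtain ⟨i, -, rfl⟩ := List.mem_map.1 hx
    obtain ⟨j, -, rfl⟩ := List.mem_map.1 hy
    rfl

/-- The tensor factors of the other colours become matrix indices and those of the first colour stay
inside the coefficients. Mixed `R`-matrices then become multiples of `Lmat` and merge with the `T`'s
into dressed matrices. Both prefactors cancel, which needs the differences and the differences plus
one to be nonzero. -/
theorem gB_succ (ξ : Fin (n + 1) → ℕ) (T : Pos ξ → Matrix (Fin (n + 2)) (Fin (n + 2)) A)
    (z : Pos ξ → K)
    (hT : ∀ i j, i ≠ j →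
      RTT (z (headPos ξ i) - z (headPos ξ j)) (T (headPos ξ i)) (T (headPos ξ j)))
    (hz : ∀ p q, p ≠ q → z p - z q ≠ 0) (hz1 : ∀ p q, p ≠ q → z p - z q + 1 ≠ 0) :
    gB ξ T z = nested (List.finRange (ξ 0)) (T ∘ headPos ξ) (z ∘ headPos ξ) (fun a => ξ a.succ)
      (fun y => (T (tailPos ξ y)).submatrix Fin.succ Fin.succ) (z ∘ tailPos ξ) := by
  have hs : (∏ i, ∏ j ∈ Finset.univ.filter (fun j => i < j),
          (z (headPos ξ j) - z (headPos ξ i) + 1)) ≠ 0 := by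
    refine Finset.prod_ne_zero_iff.2 fun i _ => Finset.prod_ne_zero_iff.2 fun j hj => hz1 _ _ ?_
    intro e
    rw [Finset.mem_filter] at hj
    exact hj.2.ne (headPos_injective ξ e).symm
  have hz' : ∀ i y, z (tailPos ξ y) - z (headPos ξ i) ≠ 0 := fun i y =>
    hz _ _ (headPos_ne_tailPos ξ i y).symm
  have hc : (∏ p, ∏ i, (z (tailPos ξ p) - z (headPos ξ i))) ≠ 0 :=
    Finset.prod_ne_zero_iff.2 fun p _ => Finset.prod_ne_zero_iff.2 fun i _ => hz' i p
  rw [gB, gHat_succ_aux ξ T z hT, gPre_succ]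
  set s := (∏ i, ∏ j ∈ Finset.univ.filter (fun j => i < j),
          (z (headPos ξ j) - z (headPos ξ i) + 1)) with hs_def
  set d := (∏ p, ∏ i, (z (tailPos ξ p) - z (headPos ξ i))) with hd_def
  rw [smul_smul, show s⁻¹ * d⁻¹ * gPre (fun a => ξ a.succ) (z ∘ tailPos ξ) * s
    = gPre (fun a => ξ a.succ) (z ∘ tailPos ξ) * d⁻¹ by field_simp]
  set ξ' : Fin n → ℕ := fun a => ξ a.succ with hξ'
  set Q : Matrix (Pos ξ → Fin (n + 1)) (Pos ξ → Fin (n + 1)) A :=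
    ((positions ξ').map fun y => ((List.finRange (ξ 0)).map fun i =>
      (Rmat (tailPos ξ y) (headPos ξ i) (z (tailPos ξ y) - z (headPos ξ i)))).prod).prod
            * Rprod A ((positions ξ').map (tailPos ξ)) z with hQ
  set B := Matrix (Fin (ξ 0) → Fin (n + 1)) (Fin (ξ 0) → Fin (n + 1)) A with hB
  have hQc : curryHom K (posEquiv ξ) Q = d • (lineProd (positions ξ')
      (fun y => Lprod A (List.finRange (ξ 0)) (fun i => z (headPos ξ i)) (z (tailPos ξ y)))
        * Rprod B (positions ξ') (z ∘ tailPos ξ)) := by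
    rw [hQ, map_mul, curry_Rprod, map_list_prod, List.map_map]
    have : (curryHom K (posEquiv ξ) ∘ fun y => ((List.finRange (ξ 0)).map fun i =>
      (Rmat (tailPos ξ y) (headPos ξ i) (z (tailPos ξ y) - z (headPos ξ i)) :
        Matrix (Pos ξ → Fin (n + 1)) (Pos ξ → Fin (n + 1)) A)).prod)
      = fun y => (∏ i, (z (tailPos ξ y) - z (headPos ξ i))) • embed y
        (Lprod A (List.finRange (ξ 0)) (fun i => z (headPos ξ i)) (z (tailPos ξ y))) := by
      funext y
      rw [Function.comp_apply, map_prod_Rmat_curry ξ z hz', ← List.ofFn_eq_map, List.prod_ofFn]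
    rw [this, list_prod_map_smul, prod_positions, smul_mul_assoc]
    rfl
  have e5 : lineProd (positions ξ') (fun p => dressed (List.finRange (ξ 0)) (z ∘ headPos ξ)
      ((z ∘ tailPos ξ) p) ((T (tailPos ξ p)).submatrix Fin.succ Fin.succ))
      = lineProd (positions ξ') (fun p => ((T (tailPos ξ p)).submatrix Fin.succ Fin.succ).map
          (Matrix.scalar (Fin (ξ 0) → Fin (n + 1))))
        * lineProd (positions ξ') (fun p =>
          Lprod A (List.finRange (ξ 0)) (z ∘ headPos ξ) (z (tailPos ξ p))) :=
    lineProd_mul _ (nodup_positions ξ') _ _ fun p q a b c d => scalar_comm_Lprod _ _ _ _ _ _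
  -- An entry of the smaller Bethe function, expanded over the labels `c'` of the other colours;
  -- after lowering the labels, the column label of the first colour is `0`.
  have e6 : ∀ c : Fin (ξ 0) → Fin (n + 1),
      gB ξ' (fun p => dressed (List.finRange (ξ 0)) (z ∘ headPos ξ)
      ((z ∘ tailPos ξ) p) ((T (tailPos ξ p)).submatrix Fin.succ Fin.succ)) (z ∘ tailPos ξ) c
        (fun _ => 0) = gPre ξ' (z ∘ tailPos ξ) • d⁻¹ • ∑ c' : Pos ξ' → Fin (n + 1),
          ((positions ξ').map fun y => T (tailPos ξ y) y.1.castSucc.succ (c' y).succ).prod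
            * Q (curryEquiv _ (posEquiv ξ) (c', c)) fun p => p.1 := by
    intro c
    rw [gB, gHat, e5, mul_assoc, Matrix.mul_apply, Matrix.smul_apply, Matrix.sum_apply]
    congr 1
    rw [Finset.smul_sum]
    refine Finset.sum_congr rfl fun c' _ => ?_
    have e7 := congrFun (congrFun (congrFun (congrFun hQc c') fun p => p.1.succ) c) fun _ => 0
    have e8 : curryHom K (posEquiv ξ) Q c' (fun p => p.1.succ) c (fun _ => 0)
        = Q (curryEquiv _ (posEquiv ξ) (c', c)) fun p => p.1 := by
      change Q _ _ = Q _ _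
      congr 1
      funext p
      obtain ⟨p, rfl⟩ := (posEquiv ξ).surjective p
      rcases p with p | p
      · change Sum.elim (fun _ => (0 : Fin (n + 1))) (fun p => p.1.succ)
          ((posEquiv ξ).symm (posEquiv ξ (Sum.inl p))) = _
        rw [Equiv.symm_apply_apply, posEquiv_inl]
        rfl
      · change Sum.elim (fun _ => (0 : Fin (n + 1))) (fun p => p.1.succ)
          ((posEquiv ξ).symm (posEquiv ξ (Sum.inr p))) = _
        rw [Equiv.symm_apply_apply, posEquiv_inr]
        rfl
    rw [e8] at e7
    rw [e7, lineProd_apply_of_complete _ (nodup_positions ξ') (mem_positions ξ')]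
    have e9 : ((positions ξ').map fun p => ((T (tailPos ξ p)).submatrix Fin.succ Fin.succ).map
          (Matrix.scalar (Fin (ξ 0) → Fin (n + 1))) p.1.castSucc (c' p)).prod
        = Matrix.scalar _ ((positions ξ').map fun y =>
          T (tailPos ξ y) y.1.castSucc.succ (c' y).succ).prod := by
      rw [map_list_prod, List.map_map]
      rfl
    rw [e9, Matrix.scalar_apply, Matrix.diagonal_mul]
    rw [← mul_smul_comm]
    congr 1
    rw [Matrix.smul_apply, Matrix.smul_apply, smul_smul, inv_mul_cancel₀ hc, one_smul]
    rfl
  rw [nested, Matrix.mul_apply]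
  refine Eq.trans ?_ (Finset.sum_congr rfl fun c _ => congrArg
    ((lineProd (List.finRange (ξ 0)).reverse (T ∘ headPos ξ) *
      succMat (Fin (ξ 0)) (n + 1) A : Matrix (Fin (ξ 0) → Fin (n + 2)) (Fin (ξ 0) → Fin (n + 1)) A)
      (fun _ => 0) c * ·) (e6 c).symm)
  simp only [mul_smul_comm, ← Finset.smul_sum]
  rw [smul_smul]
  congr 1
  rw [← (curryEquiv _ (posEquiv ξ)).sum_comp, Fintype.sum_prod_type, Finset.sum_comm]
  refine Finset.sum_congr rfl fun c _ => ?_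
  rw [Finset.mul_sum]
  refine Finset.sum_congr rfl fun c' _ => ?_
  rw [mul_succMat_apply, lineProd_apply_of_complete, mul_assoc]
  · refine congrArg₂ (fun x y : A => x * y) ?_ (congrArg₂ (fun x y : A => x * y) ?_ rfl)
    · refine congrArg List.prod (List.map_congr_left fun i _ => ?_)
      have : curryEquiv (n + 1) (posEquiv ξ) (c', c) (headPos ξ i) = c i := by
        rw [← posEquiv_inl]
        simp [curryEquiv]
      rw [this]
      rfl
    · refine congrArg List.prod (List.map_congr_left fun i _ => ?_)
      have : curryEquiv (n + 1) (posEquiv ξ) (c', c) (tailPos ξ i) = c' i := by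
        rw [← posEquiv_inr]
        simp [curryEquiv]
      rw [this]
  · simpa using List.nodup_finRange _
  · intro i
    simp

end Nested

/-! ## Relations between the matrices `Lmat` -/

section LRelations

/-- Operators on a tensor power. -/
abbrev TMat (ι : Type*) (N : ℕ) (A : Type*) : Type _ := Matrix (ι → Fin N) (ι → Fin N) A

/-- Operators on a tensor power and one more tensor factor. -/
abbrev LMat (ι : Type*) (N : ℕ) (A : Type*) : Type _ := Matrix (Fin N) (Fin N) (TMat ι N A)

variable {ι : Type*} [Fintype ι] [DecidableEq ι] {N : ℕ} {K A : Type*} [Field K] [Ring A]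
  [Algebra K A]

theorem Lmat_apply (p : ι) (u : K) (a b : Fin N) :
    Lmat A p u a b = (if a = b then 1 else 0) + u⁻¹ • embed p (Matrix.single b a 1) := rfl

/-- Summing over the intermediate index of the auxiliary factor leaves one elementary matrix and a
flip. This is the quadratic term of a product of two matrices `Lmat`. -/
theorem sum_embed_mul_embed {p q : ι} (hpq : p ≠ q) (a b : Fin N) :
    (∑ c, embed p (Matrix.single c a 1) * embed q (Matrix.single b c 1) :
      Matrix (ι → Fin N) (ι → Fin N) A)
      = embed q (Matrix.single b a 1) * permMat N A (Equiv.swap p q) := by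
  have h := permMat_mul_embed (N := N) (A := A) (Equiv.swap p q) p (Matrix.single b a 1)
  rw [Equiv.swap_apply_left] at h
  rw [← h, ← sum_embed_single_eq hpq, Finset.sum_mul]
  refine Finset.sum_congr rfl fun c _ => ?_
  rw [Finset.sum_mul, Finset.sum_eq_single b]
  · rw [mul_assoc, ← embed_comm hpq, ← mul_assoc, ← embed_mul, Matrix.single_mul_single_same,
      mul_one]
    intro a' b' c' d'
    simp only [Matrix.single_apply]
    split_ifs <;> simp
  · intro d _ hd
    rw [mul_assoc, ← embed_comm hpq, ← mul_assoc, ← embed_mul, Matrix.single_mul_single_of_ne,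
      embed_zero, zero_mul]
    · exact hd
    · intro a' b' c' d'
      simp only [Matrix.single_apply]
      split_ifs <;> simp
  · simp

theorem Lmat_mul_Lmat_apply {p q : ι} (hpq : p ≠ q) (u w : K) (a b : Fin N) :
    (Lmat A p u * Lmat A q w : LMat ι N A) a b = (if a = b then 1 else 0) + u⁻¹ • embed p (Matrix.single b a 1)
      + w⁻¹ • embed q (Matrix.single b a 1) + (u⁻¹ * w⁻¹) •
        (embed q (Matrix.single b a 1) * permMat N A (Equiv.swap p q)) := by
  rw [Matrix.mul_apply, ← sum_embed_mul_embed hpq]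
  simp only [Lmat_apply, add_mul, mul_add, Finset.sum_add_distrib, ite_mul, mul_ite, one_mul,
    mul_one, zero_mul, mul_zero, Finset.sum_ite_eq, Finset.sum_ite_eq', Finset.mem_univ, if_true,
    smul_mul_smul_comm, Finset.smul_sum]
  abel

/-- The Yang–Baxter equation. -/
theorem Lmat_mul_Rmat {p q : ι} (hpq : p ≠ q) {u w : K} (hu : u ≠ 0) (hw : w ≠ 0) (a b : Fin N) :
    (Lmat A p u * Lmat A q w : LMat ι N A) a b * Rmat p q (w - u)
      = Rmat p q (w - u) * (Lmat A q w * Lmat A p u : LMat ι N A) a b := by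
  rw [Lmat_mul_Lmat_apply hpq, Lmat_mul_Lmat_apply hpq.symm, Rmat_eq hpq, Equiv.swap_comm q p]
  set P := permMat N A (Equiv.swap p q) with hP
  have hPP : P * P = 1 := by rw [hP, ← map_mul, Equiv.swap_mul_self, map_one]
  have h1 := permMat_mul_embed (N := N) (A := A) (Equiv.swap p q) p (Matrix.single b a 1)
  have h2 := permMat_mul_embed (N := N) (A := A) (Equiv.swap p q) q (Matrix.single b a 1)
  rw [Equiv.swap_apply_left, ← hP] at h1
  rw [Equiv.swap_apply_right, ← hP] at h2
  set e := (embed p (Matrix.single b a 1) : Matrix (ι → Fin N) (ι → Fin N) A)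
  set f := (embed q (Matrix.single b a 1) : Matrix (ι → Fin N) (ι → Fin N) A)
  have h3 : P * (e * P) = f := by rw [← mul_assoc, h1, mul_assoc, hPP, mul_one]
  have h4 : f * P * P = f := by rw [mul_assoc, hPP, mul_one]
  simp only [mul_add, add_mul, mul_smul_comm, smul_mul_assoc, mul_one, one_mul, smul_smul,
    smul_add, h1, h2, h3, h4]
  have h5 : P * (if a = b then 1 else 0) = (if a = b then 1 else 0) * P := by split_ifs <;> simp
  rw [h5]
  have e1 : (w - u) * (u⁻¹ * w⁻¹) = u⁻¹ - w⁻¹ := by field_simp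
  have e2 : w⁻¹ * u⁻¹ * (w - u) = u⁻¹ - w⁻¹ := by field_simp
  rw [e1, e2, mul_comm u⁻¹ (w - u), mul_comm w⁻¹ (w - u), sub_smul u⁻¹ w⁻¹, sub_smul u⁻¹ w⁻¹, mul_comm w⁻¹ u⁻¹]
  abel

/-- The operators `embed p (E_{ba})` multiply like elementary matrices, so `Lmat` is the evaluation
solution of the RTT relation. -/
theorem Lmat_rtt (p : ι) {u w : K} (hu : u ≠ 0) (hw : w ≠ 0) :
    RTT (u - w) (Lmat A p u : Matrix (Fin N) (Fin N) (Matrix (ι → Fin N) (ι → Fin N) A))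
      (Lmat A p w) := by
  have key : ∀ a b c d : Fin N, (embed p (Matrix.single b a 1) * embed p (Matrix.single d c 1) :
      Matrix (ι → Fin N) (ι → Fin N) A) = if a = d then embed p (Matrix.single b c 1) else 0 := by
    intro a b c d
    rw [← embed_mul]
    split_ifs with h
    · rw [h, Matrix.single_mul_single_same, mul_one]
    · rw [Matrix.single_mul_single_of_ne _ _ _ _ h, embed_zero]
  intro a b c d
  simp only [Lmat_apply, add_mul, mul_add, smul_mul_smul_comm, key, smul_sub, smul_add, smul_smul,
    mul_smul_comm, smul_mul_assoc]
  have e1 : (u - w) * (u⁻¹ * w⁻¹) = w⁻¹ - u⁻¹ := by field_simp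
  have e2 : (u - w) * (w⁻¹ * u⁻¹) = w⁻¹ - u⁻¹ := by field_simp
  rw [e1, e2]
  simp only [ite_mul, mul_ite, one_mul, mul_one, zero_mul, mul_zero, smul_ite, smul_zero, sub_smul,
    mul_comm w⁻¹ u⁻¹]
  split_ifs <;>abel1

theorem scalar_mul_embed (r : A) (p : ι) (M : Matrix (Fin N) (Fin N) A) :
    Matrix.scalar (ι → Fin N) r * embed p M = embed p (M.map (r * ·)) := by
  ext α β
  simp only [Matrix.scalar_apply, Matrix.diagonal_mul, embed, Matrix.map_apply]
  split_ifs <;> simp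

theorem embed_mul_scalar (r : A) (p : ι) (M : Matrix (Fin N) (Fin N) A) :
    embed p M * Matrix.scalar (ι → Fin N) r = embed p (M.map (· * r)) := by
  ext α β
  simp only [Matrix.scalar_apply, Matrix.mul_diagonal, embed, Matrix.map_apply]
  split_ifs <;> simp

theorem embed_sum {α : Type*} (s : Finset α) (p : ι) (M : α → Matrix (Fin N) (Fin N) A) :
    embed p (∑ i ∈ s, M i) = ∑ i ∈ s, embed p (M i) := by
  classical
  induction s using Finset.induction_on with
  | empty => simp [embed_zero]
  | insert i s hi ih => rw [Finset.sum_insert hi, Finset.sum_insert hi, embed_add, ih]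

/-- The RTT relation in terms of `Lmat`. -/
theorem embed_exchange {M M' : Matrix (Fin N) (Fin N) A} {u : K} (hu : u ≠ 0) (h : RTT u M' M)
    (x : ι) (a b : Fin N) :
    embed x M * (M'.map (Matrix.scalar (ι → Fin N)) * Lmat A x u : LMat ι N A) a b
      = (Lmat A x u * M'.map (Matrix.scalar (ι → Fin N)) : LMat ι N A) a b * embed x M := by
  simp only [Matrix.mul_apply, Matrix.map_apply, Lmat_apply, mul_add, add_mul, Finset.mul_sum,
    Finset.sum_mul, Finset.sum_add_distrib, ite_mul, mul_ite, one_mul, mul_one, zero_mul, mul_zero,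
    mul_smul_comm, smul_mul_assoc, Finset.sum_ite_eq, Finset.sum_ite_eq', Finset.mem_univ, if_true,
    scalar_mul_embed, embed_mul_scalar, ← embed_mul, ← Finset.smul_sum, ← embed_sum, ← embed_smul,
    ← embed_add]
  congr 1
  ext d e
  simp only [Matrix.add_apply, Matrix.smul_apply, Matrix.sum_apply, Matrix.map_apply,
    Matrix.mul_apply, Matrix.single_apply, ite_and, mul_smul_comm, smul_mul_assoc,
    ← Finset.smul_sum, mul_ite, ite_mul, mul_one, one_mul, mul_zero, zero_mul,
    Finset.sum_ite_irrel, Finset.sum_const_zero, Finset.sum_ite_eq, Finset.sum_ite_eq',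
    Finset.mem_univ, if_true]
  have := h a b d e
  rw [smul_sub, sub_eq_iff_eq_add] at this
  apply smul_right_injective A hu
  simp only [smul_add, smul_smul, mul_inv_cancel₀ hu, one_smul, this]
  abel

theorem Lmat_comm_embed {p q : ι} (hpq : p ≠ q) (u : K) (a b : Fin N)
    (M : Matrix (Fin N) (Fin N) A) :
    Lmat A p u a b * embed q M = embed q M * Lmat A p u a b := by
  rw [Lmat_apply, add_mul, mul_add, mul_smul_comm, smul_mul_assoc, embed_comm hpq]
  · congr 1
    split_ifs <;> simp
  · intro a' b' c' d'
    simp only [Matrix.single_apply]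
    split_ifs <;> simp

theorem Lmat_comm_Lmat {p q : ι} (hpq : p ≠ q) (u w : K) (a b c d : Fin N) :
    Lmat A p u a b * Lmat A q w c d = Lmat A q w c d * Lmat A p u a b := by
  rw [Lmat_apply q, add_mul, mul_add, mul_smul_comm, smul_mul_assoc, Lmat_comm_embed hpq]
  congr 1
  split_ifs <;> simp

end LRelations

/-! ## Families covariant under permutations of the tensor factors -/

section Covariance

variable {ι : Type*} [Fintype ι] [DecidableEq ι] {N N' N'' : ℕ} {K A : Type*} [Field K] [Ring A]
  [Algebra K A]

/-- The parameters are pairwise distinct and no two of them differ by one. -/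
def Generic {α : Type*} (x : α → K) : Prop :=
  ∀ a b, a ≠ b → x a - x b ≠ 0 ∧ x a - x b + 1 ≠ 0

theorem Generic.sub_ne {α : Type*} {x : α → K} (h : Generic x) {a b : α} (hab : a ≠ b) :
    x a - x b ≠ 0 := (h a b hab).1

theorem Generic.sub_add_ne {α : Type*} {x : α → K} (h : Generic x) {a b : α} (hab : a ≠ b) :
    x a - x b + 1 ≠ 0 := (h a b hab).2

theorem Generic.comp {α β : Type*} {x : α → K} (h : Generic x) {f : β → α}
    (hf : Function.Injective f) : Generic (x ∘ f) := fun _ _ hab => h _ _ (hf.ne hab)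

/-- The normalized R-matrix. -/
def Rn (N : ℕ) (A : Type*) [Ring A] [Algebra K A] (x : ι → K) (a b : ι) : TMat ι N A :=
  (x a - x b + 1)⁻¹ • Rmat a b (x a - x b)

/-- Unitarity: `R(u) R(-u) = 1 - u²`, and the normalization divides by `(1 + u)(1 - u)`. With the
same normalization, equal labels are left unchanged. -/
theorem Rn_mul_Rn {x : ι → K} (hx : Generic x) {a b : ι} (hab : a ≠ b) :
    Rn N A x a b * Rn N A x b a = 1 := by
  unfold Rn
  rw [smul_mul_smul_comm, Rmat_symm hab.symm, ← neg_sub (x a) (x b), Rmat_mul_Rmat_neg hab,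
    smul_smul]
  have h1 := hx.sub_add_ne hab
  have h2 := hx.sub_add_ne hab.symm
  have h3 : -(x a - x b) + 1 ≠ 0 := by rwa [neg_sub]
  rw [show (x a - x b + 1)⁻¹ * (-(x a - x b) + 1)⁻¹ * (1 - (x a - x b) ^ 2) = 1 by
    field_simp; ring, one_smul]

theorem Rn_mul_apply_of_eq {m : Type*} {x : ι → K} (hx : Generic x) {a b : ι} (hab : a ≠ b)
    (M : Matrix (ι → Fin N) m A) (α : ι → Fin N) (β : m) (h : α a = α b) :
    (Rn N A x a b * M) α β = M α β := by
  unfold Rn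
  rw [Matrix.smul_mul, Matrix.smul_apply, Rmat_mul_apply_of_eq hab _ _ _ _ h, smul_smul,
    inv_mul_cancel₀ (hx.sub_add_ne hab), one_smul]

theorem mul_Rn_apply_of_eq {m : Type*} {x : ι → K} (hx : Generic x) {a b : ι} (hab : a ≠ b)
    (M : Matrix m (ι → Fin N) A) (α : m) (β : ι → Fin N) (h : β a = β b) :
    (M * Rn N A x a b) α β = M α β := by
  unfold Rn
  rw [Matrix.mul_smul, Matrix.smul_apply, mul_Rmat_apply_of_eq hab _ _ _ _ h, smul_smul,
    inv_mul_cancel₀ (hx.sub_add_ne hab), one_smul]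

theorem Rn_map_algebraMap (x : ι → K) (a b : ι) :
    (Rn N K x a b).map (algebraMap K A) = Rn N A x a b := by
  unfold Rn
  rw [← Rmat_map_algebraMap (A := A)]
  ext α β
  rw [Matrix.map_apply, Matrix.smul_apply, Matrix.smul_apply, Matrix.map_apply, smul_eq_mul,
    map_mul, Algebra.smul_def]

/-- A family of operators, depending on an ordering of the tensor factors, which is intertwined
by the R-matrices. -/
def Covariant (x : ι → K) (F : List ι → Matrix (ι → Fin N) (ι → Fin N') A) : Prop :=
  ∀ (pre : List ι) (a b : ι) (post : List ι), (pre ++ a :: b :: post).Nodup →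
    F (pre ++ a :: b :: post) * Rn N' A x a b = Rn N A x a b * F (pre ++ b :: a :: post)

theorem Covariant.mul {x : ι → K} {F : List ι → Matrix (ι → Fin N) (ι → Fin N') A}
    {G : List ι → Matrix (ι → Fin N') (ι → Fin N'') A} (hF : Covariant x F) (hG : Covariant x G) :
    Covariant x fun w => F w * G w := by
  intro pre a b post h
  rw [Matrix.mul_assoc, hG pre a b post h, ← Matrix.mul_assoc, hF pre a b post h, Matrix.mul_assoc]

theorem nodup_swap {pre : List ι} {a b : ι} {post : List ι} (h : (pre ++ a :: b :: post).Nodup) :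
    (pre ++ b :: a :: post).Nodup :=
  ((List.Perm.append_left pre (List.Perm.swap _ _ _)).nodup_iff).1 h

theorem ne_of_nodup {pre : List ι} {a b : ι} {post : List ι}
    (h : (pre ++ a :: b :: post).Nodup) : a ≠ b := by
  have := (List.nodup_append.1 h).2.1
  rw [List.nodup_cons, List.mem_cons, not_or] at this
  exact this.1.1

theorem covariant_succMat (x : ι → K) :
    Covariant x fun _ => (succMat ι N A : Matrix (ι → Fin (N + 1)) (ι → Fin N) A) := by
  intro pre a b post h
  unfold Rn
  rw [Matrix.mul_smul, Matrix.smul_mul, Rmat_mul_succMat (ne_of_nodup h)]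

theorem covariant_of_rmat {x : ι → K} {F : List ι → Matrix (ι → Fin N) (ι → Fin N') A}
    (h : ∀ (pre : List ι) (a b : ι) (post : List ι), (pre ++ a :: b :: post).Nodup →
      F (pre ++ a :: b :: post) * (Rmat a b (x a - x b) : TMat ι N' A)
        = (Rmat a b (x a - x b) : TMat ι N A) * F (pre ++ b :: a :: post)) : Covariant x F := by
  intro pre a b post hn
  unfold Rn
  rw [Matrix.mul_smul, Matrix.smul_mul, h pre a b post hn]

theorem Rmat_comm_lineProd {a b : ι} (hab : a ≠ b) (l : List ι) (ha : a ∉ l) (hb : b ∉ l) (u : K)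
    (T : ι → Matrix (Fin N) (Fin N) A) :
    (Rmat a b u : TMat ι N A) * lineProd l T = lineProd l T * Rmat a b u := by
  apply commute_list_prod
  intro m hm
  obtain ⟨c, hc, rfl⟩ := List.mem_map.1 hm
  exact Rmat_comm_embed hab (ne_of_mem_of_not_mem hc ha) (ne_of_mem_of_not_mem hc hb) _ _

theorem notMem_of_nodup {pre : List ι} {a b : ι} {post : List ι}
    (h : (pre ++ a :: b :: post).Nodup) : a ∉ pre ∧ b ∉ pre ∧ a ∉ post ∧ b ∉ post := by
  have h1 := List.nodup_append.1 h
  have h2 := h1.2.1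
  rw [List.nodup_cons, List.mem_cons, not_or, List.nodup_cons] at h2
  refine ⟨fun h => ?_, fun h => ?_, h2.1.2, h2.2.1⟩
  · exact h1.2.2 a h a (by simp) rfl
  · exact h1.2.2 b h b (by simp) rfl

/-- For `a` before `b` in the list, the reversed product contains `T_b T_a`, and RTT reads `T_b T_a
R = R T_a T_b`; hence the reversal of the list. -/
theorem covariant_lineProd {x : ι → K} {T : ι → Matrix (Fin N) (Fin N) A}
    (hT : ∀ a b, a ≠ b → RTT (x a - x b) (T a) (T b)) :
    Covariant x fun w => lineProd w.reverse T := by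
  refine covariant_of_rmat fun pre a b post h => ?_
  obtain ⟨h1, h2, h3, h4⟩ := notMem_of_nodup h
  have hab := ne_of_nodup h
  have h5 := (rtt_iff hab _ _ _).1 (hT a b hab)
  simp only [List.reverse_append, List.reverse_cons, lineProd_append, lineProd_cons, lineProd_nil,
    mul_one, mul_assoc]
  rw [← Rmat_comm_lineProd hab pre.reverse (by simpa using h1) (by simpa using h2)]
  rw [← mul_assoc (Rmat a b _) (lineProd _ _), Rmat_comm_lineProd hab post.reverse
    (by simpa using h3) (by simpa using h4), mul_assoc]
  congr 1
  rw [← mul_assoc (embed b _), ← mul_assoc (embed b _ * embed a _), ← h5]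
  simp only [mul_assoc]

theorem Rmat_comm_Lmat {p q r : ι} (hpq : p ≠ q) (hp : r ≠ p) (hq : r ≠ q) (u w : K)
    (i j : Fin N) :
    (Rmat p q u : TMat ι N A) * Lmat A r w i j = Lmat A r w i j * Rmat p q u := by
  rw [Lmat_apply, mul_add, add_mul, mul_smul_comm, smul_mul_assoc, Rmat_comm_embed hpq hp hq]
  congr 1
  split_ifs <;> simp

/-- An element intertwining the entries of matrices intertwines the entries of their products. -/
theorem intertwine_matrix_mul {m : Type*} [Fintype m] {r : A} {X X' Y Y' : Matrix m m A}
    (hX : ∀ i j, r * X i j = X' i j * r) (hY : ∀ i j, r * Y i j = Y' i j * r) (i j : m) :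
    r * (X * Y) i j = (X' * Y') i j * r := by
  simp only [Matrix.mul_apply, Finset.mul_sum, Finset.sum_mul]
  refine Finset.sum_congr rfl fun k _ => ?_
  rw [← mul_assoc, hX, mul_assoc, hY, mul_assoc]

theorem covariant_Lprod {x : ι → K} {s : K} (hs : ∀ i, s - x i ≠ 0) (i j : Fin N) :
    Covariant x fun w => Lprod A w x s i j := by
  refine covariant_of_rmat fun pre a b post h => ?_
  obtain ⟨h1, h2, h3, h4⟩ := notMem_of_nodup h
  have hab := ne_of_nodup h
  have e : ∀ l : List ι, a ∉ l → b ∉ l → ∀ i j, (Rmat a b (x a - x b) : TMat ι N A) * Lprod A l x s i j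
      = Lprod A l x s i j * Rmat a b (x a - x b) := by
    intro l ha hb
    apply comm_matrix_list_prod
    intro M hM i j
    obtain ⟨c, hc, rfl⟩ := List.mem_map.1 hM
    exact Rmat_comm_Lmat hab (ne_of_mem_of_not_mem hc ha) (ne_of_mem_of_not_mem hc hb) _ _ _ _
  have e2 : ∀ i j, (Rmat a b (x a - x b) : TMat ι N A) *
      (Lmat A b (s - x b) * Lmat A a (s - x a) : LMat ι N A) i j
      = (Lmat A a (s - x a) * Lmat A b (s - x b) : LMat ι N A) i j * Rmat a b (x a - x b) := by
    intro i j
    have := Lmat_mul_Rmat (N := N) (A := A) hab (hs a) (hs b) i j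
    rw [sub_sub_sub_cancel_left] at this
    exact this.symm
  have e3 : ∀ a b, (Lprod A (pre ++ a :: b :: post) x s : LMat ι N A)
      = Lprod A pre x s * ((Lmat A a (s - x a) * Lmat A b (s - x b)) * Lprod A post x s) := by
    intro a b
    simp [Lprod, mul_assoc]
  rw [e3 a b, e3 b a]
  exact (intertwine_matrix_mul (e pre h1 h2)
    (intertwine_matrix_mul e2 (e post h3 h4)) i j).symm

/-- The Yang–Baxter equation again, for arguments `x_i - s`. The entry `00` of this product is the
operator whose eigenvalues will distinguish the projections in the resolution of the identity. -/
theorem covariant_Lprod_reverse {x : ι → K} {s : K} (hs : ∀ i, x i - s ≠ 0) (i j : Fin N) :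
    Covariant x fun w => (((w.reverse.map fun i => Lmat A i (x i - s)).prod : LMat ι N A) i j) := by
  refine covariant_of_rmat fun pre a b post h => ?_
  obtain ⟨h1, h2, h3, h4⟩ := notMem_of_nodup h
  have hab := ne_of_nodup h
  have e : ∀ l : List ι, a ∉ l → b ∉ l → ∀ i j, (Rmat a b (x a - x b) : TMat ι N A) *
      ((l.reverse.map fun i => Lmat A i (x i - s)).prod : LMat ι N A) i j
      = ((l.reverse.map fun i => Lmat A i (x i - s)).prod : LMat ι N A) i j * Rmat a b (x a - x b) := by
    intro l ha hb
    apply comm_matrix_list_prod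
    intro M hM i j
    obtain ⟨c, hc, rfl⟩ := List.mem_map.1 hM
    rw [List.mem_reverse] at hc
    exact Rmat_comm_Lmat hab (ne_of_mem_of_not_mem hc ha) (ne_of_mem_of_not_mem hc hb) _ _ _ _
  have e2 : ∀ i j, (Rmat a b (x a - x b) : TMat ι N A) *
      (Lmat A a (x a - s) * Lmat A b (x b - s) : LMat ι N A) i j
      = (Lmat A b (x b - s) * Lmat A a (x a - s) : LMat ι N A) i j * Rmat a b (x a - x b) := by
    intro i j
    have := Lmat_mul_Rmat (N := N) (A := A) hab.symm (hs b) (hs a) i j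
    rw [sub_sub_sub_cancel_right, Rmat_symm hab.symm] at this
    exact this.symm
  have e3 : ∀ a b, (((pre ++ a :: b :: post).reverse.map fun i => Lmat A i (x i - s)).prod : LMat ι N A)
      = (post.reverse.map fun i => Lmat A i (x i - s)).prod
        * ((Lmat A b (x b - s) * Lmat A a (x a - s)) *
          (pre.reverse.map fun i => Lmat A i (x i - s)).prod) := by
    intro a b
    simp [mul_assoc]
  rw [e3 a b, e3 b a]
  exact (intertwine_matrix_mul (e post h3 h4)
    (intertwine_matrix_mul e2 (e pre h1 h2)) i j).symm

theorem scalar_comm_of_map {r : TMat ι N K} (y : A) :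
    r.map (algebraMap K A) * Matrix.scalar (ι → Fin N) y
      = Matrix.scalar (ι → Fin N) y * r.map (algebraMap K A) := by
  ext α β
  simp [Matrix.scalar_apply, Matrix.mul_diagonal, Matrix.diagonal_mul, Algebra.commutes]

theorem covariant_dressed {x : ι → K} {s : K} (hs : ∀ i, s - x i ≠ 0)
    (T : Matrix (Fin N) (Fin N) A) (i j : Fin N) : Covariant x fun w => dressed w x s T i j := by
  intro pre a b post h
  have h1 := covariant_Lprod (N := N) (A := A) hs
  refine (intertwine_matrix_mul (fun i j => ?_) (fun i j => (h1 i j pre a b post h).symm) i j).symm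
  rw [Matrix.map_apply, ← Rn_map_algebraMap, scalar_comm_of_map]

theorem covariant_gB_dressed {n : ℕ} {x : ι → K} (ξ : Fin n → ℕ) {z : Pos ξ → K}
    (hs : ∀ p i, z p - x i ≠ 0) (T : Pos ξ → Matrix (Fin (n + 1)) (Fin (n + 1)) A) :
    Covariant x fun w => gB ξ (fun p => dressed w x (z p) (T p)) z := by
  intro pre a b post h
  refine (intertwine_gB ξ _ _ _ z fun p i j => ?_).symm
  exact (covariant_dressed (hs p) (T p) i j pre a b post h).symm

/-- Exchanging neighbours conjugates `F` by a normalized `R`-matrix, which acts trivially at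
constant labels on either side. -/
theorem Covariant.apply_eq_of_perm {x : ι → K} (hx : Generic x)
    {F : List ι → Matrix (ι → Fin N) (ι → Fin N') A} (hF : Covariant x F) (c : Fin N) (c' : Fin N')
    {w w' : List ι} (h : w.Perm w') (hw : w.Nodup) :
    F w (fun _ => c) (fun _ => c') = F w' (fun _ => c) (fun _ => c') := by
  -- Covariance concerns exchanges in the middle of a list, so an arbitrary prefix has to be carried
  -- along.
  suffices H : ∀ pre : List ι, (pre ++ w).Nodup →
      F (pre ++ w) (fun _ => c) (fun _ => c') = F (pre ++ w') (fun _ => c) (fun _ => c') from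
    H [] hw
  clear hw
  induction h with
  | nil => intros; rfl
  | cons a h ih =>
    intro pre hn
    have := ih (pre ++ [a]) (by simpa using hn)
    simpa using this
  | swap b a l =>
    intro pre hn
    have hab := ne_of_nodup hn
    have := congrFun (congrFun (hF pre a b l hn) fun _ => c) fun _ => c'
    rw [mul_Rn_apply_of_eq hx hab _ _ _ rfl, Rn_mul_apply_of_eq hx hab _ _ _ rfl] at this
    exact this
  | trans h1 h2 ih1 ih2 =>
    intro pre hn
    rw [ih1 pre hn, ih2 pre (((List.Perm.append_left pre h1).nodup_iff).1 hn)]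

theorem covariant_nested {n : ℕ} {x : ι → K} {T : ι → Matrix (Fin (n + 2)) (Fin (n + 2)) A}
    (hT : ∀ a b, a ≠ b → RTT (x a - x b) (T a) (T b)) (ξ : Fin n → ℕ) {z : Pos ξ → K}
    (hs : ∀ p i, z p - x i ≠ 0) (T' : Pos ξ → Matrix (Fin (n + 1)) (Fin (n + 1)) A) :
    Covariant x fun w => (lineProd w.reverse T * succMat ι (n + 1) A) *
      gB ξ (fun p => dressed w x (z p) (T' p)) z :=
  ((covariant_lineProd hT).mul (covariant_succMat x)).mul (covariant_gB_dressed ξ hs T')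

/-- Symmetry in the variables of the first colour, needed because the splitting delivers them in the
order of the original list rather than of the new index set. -/
theorem nested_eq_of_perm {n : ℕ} {x : ι → K} (hx : Generic x)
    {T : ι → Matrix (Fin (n + 2)) (Fin (n + 2)) A}
    (hT : ∀ a b, a ≠ b → RTT (x a - x b) (T a) (T b)) (ξ : Fin n → ℕ) {z : Pos ξ → K}
    (hs : ∀ p i, z p - x i ≠ 0) (T' : Pos ξ → Matrix (Fin (n + 1)) (Fin (n + 1)) A)
    {w w' : List ι} (h : w.Perm w') (hw : w.Nodup) :
    nested w T x ξ T' z = nested w' T x ξ T' z :=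
  (covariant_nested hT ξ hs T').apply_eq_of_perm hx 0 0 h hw

end Covariance

/-! ## Sorting the tensor factors and the resolution of the identity -/

section Sorting

variable {ι : Type*} [Fintype ι] [DecidableEq ι] {N N' : ℕ} {K A : Type*} [Field K] [Ring A]
  [Algebra K A]

/-- The product of R-matrices moving the tensor factors with `q = true` to the front. -/
def sortOp (N : ℕ) (A : Type*) [Ring A] [Algebra K A] (x : ι → K) (q : ι → Bool) :
    List ι → TMat ι N A
  | [] => 1
  | y :: l => if q y then sortOp N A x q l else
      sortOp N A x q l * ((l.filter q).map fun i => Rn N A x y i).prod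

/-- The inverse of `sortOp`. -/
def sortOpInv (N : ℕ) (A : Type*) [Ring A] [Algebra K A] (x : ι → K) (q : ι → Bool) :
    List ι → TMat ι N A
  | [] => 1
  | y :: l => if q y then sortOpInv N A x q l else
      ((l.filter q).reverse.map fun i => Rn N A x i y).prod * sortOpInv N A x q l

theorem prod_Rn_mul_prod_Rn {x : ι → K} (hx : Generic x) (y : ι) (l : List ι) (hy : y ∉ l) :
    (l.map fun i => Rn N A x y i).prod * (l.reverse.map fun i => Rn N A x i y).prod = 1 := by
  induction l with
  | nil => simp
  | cons i l ih =>
    rw [List.mem_cons, not_or] at hy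
    simp only [List.map_cons, List.prod_cons, List.reverse_cons, List.map_append, List.prod_append,
      List.map_nil, List.prod_nil, mul_one]
    rw [mul_assoc, ← mul_assoc _ _ (Rn N A x i y), ih hy.2, one_mul, Rn_mul_Rn hx hy.1]

theorem prod_Rn_mul_prod_Rn' {x : ι → K} (hx : Generic x) (y : ι) (l : List ι) (hy : y ∉ l) :
    (l.reverse.map fun i => Rn N A x i y).prod * (l.map fun i => Rn N A x y i).prod = 1 := by
  induction l with
  | nil => simp
  | cons i l ih =>
    rw [List.mem_cons, not_or] at hy
    simp only [List.map_cons, List.prod_cons, List.reverse_cons, List.map_append, List.prod_append,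
      List.map_nil, List.prod_nil, mul_one]
    rw [mul_assoc, ← mul_assoc (Rn N A x i y), Rn_mul_Rn hx (Ne.symm hy.1), one_mul, ih hy.2]

theorem notMem_filter {y : ι} {l : List ι} (h : y ∉ l) (q : ι → Bool) : y ∉ l.filter q :=
  fun h' => h (List.mem_filter.1 h').1

theorem sortOp_mul_sortOpInv {x : ι → K} (hx : Generic x) (q : ι → Bool) (l : List ι)
    (hl : l.Nodup) : sortOp N A x q l * sortOpInv N A x q l = 1 := by
  induction l with
  | nil => simp [sortOp, sortOpInv]
  | cons y l ih =>
    rw [List.nodup_cons] at hl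
    unfold sortOp sortOpInv
    split_ifs
    · exact ih hl.2
    · rw [mul_assoc, ← mul_assoc _ _ (sortOpInv N A x q l),
        prod_Rn_mul_prod_Rn hx y _ (notMem_filter hl.1 q), one_mul, ih hl.2]

theorem sortOpInv_mul_sortOp {x : ι → K} (hx : Generic x) (q : ι → Bool) (l : List ι)
    (hl : l.Nodup) : sortOpInv N A x q l * sortOp N A x q l = 1 := by
  induction l with
  | nil => simp [sortOp, sortOpInv]
  | cons y l ih =>
    rw [List.nodup_cons] at hl
    unfold sortOp sortOpInv
    split_ifs
    · exact ih hl.2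
    · rw [mul_assoc, ← mul_assoc (sortOpInv N A x q l), ih hl.2, one_mul,
        prod_Rn_mul_prod_Rn' hx y _ (notMem_filter hl.1 q)]

theorem map_list_prod_algebraMap {α : Type*} (f : α → TMat ι N K) (g : α → TMat ι N A)
    (l : List α) (h : ∀ a ∈ l, (f a).map (algebraMap K A) = g a) :
    (l.map f).prod.map (algebraMap K A) = (l.map g).prod := by
  induction l with
  | nil => simp [Matrix.map_one]
  | cons a l ih =>
    simp only [List.map_cons, List.prod_cons]
    rw [Matrix.map_mul, h a List.mem_cons_self, ih fun b hb => h b (List.mem_cons_of_mem _ hb)]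

theorem sortOp_map_algebraMap (x : ι → K) (q : ι → Bool) (l : List ι) :
    (sortOp N K x q l).map (algebraMap K A) = sortOp N A x q l := by
  induction l with
  | nil => simp [sortOp, Matrix.map_one]
  | cons y l ih =>
    unfold sortOp
    split_ifs
    · exact ih
    · rw [Matrix.map_mul, ih, map_list_prod_algebraMap _ _ _ fun i _ => Rn_map_algebraMap x y i]

theorem sortOpInv_map_algebraMap (x : ι → K) (q : ι → Bool) (l : List ι) :
    (sortOpInv N K x q l).map (algebraMap K A) = sortOpInv N A x q l := by
  induction l with
  | nil => simp [sortOpInv, Matrix.map_one]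
  | cons y l ih =>
    unfold sortOpInv
    split_ifs
    · exact ih
    · rw [Matrix.map_mul, ih, map_list_prod_algebraMap _ _ _ fun i _ => Rn_map_algebraMap x i y]

theorem Covariant.mul_prod_Rn {x : ι → K} {F : List ι → Matrix (ι → Fin N) (ι → Fin N') A}
    (hF : Covariant x F) (pre : List ι) (y : ι) (l post : List ι)
    (h : (pre ++ y :: (l ++ post)).Nodup) :
    F (pre ++ y :: (l ++ post)) * (l.map fun i => Rn N' A x y i).prod
      = (l.map fun i => Rn N A x y i).prod * F (pre ++ (l ++ y :: post)) := by
  induction l generalizing pre with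
  | nil => simp
  | cons i l ih =>
    simp only [List.map_cons, List.prod_cons]
    have h' : ((pre ++ [i]) ++ y :: (l ++ post)).Nodup := by
      have := nodup_swap h
      simpa using this
    have := ih (pre ++ [i]) h'
    simp only [List.append_assoc, List.cons_append, List.nil_append] at this ⊢
    rw [← Matrix.mul_assoc, hF pre y i (l ++ post) h, Matrix.mul_assoc, this, Matrix.mul_assoc]

theorem filter_append_perm (q : ι → Bool) (l : List ι) :
    (l.filter q ++ l.filter fun i => !q i).Perm l := List.filter_append_perm q l

/-- The tail is sorted first; then a head with `q = false` is moved right past the elements with `q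
= true`, each adjacent exchange being an instance of covariance. -/
theorem Covariant.mul_sortOp {x : ι → K} {F : List ι → Matrix (ι → Fin N) (ι → Fin N') A}
    (hF : Covariant x F) (q : ι → Bool) (l : List ι) (pre : List ι) (h : (pre ++ l).Nodup) :
    F (pre ++ l) * sortOp N' A x q l
      = sortOp N A x q l * F (pre ++ (l.filter q ++ l.filter fun i => !q i)) := by
  induction l generalizing pre with
  | nil => simp [sortOp]
  | cons y l ih =>
    have h' : ((pre ++ [y]) ++ l).Nodup := by simpa using h
    have := ih (pre ++ [y]) h'
    simp only [List.append_assoc, List.singleton_append] at this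
    unfold sortOp
    split_ifs with hq
    · rw [this]
      simp [hq]
    · have hn : (pre ++ y :: (l.filter q ++ l.filter fun i => !q i)).Nodup :=
        (List.Perm.nodup_iff (List.Perm.append_left _ (List.Perm.cons _
          (filter_append_perm q l)))).2 h
      rw [← Matrix.mul_assoc, this, Matrix.mul_assoc, hF.mul_prod_Rn pre y _ _ hn,
        Matrix.mul_assoc]
      simp [hq]

theorem Covariant.sortOpInv_mul {x : ι → K} (hx : Generic x)
    {F : List ι → Matrix (ι → Fin N) (ι → Fin N') A}
    (hF : Covariant x F) (q : ι → Bool) (l : List ι) (h : l.Nodup) :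
    sortOpInv N A x q l * F l
      = F (l.filter q ++ l.filter fun i => !q i) * sortOpInv N' A x q l := by
  have h1 := hF.mul_sortOp q l [] h
  simp only [List.nil_append] at h1
  calc sortOpInv N A x q l * F l
      = sortOpInv N A x q l * (F l * sortOp N' A x q l) * sortOpInv N' A x q l := by
        rw [Matrix.mul_assoc, Matrix.mul_assoc (F l), sortOp_mul_sortOpInv hx q l h, Matrix.mul_one]
    _ = _ := by
        rw [h1, ← Matrix.mul_assoc, sortOpInv_mul_sortOp hx q l h, Matrix.one_mul]

theorem prod_Rn_mul_apply {m : Type*} {x : ι → K} (hx : Generic x) (y : ι) (l : List ι)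
    (hy : y ∉ l) (M : Matrix (ι → Fin N) m A) (c : Fin N) (β : m) :
    ((l.map fun i => Rn N A x y i).prod * M) (fun _ => c) β = M (fun _ => c) β := by
  induction l with
  | nil => simp
  | cons i l ih =>
    rw [List.mem_cons, not_or] at hy
    simp only [List.map_cons, List.prod_cons]
    rw [Matrix.mul_assoc, Rn_mul_apply_of_eq hx hy.1 _ _ _ rfl, ih hy.2]

theorem mul_prod_Rn_apply {m : Type*} {x : ι → K} (hx : Generic x) (y : ι) (l : List ι)
    (hy : y ∉ l) (M : Matrix m (ι → Fin N) A) (α : m) (c : Fin N) :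
    (M * (l.map fun i => Rn N A x i y).prod) α (fun _ => c) = M α (fun _ => c) := by
  induction l generalizing M with
  | nil => simp
  | cons i l ih =>
    rw [List.mem_cons, not_or] at hy
    simp only [List.map_cons, List.prod_cons]
    rw [← Matrix.mul_assoc, ih hy.2, mul_Rn_apply_of_eq hx (Ne.symm hy.1) _ _ _ rfl]

theorem sortOp_mul_apply {m : Type*} {x : ι → K} (hx : Generic x) (q : ι → Bool) (l : List ι)
    (hl : l.Nodup) (M : Matrix (ι → Fin N) m A) (c : Fin N) (β : m) :
    (sortOp N A x q l * M) (fun _ => c) β = M (fun _ => c) β := by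
  induction l generalizing M with
  | nil => simp [sortOp]
  | cons y l ih =>
    rw [List.nodup_cons] at hl
    unfold sortOp
    split_ifs
    · exact ih hl.2 M
    · rw [Matrix.mul_assoc, ih hl.2, prod_Rn_mul_apply hx y _ (notMem_filter hl.1 q)]

theorem mul_sortOpInv_apply {m : Type*} {x : ι → K} (hx : Generic x) (q : ι → Bool) (l : List ι)
    (hl : l.Nodup) (M : Matrix m (ι → Fin N) A) (α : m) (c : Fin N) :
    (M * sortOpInv N A x q l) α (fun _ => c) = M α (fun _ => c) := by
  induction l generalizing M with
  | nil => simp [sortOpInv]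
  | cons y l ih =>
    rw [List.nodup_cons] at hl
    unfold sortOpInv
    split_ifs
    · exact ih hl.2 M
    · rw [← Matrix.mul_assoc, ih hl.2, mul_prod_Rn_apply hx y _
        (by simpa using fun h : y ∈ l => absurd h hl.1)]

/-- Constant labels are fixed by every normalized `R`-matrix. This removes the right-hand sorting
operator at the vacuum. -/
theorem sortOpInv_mul_single {x : ι → K} (hx : Generic x) (q : ι → Bool) (l : List ι)
    (hl : l.Nodup) (c : Fin N) (v : A) :
    sortOpInv N A x q l * (Matrix.single (fun _ => c) (fun _ => c) v : TMat ι N A)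
      = (Matrix.single (fun _ => c) (fun _ => c) v : TMat ι N A) := by
  ext α β
  by_cases hβ : β = fun _ => c
  · subst hβ
    have h := mul_sortOpInv_apply hx q l hl (1 : TMat ι N A) α c
    rw [Matrix.one_mul] at h
    rw [Matrix.mul_single_apply_same, h, Matrix.one_apply, Matrix.single_apply]
    simp [eq_comm]
  · rw [Matrix.mul_single_apply_of_ne _ _ _ _ _ hβ]
    rw [Matrix.single_apply, if_neg]
    rintro ⟨-, h⟩
    exact hβ h.symm

theorem commute_sortOp {x : ι → K} (q : ι → Bool) (l : List ι) (hl : l.Nodup) (r : TMat ι N A)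
    (h : ∀ a ∈ l, ∀ b ∈ l, a ≠ b → r * Rn N A x a b = Rn N A x a b * r) :
    r * sortOp N A x q l = sortOp N A x q l * r := by
  induction l with
  | nil => simp [sortOp]
  | cons y l ih =>
    rw [List.nodup_cons] at hl
    have h1 := ih hl.2 fun a ha b hb =>
      h a (List.mem_cons_of_mem _ ha) b (List.mem_cons_of_mem _ hb)
    unfold sortOp
    split_ifs
    · exact h1
    · rw [← mul_assoc, h1, mul_assoc, mul_assoc, commute_list_prod]
      intro m hm
      obtain ⟨i, hi, rfl⟩ := List.mem_map.1 hm
      have hi := (List.mem_filter.1 hi).1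
      exact h y List.mem_cons_self i (List.mem_cons_of_mem _ hi) (ne_of_mem_of_not_mem hi hl.1).symm

theorem commute_sortOpInv {x : ι → K} (q : ι → Bool) (l : List ι) (hl : l.Nodup) (r : TMat ι N A)
    (h : ∀ a ∈ l, ∀ b ∈ l, a ≠ b → r * Rn N A x a b = Rn N A x a b * r) :
    r * sortOpInv N A x q l = sortOpInv N A x q l * r := by
  induction l with
  | nil => simp [sortOpInv]
  | cons y l ih =>
    rw [List.nodup_cons] at hl
    have h1 := ih hl.2 fun a ha b hb =>
      h a (List.mem_cons_of_mem _ ha) b (List.mem_cons_of_mem _ hb)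
    unfold sortOpInv
    split_ifs
    · exact h1
    · rw [mul_assoc, ← h1, ← mul_assoc, ← mul_assoc, commute_list_prod]
      intro m hm
      obtain ⟨i, hi, rfl⟩ := List.mem_map.1 hm
      rw [List.mem_reverse] at hi
      have hi := (List.mem_filter.1 hi).1
      exact h i (List.mem_cons_of_mem _ hi) y List.mem_cons_self (ne_of_mem_of_not_mem hi hl.1)

/-- The projection to the labels such that exactly the tensor factors with `q = true` have
label `0`. -/
def projZero (N : ℕ) (A : Type*) [Ring A] (q : ι → Bool) : TMat ι (N + 1) A :=
  Matrix.diagonal fun α => if ∀ i, decide (α i = 0) = q i then 1 else 0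

/-- The projection to the labels such that the label of the tensor factor `i` is `0`, or not. -/
def projAt (N : ℕ) (A : Type*) [Ring A] (i : ι) (b : Bool) : TMat ι (N + 1) A :=
  Matrix.diagonal fun α => if decide (α i = 0) = b then 1 else 0

theorem projZero_mul_projAt (q : ι → Bool) (i : ι) (b : Bool) (h : q i = b) :
    projZero N A q * projAt N A i b = projZero N A q := by
  subst h
  unfold projZero projAt
  rw [Matrix.diagonal_mul_diagonal]
  congr 1
  funext α
  by_cases hα : ∀ j, decide (α j = 0) = q j
  · rw [if_pos hα, if_pos (hα i), mul_one]
  · rw [if_neg hα, zero_mul]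

theorem projAt_mul_projZero (q : ι → Bool) (i : ι) (b : Bool) (h : q i = b) :
    projAt N A i b * projZero N A q = projZero N A q := by
  refine Eq.trans ?_ (projZero_mul_projAt q i b h)
  unfold projZero projAt
  rw [Matrix.diagonal_mul_diagonal, Matrix.diagonal_mul_diagonal]
  congr 1
  funext α
  split_ifs <;> simp

theorem projZero_mul_projZero (q q' : ι → Bool) :
    projZero N A q * projZero N A q' = if q = q' then projZero N A q else 0 := by
  unfold projZero
  rw [Matrix.diagonal_mul_diagonal]
  split_ifs with h
  · subst h
    congr 1
    funext α
    split_ifs <;> simp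
  · rw [← Matrix.diagonal_zero]
    congr 1
    funext α
    split_ifs with h1 h2
    · exact absurd (funext fun i => (h1 i).symm.trans (h2 i)) h
    all_goals simp

theorem sum_projZero : ∑ q : ι → Bool, projZero N A q = 1 := by
  ext α β
  simp only [Matrix.sum_apply, projZero, Matrix.diagonal_apply, Matrix.one_apply]
  by_cases h : α = β
  · simp only [h, if_true]
    rw [Finset.sum_eq_single fun i => decide (β i = 0)]
    · simp
    · intro q _ hq
      rw [if_neg]
      intro h'
      exact hq (funext fun i => (h' i).symm)
    · simp
  · simp [h]

theorem projAt_comm_permMat (i : ι) (b : Bool) (σ : Equiv.Perm ι) :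
    permMat (N + 1) A σ * projAt N A i b = projAt N A (σ i) b * permMat (N + 1) A σ := by
  ext α β
  unfold projAt
  rw [Matrix.mul_diagonal, Matrix.diagonal_mul, permMat_apply]
  by_cases h : α = β ∘ ⇑σ⁻¹
  · subst h
    simp
  · rw [if_neg h, zero_mul, mul_zero]

theorem projAt_comm_Rn {a b i : ι} (hab : a ≠ b) (hia : i ≠ a) (hib : i ≠ b) (c : Bool)
    (x : ι → K) : projAt N A i c * Rn (N + 1) A x a b = Rn (N + 1) A x a b * projAt N A i c := by
  unfold Rn
  rw [mul_smul_comm, smul_mul_assoc, Rmat_eq hab, mul_add, add_mul, projAt_comm_permMat,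
    Equiv.swap_apply_of_ne_of_ne hia hib, mul_smul_comm, smul_mul_assoc, mul_one, one_mul]

theorem projAt_mul_projAt_ne (i : ι) : projAt N A i false * projAt N A i true = 0 := by
  unfold projAt
  rw [Matrix.diagonal_mul_diagonal, ← Matrix.diagonal_zero]
  congr 1
  funext α
  by_cases h : α i = 0 <;> simp [h]

/-- The matrix element of the normalized R-matrix preserving the labels. -/
def rnDiag (x : ι → K) (a b : ι) : K := (x a - x b) / (x a - x b + 1)

/-- The flip would carry the label `0` from `b` to `a`, where a nonzero label is required; only the
scalar part of `R` survives. -/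
theorem projAt_mul_Rn_mul_projAt {a b : ι} (hab : a ≠ b) (x : ι → K) :
    projAt N A a false * Rn (N + 1) A x a b * projAt N A b true
      = rnDiag x a b • (projAt N A a false * projAt N A b true) := by
  unfold Rn
  have h := projAt_comm_permMat (N := N) (A := A) b true (Equiv.swap a b)
  rw [Equiv.swap_apply_right] at h
  rw [mul_smul_comm, smul_mul_assoc, Rmat_eq hab, mul_add, add_mul,
    mul_assoc _ (permMat (N + 1) A _) (projAt N A b _), h, ← mul_assoc (projAt N A a false) (projAt N A a true), projAt_mul_projAt_ne, zero_mul,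
    add_zero, mul_smul_comm, mul_one, smul_mul_assoc, smul_smul]
  congr 1
  rw [rnDiag, div_eq_inv_mul]

/-- The scalar by which the product of the sorting operators acts. -/
def sortScalar (x : ι → K) (q : ι → Bool) (l : List ι) : K :=
  ((l.filter q).map fun i => ((l.filter fun j => !q j).map fun j => rnDiag x j i).prod).prod

theorem projZero_mul_prod_Rn (x : ι → K) (q : ι → Bool) (y : ι) (l : List ι)
    (hl : l.Nodup) (hy : y ∉ l) (hq : ∀ j ∈ l, q j = false) :
    projZero N A q * (l.map fun j => Rn (N + 1) A x j y).prod * projAt N A y true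
      = (l.map fun j => rnDiag x j y).prod • (projZero N A q * projAt N A y true) := by
  -- The last `R`-matrix is the one next to the projection at `y`. The nonzero label it needs at `i`
  -- is supplied by `projZero` and passes through the earlier `R`-matrices, which do not involve
  -- `i`.
  induction l using List.reverseRecOn with
  | nil => simp
  | append_singleton l i ih =>
    rw [List.nodup_append] at hl
    simp only [List.mem_append, List.mem_singleton, not_or] at hy hq
    have hi : i ∉ l := fun h => hl.2.2 i h i (by simp) rfl
    have hiy : i ≠ y := fun h => hy.2 h.symm
    have ih' := ih hl.1 hy.1 fun j hj => hq j (Or.inl hj)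
    simp only [List.map_append, List.prod_append, List.map_cons, List.map_nil, List.prod_cons,
      List.prod_nil, mul_one]
    have h1 : projAt N A i false * (l.map fun j => Rn (N + 1) A x j y).prod
        = (l.map fun j => Rn (N + 1) A x j y).prod * projAt N A i false := by
      apply commute_list_prod
      intro m hm
      obtain ⟨j, hj, rfl⟩ := List.mem_map.1 hm
      exact projAt_comm_Rn (ne_of_mem_of_not_mem hj hy.1) (ne_of_mem_of_not_mem hj hi).symm hiy _ _
    calc projZero N A q * ((l.map fun j => Rn (N + 1) A x j y).prod * Rn (N + 1) A x i y)
          * projAt N A y true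
        = projZero N A q * (l.map fun j => Rn (N + 1) A x j y).prod
          * (projAt N A i false * Rn (N + 1) A x i y * projAt N A y true) := by
          conv_lhs => rw [← projZero_mul_projAt q i false (hq i (Or.inr rfl))]
          simp only [mul_assoc]
          rw [← mul_assoc (projAt N A i false), h1]
          simp only [mul_assoc]
      _ = rnDiag x i y • (projZero N A q * projAt N A i false *
            (l.map fun j => Rn (N + 1) A x j y).prod * projAt N A y true) := by
          rw [projAt_mul_Rn_mul_projAt hiy, mul_smul_comm]
          congr 1
          simp only [mul_assoc]
          rw [← mul_assoc (projAt N A i false), h1]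
          simp only [mul_assoc]
      _ = _ := by
          rw [projZero_mul_projAt q i false (hq i (Or.inr rfl)), ih', smul_smul, mul_comm]

theorem prod_Rn_mul_projZero (x : ι → K) (q : ι → Bool) (y : ι) (l : List ι)
    (hl : l.Nodup) (hy : y ∉ l) (hq : ∀ j ∈ l, q j = true) :
    projAt N A y false * ((l.map fun i => Rn (N + 1) A x y i).prod * projZero N A q)
      = (l.map fun i => rnDiag x y i).prod • (projAt N A y false * projZero N A q) := by
  induction l with
  | nil => simp
  | cons i l ih =>
    rw [List.nodup_cons] at hl
    rw [List.mem_cons, not_or] at hy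
    have ih' := ih hl.2 hy.2 fun j hj => hq j (List.mem_cons_of_mem _ hj)
    simp only [List.map_cons, List.prod_cons]
    have h1 : projAt N A i true * (l.map fun j => Rn (N + 1) A x y j).prod
        = (l.map fun j => Rn (N + 1) A x y j).prod * projAt N A i true := by
      apply commute_list_prod
      intro m hm
      obtain ⟨j, hj, rfl⟩ := List.mem_map.1 hm
      exact projAt_comm_Rn (ne_of_mem_of_not_mem hj hy.2).symm (Ne.symm hy.1)
        (ne_of_mem_of_not_mem hj hl.1).symm _ _
    calc projAt N A y false * (Rn (N + 1) A x y i * (l.map fun j => Rn (N + 1) A x y j).prod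
          * projZero N A q)
        = projAt N A y false * Rn (N + 1) A x y i * projAt N A i true
          * ((l.map fun j => Rn (N + 1) A x y j).prod * projZero N A q) := by
          conv_lhs => rw [← projAt_mul_projZero q i true (hq i List.mem_cons_self)]
          simp only [mul_assoc]
          rw [← mul_assoc (projAt N A i true), h1]
          simp only [mul_assoc]
      _ = rnDiag x y i • (projAt N A y false * ((l.map fun j => Rn (N + 1) A x y j).prod
            * (projAt N A i true * projZero N A q))) := by
          rw [projAt_mul_Rn_mul_projAt hy.1, smul_mul_assoc]
          congr 1
          simp only [mul_assoc]
          rw [← mul_assoc (projAt N A i true), h1]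
          simp only [mul_assoc]
      _ = _ := by
          rw [projAt_mul_projZero q i true (hq i List.mem_cons_self), ih', smul_smul]

/-- A new head `y` adds `R`-matrices at the right end if `q y` is false and at the left end if it is
true. In both cases the adjacent projection reduces them to scalars, one for each pair of elements
on different sides of `q`. -/
theorem sortOpInv_sortOp_diag (x : ι → K) (q : ι → Bool) (l : List ι) (hl : l.Nodup) :
    projZero N A q * (sortOpInv (N + 1) A x (fun i => !q i) l * sortOp (N + 1) A x q l)
      * projZero N A q = sortScalar x q l • projZero N A q := by
  induction l with
  | nil => simp [sortOp, sortOpInv, sortScalar, projZero_mul_projZero]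
  | cons y l ih =>
    rw [List.nodup_cons] at hl
    -- The sorting operators of the tail do not involve `y`, so the condition on its label can be
    -- carried across them.
    have hc : ∀ b, projAt N A y b *
        (sortOpInv (N + 1) A x (fun i => !q i) l * sortOp (N + 1) A x q l)
        = (sortOpInv (N + 1) A x (fun i => !q i) l * sortOp (N + 1) A x q l) * projAt N A y b := by
      intro b
      have h : ∀ a ∈ l, ∀ c ∈ l, a ≠ c →
          projAt N A y b * Rn (N + 1) A x a c = Rn (N + 1) A x a c * projAt N A y b :=
        fun a ha c hc hac => projAt_comm_Rn hac (ne_of_mem_of_not_mem ha hl.1).symm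
          (ne_of_mem_of_not_mem hc hl.1).symm _ _
      rw [← mul_assoc, commute_sortOpInv _ l hl.2 _ h, mul_assoc, commute_sortOp _ l hl.2 _ h,
        mul_assoc]
    have ih' := ih hl.2
    cases hq : q y
    · simp only [sortOp, sortOpInv, hq, Bool.not_false, if_true, Bool.false_eq_true, if_false]
      calc projZero N A q * (sortOpInv (N + 1) A x (fun i => !q i) l * (sortOp (N + 1) A x q l
            * ((l.filter q).map fun i => Rn (N + 1) A x y i).prod)) * projZero N A q
          = projZero N A q * projAt N A y false * (sortOpInv (N + 1) A x (fun i => !q i) l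
            * sortOp (N + 1) A x q l) * (((l.filter q).map fun i => Rn (N + 1) A x y i).prod
            * projZero N A q) := by
            rw [projZero_mul_projAt q y false hq]
            simp only [mul_assoc]
        _ = projZero N A q * (sortOpInv (N + 1) A x (fun i => !q i) l * sortOp (N + 1) A x q l)
            * (projAt N A y false * (((l.filter q).map fun i => Rn (N + 1) A x y i).prod
            * projZero N A q)) := by
            rw [mul_assoc (projZero N A q) (projAt N A y false), hc]
            simp only [mul_assoc]
        _ = _ := by
            rw [prod_Rn_mul_projZero x q y _ (hl.2.filter _) (notMem_filter hl.1 q)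
              fun j hj => (List.mem_filter.1 hj).2, projAt_mul_projZero q y false hq,
              mul_smul_comm, ih', smul_smul]
            congr 1
            simp only [sortScalar, List.filter_cons, hq, Bool.not_false, if_true,
              Bool.false_eq_true, if_false, List.map_cons, List.prod_cons, List.prod_map_mul]
    · simp only [sortOp, sortOpInv, hq, Bool.not_true, if_true, Bool.false_eq_true, if_false]
      calc projZero N A q * (((l.filter fun i => !q i).reverse.map fun i =>
            Rn (N + 1) A x i y).prod * sortOpInv (N + 1) A x (fun i => !q i) l
            * sortOp (N + 1) A x q l) * projZero N A q
          = projZero N A q * ((l.filter fun i => !q i).reverse.map fun i =>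
            Rn (N + 1) A x i y).prod * ((sortOpInv (N + 1) A x (fun i => !q i) l
            * sortOp (N + 1) A x q l) * projAt N A y true) * projZero N A q := by
            simp only [mul_assoc]
            rw [projAt_mul_projZero q y true hq]
        _ = projZero N A q * ((l.filter fun i => !q i).reverse.map fun i =>
            Rn (N + 1) A x i y).prod * projAt N A y true
            * (sortOpInv (N + 1) A x (fun i => !q i) l
            * sortOp (N + 1) A x q l) * projZero N A q := by
            rw [← hc]
            simp only [mul_assoc]
        _ = _ := by
            rw [projZero_mul_prod_Rn x q y _ (List.nodup_reverse.2 (hl.2.filter _))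
              (by simpa using fun h : y ∈ l => absurd h hl.1)
              fun j hj => by simpa using (List.mem_filter.1 (List.mem_reverse.1 hj)).2,
              projZero_mul_projAt q y true hq,
              smul_mul_assoc, smul_mul_assoc, ih', smul_smul]
            congr 1
            simp only [sortScalar, List.filter_cons, hq, Bool.not_true, if_true,
              Bool.false_eq_true, if_false, List.map_cons, List.prod_cons, List.map_reverse,
              List.prod_reverse]

end Sorting

/-! ### Transfer operators and the resolution of the identity -/

section Resolution

variable {ι : Type*} [Fintype ι] [DecidableEq ι] {N N' : ℕ} {K A : Type*} [Field K] [Ring A]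
  [Algebra K A]

theorem embed_single_mul_projZero_eq_zero (q : ι → Bool) (j : ι) (a b : Fin (N + 1))
    (h : decide (b = 0) ≠ q j) :
    embed j (Matrix.single a b (1 : A)) * projZero N A q = 0 := by
  ext α β
  rw [projZero, Matrix.mul_diagonal, embed, Matrix.zero_apply]
  by_cases hβ : ∀ i, decide (β i = 0) = q i
  · rw [Matrix.single_apply_of_ne, ite_self, zero_mul]
    rintro ⟨-, rfl⟩
    exact h (hβ j)
  · rw [if_neg hβ, mul_zero]

theorem projZero_mul_embed_single_eq_zero (q : ι → Bool) (j : ι) (a b : Fin (N + 1))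
    (h : decide (a = 0) ≠ q j) :
    projZero N A q * embed j (Matrix.single a b (1 : A)) = 0 := by
  ext α β
  rw [projZero, Matrix.diagonal_mul, embed, Matrix.zero_apply]
  by_cases hα : ∀ i, decide (α i = 0) = q i
  · rw [Matrix.single_apply_of_ne, ite_self, mul_zero]
    rintro ⟨rfl, -⟩
    exact h (hα j)
  · rw [if_neg hα, zero_mul]

theorem embed_single_eq_projAt (j : ι) :
    embed j (Matrix.single (0 : Fin (N + 1)) 0 (1 : A)) = projAt N A j true := by
  ext α β
  rw [projAt, Matrix.diagonal_apply, embed, Matrix.single_apply]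
  by_cases h : α = β
  · subst h
    simp [eq_comm]
  · rw [if_neg h]
    split_ifs with h1 h2
    · exact absurd (funext fun i => by
        by_cases hi : i = j
        · subst hi
          rw [← h2.1, ← h2.2]
        · exact h1 i hi) h
    · rfl
    · rfl

/-- The `u⁻¹` term of `L_{0c}` is an elementary matrix that reads the label `0` at `j`; it vanishes
where that label is nonzero. With its variants below, this makes products of `L` triangular on the
projections. -/
theorem Lmat_mul_projZero_of_false (q : ι → Bool) (j : ι) (hj : q j = false) (u : K)
    (c : Fin (N + 1)) :
    Lmat A j u 0 c * projZero N A q = if c = 0 then projZero N A q else 0 := by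
  rw [Lmat_apply, add_mul, smul_mul_assoc, embed_single_mul_projZero_eq_zero _ _ _ _ (by simp [hj]),
    smul_zero, add_zero]
  simp [eq_comm]

theorem projZero_mul_Lmat_of_false (q : ι → Bool) (j : ι) (hj : q j = false) (u : K)
    (c : Fin (N + 1)) :
    projZero N A q * Lmat A j u c 0 = if c = 0 then projZero N A q else 0 := by
  rw [Lmat_apply, mul_add, mul_smul_comm, projZero_mul_embed_single_eq_zero _ _ _ _ (by simp [hj]),
    smul_zero, add_zero]
  simp [eq_comm]

theorem Lmat_mul_projZero_of_true (q : ι → Bool) (i : ι) (hi : q i = true) (u : K)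
    (c : Fin (N + 1)) :
    Lmat A i u c 0 * projZero N A q = if c = 0 then (1 + u⁻¹) • projZero N A q else 0 := by
  rw [Lmat_apply, add_mul, smul_mul_assoc]
  split_ifs with h
  · subst h
    rw [embed_single_eq_projAt, projAt_mul_projZero q i true hi, one_mul, add_smul, one_smul]
  · rw [embed_single_mul_projZero_eq_zero _ _ _ _ (by simp [hi, h]), smul_zero, add_zero, zero_mul]

theorem projZero_mul_Lmat_of_true (q : ι → Bool) (i : ι) (hi : q i = true) (u : K)
    (c : Fin (N + 1)) :
    projZero N A q * Lmat A i u 0 c = if c = 0 then (1 + u⁻¹) • projZero N A q else 0 := by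
  rw [Lmat_apply, mul_add, mul_smul_comm]
  by_cases h : c = 0
  · subst h
    rw [embed_single_eq_projAt, projZero_mul_projAt q i true hi, if_pos rfl, if_pos rfl, mul_one,
      add_smul, one_smul]
  · rw [projZero_mul_embed_single_eq_zero _ _ _ _ (by simp [hi, h]), smul_zero, add_zero,
      if_neg (Ne.symm h), mul_zero, if_neg h]

theorem Lmat_comm_list_prod (j : ι) (l : List ι) (hj : j ∉ l) (u : K) (w : ι → K)
    (a b c d : Fin N) :
    Lmat A j u a b * ((l.map fun i => Lmat A i (w i)).prod : LMat ι N A) c d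
      = ((l.map fun i => Lmat A i (w i)).prod : LMat ι N A) c d * Lmat A j u a b := by
  apply comm_matrix_list_prod
  intro M hM c d
  obtain ⟨i, hi, rfl⟩ := List.mem_map.1 hM
  exact Lmat_comm_Lmat (ne_of_mem_of_not_mem hi hj).symm _ _ _ _ _ _

theorem Lprod_mul_projZero_of_false (q : ι → Bool) (w : ι → K) (l : List ι) (hl : l.Nodup)
    (h : ∀ j ∈ l, q j = false) (c : Fin (N + 1)) :
    ((l.map fun i => Lmat A i (w i)).prod : LMat ι (N + 1) A) 0 c * projZero N A q
      = if c = 0 then projZero N A q else 0 := by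
  induction l generalizing c with
  | nil => simp [Matrix.one_apply, eq_comm]
  | cons j l ih =>
    rw [List.nodup_cons] at hl
    rw [List.map_cons, List.prod_cons, Matrix.mul_apply, Finset.sum_mul, Finset.sum_eq_single 0]
    · rw [Lmat_comm_list_prod j l hl.1, mul_assoc,
        Lmat_mul_projZero_of_false q j (h j List.mem_cons_self), if_pos rfl,
        ih hl.2 fun i hi => h i (List.mem_cons_of_mem _ hi)]
    · intro d _ hd
      rw [Lmat_comm_list_prod j l hl.1, mul_assoc,
        Lmat_mul_projZero_of_false q j (h j List.mem_cons_self), if_neg hd, mul_zero]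
    · simp

theorem projZero_mul_Lprod_of_false (q : ι → Bool) (w : ι → K) (l : List ι) (hl : l.Nodup)
    (h : ∀ j ∈ l, q j = false) (c : Fin (N + 1)) :
    projZero N A q * ((l.map fun i => Lmat A i (w i)).prod : LMat ι (N + 1) A) c 0
      = if c = 0 then projZero N A q else 0 := by
  induction l generalizing c with
  | nil => simp [Matrix.one_apply, eq_comm]
  | cons j l ih =>
    rw [List.nodup_cons] at hl
    have ih' := ih hl.2 fun i hi => h i (List.mem_cons_of_mem _ hi)
    rw [List.map_cons, List.prod_cons, Matrix.mul_apply, Finset.mul_sum, Finset.sum_eq_single 0]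
    · rw [Lmat_comm_list_prod j l hl.1, ← mul_assoc, ih', if_pos rfl,
        projZero_mul_Lmat_of_false q j (h j List.mem_cons_self)]
    · intro d _ hd
      rw [Lmat_comm_list_prod j l hl.1, ← mul_assoc, ih', if_neg hd, zero_mul]
    · simp

theorem Lprod_mul_projZero_of_true (q : ι → Bool) (w : ι → K) (l : List ι)
    (h : ∀ j ∈ l, q j = true) (c : Fin (N + 1)) :
    ((l.map fun i => Lmat A i (w i)).prod : LMat ι (N + 1) A) c 0 * projZero N A q
      = if c = 0 then (l.map fun i => 1 + (w i)⁻¹).prod • projZero N A q else 0 := by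
  induction l generalizing c with
  | nil => simp [Matrix.one_apply, eq_comm]
  | cons j l ih =>
    have ih' := ih fun i hi => h i (List.mem_cons_of_mem _ hi)
    rw [List.map_cons, List.prod_cons, Matrix.mul_apply, Finset.sum_mul, Finset.sum_eq_single 0]
    · rw [mul_assoc, ih', if_pos rfl, mul_smul_comm,
        Lmat_mul_projZero_of_true q j (h j List.mem_cons_self)]
      split_ifs
      · rw [smul_smul, List.map_cons, List.prod_cons, mul_comm]
      · simp
    · intro d _ hd
      rw [mul_assoc, ih', if_neg hd, mul_zero]
    · simp

theorem projZero_mul_Lprod_of_true (q : ι → Bool) (w : ι → K) (l : List ι)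
    (h : ∀ j ∈ l, q j = true) (c : Fin (N + 1)) :
    projZero N A q * ((l.map fun i => Lmat A i (w i)).prod : LMat ι (N + 1) A) 0 c
      = if c = 0 then (l.map fun i => 1 + (w i)⁻¹).prod • projZero N A q else 0 := by
  induction l generalizing c with
  | nil => simp [Matrix.one_apply, eq_comm]
  | cons j l ih =>
    have ih' := ih fun i hi => h i (List.mem_cons_of_mem _ hi)
    rw [List.map_cons, List.prod_cons, Matrix.mul_apply, Finset.mul_sum, Finset.sum_eq_single 0]
    · rw [← mul_assoc, projZero_mul_Lmat_of_true q j (h j List.mem_cons_self), if_pos rfl,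
        smul_mul_assoc, ih']
      split_ifs
      · rw [smul_smul, List.map_cons, List.prod_cons]
      · simp
    · intro d _ hd
      rw [← mul_assoc, projZero_mul_Lmat_of_true q j (h j List.mem_cons_self), if_neg hd, zero_mul]
    · simp

/-- The eigenvalue of the transfer operator separating the projections. -/
def sepEigen (x : ι → K) (q : ι → Bool) (l : List ι) (s : K) : K :=
  ((l.filter q).map fun i => 1 + (x i - s)⁻¹).prod

/-- In the sorted order the factors with label `0` act first. On them column `0` of `L` is diagonal,
which forces the intermediate auxiliary index to be `0`; on the others row `0` acts trivially. The
eigenvalue comes from the former alone. -/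
theorem transfer_mul_projZero (x : ι → K) (q : ι → Bool) (l : List ι) (hl : l.Nodup) (s : K) :
    ((((l.filter q ++ l.filter fun i => !q i).reverse.map fun i => Lmat A i (x i - s)).prod :
      LMat ι (N + 1) A) 0 0) * projZero N A q = sepEigen x q l s • projZero N A q := by
  rw [List.reverse_append, List.map_append, List.prod_append, Matrix.mul_apply, Finset.sum_mul,
    Finset.sum_eq_single 0]
  · rw [mul_assoc, Lprod_mul_projZero_of_true, if_pos rfl, mul_smul_comm,
      Lprod_mul_projZero_of_false, if_pos rfl, List.map_reverse, List.prod_reverse, sepEigen]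
    · exact List.nodup_reverse.2 (hl.filter _)
    · intro j hj
      simpa using (List.mem_filter.1 (List.mem_reverse.1 hj)).2
    · intro j hj
      exact (List.mem_filter.1 (List.mem_reverse.1 hj)).2
  · intro d _ hd
    rw [mul_assoc, Lprod_mul_projZero_of_true, if_neg hd, mul_zero]
    intro j hj
    exact (List.mem_filter.1 (List.mem_reverse.1 hj)).2
  · simp

theorem projZero_mul_transfer (x : ι → K) (q : ι → Bool) (l : List ι) (hl : l.Nodup) (s : K) :
    projZero N A q * ((((l.filter (fun i => !q i) ++ l.filter q).reverse.map
      fun i => Lmat A i (x i - s)).prod : LMat ι (N + 1) A) 0 0)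
      = sepEigen x q l s • projZero N A q := by
  rw [List.reverse_append, List.map_append, List.prod_append, Matrix.mul_apply, Finset.mul_sum,
    Finset.sum_eq_single 0]
  · rw [← mul_assoc, projZero_mul_Lprod_of_true, if_pos rfl, smul_mul_assoc,
      projZero_mul_Lprod_of_false, if_pos rfl, List.map_reverse, List.prod_reverse, sepEigen]
    · exact List.nodup_reverse.2 (hl.filter _)
    · intro j hj
      simpa using (List.mem_filter.1 (List.mem_reverse.1 hj)).2
    · intro j hj
      exact (List.mem_filter.1 (List.mem_reverse.1 hj)).2
  · intro d _ hd
    rw [← mul_assoc, projZero_mul_Lprod_of_true, if_neg hd, zero_mul]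
    intro j hj
    exact (List.mem_filter.1 (List.mem_reverse.1 hj)).2
  · simp

/-- At `s = x_y + 1` the factor of `i` equals `(x_i - x_y)/(x_i - x_y - 1)`, which vanishes only for
`i = y`. -/
theorem sepEigen_eq_zero_iff {x : ι → K} (hx : Generic x) (q : ι → Bool) (l : List ι) (y : ι)
    (hy : y ∈ l) : sepEigen x q l (x y + 1) = 0 ↔ q y = true := by
  have h : ∀ i, 1 + (x i - (x y + 1))⁻¹ = 0 ↔ i = y := by
    intro i
    constructor
    · intro h
      by_contra hi
      have h1 := hx.sub_ne hi
      have h2 := hx.sub_add_ne (Ne.symm hi)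
      have h3 : x i - (x y + 1) ≠ 0 := by
        intro h3
        apply h2
        rw [← neg_eq_zero, ← h3]
        ring
      field_simp at h
      apply h1
      rw [mul_zero] at h
      rw [← h]
      ring
    · rintro rfl
      rw [show x i - (x i + 1) = -1 by ring]
      norm_num
  rw [sepEigen, List.prod_eq_zero_iff, List.mem_map]
  constructor
  · rintro ⟨i, hi, hi'⟩
    rw [h] at hi'
    subst hi'
    exact (List.mem_filter.1 hi).2
  · intro hq
    exact ⟨y, List.mem_filter.2 ⟨hy, hq⟩, (h y).2 rfl⟩

/-- One transfer operator, inserted between the two sorting operators, can be moved to either side;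
it acts there by the eigenvalue of `q` or by that of `q'`. With `y` a place where these differ, the
parameter `x_y + 1` makes exactly one of the eigenvalues zero. -/
theorem sortOpInv_sortOp_offDiag {x : ι → K} (hx : Generic x) (q q' : ι → Bool) (l : List ι)
    (hl : l.Nodup) (hc : ∀ i, i ∈ l) (hq : q ≠ q') :
    projZero N K q' * (sortOpInv (N + 1) K x (fun i => !q' i) l * sortOp (N + 1) K x q l)
      * projZero N K q = 0 := by
  obtain ⟨y, hy⟩ := Function.ne_iff.1 hq
  have hs : ∀ i, x i - (x y + 1) ≠ 0 := by
    intro i h3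
    by_cases hi : i = y
    · subst hi
      have : (-1 : K) = 0 := by rw [← h3]; ring
      norm_num at this
    · apply hx.sub_add_ne (Ne.symm hi)
      rw [← neg_eq_zero, ← h3]
      ring
  have hcov := covariant_Lprod_reverse (N := N + 1) (A := K) hs 0 0
  have h1 := hcov.mul_sortOp q l [] hl
  have h2 := hcov.sortOpInv_mul hx (fun i => !q' i) l hl
  simp only [List.nil_append, Bool.not_not] at h1 h2
  set F := ((l.reverse.map fun i => Lmat K i (x i - (x y + 1))).prod : LMat ι (N + 1) K) 0 0
    with hF
  set X := projZero N K q' * (sortOpInv (N + 1) K x (fun i => !q' i) l * sortOp (N + 1) K x q l)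
      * projZero N K q with hX
  have e1 : projZero N K q' * sortOpInv (N + 1) K x (fun i => !q' i) l * F
      * sortOp (N + 1) K x q l * projZero N K q = sepEigen x q' l (x y + 1) • X := by
    rw [mul_assoc (projZero N K q'), h2, ← mul_assoc (projZero N K q'),
      projZero_mul_transfer x q' l hl, hX]
    simp only [smul_mul_assoc, mul_assoc]
  have e2 : projZero N K q' * sortOpInv (N + 1) K x (fun i => !q' i) l * F
      * sortOp (N + 1) K x q l * projZero N K q = sepEigen x q l (x y + 1) • X := by
    rw [mul_assoc _ F, h1, mul_assoc, mul_assoc (sortOp _ _ _ _ _),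
      transfer_mul_projZero x q l hl, hX]
    simp only [mul_smul_comm, mul_assoc]
  have e3 : (sepEigen x q' l (x y + 1) - sepEigen x q l (x y + 1)) • X = 0 := by
    rw [sub_smul, ← e1, ← e2, sub_self]
  refine (smul_eq_zero.1 e3).resolve_left fun h => ?_
  have h4 := sepEigen_eq_zero_iff hx q l y (hc y)
  have h5 := sepEigen_eq_zero_iff hx q' l y (hc y)
  rw [sub_eq_zero] at h
  rw [h, h4] at h5
  apply hy
  cases h6 : q y <;> cases h7 : q' y <;> simp [h6, h7] at h5 <;> rfl

theorem sortScalar_ne_zero {x : ι → K} (hx : Generic x) (q : ι → Bool) (l : List ι) :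
    sortScalar x q l ≠ 0 := by
  unfold sortScalar
  rw [Ne, List.prod_eq_zero_iff, List.mem_map]
  rintro ⟨i, hi, h⟩
  rw [List.prod_eq_zero_iff, List.mem_map] at h
  obtain ⟨j, hj, h⟩ := h
  have hij : j ≠ i := by
    rintro rfl
    have h1 := (List.mem_filter.1 hi).2
    have h2 := (List.mem_filter.1 hj).2
    simp [h1] at h2
  exact div_ne_zero (hx.sub_ne hij) (hx.sub_add_ne hij) h

/-- The conjugated projections form dual systems: their pairings vanish for `q ≠ q'` and are the
nonzero `sortScalar` for `q = q'`. So one product is the identity, and hence so is the product in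
the other order. -/
theorem resolution_aux {x : ι → K} (hx : Generic x) (l : List ι) (hl : l.Nodup)
    (hc : ∀ i, i ∈ l) :
    ∑ q : ι → Bool, (sortScalar x q l)⁻¹ • (sortOp (N + 1) K x q l * projZero N K q
      * sortOpInv (N + 1) K x (fun i => !q i) l) = 1 := by
  have h : (∑ q : ι → Bool, projZero N K q * sortOpInv (N + 1) K x (fun i => !q i) l)
      * (∑ q : ι → Bool, (sortScalar x q l)⁻¹ • (sortOp (N + 1) K x q l * projZero N K q)) = 1 := by
    rw [Finset.sum_mul_sum, ← sum_projZero]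
    refine Finset.sum_congr rfl fun q' _ => ?_
    rw [Finset.sum_eq_single q']
    · have := sortOpInv_sortOp_diag (N := N) (A := K) x q' l hl
      simp only [mul_assoc] at this
      rw [mul_smul_comm, mul_assoc, this, smul_smul, inv_mul_cancel₀ (sortScalar_ne_zero hx q' l),
        one_smul]
    · intro q _ hq
      have := sortOpInv_sortOp_offDiag (N := N) hx q q' l hl hc hq
      simp only [mul_assoc] at this
      rw [mul_smul_comm, mul_assoc, this, smul_zero]
    · simp
  -- A one-sided inverse of a square matrix over a field is two-sided. This is the reason to work
  -- over `K` before passing to `A`.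
  rw [mul_eq_one_comm, Finset.sum_mul_sum] at h
  rw [← h]
  refine Finset.sum_congr rfl fun q _ => ?_
  rw [Finset.sum_eq_single q]
  · rw [smul_mul_assoc, mul_assoc, mul_assoc, ← mul_assoc (projZero N K q) (projZero N K q),
      projZero_mul_projZero, if_pos rfl]
  · intro q' _ hq
    rw [smul_mul_assoc, mul_assoc, ← mul_assoc (projZero N K q) (projZero N K q'),
      projZero_mul_projZero, if_neg (Ne.symm hq), zero_mul, mul_zero, smul_zero]
  · simp

theorem projZero_map_algebraMap (q : ι → Bool) :
    (projZero N K q).map (algebraMap K A) = projZero N A q := by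
  unfold projZero
  rw [Matrix.diagonal_map (map_zero _)]
  congr 1
  funext α
  split_ifs <;> simp

/-- The resolution of the identity by the projections, transported by the sorting operators. -/
theorem resolution {x : ι → K} (hx : Generic x) (l : List ι) (hl : l.Nodup) (hc : ∀ i, i ∈ l) :
    ∑ q : ι → Bool, (sortScalar x q l)⁻¹ • (sortOp (N + 1) A x q l * projZero N A q
      * sortOpInv (N + 1) A x (fun i => !q i) l) = 1 := by
  have h : (1 : TMat ι (N + 1) K).map (algebraMap K A) = 1 :=
    Matrix.map_one _ (map_zero _) (map_one _)
  rw [← h, ← resolution_aux (N := N) hx l hl hc]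
  ext α β
  simp only [Matrix.map_apply, Matrix.sum_apply, map_sum, Matrix.smul_apply]
  refine Finset.sum_congr rfl fun q _ => ?_
  rw [smul_eq_mul, map_mul, ← Algebra.smul_def]
  congr 1
  rw [← Matrix.map_apply (f := algebraMap K A), Matrix.map_mul, Matrix.map_mul,
    sortOp_map_algebraMap, projZero_map_algebraMap, sortOpInv_map_algebraMap]

end Resolution

/-! ## Vectors killed by the entries below the diagonal -/

section Singular

variable {n : ℕ} {K A : Type*} [Field K] [Ring A] [Algebra K A]

theorem RTT.submatrix {N N' : ℕ} {u : K} {M M' : Matrix (Fin N) (Fin N) A}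
    (h : RTT u M M') (f : Fin N' → Fin N) : RTT u (M.submatrix f f) (M'.submatrix f f) :=
  fun a b c d => h (f a) (f b) (f c) (f d)

/-- In the relation for `M_{cd}` and `M'_{a0}` every other term ends with an entry of column `0` and
nonzero row, which kills `w`. So being killed persists after applying entries of nonzero row. -/
theorem RTT.mul_eq_zero {u : K} (hu : u ≠ 0) {M M' : Matrix (Fin (n + 1)) (Fin (n + 1)) A}
    (h : RTT u M M') {w : A} (hM : ∀ c, c ≠ 0 → M c 0 * w = 0) (hM' : ∀ c, c ≠ 0 → M' c 0 * w = 0)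
    {a c : Fin (n + 1)} (ha : a ≠ 0) (hc : c ≠ 0) (d : Fin (n + 1)) :
    M' a 0 * (M c d * w) = 0 := by
  have h1 := congrArg (· * w) (h c d a 0)
  simp only [sub_mul, smul_mul_assoc, mul_assoc, hM c hc, hM' c hc, hM' a ha, mul_zero,
    sub_self, zero_sub, smul_neg, neg_eq_zero] at h1
  exact (smul_eq_zero_iff_right hu).1 h1

/-- Here the right-hand side of the relation for `M_{cd}` and `M'_{00}` ends with entries of column
`0` and row `c ≠ 0`, so the two entries commute on `w`. -/
theorem RTT.mul_comm_apply {u : K} (hu : u ≠ 0) {M M' : Matrix (Fin (n + 1)) (Fin (n + 1)) A}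
    (h : RTT u M M') {w : A} (hM : ∀ c, c ≠ 0 → M c 0 * w = 0) (hM' : ∀ c, c ≠ 0 → M' c 0 * w = 0)
    {c : Fin (n + 1)} (hc : c ≠ 0) (d : Fin (n + 1)) :
    M' 0 0 * (M c d * w) = M c d * (M' 0 0 * w) := by
  have h1 := congrArg (· * w) (h c d 0 0)
  simp only [sub_mul, smul_mul_assoc, mul_assoc, hM c hc, hM' c hc, mul_zero, sub_self] at h1
  have := (smul_eq_zero_iff_right hu).1 h1
  rw [sub_eq_zero] at this
  exact this.symm

/-- On a vector killed by the entries `P_{a0}`, the entries of `P` in the row `0` do not contribute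
to the Bethe function of the lower right block of `P * Q`. -/
theorem gB_block_mul (ξ : Fin n → ℕ) (z : Pos ξ → K) (hz : Generic z)
    (P : Pos ξ → Matrix (Fin (n + 2)) (Fin (n + 2)) A)
    (Q : Pos ξ → Matrix (Fin (n + 2)) (Fin (n + 1)) A)
    (hP : ∀ p q, p ≠ q → RTT (z p - z q) (P p) (P q))
    (hPQ : ∀ p q a b c d, P p a b * Q q c d = Q q c d * P p a b)
    (v : A) (hv : ∀ p a, a ≠ 0 → P p a 0 * v = 0) :
    gB ξ (fun p => (P p * Q p).submatrix Fin.succ id) z * v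
      = gB ξ (fun p => (P p).submatrix Fin.succ Fin.succ * (Q p).submatrix Fin.succ id) z * v := by
  -- Annihilation is tracked only for positions not yet used: the RTT relation is available for
  -- distinct positions only.
  refine gB_mul_congr ξ _ _ z v (fun l u => ∀ y, y ∉ l → ∀ a, a ≠ 0 → P y a 0 * u = 0)
    (fun y _ a ha => hv y a ha) ?_
  intro p l u hp hu a b _
  -- The term with intermediate label `0` contains `P_{a+1,0}`, which commutes past the entry of `Q`
  -- and kills `u`.
  have e : (P p * Q p) a.succ b * u = ∑ e : Fin (n + 1), P p a.succ e.succ * (Q p e.succ b * u) := by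
    rw [Matrix.mul_apply, Finset.sum_mul, Fin.sum_univ_succ, hPQ, mul_assoc,
      hu p hp _ (Fin.succ_ne_zero a), mul_zero, zero_add]
    simp only [mul_assoc]
  constructor
  · simp only [Matrix.submatrix_apply, id]
    rw [e, Matrix.mul_apply, Finset.sum_mul]
    simp only [Matrix.submatrix_apply, id, mul_assoc]
  · intro y hy c hc
    simp only [Matrix.submatrix_apply, id]
    rw [e, Finset.mul_sum]
    rw [List.mem_cons, not_or] at hy
    refine Finset.sum_eq_zero fun e _ => ?_
    refine (hP p y (Ne.symm hy.1)).mul_eq_zero (hz.sub_ne (Ne.symm hy.1)) ?_ ?_ hc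
      (Fin.succ_ne_zero a) _
    · intro c hc
      rw [← mul_assoc, hPQ, mul_assoc, hu p hp c hc, mul_zero]
    · intro c hc
      rw [← mul_assoc, hPQ, mul_assoc, hu y hy.2 c hc, mul_zero]

/-- An eigenvector of `M_{00}` killed by the entries `P_{a0}` and `M_{a0}` is mapped by the Bethe
function of the lower right block of `P` to an eigenvector of `M_{00}`. -/
theorem mul_gB_block (ξ : Fin n → ℕ) (z : Pos ξ → K) (hz : Generic z)
    (P : Pos ξ → Matrix (Fin (n + 2)) (Fin (n + 2)) A)
    (Q : Pos ξ → Matrix (Fin (n + 1)) (Fin (n + 1)) A)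
    (hP : ∀ p q, p ≠ q → RTT (z p - z q) (P p) (P q))
    (hPQ : ∀ p q a b c d, P p a b * Q q c d = Q q c d * P p a b)
    (M : Matrix (Fin (n + 2)) (Fin (n + 2)) A) (u : Pos ξ → K) (hu : ∀ p, u p ≠ 0)
    (hM : ∀ p, RTT (u p) (P p) M) (hMQ : ∀ q a b c d, M a b * Q q c d = Q q c d * M a b)
    (v : A) (hv : ∀ p a, a ≠ 0 → P p a 0 * v = 0) (hMv : ∀ a, a ≠ 0 → M a 0 * v = 0)
    (c : K) (hc : M 0 0 * v = c • v) :
    M 0 0 * (gB ξ (fun p => (P p).submatrix Fin.succ Fin.succ * Q p) z * v)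
      = c • (gB ξ (fun p => (P p).submatrix Fin.succ Fin.succ * Q p) z * v) := by
  let G : Submodule K A := LinearMap.ker (LinearMap.mulLeft K (M 0 0) - c • LinearMap.id)
  have hG : ∀ x, x ∈ G ↔ M 0 0 * x = c • x := by
    intro x
    simp [G, sub_eq_zero]
  rw [← hG]
  -- The eigenvector property alone is not stable: moving `M_{00}` past an entry of `P` uses
  -- annihilation by column `0` of both `M` and the unused `P`.
  refine gB_invariant ξ _ z v G (fun l u => M 0 0 * u = c • u ∧ (∀ a, a ≠ 0 → M a 0 * u = 0)
    ∧ ∀ y, y ∉ l → ∀ a, a ≠ 0 → P y a 0 * u = 0) ⟨hc, hMv, fun y _ a ha => hv y a ha⟩ ?_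
    fun l u h => (hG u).2 h.1
  rintro p l w hp ⟨h1, h2, h3⟩ a b
  have e : ((P p).submatrix Fin.succ Fin.succ * Q p) a b * w
      = ∑ e : Fin (n + 1), P p a.succ e.succ * (Q p e b * w) := by
    rw [Matrix.mul_apply, Finset.sum_mul]
    simp only [Matrix.submatrix_apply, mul_assoc]
  have k1 : ∀ e b a, a ≠ 0 → P p a 0 * (Q p e b * w) = 0 := by
    intro e b a ha
    rw [← mul_assoc, hPQ, mul_assoc, h3 p hp a ha, mul_zero]
  have k2 : ∀ e b a, a ≠ 0 → M a 0 * (Q p e b * w) = 0 := by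
    intro e b a ha
    rw [← mul_assoc, hMQ, mul_assoc, h2 a ha, mul_zero]
  rw [e]
  refine ⟨?_, ?_, ?_⟩
  · rw [Finset.mul_sum, Finset.smul_sum]
    refine Finset.sum_congr rfl fun e _ => ?_
    rw [(hM p).mul_comm_apply (hu p) (k1 e b) (k2 e b) (Fin.succ_ne_zero a), ← mul_assoc (M 0 0),
      hMQ, mul_assoc, h1, mul_smul_comm, mul_smul_comm]
  · intro a' ha'
    rw [Finset.mul_sum]
    exact Finset.sum_eq_zero fun e _ =>
      (hM p).mul_eq_zero (hu p) (k1 e b) (k2 e b) ha' (Fin.succ_ne_zero a) _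
  · intro y hy a' ha'
    rw [List.mem_cons, not_or] at hy
    rw [Finset.mul_sum]
    refine Finset.sum_eq_zero fun e _ => (hP p y (Ne.symm hy.1)).mul_eq_zero
      (hz.sub_ne (Ne.symm hy.1)) (k1 e b) ?_ ha' (Fin.succ_ne_zero a) _
    intro c' hc'
    rw [← mul_assoc, hPQ, mul_assoc, h3 y hy.2 c' hc', mul_zero]

end Singular

/-! ### Action on the vacuum of the auxiliary tensor factors -/

section Vacuum

variable {ι : Type*} [Fintype ι] [DecidableEq ι] {n N : ℕ} {K A : Type*} [Field K] [Ring A]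
  [Algebra K A]

/-- An element of `A` as an operator at the labels `0`. -/
def vac (ι : Type*) [Fintype ι] [DecidableEq ι] (N : ℕ) (v : A) : TMat ι (N + 1) A :=
  Matrix.single (fun _ => 0) (fun _ => 0) v

theorem mul_vac_apply {m : Type*} (X : Matrix m (ι → Fin (N + 1)) A) (v : A) (α : m) :
    (X * vac ι N v) α (fun _ => 0) = X α (fun _ => 0) * v := by
  rw [vac, Matrix.mul_single_apply_same]

theorem scalar_mul_vac (r v : A) :
    Matrix.scalar (ι → Fin (N + 1)) r * vac ι N v = vac ι N (r * v) := by
  ext α β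
  rw [Matrix.scalar_apply, Matrix.diagonal_mul, vac, vac, Matrix.single_apply, Matrix.single_apply]
  split_ifs <;> simp

theorem smul_vac (c : K) (v : A) : vac ι N (c • v) = c • vac ι N v := by
  rw [vac, vac, Matrix.smul_single]

theorem vac_zero : vac ι N (0 : A) = 0 := Matrix.single_zero _ _

theorem projZero_mul_vac (v : A) : projZero N A (fun _ => true) * vac ι N v = vac ι N v := by
  ext α β
  rw [projZero, Matrix.diagonal_mul, vac, Matrix.single_apply]
  by_cases h : ∀ i, decide (α i = 0) = true
  · rw [if_pos h, one_mul]
  · rw [if_neg h, zero_mul, if_neg]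
    rintro ⟨rfl, -⟩
    exact h fun i => by simp

theorem Lprod_mul_vac_zero (l : List ι) (x : ι → K) (s : K) (c : Fin (N + 1)) (v : A) :
    Lprod A l x s c 0 * vac ι N v
      = if c = 0 then (l.map fun i => 1 + (s - x i)⁻¹).prod • vac ι N v else 0 := by
  rw [← projZero_mul_vac, ← mul_assoc, Lprod,
    Lprod_mul_projZero_of_true _ (fun i => s - x i) l fun _ _ => rfl]
  split_ifs
  · rw [smul_mul_assoc]
  · rw [zero_mul]

theorem Lmat_mul_projZero_of_ne (q : ι → Bool) (i : ι) (hi : q i = true) (u : K)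
    (c a : Fin (N + 1)) (hc : c ≠ 0) :
    Lmat A i u c a * projZero N A q = if c = a then projZero N A q else 0 := by
  rw [Lmat_apply, add_mul, smul_mul_assoc,
    embed_single_mul_projZero_eq_zero _ _ _ _ (by simp [hi, hc]), smul_zero, add_zero]
  split_ifs <;> simp

/-- A row `c ≠ 0` of `L` reads the label `c`, absent from the vacuum, so such rows act as rows of
the identity. -/
theorem Lprod_mul_vac_of_ne (l : List ι) (hl : l.Nodup) (x : ι → K) (s : K) (c a : Fin (N + 1))
    (hc : c ≠ 0) (v : A) :
    Lprod A l x s c a * vac ι N v = if c = a then vac ι N v else 0 := by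
  have h : Lprod A l x s c a * projZero N A (fun _ => true)
      = if c = a then projZero N A (fun _ => true) else 0 := by
    induction l with
    | nil =>
      simp only [Lprod, List.map_nil, List.prod_nil, Matrix.one_apply]
      split_ifs <;> simp
    | cons j l ih =>
      rw [List.nodup_cons] at hl
      have ih' := ih hl.2
      simp only [Lprod, List.map_cons, List.prod_cons] at ih' ⊢
      rw [Matrix.mul_apply, Finset.sum_mul, Finset.sum_eq_single c]
      · rw [Lmat_comm_list_prod j l hl.1, mul_assoc, Lmat_mul_projZero_of_ne _ j rfl _ _ _ hc,
          if_pos rfl, ih']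
      · intro d _ hd
        rw [Lmat_comm_list_prod j l hl.1, mul_assoc, Lmat_mul_projZero_of_ne _ j rfl _ _ _ hc,
          if_neg (Ne.symm hd), mul_zero]
      · simp
  rw [← projZero_mul_vac, ← mul_assoc, h]
  split_ifs <;> simp

theorem dressed_apply (w : List ι) (x : ι → K) (s : K) (T : Matrix (Fin N) (Fin N) A)
    (a b : Fin N) : dressed w x s T a b
      = ∑ c, Matrix.scalar (ι → Fin N) (T a c) * Lprod A w x s c b := rfl

/-- Dressing preserves triangularity: the term with intermediate label `0` is killed by `T`, and the
other rows of `L` are trivial on the vacuum. -/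
theorem dressed_mul_vac_eq_zero (w : List ι) (hw : w.Nodup) (x : ι → K) (s : K)
    (T : Matrix (Fin (N + 1)) (Fin (N + 1)) A) (v : A) (hT : ∀ a b, a < b → T b a * v = 0)
    (a b : Fin (N + 1)) (hab : a < b) : dressed w x s T b a * vac ι N v = 0 := by
  rw [dressed_apply, Finset.sum_mul]
  refine Finset.sum_eq_zero fun c _ => ?_
  have hb : b ≠ 0 := (Fin.pos_iff_ne_zero.1 ((Fin.zero_le a).trans_lt hab))
  by_cases hc : c = 0
  · subst hc
    rw [scalar_comm_Lprod, mul_assoc, scalar_mul_vac, hT 0 b (Fin.pos_iff_ne_zero.2 hb), vac_zero,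
      mul_zero]
  · rw [mul_assoc, Lprod_mul_vac_of_ne _ hw _ _ _ _ hc]
    split_ifs with h
    · rw [h, scalar_mul_vac, hT a b hab, vac_zero]
    · rw [mul_zero]

/-- Dressing changes only the eigenvalue of label `0`, by `∏ (1 + 1/(s - x_i))`. These products are
the source of the cross factors between neighbouring colours. -/
theorem dressed_mul_vac_self (w : List ι) (hw : w.Nodup) (x : ι → K) (s : K)
    (T : Matrix (Fin (N + 1)) (Fin (N + 1)) A) (v : A) (c : Fin (N + 1) → K)
    (hT : ∀ a b, a < b → T b a * v = 0) (hc : ∀ a, T a a * v = c a • v) (a : Fin (N + 1)) :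
    dressed w x s T a a * vac ι N v
      = ((if a = 0 then (w.map fun i => 1 + (s - x i)⁻¹).prod else 1) * c a) • vac ι N v := by
  rw [dressed_apply, Finset.sum_mul, Finset.sum_eq_single a]
  · by_cases ha : a = 0
    · subst ha
      rw [mul_assoc, Lprod_mul_vac_zero, if_pos rfl, if_pos rfl, mul_smul_comm, scalar_mul_vac, hc,
        smul_vac, smul_smul]
    · rw [mul_assoc, Lprod_mul_vac_of_ne _ hw _ _ _ _ ha, if_pos rfl, if_neg ha, scalar_mul_vac, hc,
        smul_vac, one_mul]
  · intro d _ hd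
    by_cases hd0 : d = 0
    · subst hd0
      rw [scalar_comm_Lprod, mul_assoc, scalar_mul_vac,
        hT 0 a (Fin.pos_iff_ne_zero.2 (Ne.symm hd)), vac_zero, mul_zero]
    · rw [mul_assoc, Lprod_mul_vac_of_ne _ hw _ _ _ _ hd0, if_neg hd, mul_zero]
  · simp

theorem embed_mul_vac (j : ι) (M : Matrix (Fin (N + 1)) (Fin (N + 1)) A) (v : A) (c : K)
    (hM : ∀ a, a ≠ 0 → M a 0 * v = 0) (hc : M 0 0 * v = c • v) :
    embed j M * vac ι N v = c • vac ι N v := by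
  ext α β
  by_cases hβ : β = fun _ => 0
  · subst hβ
    rw [vac, Matrix.mul_single_apply_same, Matrix.smul_apply, Matrix.single_apply, embed]
    by_cases hα : ∀ i, i ≠ j → α i = 0
    · rw [if_pos hα]
      by_cases hj : α j = 0
      · have : α = fun _ => 0 := funext fun i => by
          by_cases hi : i = j
          · rw [hi, hj]
          · exact hα i hi
        subst this
        simp [hc]
      · rw [hM _ hj, if_neg, smul_zero]
        rintro ⟨h, -⟩
        exact hj (congrFun h j).symm
    · rw [if_neg hα, zero_mul, if_neg, smul_zero]
      rintro ⟨h, -⟩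
      exact hα fun i _ => (congrFun h i).symm
  · rw [vac, Matrix.mul_single_apply_of_ne _ _ _ _ _ hβ, Matrix.smul_apply, Matrix.single_apply,
      if_neg, smul_zero]
    rintro ⟨-, h⟩
    exact hβ h.symm

theorem lineProd_mul_vac (l : List ι) (T : ι → Matrix (Fin (N + 1)) (Fin (N + 1)) A) (v : A)
    (c : ι → K) (hT : ∀ j a, a ≠ 0 → T j a 0 * v = 0) (hc : ∀ j, T j 0 0 * v = c j • v) :
    lineProd l T * vac ι N v = (l.map c).prod • vac ι N v := by
  induction l with
  | nil => simp
  | cons j l ih =>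
    rw [lineProd_cons, mul_assoc, ih, mul_smul_comm, embed_mul_vac j _ v (c j) (hT j) (hc j),
      smul_smul, List.map_cons, List.prod_cons, mul_comm]

theorem embed_comm_Lprod (j : ι) (l : List ι) (hj : j ∉ l) (x : ι → K) (s : K)
    (M : Matrix (Fin N) (Fin N) A) (a b : Fin N) :
    embed j M * Lprod A l x s a b = Lprod A l x s a b * embed j M := by
  apply comm_matrix_list_prod
  intro L hL a b
  obtain ⟨i, hi, rfl⟩ := List.mem_map.1 hL
  exact (Lmat_comm_embed (ne_of_mem_of_not_mem hi hj) _ _ _ _).symm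

/-- Passing a product of matrices of `T` through `T' * L`. -/
theorem lineProd_exchange (l : List ι) (hl : l.Nodup) (x : ι → K) (s : K) (hs : ∀ i, s - x i ≠ 0)
    (T : ι → Matrix (Fin N) (Fin N) A) (T' : Matrix (Fin N) (Fin N) A)
    (h : ∀ i, RTT (s - x i) T' (T i)) (a b : Fin N) :
    lineProd l.reverse T * (T'.map (Matrix.scalar (ι → Fin N)) * Lprod A l x s : LMat ι N A) a b
      = (Lprod A l x s * T'.map (Matrix.scalar (ι → Fin N)) : LMat ι N A) a b
        * lineProd l.reverse T := by
  induction l generalizing a b with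
  | nil => simp [Lprod]
  | cons j l ih =>
    rw [List.nodup_cons] at hl
    have e : (Lprod A (j :: l) x s : LMat ι N A) = Lmat A j (s - x j) * Lprod A l x s := by
      simp [Lprod]
    have e1 := intertwine_matrix_mul (embed_exchange (hs j) (h j) j)
      (embed_comm_Lprod (A := A) j l hl.1 x s (T j)) a b
    have e2 := intertwine_matrix_mul (r := lineProd l.reverse T)
      (X := Lmat A j (s - x j)) (X' := Lmat A j (s - x j)) (fun a b => by
        symm
        apply commute_list_prod
        intro m hm
        obtain ⟨i, hi, rfl⟩ := List.mem_map.1 hm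
        rw [List.mem_reverse] at hi
        exact Lmat_comm_embed (ne_of_mem_of_not_mem hi hl.1).symm _ _ _ _) (ih hl.2) a b
    rw [e, List.reverse_cons, lineProd_append, lineProd_cons, lineProd_nil, mul_one, mul_assoc,
      ← mul_assoc (T'.map _), e1, mul_assoc (Lmat A j _), ← mul_assoc, e2]
    simp only [mul_assoc]

theorem projAt_mul_embed_mul_succMat (j : ι) (M : Matrix (Fin (N + 1)) (Fin (N + 1)) A) :
    projAt N A j false * (embed j M * succMat ι N A)
      = succMat ι N A * embed j (M.submatrix Fin.succ Fin.succ) := by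
  ext α β
  rw [projAt, Matrix.diagonal_mul, mul_succMat_apply]
  by_cases hα : ∃ i, α i = 0
  · obtain ⟨i, hi⟩ := hα
    rw [succMat_mul_apply_eq_zero _ _ _ i hi]
    by_cases hij : i = j
    · subst hij
      simp [hi]
    · have h : ¬∀ q, q ≠ j → α q = (Fin.succ ∘ β) q := by
        intro h
        have := h i hij
        rw [hi] at this
        exact Fin.succ_ne_zero _ this.symm
      rw [embed, if_neg h, mul_zero]
  · simp only [not_exists] at hα
    obtain ⟨α', rfl⟩ : ∃ α', α = Fin.succ ∘ α' :=
      ⟨fun i => (α i).pred (hα i), funext fun i => by simp⟩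
    rw [succMat_mul_apply]
    simp [embed]

theorem projAt_comm_embed (i j : ι) (hij : i ≠ j) (b : Bool)
    (M : Matrix (Fin (N + 1)) (Fin (N + 1)) A) :
    projAt N A i b * embed j M = embed j M * projAt N A i b := by
  ext α β
  rw [projAt, Matrix.diagonal_mul, Matrix.mul_diagonal, embed]
  by_cases h : ∀ q, q ≠ j → α q = β q
  · rw [h i hij]
    split_ifs <;> simp
  · simp [h]

theorem prod_projAt_mul_lineProd_mul_succMat (l : List ι) (hl : l.Nodup)
    (T : ι → Matrix (Fin (N + 1)) (Fin (N + 1)) A) :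
    (l.map fun j => projAt N A j false).prod * (lineProd l T * succMat ι N A)
      = succMat ι N A * lineProd l fun j => (T j).submatrix Fin.succ Fin.succ := by
  induction l with
  | nil => simp
  | cons j l ih =>
    rw [List.nodup_cons] at hl
    have h1 : embed j (T j) * (l.map fun j => projAt N A j false).prod
        = (l.map fun j => projAt N A j false).prod * embed j (T j) := by
      apply commute_list_prod
      intro m hm
      obtain ⟨i, hi, rfl⟩ := List.mem_map.1 hm
      exact (projAt_comm_embed i j (ne_of_mem_of_not_mem hi hl.1) _ _).symm
    simp only [List.map_cons, List.prod_cons, lineProd_cons]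
    calc projAt N A j false * (l.map fun j => projAt N A j false).prod
          * (embed j (T j) * lineProd l T * succMat ι N A)
        = projAt N A j false * (embed j (T j) * ((l.map fun j => projAt N A j false).prod
          * (lineProd l T * succMat ι N A))) := by
          rw [← Matrix.mul_assoc (embed j (T j)), h1]
          simp only [Matrix.mul_assoc]
      _ = _ := by
          rw [ih hl.2, ← Matrix.mul_assoc (embed j (T j)), ← Matrix.mul_assoc (projAt N A j false),
            projAt_mul_embed_mul_succMat, Matrix.mul_assoc]

/-- On the factors of `l` the projection allows only nonzero row labels and `succMat` only nonzero
column labels, so nothing but the lower right block of `T` survives. -/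
theorem projZero_mul_lineProd_mul_succMat (q : ι → Bool) (l l' : List ι) (hl : l.Nodup)
    (h : ∀ j ∈ l, q j = false) (hll : ∀ j ∈ l, j ∉ l')
    (T : ι → Matrix (Fin (N + 1)) (Fin (N + 1)) A) :
    projZero N A q * lineProd l' T * (lineProd l T * succMat ι N A)
      = projZero N A q * lineProd l' T * (succMat ι N A *
        lineProd l fun j => (T j).submatrix Fin.succ Fin.succ) := by
  -- The conditions on the labels in `l` are extracted from `projZero` and passed through `lineProd
  -- l' T`, which lives in other tensor factors.
  have key : projZero N A q * lineProd l' T * (l.map fun j => projAt N A j false).prod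
      = projZero N A q * lineProd l' T := by
    clear hl
    induction l with
    | nil => simp
    | cons j l ih =>
      have h1 : projZero N A q * lineProd l' T * projAt N A j false
          = projZero N A q * lineProd l' T := by
        conv_rhs => rw [← projZero_mul_projAt q j false (h j List.mem_cons_self)]
        rw [mul_assoc, mul_assoc]
        congr 1
        symm
        apply commute_list_prod
        intro m hm
        obtain ⟨i, hi, rfl⟩ := List.mem_map.1 hm
        exact projAt_comm_embed j i (ne_of_mem_of_not_mem hi (hll j List.mem_cons_self)).symm _ _
      rw [List.map_cons, List.prod_cons, ← mul_assoc, h1]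
      exact ih (fun i hi => h i (List.mem_cons_of_mem _ hi))
        fun i hi => hll i (List.mem_cons_of_mem _ hi)
  rw [← prod_projAt_mul_lineProd_mul_succMat l hl, ← Matrix.mul_assoc, ← Matrix.mul_assoc _ _
    (lineProd l T * succMat ι N A), key]
  simp only [Matrix.mul_assoc]

end Vacuum

/-! ## Separating the tensor factors -/

section Separation

variable {ι κ κ' : Type*} [Fintype ι] [DecidableEq ι] [Fintype κ] [DecidableEq κ] [Fintype κ']
  [DecidableEq κ'] {n N : ℕ} {K A : Type*} [Field K] [Ring A] [Algebra K A]

theorem liftMat_Lmat {f : κ → ι} (hf : Function.Injective f) (i : κ) (u : K) (a b : Fin N) :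
    liftMat f (Lmat A i u a b) = Lmat A (f i) u a b := by
  rw [Lmat_apply, Lmat_apply, ← liftHom_apply (K := K) hf, map_add, map_smul, liftHom_apply,
    liftHom_apply, liftMat_embed hf]
  congr 1
  split_ifs
  · exact liftMat_one f
  · rw [← liftHom_apply (K := K) hf, map_zero]

theorem Lprod_map_liftHom {f : κ → ι} (hf : Function.Injective f) (l : List κ) (x : ι → K) (s : K) :
    (Lprod A l (x ∘ f) s : LMat κ N A).map (liftHom (K := K) hf) = Lprod A (l.map f) x s := by
  unfold Lprod
  induction l with
  | nil => simp [Matrix.map_one]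
  | cons i l ih =>
    simp only [List.map_cons, List.prod_cons]
    rw [Matrix.map_mul, ih]
    congr 1
    refine Matrix.ext fun a b => ?_
    exact liftMat_Lmat hf i _ a b

theorem dressed_map_liftHom {f : κ → ι} (hf : Function.Injective f) (l : List κ) (x : ι → K) (s : K)
    (T : Matrix (Fin N) (Fin N) A) :
    (dressed l (x ∘ f) s T).map (liftHom (K := K) hf) = dressed (l.map f) x s T := by
  unfold dressed
  rw [Matrix.map_mul, Lprod_map_liftHom hf]
  congr 1
  refine Matrix.ext fun a b => ?_
  exact liftMat_scalar _

theorem gB_dressed_map {f : κ → ι} (hf : Function.Injective f) (l : List κ) (x : ι → K)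
    (ξ : Fin n → ℕ) (z : Pos ξ → K) (T : Pos ξ → Matrix (Fin (n + 1)) (Fin (n + 1)) A) :
    gB ξ (fun p => dressed (l.map f) x (z p) (T p)) z
      = liftMat f (gB ξ (fun p => dressed l (x ∘ f) (z p) (T p)) z) := by
  rw [← liftHom_apply (K := K) hf, map_gB]
  simp only [dressed_map_liftHom hf]

/-- The operators act on complementary factors, so with column labels `0` exactly one intermediate
label contributes and the matrix elements multiply. -/
theorem liftMat_mul_liftMat_apply (e : κ ⊕ κ' ≃ ι) (B : TMat κ (N + 1) A) (B' : TMat κ' (N + 1) A)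
    (d : ι → Fin (N + 1)) :
    (liftMat (e ∘ Sum.inl) B * liftMat (e ∘ Sum.inr) B') d (fun _ => 0)
      = B (d ∘ e ∘ Sum.inl) (fun _ => 0) * B' (d ∘ e ∘ Sum.inr) (fun _ => 0) := by
  have hf : Function.Injective (e ∘ Sum.inl) := e.injective.comp Sum.inl_injective
  rw [liftMat_mul_apply hf, Finset.sum_eq_single fun _ => 0]
  · congr 1
    rw [liftMat, if_pos]
    · congr 1
      funext j
      rw [Function.comp_apply, Function.extend_apply']
      · rfl
      · rintro ⟨i, hi⟩
        exact Sum.inl_ne_inr (e.injective hi)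
    · intro r hr
      obtain ⟨i | j, rfl⟩ := e.surjective r
      · exact hf.extend_apply _ _ i
      · exact absurd ⟨j, rfl⟩ hr
  · intro δ _ hδ
    rw [liftMat, if_neg, mul_zero]
    intro h
    apply hδ
    funext i
    have := h (e (Sum.inl i)) (by
      rintro ⟨j, hj⟩
      exact Sum.inl_ne_inr (e.injective hj).symm)
    rwa [show e (Sum.inl i) = (e ∘ Sum.inl) i from rfl, hf.extend_apply] at this
  · simp

theorem mem_map_append_map (e : κ ⊕ κ' ≃ ι) {l : List κ} {l' : List κ'} (hl : ∀ i, i ∈ l)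
    (hl' : ∀ j, j ∈ l') (r : ι) : r ∈ l.map (e ∘ Sum.inl) ++ l'.map (e ∘ Sum.inr) := by
  obtain ⟨i | j, rfl⟩ := e.surjective r
  · exact List.mem_append_left _ (List.mem_map.2 ⟨i, hl i, rfl⟩)
  · exact List.mem_append_right _ (List.mem_map.2 ⟨j, hl' j, rfl⟩)

theorem nodup_map_append_map (e : κ ⊕ κ' ≃ ι) {l : List κ} {l' : List κ'} (hl : l.Nodup)
    (hl' : l'.Nodup) : (l.map (e ∘ Sum.inl) ++ l'.map (e ∘ Sum.inr)).Nodup := by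
  rw [List.nodup_append]
  refine ⟨hl.map (e.injective.comp Sum.inl_injective),
    hl'.map (e.injective.comp Sum.inr_injective), ?_⟩
  intro a ha b hb hab
  obtain ⟨i, -, rfl⟩ := List.mem_map.1 ha
  obtain ⟨j, -, rfl⟩ := List.mem_map.1 hb
  exact Sum.inl_ne_inr (e.injective hab)

/-- The projection forces the intermediate labels: `0` on the first block, and on the second, where
`T₁` is absent, the final labels. So `T₂` contributes `00` entries on the first block and creation
entries on the second, while `T₁` creates on the first. -/
theorem separated_row (e : κ ⊕ κ' ≃ ι) (q : ι → Bool) (hq : ∀ i, q (e (Sum.inl i)) = true)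
    (hq' : ∀ j, q (e (Sum.inr j)) = false) (l : List κ) (l' : List κ') (hl : l.Nodup)
    (hl' : l'.Nodup) (hlc : ∀ i, i ∈ l) (hlc' : ∀ j, j ∈ l')
    (T₁ T₂ : ι → Matrix (Fin (N + 1)) (Fin (N + 1)) A) (d : ι → Fin N) :
    (lineProd (l.map (e ∘ Sum.inl) ++ l'.map (e ∘ Sum.inr)).reverse T₂ * (projZero N A q *
      (lineProd (l.map (e ∘ Sum.inl)).reverse T₁ * succMat ι N A))
        : Matrix (ι → Fin (N + 1)) (ι → Fin N) A) (fun _ => 0) d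
      = (l'.reverse.map fun j => T₂ (e (Sum.inr j)) 0 (d (e (Sum.inr j))).succ).prod
        * (l.reverse.map fun i => T₂ (e (Sum.inl i)) 0 0).prod
        * (l.reverse.map fun i => T₁ (e (Sum.inl i)) 0 (d (e (Sum.inl i))).succ).prod := by
  have hn := nodup_map_append_map e hl hl'
  have hn1 := (List.nodup_append.1 hn).1
  set c : ι → Fin (N + 1) := Sum.elim (fun _ => 0) (fun j => (d (e (Sum.inr j))).succ) ∘ e.symm
    with hc
  have c1 : ∀ i, c (e (Sum.inl i)) = 0 := fun i => by simp [hc]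
  have c2 : ∀ j, c (e (Sum.inr j)) = (d (e (Sum.inr j))).succ := fun i => by simp [hc]
  rw [Matrix.mul_apply, Finset.sum_eq_single c]
  · rw [projZero, Matrix.diagonal_mul, if_pos, one_mul, mul_succMat_apply,
      lineProd_apply_of_complete _ (List.nodup_reverse.2 hn)
        fun r => List.mem_reverse.2 (mem_map_append_map e hlc hlc' r),
      lineProd_apply _ (List.nodup_reverse.2 hn1), if_pos]
    · simp only [List.reverse_append, List.map_append, List.prod_append, ← List.map_reverse,
        List.map_map, Function.comp_def, c1, c2]
    · intro r hr
      obtain ⟨i | j, rfl⟩ := e.surjective r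
      · exact absurd (List.mem_reverse.2 (List.mem_map.2 ⟨i, hlc i, rfl⟩)) hr
      · exact c2 j
    · intro r
      obtain ⟨i | j, rfl⟩ := e.surjective r
      · rw [c1, hq]; simp
      · rw [c2, hq']; simp
  · intro c' _ hc'
    rw [projZero, Matrix.diagonal_mul, mul_succMat_apply,
      lineProd_apply _ (List.nodup_reverse.2 hn1)]
    by_cases h1 : ∀ i, decide (c' i = 0) = q i
    · have h3 : ¬∀ r, r ∉ (l.map (e ∘ Sum.inl)).reverse → c' r = (Fin.succ ∘ d) r := ?_
      · rw [if_neg h3, mul_zero, mul_zero]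
      intro h2
      apply hc'
      funext r
      obtain ⟨i | j, rfl⟩ := e.surjective r
      · rw [c1]
        simpa [hq] using h1 (e (Sum.inl i))
      · rw [c2]
        refine h2 _ fun h => ?_
        obtain ⟨i, -, hi⟩ := List.mem_map.1 (List.mem_reverse.1 h)
        exact Sum.inl_ne_inr (e.injective hi)
    · rw [if_neg h1, zero_mul, mul_zero]
  · simp

theorem nested_eq_sum (l : List ι) (hl : l.Nodup) (hlc : ∀ i, i ∈ l)
    (T : ι → Matrix (Fin (n + 2)) (Fin (n + 2)) A) (x : ι → K) (ξ : Fin n → ℕ)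
    (T' : Pos ξ → Matrix (Fin (n + 1)) (Fin (n + 1)) A) (z : Pos ξ → K) :
    nested l T x ξ T' z = ∑ d : ι → Fin (n + 1), (l.reverse.map fun i => T i 0 (d i).succ).prod *
      gB ξ (fun p => dressed l x (z p) (T' p)) z d (fun _ => 0) := by
  rw [nested, Matrix.mul_apply]
  refine Finset.sum_congr rfl fun d _ => ?_
  rw [mul_succMat_apply, lineProd_apply_of_complete _ (List.nodup_reverse.2 hl)
    fun r => List.mem_reverse.2 (hlc r)]
  rfl

theorem comm_list_prod_map {α : Type*} (r : A) (l : List α) (f : α → A)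
    (h : ∀ a, r * f a = f a * r) : r * (l.map f).prod = (l.map f).prod * r := by
  apply commute_list_prod
  intro m hm
  obtain ⟨a, -, rfl⟩ := List.mem_map.1 hm
  exact h a

theorem comm_gB_dressed (r : A) (l : List ι) (x : ι → K) (ξ : Fin n → ℕ)
    (T : Pos ξ → Matrix (Fin (n + 1)) (Fin (n + 1)) A) (z : Pos ξ → K)
    (h : ∀ p a b, r * T p a b = T p a b * r) (d d' : ι → Fin (n + 1)) :
    r * gB ξ (fun p => dressed l x (z p) (T p)) z d d'
      = gB ξ (fun p => dressed l x (z p) (T p)) z d d' * r := by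
  have h1 := intertwine_gB ξ (Matrix.scalar (ι → Fin (n + 1)) r)
    (fun p => dressed l x (z p) (T p)) (fun p => dressed l x (z p) (T p)) z fun p a b => by
      refine intertwine_matrix_mul (fun a b => ?_) (scalar_comm_Lprod r l x (z p)) a b
      rw [Matrix.map_apply, ← map_mul, ← map_mul, h]
  have h2 := congrFun (congrFun h1 d) d'
  rwa [Matrix.scalar_apply, Matrix.diagonal_mul, Matrix.mul_diagonal] at h2

/-- The matrix element for separated tensor factors is a product of Bethe functions. -/
theorem separated_eq_nested_mul_nested (e : κ ⊕ κ' ≃ ι) (q : ι → Bool)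
    (hq : ∀ i, q (e (Sum.inl i)) = true) (hq' : ∀ j, q (e (Sum.inr j)) = false)
    (l : List κ) (l' : List κ') (hl : l.Nodup) (hl' : l'.Nodup) (hlc : ∀ i, i ∈ l)
    (hlc' : ∀ j, j ∈ l') (T₁ T₂ : ι → Matrix (Fin (n + 2)) (Fin (n + 2)) A) (x : ι → K)
    (η ζ : Fin n → ℕ) (T₁' : Pos η → Matrix (Fin (n + 1)) (Fin (n + 1)) A)
    (T₂' : Pos ζ → Matrix (Fin (n + 1)) (Fin (n + 1)) A) (y : Pos η → K) (z : Pos ζ → K) (v : A)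
    (h₁ : ∀ i j a b c d, T₂ i a b * T₁ j c d = T₁ j c d * T₂ i a b)
    (h₂ : ∀ i p a b c d, T₂ i a b * T₁' p c d = T₁' p c d * T₂ i a b)
    (c : κ → K) (hc : ∀ i d, T₂ (e (Sum.inl i)) 0 0 *
      (gB ζ (fun p => dressed l' (x ∘ e ∘ Sum.inr) (z p) (T₂' p)) z d (fun _ => 0) * v)
      = c i • (gB ζ (fun p => dressed l' (x ∘ e ∘ Sum.inr) (z p) (T₂' p)) z d (fun _ => 0) * v)) :
    ((lineProd (l.map (e ∘ Sum.inl) ++ l'.map (e ∘ Sum.inr)).reverse T₂ * (projZero (n + 1) A q *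
      (lineProd (l.map (e ∘ Sum.inl)).reverse T₁ * succMat ι (n + 1) A))
        : Matrix (ι → Fin (n + 2)) (ι → Fin (n + 1)) A) *
      (gB η (fun p => dressed (l.map (e ∘ Sum.inl)) x (y p) (T₁' p)) y *
        gB ζ (fun p => dressed (l'.map (e ∘ Sum.inr)) x (z p) (T₂' p)) z * vac ι n v)
        : Matrix (ι → Fin (n + 2)) (ι → Fin (n + 1)) A) (fun _ => 0) (fun _ => 0)
      = (l.map c).prod • (nested l (T₁ ∘ e ∘ Sum.inl) (x ∘ e ∘ Sum.inl) η T₁' y *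
        nested l' (T₂ ∘ e ∘ Sum.inr) (x ∘ e ∘ Sum.inr) ζ T₂' z * v) := by
  have hf : Function.Injective (e ∘ Sum.inl) := e.injective.comp Sum.inl_injective
  have hg : Function.Injective (e ∘ Sum.inr) := e.injective.comp Sum.inr_injective
  rw [Matrix.mul_apply, nested_eq_sum l hl hlc, nested_eq_sum l' hl' hlc']
  simp only [separated_row e q hq hq' l l' hl hl' hlc hlc' T₁ T₂, mul_vac_apply,
    gB_dressed_map hf, gB_dressed_map hg, liftMat_mul_liftMat_apply]
  set G := gB η (fun p => dressed l (x ∘ e ∘ Sum.inl) (y p) (T₁' p)) y with hG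
  set H := gB ζ (fun p => dressed l' (x ∘ e ∘ Sum.inr) (z p) (T₂' p)) z with hH
  have hGc : ∀ i a b d, T₂ i a b * G d (fun _ => 0) = G d (fun _ => 0) * T₂ i a b :=
    fun i a b d => comm_gB_dressed _ _ _ _ _ _ (fun p a' b' => h₂ i p a b a' b') _ _
  -- All entries of `T₂` commute with those of `T₁` and with `G`. Hence the `00` entries of `T₂` can
  -- be brought to `H v`, an eigenvector, and the creation entries of `T₂` to `H`, completing the
  -- second Bethe function.
  have key : ∀ (d : κ → Fin (n + 1)) (d' : κ' → Fin (n + 1)),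
      (l'.reverse.map fun j => T₂ (e (Sum.inr j)) 0 (d' j).succ).prod
        * (l.reverse.map fun i => T₂ (e (Sum.inl i)) 0 0).prod
        * (l.reverse.map fun i => T₁ (e (Sum.inl i)) 0 (d i).succ).prod
        * (G d (fun _ => 0) * H d' (fun _ => 0) * v)
      = (l.map c).prod • ((l.reverse.map fun i => T₁ (e (Sum.inl i)) 0 (d i).succ).prod
        * G d (fun _ => 0) * ((l'.reverse.map fun j => T₂ (e (Sum.inr j)) 0 (d' j).succ).prod
        * H d' (fun _ => 0)) * v) := by
    intro d d'
    set a := (l'.reverse.map fun j => T₂ (e (Sum.inr j)) 0 (d' j).succ).prod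
    set b := (l.reverse.map fun i => T₂ (e (Sum.inl i)) 0 0).prod
    set t := (l.reverse.map fun i => T₁ (e (Sum.inl i)) 0 (d i).succ).prod
    have at' : a * t = t * a := by
      refine comm_list_prod_map _ _ _ fun i => ?_
      symm
      exact comm_list_prod_map _ _ _ fun j => (h₁ _ _ _ _ _ _).symm
    have bt : b * t = t * b := by
      refine comm_list_prod_map _ _ _ fun i => ?_
      symm
      exact comm_list_prod_map _ _ _ fun j => (h₁ _ _ _ _ _ _).symm
    have aG : a * G d (fun _ => 0) = G d (fun _ => 0) * a :=
      (comm_list_prod_map _ _ _ fun j => (hGc _ _ _ _).symm).symm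
    have bG : b * G d (fun _ => 0) = G d (fun _ => 0) * b :=
      (comm_list_prod_map _ _ _ fun j => (hGc _ _ _ _).symm).symm
    have bH : b * (H d' (fun _ => 0) * v) = (l.map c).prod • (H d' (fun _ => 0) * v) := by
      have : ∀ m : List κ, (m.map fun i => T₂ (e (Sum.inl i)) 0 0).prod * (H d' (fun _ => 0) * v)
          = (m.map c).prod • (H d' (fun _ => 0) * v) := by
        intro m
        induction m with
        | nil => simp
        | cons i m ih =>
          rw [List.map_cons, List.prod_cons, mul_assoc, ih, mul_smul_comm, hc, smul_smul,
            List.map_cons, List.prod_cons, mul_comm]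
      rw [this, List.map_reverse, List.prod_reverse]
    calc a * b * t * (G d (fun _ => 0) * H d' (fun _ => 0) * v)
        = a * (b * t) * G d (fun _ => 0) * (H d' (fun _ => 0) * v) := by simp only [mul_assoc]
      _ = (a * t) * (b * G d (fun _ => 0)) * (H d' (fun _ => 0) * v) := by
          rw [bt]; simp only [mul_assoc]
      _ = t * (a * G d (fun _ => 0)) * (b * (H d' (fun _ => 0) * v)) := by
          rw [bG, at']; simp only [mul_assoc]
      _ = _ := by
          rw [bH, aG]; simp only [mul_assoc, mul_smul_comm]
  rw [← (curryEquiv (n + 1) e).sum_comp, Fintype.sum_prod_type, Finset.sum_comm,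
    Finset.sum_mul_sum, Finset.sum_mul, Finset.smul_sum]
  refine Finset.sum_congr rfl fun d _ => ?_
  rw [Finset.sum_mul, Finset.smul_sum]
  refine Finset.sum_congr rfl fun d' _ => ?_
  have E1 : ∀ i, curryEquiv (n + 1) e (d', d) (e (Sum.inl i)) = d i := fun i => by
    simp [curryEquiv]
  have E2 : ∀ j, curryEquiv (n + 1) e (d', d) (e (Sum.inr j)) = d' j := fun j => by
    simp [curryEquiv]
  have E3 : curryEquiv (n + 1) e (d', d) ∘ e ∘ Sum.inl = d := funext E1
  have E4 : curryEquiv (n + 1) e (d', d) ∘ e ∘ Sum.inr = d' := funext E2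
  simp only [E1, E2, E3, E4]
  exact key d d'

end Separation

/-! ## Splitting the variables of the first colour -/

section Splitting

variable {n N : ℕ} {K A : Type*} [Field K] [Ring A] [Algebra K A]

/-- The RTT relations for a family of matrices with parameters. -/
def RTTFamily {α : Type*} (z : α → K) (T : α → Matrix (Fin N) (Fin N) A) : Prop :=
  ∀ p q, p ≠ q → RTT (z p - z q) (T p) (T q)

theorem RTTFamily.comp {α β : Type*} {z : α → K} {T : α → Matrix (Fin N) (Fin N) A}
    (h : RTTFamily z T) {f : β → α} (hf : Function.Injective f) : RTTFamily (z ∘ f) (T ∘ f) :=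
  fun _ _ hpq => h _ _ (hf.ne hpq)

theorem scalar_map_rtt {m : Type*} [Fintype m] [DecidableEq m] {u : K}
    {M M' : Matrix (Fin N) (Fin N) A} (h : RTT u M M') :
    RTT u (M.map (Matrix.scalar m)) (M'.map (Matrix.scalar m)) := by
  intro a b c d
  have h1 := congrArg (Matrix.scalar m) (h a b c d)
  have h2 : ∀ r : A, Matrix.scalar m (u • r) = u • Matrix.scalar m r := by
    intro r
    ext α β
    rw [Matrix.smul_apply, Matrix.scalar_apply, Matrix.scalar_apply, Matrix.diagonal_apply,
      Matrix.diagonal_apply]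
    split_ifs <;> simp
  rw [h2] at h1
  simp only [map_sub, map_mul] at h1
  exact h1

theorem Lprod_rtt {ι : Type*} [Fintype ι] [DecidableEq ι] (w : List ι) (hw : w.Nodup) (x : ι → K)
    (s s' : K) (hs : ∀ i, s - x i ≠ 0) (hs' : ∀ i, s' - x i ≠ 0) :
    RTT (s - s') (Lprod A w x s : LMat ι N A) (Lprod A w x s') := by
  induction w with
  | nil =>
    intro a b c d
    simp only [Lprod, List.map_nil, List.prod_nil, Matrix.one_apply]
    split_ifs <;> simp
  | cons i w ih =>
    rw [List.nodup_cons] at hw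
    have h := Lmat_rtt (N := N) (A := A) i (hs i) (hs' i)
    rw [sub_sub_sub_cancel_right] at h
    have := h.mul (ih hw.2) (fun a b c d => Lmat_comm_list_prod i w hw.1 _ (fun i => s' - x i) _ _ _ _)
      fun a b c d => Lmat_comm_list_prod i w hw.1 _ (fun i => s - x i) _ _ _ _
    simpa only [Lprod, List.map_cons, List.prod_cons] using this

/-- Dressed families satisfy the RTT relations of the original parameters, since differences of
arguments do not see the shift by `x_i`. This makes them admissible in the induction hypothesis. -/
theorem dressed_rtt {ι : Type*} [Fintype ι] [DecidableEq ι] (w : List ι) (hw : w.Nodup) (x : ι → K)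
    {s s' : K} (hs : ∀ i, s - x i ≠ 0) (hs' : ∀ i, s' - x i ≠ 0) {M M' : Matrix (Fin N) (Fin N) A}
    (h : RTT (s - s') M M') : RTT (s - s') (dressed w x s M) (dressed w x s' M') :=
  (scalar_map_rtt h).mul (Lprod_rtt w hw x s s' hs hs') (fun _ _ _ _ => scalar_comm_Lprod _ _ _ _ _ _)
    fun _ _ _ _ => scalar_comm_Lprod _ _ _ _ _ _

/-- The product of `M` without its column `0` with `L`. -/
def rowMul {B : Type*} [Ring B] (M : Matrix (Fin (n + 2)) (Fin (n + 2)) B)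
    (L : Matrix (Fin (n + 1)) (Fin (n + 1)) B) : Matrix (Fin (n + 2)) (Fin (n + 1)) B :=
  M.submatrix id Fin.succ * L

theorem rowMul_apply {B : Type*} [Ring B] (M : Matrix (Fin (n + 2)) (Fin (n + 2)) B)
    (L : Matrix (Fin (n + 1)) (Fin (n + 1)) B) (a : Fin (n + 2)) (b : Fin (n + 1)) :
    rowMul M L a b = ∑ e, M a e.succ * L e b := rfl

theorem submatrix_mul_eq_rowMul {B : Type*} [Ring B] (M M' : Matrix (Fin (n + 2)) (Fin (n + 2)) B)
    (L : Matrix (Fin (n + 1)) (Fin (n + 1)) B) :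
    (M * M').submatrix Fin.succ Fin.succ * L = (M * rowMul M' L).submatrix Fin.succ id := by
  rw [rowMul, ← Matrix.mul_assoc]
  rfl

theorem dressed_submatrix_mul {ι : Type*} [Fintype ι] [DecidableEq ι] (w : List ι) (x : ι → K)
    (s : K) (M M' : Matrix (Fin (n + 2)) (Fin (n + 2)) A) :
    dressed w x s ((M * M').submatrix Fin.succ Fin.succ)
      = (M.map (Matrix.scalar (ι → Fin (n + 1))) *
        rowMul (M'.map (Matrix.scalar (ι → Fin (n + 1)))) (Lprod A w x s)).submatrix
          Fin.succ id := by
  have : (M * M').map (Matrix.scalar (ι → Fin (n + 1)))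
      = M.map (Matrix.scalar (ι → Fin (n + 1))) * M'.map (Matrix.scalar (ι → Fin (n + 1))) :=
    Matrix.map_mul
  rw [← submatrix_mul_eq_rowMul, dressed, ← Matrix.submatrix_map, this]

/-- With disjoint lists the `L`-matrices live in different tensor factors, and each `L` commutes
with scalar operators. This gives the commutation of the two families in the induction step. -/
theorem dressed_comm_dressed {ι : Type*} [Fintype ι] [DecidableEq ι] {w w' : List ι}
    (hw : ∀ i ∈ w, i ∉ w') (x : ι → K) (s s' : K) {M M' : Matrix (Fin N) (Fin N) A}
    (h : ∀ a b c d, M a b * M' c d = M' c d * M a b) (a b c d : Fin N) :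
    dressed w x s M a b * dressed w' x s' M' c d = dressed w' x s' M' c d * dressed w x s M a b := by
  have hL : ∀ e f g h : Fin N, Lprod A w x s e f * Lprod A w' x s' g h
      = Lprod A w' x s' g h * Lprod A w x s e f := by
    intro e f g h
    symm
    apply comm_matrix_list_prod
    intro L hL e f
    obtain ⟨i, hi, rfl⟩ := List.mem_map.1 hL
    exact (Lmat_comm_list_prod i w' (hw i hi) _ (fun i => s' - x i) _ _ _ _).symm
  refine intertwine_matrix_mul (fun c d => ?_) (fun g h => ?_) c d
  · symm
    refine intertwine_matrix_mul (fun a b => ?_) (fun e f => ?_) a b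
    · rw [Matrix.map_apply, Matrix.map_apply, ← map_mul, ← map_mul, h]
    · exact scalar_comm_Lprod _ _ _ _ _ _
  · symm
    refine intertwine_matrix_mul (fun a b => ?_) (fun e f => ?_) a b
    · exact (scalar_comm_Lprod _ _ _ _ _ _).symm
    · exact (hL _ _ _ _).symm

theorem mul_congr_of_mul_eq {l m : Type*} [Fintype l] [Fintype m] (X Y : Matrix l l A)
    (S : Matrix l m A) {G G' V : Matrix m m A} (h : G * V = G' * V) :
    X * Y * S * G * V = X * (Y * S * G') * V := by
  simp only [Matrix.mul_assoc, h]

/-- The `T`'s in the factors of `w` exchange `M'` with the part of the dressing coming from `w` and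
leave the rest untouched. The `L`-matrices of `w` thereby end up attached to `M` and those of `w'`
to `M'`. -/
theorem lineProd_mul_dressed {ι : Type*} [Fintype ι] [DecidableEq ι] (w w' : List ι)
    (hw : w.Nodup) (hww : ∀ i ∈ w, i ∉ w') (x : ι → K) (s : K) (hs : ∀ i, s - x i ≠ 0)
    (T : ι → Matrix (Fin N) (Fin N) A) (M M' : Matrix (Fin N) (Fin N) A)
    (h : ∀ i, RTT (s - x i) M' (T i)) (hM : ∀ i a b c d, M a b * T i c d = T i c d * M a b)
    (a b : Fin N) :
    lineProd w.reverse T * dressed (w ++ w') x s (M * M') a b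
      = (dressed w x s M * dressed w' x s M' : LMat ι N A) a b * lineProd w.reverse T := by
  have e1 : dressed (w ++ w') x s (M * M') = (M.map (Matrix.scalar (ι → Fin N)) *
      ((M'.map (Matrix.scalar (ι → Fin N)) * Lprod A w x s) * Lprod A w' x s) : LMat ι N A) := by
    have h1 : (M * M').map (Matrix.scalar (ι → Fin N))
      = M.map (Matrix.scalar (ι → Fin N)) * M'.map (Matrix.scalar (ι → Fin N)) := Matrix.map_mul
    have h2 : (Lprod A (w ++ w') x s : LMat ι N A) = Lprod A w x s * Lprod A w' x s := by
      simp [Lprod]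
    rw [dressed, h1, h2]
    simp only [Matrix.mul_assoc]
  have e2 : (dressed w x s M * dressed w' x s M' : LMat ι N A) = M.map (Matrix.scalar (ι → Fin N)) *
      ((Lprod A w x s * M'.map (Matrix.scalar (ι → Fin N))) * Lprod A w' x s) := by
    simp only [dressed, Matrix.mul_assoc]
  rw [e1, e2]
  refine intertwine_matrix_mul (fun a b => ?_) (intertwine_matrix_mul
    (lineProd_exchange w hw x s hs T M' h) fun a b => ?_) a b
  · symm
    apply commute_list_prod
    intro m hm
    obtain ⟨i, -, rfl⟩ := List.mem_map.1 hm
    exact scalar_comm_embed _ _ fun c d => hM i a b c d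
  · symm
    apply commute_list_prod
    intro m hm
    obtain ⟨i, hi, rfl⟩ := List.mem_map.1 hm
    exact (embed_comm_Lprod i w' (hww i (List.mem_reverse.1 hi)) x s (T i) a b).symm

/-- The expansion of a Bethe function of a product over the ways to split the variables of the
first colour. -/
theorem gB_mul_eq_sum_split (ξ : Fin (n + 1) → ℕ) (z : Pos ξ → K) (hz : Generic z)
    (T₁ T₂ : Pos ξ → Matrix (Fin (n + 2)) (Fin (n + 2)) A) (h₁ : RTTFamily z T₁)
    (h₂ : RTTFamily z T₂) (h₁₂ : ∀ p q a b c d, T₂ p a b * T₁ q c d = T₁ q c d * T₂ p a b)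
    (v : A) (hv₁ : ∀ p a b, a < b → T₁ p b a * v = 0) (hv₂ : ∀ p a b, a < b → T₂ p b a * v = 0)
    (c : Fin (ξ 0) → K) (hc : ∀ j, T₁ (headPos ξ j) 1 1 * v = c j • v) :
    gB ξ (fun p => T₂ p * T₁ p) z * v = ∑ q : Fin (ξ 0) → Bool,
      (sortScalar (z ∘ headPos ξ) q (List.finRange (ξ 0)))⁻¹ •
        ((((List.finRange (ξ 0)).filter fun j => !q j).map c).prod •
        ((lineProd ((List.finRange (ξ 0)).filter q ++
              (List.finRange (ξ 0)).filter fun j => !q j).reverse (T₂ ∘ headPos ξ) *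
            (projZero (n + 1) A q *
              (lineProd ((List.finRange (ξ 0)).filter q).reverse (T₁ ∘ headPos ξ) *
                succMat (Fin (ξ 0)) (n + 1) A))
          : Matrix (Fin (ξ 0) → Fin (n + 2)) (Fin (ξ 0) → Fin (n + 1)) A) *
          (gB (fun a => ξ a.succ) (fun p =>
            dressed ((List.finRange (ξ 0)).filter fun j => !q j) (z ∘ headPos ξ) (z (tailPos ξ p))
              ((T₂ (tailPos ξ p)).submatrix Fin.succ Fin.succ) *
            dressed ((List.finRange (ξ 0)).filter q) (z ∘ headPos ξ) (z (tailPos ξ p))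
              ((T₁ (tailPos ξ p)).submatrix Fin.succ Fin.succ)) (z ∘ tailPos ξ) *
            vac (Fin (ξ 0)) n v)
          : Matrix (Fin (ξ 0) → Fin (n + 2)) (Fin (ξ 0) → Fin (n + 1)) A)
            (fun _ => 0) (fun _ => 0)) := by
  set w := List.finRange (ξ 0) with hw
  have hwn : w.Nodup := List.nodup_finRange _
  have hwc : ∀ i, i ∈ w := List.mem_finRange
  set x := z ∘ headPos ξ with hx
  have hxg : Generic x := hz.comp (headPos_injective ξ)
  set ξ' : Fin n → ℕ := fun a => ξ a.succ with hξ'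
  set z' := z ∘ tailPos ξ with hz'
  have hzg : Generic z' := hz.comp (tailPos_injective ξ)
  have hzx : ∀ p i, z' p - x i ≠ 0 := fun p i => hz.sub_ne (headPos_ne_tailPos ξ i p).symm
  set U₁ := fun p => (T₁ (tailPos ξ p)).submatrix Fin.succ Fin.succ with hU₁
  set U₂ := fun p => (T₂ (tailPos ξ p)).submatrix Fin.succ Fin.succ with hU₂
  have h12 : RTTFamily z fun p => T₂ p * T₁ p := fun p q hpq =>
    (h₂ p q hpq).mul (h₁ p q hpq) (fun _ _ _ _ => h₁₂ _ _ _ _ _ _) fun _ _ _ _ => h₁₂ _ _ _ _ _ _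
  have hlt : ∀ a : Fin (n + 2), a ≠ 0 → 0 < a := fun a ha => Fin.pos_iff_ne_zero.2 ha
  -- the nested form, without the row `0` of the matrices of the other colours
  have e1 : gB ξ (fun p => T₂ p * T₁ p) z * v
      = ((lineProd w.reverse (T₂ ∘ headPos ξ) * (lineProd w.reverse (T₁ ∘ headPos ξ) *
          succMat (Fin (ξ 0)) (n + 1) A * gB ξ' (fun p => dressed w x (z' p) (U₂ p * U₁ p)) z') :
          Matrix (Fin (ξ 0) → Fin (n + 2)) (Fin (ξ 0) → Fin (n + 1)) A) * vac (Fin (ξ 0)) n v :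
          Matrix (Fin (ξ 0) → Fin (n + 2)) (Fin (ξ 0) → Fin (n + 1)) A)
          (fun _ => 0) (fun _ => 0) := by
    rw [gB_succ ξ _ z (fun i j hij => h12 _ _ ((headPos_injective ξ).ne hij))
      (fun p q hpq => hz.sub_ne hpq) (fun p q hpq => hz.sub_add_ne hpq), nested,
      ← mul_vac_apply]
    have e2 : lineProd w.reverse ((fun p => T₂ p * T₁ p) ∘ headPos ξ)
        = lineProd w.reverse (T₂ ∘ headPos ξ) * lineProd w.reverse (T₁ ∘ headPos ξ) :=
      lineProd_mul w.reverse (List.nodup_reverse.2 hwn) _ _ fun p q a b c d =>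
        (h₁₂ _ _ _ _ _ _)
    -- The entries of `T₂` with column `0` and nonzero row kill the vacuum, so the lower right block
    -- of `T₂ T₁` may be replaced by the product of the two blocks.
    have e3 : gB ξ' (fun p => dressed w x (z' p)
        ((T₂ (tailPos ξ p) * T₁ (tailPos ξ p)).submatrix Fin.succ Fin.succ)) z'
          * vac (Fin (ξ 0)) n v
        = gB ξ' (fun p => dressed w x (z' p) (U₂ p * U₁ p)) z' * vac (Fin (ξ 0)) n v := by
      simp only [dressed_submatrix_mul]
      rw [gB_block_mul ξ' z' hzg]
      · congr 2
        funext p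
        unfold dressed
        have : (U₂ p * U₁ p).map (Matrix.scalar (Fin (ξ 0) → Fin (n + 1)))
          = (U₂ p).map (Matrix.scalar (Fin (ξ 0) → Fin (n + 1)))
            * (U₁ p).map (Matrix.scalar (Fin (ξ 0) → Fin (n + 1))) := Matrix.map_mul
        rw [this, Matrix.mul_assoc]
        rfl
      · intro p q hpq
        exact scalar_map_rtt (h₂ _ _ ((tailPos_injective ξ).ne hpq))
      · intro p q a b c d
        rw [rowMul_apply, Finset.mul_sum, Finset.sum_mul]
        refine Finset.sum_congr rfl fun e _ => ?_
        simp only [Matrix.map_apply]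
        rw [← mul_assoc, ← map_mul, h₁₂, map_mul, mul_assoc, scalar_comm_Lprod, mul_assoc]
      · intro p a ha
        rw [Matrix.map_apply, scalar_mul_vac, hv₂ _ _ _ (hlt a ha), vac_zero]
    rw [e2]
    exact congrFun (congrFun (mul_congr_of_mul_eq _ _ _ e3) _) _
  have hcov₂ : Covariant x fun w => lineProd w.reverse (T₂ ∘ headPos ξ) :=
    covariant_lineProd (h₂.comp (headPos_injective ξ))
  have hcov₁ := covariant_nested (h₁.comp (headPos_injective ξ)) ξ' hzx fun p => U₂ p * U₁ p
  -- The resolution is inserted between `T₂` and `T₁`. Its two sorting operators give `T₂` the order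
  -- `I ++ J` and `T₁` the order `J ++ I`; after reversal the entries destined to act by eigenvalues
  -- stand to the right on both sides.
  have e4 : (lineProd w.reverse (T₂ ∘ headPos ξ) * (lineProd w.reverse (T₁ ∘ headPos ξ) *
          succMat (Fin (ξ 0)) (n + 1) A * gB ξ' (fun p => dressed w x (z' p) (U₂ p * U₁ p)) z') :
          Matrix (Fin (ξ 0) → Fin (n + 2)) (Fin (ξ 0) → Fin (n + 1)) A)
      = ∑ q : Fin (ξ 0) → Bool, (sortScalar x q w)⁻¹ • (lineProd w.reverse (T₂ ∘ headPos ξ) *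
        (sortOp (n + 2) A x q w * projZero (n + 1) A q * sortOpInv (n + 2) A x (fun i => !q i) w) *
        (lineProd w.reverse (T₁ ∘ headPos ξ) *
          succMat (Fin (ξ 0)) (n + 1) A * gB ξ' (fun p => dressed w x (z' p) (U₂ p * U₁ p)) z')) := by
    conv_lhs => rw [← Matrix.mul_one (lineProd w.reverse (T₂ ∘ headPos ξ)),
      ← resolution (N := n + 1) (A := A) hxg w hwn hwc]
    rw [Matrix.mul_sum, Matrix.sum_mul]
    refine Finset.sum_congr rfl fun q _ => ?_
    rw [Matrix.mul_smul, Matrix.smul_mul]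
  rw [e1, e4, Matrix.sum_mul, Matrix.sum_apply]
  refine Finset.sum_congr rfl fun q _ => ?_
  rw [Matrix.smul_mul, Matrix.smul_apply]
  congr 1
  have f1 := hcov₂.mul_sortOp q w [] hwn
  have f2 := hcov₁.sortOpInv_mul hxg (fun i => !q i) w hwn
  simp only [List.nil_append, Bool.not_not] at f1 f2
  set I := w.filter q with hI
  set J := w.filter fun j => !q j with hJ
  have hIJ : (I ++ J).Nodup := (filter_append_perm q w).nodup_iff.2 hwn
  have hIn : I.Nodup := hwn.filter _
  have hJn : J.Nodup := hwn.filter _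
  have hdisj : ∀ j ∈ J, j ∉ I := fun j hj hi => (List.nodup_append.1 hIJ).2.2 j hi j hj rfl
  set t := lineProd J.reverse fun j => ((T₁ ∘ headPos ξ) j).submatrix Fin.succ Fin.succ with ht
  set G := gB ξ' (fun p => dressed (J ++ I) x (z' p) (U₂ p * U₁ p)) z' with hG
  set G' := gB ξ' (fun p => dressed J x (z' p) (U₂ p) * dressed I x (z' p) (U₁ p)) z' with hG'
  -- The lower right block of `T₁` on `J` moves to the right through the whole Bethe function and
  -- splits the dressed matrices into a product of two families.
  have f3 : t * G = G' * t := by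
    refine intertwine_gB ξ' t _ _ z' fun p a b => lineProd_mul_dressed J I hJn hdisj x (z' p)
      (hzx p) _ (U₂ p) (U₁ p) (fun i => ?_) (fun i a b c d => h₁₂ _ _ _ _ _ _) a b
    exact (h₁ _ _ (headPos_ne_tailPos ξ i p).symm).submatrix Fin.succ
  -- Label `0` of the smaller rank is label `1` of the original one, so the block acts on the vacuum
  -- through the entries `T₁ 1 1`.
  have f4 : t * vac (Fin (ξ 0)) n v = (J.map c).prod • vac (Fin (ξ 0)) n v := by
    rw [ht, lineProd_mul_vac J.reverse _ v c, List.map_reverse, List.prod_reverse]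
    · intro j a ha
      exact hv₁ _ _ _ (Fin.succ_lt_succ_iff.2 (Fin.pos_iff_ne_zero.2 ha))
    · exact hc
  -- On `J` the projection and the relabelling leave of `T₁` only its lower right block.
  have f5 := projZero_mul_lineProd_mul_succMat q J.reverse I.reverse (List.nodup_reverse.2 hJn)
    (fun j hj => by simpa using (List.mem_filter.1 (List.mem_reverse.1 hj)).2)
    (fun j hj hi => hdisj j (List.mem_reverse.1 hj) (List.mem_reverse.1 hi)) (T₁ ∘ headPos ξ)
  have f6 := sortOpInv_mul_single (N := n + 1) hxg (fun i => !q i) w hwn 0 v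
  set 𝕋 := lineProd w.reverse (T₂ ∘ headPos ξ)
  set 𝕋' := lineProd (I ++ J).reverse (T₂ ∘ headPos ξ)
  set Y := projZero (n + 1) A q
  set S := succMat (Fin (ξ 0)) (n + 1) A
  rw [List.reverse_append, lineProd_append] at f2
  set F := (lineProd w.reverse (T₁ ∘ headPos ξ) * S *
    gB ξ' (fun p => dressed w x (z' p) (U₂ p * U₁ p)) z' :
    Matrix (Fin (ξ 0) → Fin (n + 2)) (Fin (ξ 0) → Fin (n + 1)) A)
  set V := vac (Fin (ξ 0)) n v
  set X := lineProd I.reverse (T₁ ∘ headPos ξ)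
  set X' := lineProd J.reverse (T₁ ∘ headPos ξ)
  have f7 : (𝕋 * (sortOp (n + 2) A x q w * Y * sortOpInv (n + 2) A x (fun i => !q i) w) * F * V :
      Matrix (Fin (ξ 0) → Fin (n + 2)) (Fin (ξ 0) → Fin (n + 1)) A)
      = sortOp (n + 2) A x q w * ((J.map c).prod • ((𝕋' * (Y * (X * S)) :
        Matrix (Fin (ξ 0) → Fin (n + 2)) (Fin (ξ 0) → Fin (n + 1)) A) * (G' * V))) := by
    calc (𝕋 * (sortOp (n + 2) A x q w * Y * sortOpInv (n + 2) A x (fun i => !q i) w) * F * V :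
          Matrix (Fin (ξ 0) → Fin (n + 2)) (Fin (ξ 0) → Fin (n + 1)) A)
        = (𝕋 * sortOp (n + 2) A x q w) * (Y * ((sortOpInv (n + 2) A x (fun i => !q i) w * F) * V)) := by
          simp only [Matrix.mul_assoc]
      _ = sortOp (n + 2) A x q w * (𝕋' * ((Y * X * (X' * S)) * (G *
            (sortOpInv (n + 1) A x (fun i => !q i) w * V)))) := by
          rw [f1, f2]
          simp only [Matrix.mul_assoc]
      _ = sortOp (n + 2) A x q w * (𝕋' * (Y * (X * (S * ((t * G) * V))))) := by
          rw [f5, show sortOpInv (n + 1) A x (fun i => !q i) w * V = V from f6]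
          simp only [Matrix.mul_assoc]
          rfl
      _ = _ := by
          rw [f3, Matrix.mul_assoc G', f4]
          simp only [Matrix.mul_assoc, Matrix.mul_smul]
  -- All row labels on the left are `0`, so the remaining sorting operator acts trivially.
  rw [f7, sortOp_mul_apply hxg q w hwn, Matrix.smul_apply]
  rfl

end Splitting

/-! ## One term of the expansion -/

section Term

variable {n : ℕ} {K A : Type*} [Field K] [Ring A] [Algebra K A]

theorem gB_of_isEmpty (ξ : Fin 0 → ℕ) (T : Pos ξ → Matrix (Fin 1) (Fin 1) A) (z : Pos ξ → K) :
    gB ξ T z = 1 := by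
  have : Subsingleton (Pos ξ → Fin 1) := inferInstance
  have h : positions ξ = [] := rfl
  rw [gB, gHat, gPre, h]
  have h' : (fun p : Pos ξ => p.1.castSucc) = fun p => p.1.succ := Subsingleton.elim _ _
  simp [lexPairs, Matrix.trace, h']

/-- A matrix entry of the first row acts on the vector generated by a block. -/
theorem mul_gB_dressed_apply {ι : Type*} [Fintype ι] [DecidableEq ι] (w : List ι) (x : ι → K)
    (ζ : Fin n → ℕ) (z : Pos ζ → K) (hz : Generic z)
    (T : Pos ζ → Matrix (Fin (n + 2)) (Fin (n + 2)) A) (hT : RTTFamily z T) (s : K)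
    (hs : ∀ p, z p - s ≠ 0) (M : Matrix (Fin (n + 2)) (Fin (n + 2)) A)
    (hM : ∀ p, RTT (z p - s) (T p) M) (v : A) (hv : ∀ p a, a ≠ 0 → T p a 0 * v = 0)
    (hMv : ∀ a, a ≠ 0 → M a 0 * v = 0) (c : K) (hc : M 0 0 * v = c • v) (d : ι → Fin (n + 1)) :
    M 0 0 * (gB ζ (fun p => dressed w x (z p) ((T p).submatrix Fin.succ Fin.succ)) z d
        (fun _ => 0) * v)
      = c • (gB ζ (fun p => dressed w x (z p) ((T p).submatrix Fin.succ Fin.succ)) z d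
        (fun _ => 0) * v) := by
  have h := mul_gB_block ζ z hz (fun p => (T p).map (Matrix.scalar (ι → Fin (n + 1))))
    (fun p => Lprod A w x (z p)) (fun p q hpq => scalar_map_rtt (hT p q hpq))
    (fun p q a b c d => scalar_comm_Lprod _ _ _ _ _ _) (M.map (Matrix.scalar (ι → Fin (n + 1))))
    (fun p => z p - s) hs (fun p => scalar_map_rtt (hM p))
    (fun q a b c d => scalar_comm_Lprod _ _ _ _ _ _) (vac ι n v)
    (fun p a ha => by rw [Matrix.map_apply, scalar_mul_vac, hv p a ha, vac_zero])
    (fun a ha => by rw [Matrix.map_apply, scalar_mul_vac, hMv a ha, vac_zero]) c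
    (by rw [Matrix.map_apply, scalar_mul_vac, hc, smul_vac])
  have h' := congrFun (congrFun h d) (fun _ => 0)
  rw [Matrix.map_apply, Matrix.scalar_apply, Matrix.diagonal_mul, Matrix.smul_apply,
    mul_vac_apply] at h'
  exact h'

theorem exists_list_map_eq {α β : Type*} (f : α → β) {l : List β} (h : ∀ b ∈ l, b ∈ Set.range f) :
    ∃ l' : List α, l'.map f = l := by
  have : l ∈ Set.range (List.map f) := by
    rw [Set.range_list_map]
    exact h
  exact this

/-- Once the factors of `I` and `J` decouple, each group is the nested form of a Bethe function;
`gB_succ` read backwards identifies it. The index sets are those of `η` and `ζ`, embedded compatibly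
into that of `ξ`. -/
theorem separated_eq_gB_mul_gB (ξ η ζ : Fin (n + 1) → ℕ) (e : Fin (η 0) ⊕ Fin (ζ 0) ≃ Fin (ξ 0))
    (q : Fin (ξ 0) → Bool) (hq : ∀ i, q (e (Sum.inl i)) = true)
    (hq' : ∀ j, q (e (Sum.inr j)) = false) (F : Pos η → Pos ξ) (hF : Function.Injective F)
    (f : (Pos fun a => η a.succ) → Pos fun a => ξ a.succ)
    (hF0 : ∀ i, F (headPos η i) = headPos ξ (e (Sum.inl i)))
    (hF1 : ∀ p, F (tailPos η p) = tailPos ξ (f p)) (G : Pos ζ → Pos ξ) (hG : Function.Injective G)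
    (g : (Pos fun a => ζ a.succ) → Pos fun a => ξ a.succ)
    (hG0 : ∀ i, G (headPos ζ i) = headPos ξ (e (Sum.inr i)))
    (hG1 : ∀ p, G (tailPos ζ p) = tailPos ξ (g p))
    (z : Pos ξ → K) (hz : Generic z) (T₁ T₂ : Pos ξ → Matrix (Fin (n + 2)) (Fin (n + 2)) A)
    (h₁ : RTTFamily z T₁) (h₂ : RTTFamily z T₂)
    (h₁₂ : ∀ p q a b c d, T₂ p a b * T₁ q c d = T₁ q c d * T₂ p a b)
    (v : A) (hv₂ : ∀ p a b, a < b → T₂ p b a * v = 0) (c : Fin (ξ 0) → K)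
    (hc : ∀ j, T₂ (headPos ξ j) 0 0 * v = c j • v) :
    ((lineProd ((List.finRange (ξ 0)).filter q ++
              (List.finRange (ξ 0)).filter fun j => !q j).reverse (T₂ ∘ headPos ξ) *
            (projZero (n + 1) A q *
              (lineProd ((List.finRange (ξ 0)).filter q).reverse (T₁ ∘ headPos ξ) *
                succMat (Fin (ξ 0)) (n + 1) A))
          : Matrix (Fin (ξ 0) → Fin (n + 2)) (Fin (ξ 0) → Fin (n + 1)) A) *
          (gB (fun a => η a.succ) (fun p =>
            dressed ((List.finRange (ξ 0)).filter q) (z ∘ headPos ξ) (z (tailPos ξ (f p)))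
              ((T₁ (tailPos ξ (f p))).submatrix Fin.succ Fin.succ)) (fun p => z (tailPos ξ (f p))) *
          gB (fun a => ζ a.succ) (fun p =>
            dressed ((List.finRange (ξ 0)).filter fun j => !q j) (z ∘ headPos ξ)
              (z (tailPos ξ (g p)))
              ((T₂ (tailPos ξ (g p))).submatrix Fin.succ Fin.succ)) (fun p => z (tailPos ξ (g p))) *
            vac (Fin (ξ 0)) n v)
          : Matrix (Fin (ξ 0) → Fin (n + 2)) (Fin (ξ 0) → Fin (n + 1)) A)
            (fun _ => 0) (fun _ => 0)
      = (∏ i, c (e (Sum.inl i))) • (gB η (T₁ ∘ F) (z ∘ F) * gB ζ (T₂ ∘ G) (z ∘ G) * v) := by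
  have hcov : ∀ j, (∃ i, e (Sum.inl i) = j) ∨ ∃ i, e (Sum.inr i) = j := by
    intro j
    rcases h : e.symm j with i | i
    · exact Or.inl ⟨i, by rw [← h, e.apply_symm_apply]⟩
    · exact Or.inr ⟨i, by rw [← h, e.apply_symm_apply]⟩
  -- `l` enumerates the block in the order of the large list. It is a permutation of `List.finRange
  -- (η 0)` and not that list itself, so the symmetry `nested_eq_of_perm` is needed below.
  obtain ⟨l, hl⟩ := exists_list_map_eq (e ∘ Sum.inl) (l := (List.finRange (ξ 0)).filter q) (by
    intro j hj
    rcases hcov j with ⟨i, rfl⟩ | ⟨i, rfl⟩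
    · exact ⟨i, rfl⟩
    · rw [List.mem_filter, hq'] at hj
      exact absurd hj.2 (by simp))
  obtain ⟨l', hl'⟩ := exists_list_map_eq (e ∘ Sum.inr)
    (l := (List.finRange (ξ 0)).filter fun j => !q j) (by
    intro j hj
    rcases hcov j with ⟨i, rfl⟩ | ⟨i, rfl⟩
    · rw [List.mem_filter, hq] at hj
      exact absurd hj.2 (by simp)
    · exact ⟨i, rfl⟩)
  have hinl : Function.Injective (e ∘ Sum.inl) := e.injective.comp Sum.inl_injective
  have hinr : Function.Injective (e ∘ Sum.inr) := e.injective.comp Sum.inr_injective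
  have hln : l.Nodup := by
    refine List.Nodup.of_map (e ∘ Sum.inl) ?_
    rw [hl]
    exact (List.nodup_finRange _).filter _
  have hln' : l'.Nodup := by
    refine List.Nodup.of_map (e ∘ Sum.inr) ?_
    rw [hl']
    exact (List.nodup_finRange _).filter _
  have hlc : ∀ i, i ∈ l := by
    intro i
    rw [← List.mem_map_of_injective hinl, hl, List.mem_filter]
    exact ⟨List.mem_finRange _, hq i⟩
  have hlc' : ∀ i, i ∈ l' := by
    intro i
    rw [← List.mem_map_of_injective hinr, hl', List.mem_filter]
    exact ⟨List.mem_finRange _, by simp [hq']⟩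
  have hperm : l.Perm (List.finRange (η 0)) :=
    (List.perm_ext_iff_of_nodup hln (List.nodup_finRange _)).2 fun i => by simp [hlc]
  have hperm' : l'.Perm (List.finRange (ζ 0)) :=
    (List.perm_ext_iff_of_nodup hln' (List.nodup_finRange _)).2 fun i => by simp [hlc']
  have hg : Function.Injective g := by
    intro p p' h
    apply tailPos_injective ζ
    apply hG
    rw [hG1, hG1, h]
  have hf : Function.Injective f := by
    intro p p' h
    apply tailPos_injective η
    apply hF
    rw [hF1, hF1, h]
  rw [← hl, ← hl', separated_eq_nested_mul_nested e q hq hq' l l' hln hln' hlc hlc'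
    (T₁ ∘ headPos ξ) (T₂ ∘ headPos ξ) (z ∘ headPos ξ) (fun a => η a.succ) (fun a => ζ a.succ)
    (fun p => (T₁ (tailPos ξ (f p))).submatrix Fin.succ Fin.succ)
    (fun p => (T₂ (tailPos ξ (g p))).submatrix Fin.succ Fin.succ)
    (fun p => z (tailPos ξ (f p))) (fun p => z (tailPos ξ (g p))) v
    (fun _ _ _ _ _ _ => h₁₂ _ _ _ _ _ _) (fun _ _ _ _ _ _ => h₁₂ _ _ _ _ _ _)
    (fun i => c (e (Sum.inl i)))]
  · have e1 : gB η (T₁ ∘ F) (z ∘ F)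
        = nested l ((T₁ ∘ headPos ξ) ∘ e ∘ Sum.inl) ((z ∘ headPos ξ) ∘ e ∘ Sum.inl)
          (fun a => η a.succ) (fun p => (T₁ (tailPos ξ (f p))).submatrix Fin.succ Fin.succ)
          fun p => z (tailPos ξ (f p)) := by
      rw [gB_succ η (T₁ ∘ F) (z ∘ F)
        (fun i j hij => h₁ _ _ (hF.ne ((headPos_injective η).ne hij)))
        (fun p q hpq => hz.sub_ne (hF.ne hpq)) (fun p q hpq => hz.sub_add_ne (hF.ne hpq))]
      have a1 : (T₁ ∘ F) ∘ headPos η = (T₁ ∘ headPos ξ) ∘ e ∘ Sum.inl :=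
        funext fun i => congrArg T₁ (hF0 i)
      have a2 : (z ∘ F) ∘ headPos η = (z ∘ headPos ξ) ∘ e ∘ Sum.inl :=
        funext fun i => congrArg z (hF0 i)
      have a3 : (z ∘ F) ∘ tailPos η = fun p => z (tailPos ξ (f p)) :=
        funext fun i => congrArg z (hF1 i)
      have a4 : (fun y => ((T₁ ∘ F) (tailPos η y)).submatrix Fin.succ Fin.succ)
          = fun p => (T₁ (tailPos ξ (f p))).submatrix Fin.succ Fin.succ :=
        funext fun i => congrArg (fun y => (T₁ y).submatrix Fin.succ Fin.succ) (hF1 i)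
      rw [a1, a2, a3, a4]
      exact (nested_eq_of_perm (hz.comp ((headPos_injective ξ).comp hinl))
        (fun i j hij => h₁ _ _ ((headPos_injective ξ).ne (hinl.ne hij))) _
        (fun p i => hz.sub_ne (headPos_ne_tailPos ξ _ _).symm) _ hperm hln).symm
    have e2 : gB ζ (T₂ ∘ G) (z ∘ G)
        = nested l' ((T₂ ∘ headPos ξ) ∘ e ∘ Sum.inr) ((z ∘ headPos ξ) ∘ e ∘ Sum.inr)
          (fun a => ζ a.succ) (fun p => (T₂ (tailPos ξ (g p))).submatrix Fin.succ Fin.succ)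
          fun p => z (tailPos ξ (g p)) := by
      rw [gB_succ ζ (T₂ ∘ G) (z ∘ G)
        (fun i j hij => h₂ _ _ (hG.ne ((headPos_injective ζ).ne hij)))
        (fun p q hpq => hz.sub_ne (hG.ne hpq)) (fun p q hpq => hz.sub_add_ne (hG.ne hpq))]
      have a1 : (T₂ ∘ G) ∘ headPos ζ = (T₂ ∘ headPos ξ) ∘ e ∘ Sum.inr :=
        funext fun i => congrArg T₂ (hG0 i)
      have a2 : (z ∘ G) ∘ headPos ζ = (z ∘ headPos ξ) ∘ e ∘ Sum.inr :=
        funext fun i => congrArg z (hG0 i)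
      have a3 : (z ∘ G) ∘ tailPos ζ = fun p => z (tailPos ξ (g p)) :=
        funext fun i => congrArg z (hG1 i)
      have a4 : (fun y => ((T₂ ∘ G) (tailPos ζ y)).submatrix Fin.succ Fin.succ)
          = fun p => (T₂ (tailPos ξ (g p))).submatrix Fin.succ Fin.succ :=
        funext fun i => congrArg (fun y => (T₂ y).submatrix Fin.succ Fin.succ) (hG1 i)
      rw [a1, a2, a3, a4]
      exact (nested_eq_of_perm (hz.comp ((headPos_injective ξ).comp hinr))
        (fun i j hij => h₂ _ _ ((headPos_injective ξ).ne (hinr.ne hij))) _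
        (fun p i => hz.sub_ne (headPos_ne_tailPos ξ _ _).symm) _ hperm' hln').symm
    rw [e1, e2, (hperm.map _).prod_eq, ← List.ofFn_eq_map, List.prod_ofFn]
  · intro i d
    exact mul_gB_dressed_apply l' _ (fun a => ζ a.succ) (fun p => z (tailPos ξ (g p)))
      (hz.comp ((tailPos_injective ξ).comp hg)) (fun p => T₂ (tailPos ξ (g p)))
      (fun p q hpq => h₂ _ _ ((tailPos_injective ξ).ne (hg.ne hpq)))
      (z (headPos ξ (e (Sum.inl i)))) (fun p => hz.sub_ne (headPos_ne_tailPos ξ _ _).symm)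
      _ (fun p => h₂ _ _ (headPos_ne_tailPos ξ _ _).symm) v
      (fun p a ha => hv₂ _ _ _ (Fin.pos_iff_ne_zero.2 ha))
      (fun a ha => hv₂ _ _ _ (Fin.pos_iff_ne_zero.2 ha)) _ (hc _) d

end Term

/-! ## Sums over permutations of the weight `W` -/

section Combinatorics

variable {K : Type*} [Field K]

/-- The difference of `∏ (X - x_j - 1)` and `∏ (X - x_j)` has degree below `m` and coefficient `-m`
at `X^{m-1}`. Lagrange interpolation at the points `x_i` computes that coefficient as minus the sum
in question. -/
theorem sum_prod_erase_eq_card {α : Type*} [Fintype α] [DecidableEq α] (x : α → K)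
    (hx : Function.Injective x) :
    ∑ i, ∏ j ∈ Finset.univ.erase i, (x i - x j - 1) / (x i - x j) = (Fintype.card α : K) := by
  classical
  rcases isEmpty_or_nonempty α with h | h
  · simp
  have hcard : 0 < (Finset.univ : Finset α).card := Finset.card_pos.2 Finset.univ_nonempty
  let P : Polynomial K := ∏ j, (Polynomial.X - Polynomial.C (x j + 1))
  let R : Polynomial K := ∏ j, (Polynomial.X - Polynomial.C (x j))
  have hPm : P.Monic := Polynomial.monic_prod_of_monic _ _ fun j _ => Polynomial.monic_X_sub_C _
  have hRm : R.Monic := Polynomial.monic_prod_of_monic _ _ fun j _ => Polynomial.monic_X_sub_C _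
  have hPd : P.degree = (Finset.univ : Finset α).card := by
    simp only [P, Polynomial.degree_prod, Polynomial.degree_X_sub_C]
    simp
  have hRd : R.degree = (Finset.univ : Finset α).card := by
    simp only [R, Polynomial.degree_prod, Polynomial.degree_X_sub_C]
    simp
  have hdeg : (P - R).degree < ((Finset.univ : Finset α).card : WithBot ℕ) := by
    rw [← hPd]
    exact Polynomial.degree_sub_lt_left (hPd.trans hRd.symm) hPm.ne_zero
      (hPm.leadingCoeff.trans hRm.leadingCoeff.symm)
  have h1 := Lagrange.coeff_eq_sum (s := Finset.univ) (v := x) hx.injOn hdeg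
  rw [Polynomial.coeff_sub, Polynomial.prod_X_sub_C_coeff_card_pred _ _ hcard,
    Polynomial.prod_X_sub_C_coeff_card_pred _ _ hcard] at h1
  have h2 : ∀ i, (P - R).eval (x i) / ∏ j ∈ Finset.univ.erase i, (x i - x j)
      = - ∏ j ∈ Finset.univ.erase i, (x i - x j - 1) / (x i - x j) := by
    intro i
    have hP : P.eval (x i) = - ∏ j ∈ Finset.univ.erase i, (x i - x j - 1) := by
      simp only [P, Polynomial.eval_prod]
      rw [← Finset.mul_prod_erase _ _ (Finset.mem_univ i)]
      simp [sub_add_eq_sub_sub]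
    have hR : R.eval (x i) = 0 := by
      simp only [R, Polynomial.eval_prod]
      exact Finset.prod_eq_zero (Finset.mem_univ i) (by simp)
    rw [Polynomial.eval_sub, hP, hR, sub_zero, neg_div, Finset.prod_div_distrib]
  simp only [h2, Finset.sum_neg_distrib, Finset.sum_add_distrib] at h1
  simp only [Finset.sum_const, Finset.card_univ, nsmul_eq_mul, mul_one] at h1
  linear_combination h1

theorem prod_swap_succ {m : ℕ} {M : Type*} [CommMonoid M] (p : Fin (m + 1)) (f : Fin (m + 1) → M) :
    ∏ j : Fin m, f (Equiv.swap 0 p j.succ) = ∏ j ∈ Finset.univ.erase p, f j := by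
  classical
  have h1 : ∏ j : Fin m, f (Equiv.swap 0 p j.succ)
      = ∏ j : Fin (m + 1), if Equiv.swap 0 p j = p then 1 else f (Equiv.swap 0 p j) := by
    rw [Fin.prod_univ_succ, Equiv.swap_apply_left, if_pos rfl, one_mul]
    refine Finset.prod_congr rfl fun j _ => ?_
    rw [if_neg]
    intro h
    rw [← Equiv.swap_apply_left 0 p] at h
    exact Fin.succ_ne_zero j ((Equiv.injective _ h))
  rw [h1, Equiv.prod_comp (Equiv.swap 0 p) fun j => if j = p then 1 else f j,
    ← Finset.mul_prod_erase _ _ (Finset.mem_univ p), if_pos rfl, one_mul]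
  refine Finset.prod_congr rfl fun j hj => ?_
  rw [if_neg (Finset.ne_of_mem_erase hj)]

theorem W_succ (m : ℕ) (x : Fin (m + 1) → K) :
    W (m + 1) x = (∏ j : Fin m, (x 0 - x j.succ - 1) / (x 0 - x j.succ)) * W m (x ∘ Fin.succ) := by
  unfold W
  rw [Fin.prod_univ_succ]
  congr 1
  · rw [Finset.prod_filter, Fin.prod_univ_succ]
    simp
  · refine Finset.prod_congr rfl fun i _ => ?_
    rw [Finset.prod_filter, Finset.prod_filter, Fin.prod_univ_succ]
    simp

/-- Permutations are grouped by the image `p` of `0`. The factors involving it separate, the rest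
sums to `m!` by induction, and `sum_prod_erase_eq_card` supplies the factor `m + 1`. -/
theorem sum_perm_W (m : ℕ) (x : Fin m → K) (hx : Function.Injective x) :
    ∑ σ : Equiv.Perm (Fin m), W m (x ∘ σ) = (m ! : K) := by
  induction m with
  | zero => simp [W]
  | succ m ih =>
    rw [← Equiv.sum_comp Equiv.Perm.decomposeFin.symm, Fintype.sum_prod_type]
    have h : ∀ (p : Fin (m + 1)) (e : Equiv.Perm (Fin m)),
        W (m + 1) (x ∘ Equiv.Perm.decomposeFin.symm (p, e))
        = (∏ j ∈ Finset.univ.erase p, (x p - x j - 1) / (x p - x j))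
          * W m ((x ∘ Equiv.swap 0 p ∘ Fin.succ) ∘ e) := by
      intro p e
      rw [W_succ, ← prod_swap_succ p fun j => (x p - x j - 1) / (x p - x j)]
      congr 1
      · conv_rhs => rw [← Equiv.prod_comp e]
        refine Finset.prod_congr rfl fun j _ => ?_
        simp [Equiv.Perm.decomposeFin_symm_apply_succ, Equiv.Perm.decomposeFin_symm_apply_zero]
      · congr 1
        funext j
        simp [Equiv.Perm.decomposeFin_symm_apply_succ]
    simp only [h, ← Finset.mul_sum]
    have h' : ∀ p : Fin (m + 1), ∑ e : Equiv.Perm (Fin m), W m ((x ∘ Equiv.swap 0 p ∘ Fin.succ) ∘ e)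
        = (m ! : K) := fun p =>
      ih _ (hx.comp ((Equiv.injective _).comp (Fin.succ_injective m)))
    simp only [h', ← Finset.sum_mul]
    rw [sum_prod_erase_eq_card x hx, Fintype.card_fin, Nat.factorial_succ]
    push_cast
    ring

theorem W_add (k k' : ℕ) (y : Fin (k + k') → K) :
    W (k + k') y = W k (y ∘ Fin.castAdd k') * W k' (y ∘ Fin.natAdd k)
      * ∏ i : Fin k, ∏ j : Fin k', (y (Fin.castAdd k' i) - y (Fin.natAdd k j) - 1)
        / (y (Fin.castAdd k' i) - y (Fin.natAdd k j)) := by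
  have h1 : ∀ (i : Fin k) (j : Fin k'), Fin.castAdd k' i < Fin.natAdd k j := by
    intro i j
    simp only [Fin.lt_def, Fin.val_castAdd, Fin.val_natAdd]
    omega
  have h2 : ∀ (i : Fin k) (j : Fin k'), ¬ Fin.natAdd k j < Fin.castAdd k' i :=
    fun i j => (h1 i j).asymm
  have h3 : ∀ i i' : Fin k, Fin.castAdd k' i < Fin.castAdd k' i' ↔ i < i' := by
    intro i i'
    rw [Fin.lt_def, Fin.lt_def, Fin.val_castAdd, Fin.val_castAdd]
  have h4 : ∀ j j' : Fin k', Fin.natAdd k j < Fin.natAdd k j' ↔ j < j' := by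
    intro i i'
    rw [Fin.lt_def, Fin.lt_def, Fin.val_natAdd, Fin.val_natAdd, Nat.add_lt_add_iff_left]
  simp only [W, Finset.prod_filter, Fin.prod_univ_add, h1, h2, h3, h4, if_true, if_false,
    Finset.prod_const_one, one_mul, Finset.prod_mul_distrib, Function.comp_apply]
  ring

/-- The permutations of a block and of its complement. -/
def blockPerm {k k' : ℕ} (a : Equiv.Perm (Fin k)) (b : Equiv.Perm (Fin k')) :
    Equiv.Perm (Fin (k + k')) :=
  (finSumFinEquiv.symm.trans (Equiv.sumCongr a b)).trans finSumFinEquiv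

theorem blockPerm_castAdd {k k' : ℕ} (a : Equiv.Perm (Fin k)) (b : Equiv.Perm (Fin k'))
    (i : Fin k) : blockPerm a b (Fin.castAdd k' i) = Fin.castAdd k' (a i) := by
  simp [blockPerm]

theorem blockPerm_natAdd {k k' : ℕ} (a : Equiv.Perm (Fin k)) (b : Equiv.Perm (Fin k'))
    (i : Fin k') : blockPerm a b (Fin.natAdd k i) = Fin.natAdd k (b i) := by
  simp [blockPerm]

/-- The mixed factors of `W` are unchanged by permutations within the blocks, and `sum_perm_W` sums
the remaining factors block by block. -/
theorem sum_blockPerm_W (k k' : ℕ) (y : Fin (k + k') → K) (hy : Function.Injective y) :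
    ∑ a : Equiv.Perm (Fin k), ∑ b : Equiv.Perm (Fin k'), W (k + k') (y ∘ blockPerm a b)
      = (k ! * k' ! : K) * ∏ i : Fin k, ∏ j : Fin k',
        (y (Fin.castAdd k' i) - y (Fin.natAdd k j) - 1)
        / (y (Fin.castAdd k' i) - y (Fin.natAdd k j)) := by
  have h : ∀ (a : Equiv.Perm (Fin k)) (b : Equiv.Perm (Fin k')), W (k + k') (y ∘ blockPerm a b)
      = W k ((y ∘ Fin.castAdd k') ∘ a) * W k' ((y ∘ Fin.natAdd k) ∘ b)
      * ∏ i : Fin k, ∏ j : Fin k', (y (Fin.castAdd k' i) - y (Fin.natAdd k j) - 1)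
        / (y (Fin.castAdd k' i) - y (Fin.natAdd k j)) := by
    intro a b
    rw [W_add]
    congr 1
    · congr 2
      · funext i
        simp [blockPerm_castAdd]
      · funext i
        simp [blockPerm_natAdd]
    · conv_rhs => rw [← Equiv.prod_comp a]
      refine Finset.prod_congr rfl fun i _ => ?_
      conv_rhs => rw [← Equiv.prod_comp b]
      simp only [Function.comp_apply, blockPerm_castAdd, blockPerm_natAdd]
  simp only [h, ← Finset.sum_mul, ← Finset.mul_sum]
  rw [sum_perm_W k _ (hy.comp (Fin.castAdd_injective _ _)),
    sum_perm_W k' _ (hy.comp (Fin.natAdd_injective _ _))]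

/-- The image of the first `k` elements under `σ`. -/
def imageOf {m : ℕ} (k : ℕ) (σ : Equiv.Perm (Fin m)) : Fin m → Bool :=
  fun i => decide ((σ.symm i : ℕ) < k)

theorem imageOf_apply {m : ℕ} (k : ℕ) (σ : Equiv.Perm (Fin m)) (i : Fin m) :
    imageOf k σ (σ i) = decide ((i : ℕ) < k) := by
  simp [imageOf]

theorem imageOf_eq_iff {m : ℕ} (k : ℕ) (σ : Equiv.Perm (Fin m)) (q : Fin m → Bool) :
    imageOf k σ = q ↔ q ∘ σ = fun i : Fin m => decide ((i : ℕ) < k) := by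
  constructor
  · rintro rfl
    funext i
    simp [imageOf]
  · intro h
    funext i
    have := congrFun h (σ.symm i)
    simpa [imageOf] using this.symm

theorem card_subtype_val_lt {m k : ℕ} (h : k ≤ m) :
    Fintype.card {i : Fin m // decide ((i : ℕ) < k) = true} = k := by
  rw [Fintype.card_subtype]
  simp only [decide_eq_true_eq]
  obtain ⟨k', rfl⟩ := Nat.exists_eq_add_of_le h
  rw [Finset.card_filter, Fin.sum_univ_add]
  simp

/-- If the cardinalities match, these permutations form one coset of the stabilizer of `q`, which is
a product of two symmetric groups. -/
theorem card_imageOf_eq {m k : ℕ} (h : k ≤ m) (q : Fin m → Bool) :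
    (Finset.univ.filter fun σ : Equiv.Perm (Fin m) => imageOf k σ = q).card
      = if Fintype.card {i // q i = true} = k then k ! * (m - k)! else 0 := by
  classical
  split_ifs with hk
  · have hq : Fintype.card {i // q i = false} = m - k := by
      have h1 := Fintype.card_subtype_compl fun i => q i = true
      simp only [Bool.not_eq_true, hk, Fintype.card_fin] at h1
      exact h1
    let e : {i : Fin m // decide ((i : ℕ) < k) = true} ≃ {i // q i = true} :=
      Fintype.equivOfCardEq (by rw [card_subtype_val_lt h, hk])
    let σ₀ := e.extendSubtype
    have hσ₀ : q ∘ σ₀ = fun i : Fin m => decide ((i : ℕ) < k) := by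
      funext i
      by_cases hi : decide ((i : ℕ) < k) = true
      · rw [hi]
        exact e.extendSubtype_mem i hi
      · have := e.extendSubtype_not_mem i hi
        rw [Bool.not_eq_true] at hi this
        rw [hi]
        exact this
    have h2 := DomMulAct.stabilizer_card q
    rw [Fintype.prod_bool, hk, hq] at h2
    rw [← h2, ← Fintype.card_subtype]
    refine Fintype.card_congr (Equiv.subtypeEquiv (Equiv.mulRight σ₀⁻¹) fun σ => ?_)
    rw [imageOf_eq_iff, ← hσ₀]
    constructor
    · intro h
      funext i
      have := congrFun h (σ₀⁻¹ i)
      simpa using this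
    · intro h
      funext i
      have := congrFun h (σ₀ i)
      simpa using this
  · rw [Finset.card_eq_zero, Finset.filter_eq_empty_iff]
    rintro σ - rfl
    refine hk (Eq.trans ?_ (card_subtype_val_lt h))
    exact Fintype.card_congr (σ.symm.subtypeEquiv fun i => by simp [imageOf])

/-- The factor `∏ (x_i - x_j - 1) / (x_i - x_j)` over `i` in the block and `j` outside. -/
def blockFactor {m : ℕ} (x : Fin m → K) (q : Fin m → Bool) : K :=
  ∏ i ∈ Finset.univ.filter fun i => q i = true, ∏ j ∈ Finset.univ.filter fun j => q j = false,
    (x i - x j - 1) / (x i - x j)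

theorem blockFactor_imageOf {k k' : ℕ} (x : Fin (k + k') → K) (σ : Equiv.Perm (Fin (k + k'))) :
    blockFactor x (imageOf k σ) = ∏ i : Fin k, ∏ j : Fin k',
      (x (σ (Fin.castAdd k' i)) - x (σ (Fin.natAdd k j)) - 1)
        / (x (σ (Fin.castAdd k' i)) - x (σ (Fin.natAdd k j))) := by
  unfold blockFactor
  rw [Finset.prod_filter, ← Equiv.prod_comp σ, Fin.prod_univ_add]
  simp only [imageOf_apply, Fin.val_castAdd, Fin.val_natAdd, Fin.is_lt, decide_true, if_true]
  simp only [add_lt_iff_neg_left, not_lt_zero, decide_false, Bool.false_eq_true, if_false,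
    Finset.prod_const_one, mul_one]
  refine Finset.prod_congr rfl fun i _ => ?_
  rw [Finset.prod_filter, ← Equiv.prod_comp σ, Fin.prod_univ_add]
  simp [imageOf_apply]

theorem imageOf_mul_blockPerm {k k' : ℕ} (σ : Equiv.Perm (Fin (k + k'))) (a : Equiv.Perm (Fin k))
    (b : Equiv.Perm (Fin k')) : imageOf k (σ * blockPerm a b) = imageOf k σ := by
  rw [imageOf_eq_iff]
  funext i
  rw [Function.comp_apply, Equiv.Perm.mul_apply, imageOf_apply]
  refine Fin.addCases (fun i => ?_) (fun i => ?_) i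
  · simp [blockPerm_castAdd]
  · simp [blockPerm_natAdd]

variable {M : Type*} [AddCommGroup M] [Module K M]

/-- Composing `σ` with a permutation preserving the blocks does not change the image of the first
block. Averaging over these replaces `W` by `blockFactor`; the division by `k! k'!` uses
characteristic zero. -/
theorem sum_perm_W_smul [CharZero K] (k k' : ℕ) (x : Fin (k + k') → K) (hx : Function.Injective x)
    (g : (Fin (k + k') → Bool) → M) :
    ∑ σ : Equiv.Perm (Fin (k + k')), W (k + k') (x ∘ σ) • g (imageOf k σ)
      = ∑ σ : Equiv.Perm (Fin (k + k')), blockFactor x (imageOf k σ) • g (imageOf k σ) := by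
  have hne : (k ! * k' ! : K) ≠ 0 :=
    mul_ne_zero (Nat.cast_ne_zero.2 k.factorial_ne_zero) (Nat.cast_ne_zero.2 k'.factorial_ne_zero)
  have h1 : ∀ (a : Equiv.Perm (Fin k)) (b : Equiv.Perm (Fin k')),
      ∑ σ : Equiv.Perm (Fin (k + k')), W (k + k') (x ∘ σ) • g (imageOf k σ)
      = ∑ σ : Equiv.Perm (Fin (k + k')), W (k + k') ((x ∘ σ) ∘ blockPerm a b) • g (imageOf k σ) := by
    intro a b
    rw [← Equiv.sum_comp (Equiv.mulRight (blockPerm a b))]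
    refine Finset.sum_congr rfl fun σ _ => ?_
    rw [Equiv.coe_mulRight, imageOf_mul_blockPerm]
    rfl
  have h2 : (k ! * k' ! : K) • ∑ σ : Equiv.Perm (Fin (k + k')), W (k + k') (x ∘ σ) • g (imageOf k σ)
      = ∑ a : Equiv.Perm (Fin k), ∑ b : Equiv.Perm (Fin k'),
        ∑ σ : Equiv.Perm (Fin (k + k')), W (k + k') ((x ∘ σ) ∘ blockPerm a b) • g (imageOf k σ) := by
    simp only [← h1, Finset.sum_const, Finset.card_univ, Fintype.card_perm, Fintype.card_fin]
    rw [mul_smul, Nat.cast_smul_eq_nsmul, Nat.cast_smul_eq_nsmul]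
  have h3 : ∑ a : Equiv.Perm (Fin k), ∑ b : Equiv.Perm (Fin k'),
        ∑ σ : Equiv.Perm (Fin (k + k')), W (k + k') ((x ∘ σ) ∘ blockPerm a b) • g (imageOf k σ)
      = ∑ σ : Equiv.Perm (Fin (k + k')), (∑ a : Equiv.Perm (Fin k), ∑ b : Equiv.Perm (Fin k'),
        W (k + k') ((x ∘ σ) ∘ blockPerm a b)) • g (imageOf k σ) := by
    simp only [Finset.sum_smul]
    have h4 : ∀ a : Equiv.Perm (Fin k), ∑ b : Equiv.Perm (Fin k'),
        ∑ σ : Equiv.Perm (Fin (k + k')), W (k + k') ((x ∘ σ) ∘ blockPerm a b) • g (imageOf k σ)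
        = ∑ σ : Equiv.Perm (Fin (k + k')), ∑ b : Equiv.Perm (Fin k'),
          W (k + k') ((x ∘ σ) ∘ blockPerm a b) • g (imageOf k σ) := fun a => Finset.sum_comm
    simp only [h4]
    exact Finset.sum_comm
  rw [h3] at h2
  rw [← inv_smul_smul₀ hne (∑ σ : Equiv.Perm (Fin (k + k')), W (k + k') (x ∘ σ) • g (imageOf k σ)),
    h2, Finset.smul_sum]
  refine Finset.sum_congr rfl fun σ _ => ?_
  rw [sum_blockPerm_W k k' _ (hx.comp σ.injective), blockFactor_imageOf, smul_smul,
    inv_mul_cancel_left₀ hne]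
  rfl

/-- With `W` replaced by `blockFactor`, the summand depends only on the image of the first `k`
elements. Each subset of size `k` is such an image for `k! (m - k)!` permutations, cancelling the
prefactor. -/
theorem sum_bool_eq_sum_perm [CharZero K] {m : ℕ} (x : Fin m → K) (hx : Function.Injective x)
    (g : (Fin m → Bool) → M) :
    ∑ q : Fin m → Bool, blockFactor x q • g q
      = ∑ k : Fin (m + 1), ((1 : K) / ((m - k)! * (k : ℕ)!)) •
        ∑ σ : Equiv.Perm (Fin m), W m (x ∘ σ) • g (imageOf k σ) := by
  classical
  have h1 : ∀ k : Fin (m + 1), ∑ σ : Equiv.Perm (Fin m), W m (x ∘ σ) • g (imageOf k σ)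
      = ∑ σ : Equiv.Perm (Fin m), blockFactor x (imageOf k σ) • g (imageOf k σ) := by
    rintro ⟨k, hk⟩
    obtain ⟨k', rfl⟩ := Nat.exists_eq_add_of_le (Nat.lt_succ_iff.1 hk)
    exact sum_perm_W_smul k k' x hx g
  have h2 : ∀ k : Fin (m + 1), ∑ σ : Equiv.Perm (Fin m),
      blockFactor x (imageOf k σ) • g (imageOf k σ)
      = ∑ q : Fin m → Bool, (if Fintype.card {i // q i = true} = k then
        ((k : ℕ)! * (m - k)! : K) else 0) • (blockFactor x q • g q) := by
    intro k
    rw [← Finset.sum_fiberwise Finset.univ (imageOf (k : ℕ))]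
    refine Finset.sum_congr rfl fun q _ => ?_
    rw [Finset.sum_congr rfl (g := fun _ => blockFactor x q • g q), Finset.sum_const,
      card_imageOf_eq (Nat.lt_succ_iff.1 k.2) q]
    · split_ifs
      · rw [← Nat.cast_smul_eq_nsmul K, Nat.cast_mul]
      · simp
    · intro σ hσ
      rw [(Finset.mem_filter.1 hσ).2]
  simp only [h1, h2, Finset.smul_sum]
  rw [Finset.sum_comm]
  refine Finset.sum_congr rfl fun q _ => ?_
  have hq : Fintype.card {i // q i = true} < m + 1 := by
    have := Fintype.card_subtype_le fun i => q i = true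
    rw [Fintype.card_fin] at this
    omega
  rw [Finset.sum_eq_single (⟨_, hq⟩ : Fin (m + 1))]
  · rw [if_pos rfl, smul_smul, mul_comm (_ ! : K) (_ ! : K), one_div_mul_cancel, one_smul]
    exact mul_ne_zero (Nat.cast_ne_zero.2 (Nat.factorial_ne_zero _))
      (Nat.cast_ne_zero.2 (Nat.factorial_ne_zero _))
  · intro k _ hk
    rw [if_neg, zero_smul, smul_zero]
    intro h
    exact hk (Fin.ext h.symm)
  · simp

/-- The inverse of `rnDiag x j i` is `(x_j - x_i + 1)/(x_j - x_i)`; changing both signs gives the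
factor for `i` inside and `j` outside the block. -/
theorem sortScalar_inv_eq {m : ℕ} (x : Fin m → K) (q : Fin m → Bool) :
    (sortScalar x q (List.finRange m))⁻¹ = blockFactor x q := by
  have key : ∀ (p : Fin m → Bool) (f : Fin m → K),
      (((List.finRange m).filter p).map f).prod
        = ∏ i ∈ Finset.univ.filter fun i => p i = true, f i := by
    intro p f
    rw [← List.prod_toFinset f ((List.nodup_finRange m).filter _)]
    congr 1
    ext i
    simp
  unfold sortScalar blockFactor
  rw [key, ← Finset.prod_inv_distrib]
  refine Finset.prod_congr rfl fun i _ => ?_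
  rw [key, ← Finset.prod_inv_distrib]
  refine Finset.prod_congr (by simp) fun j _ => ?_
  rw [rnDiag, inv_div, ← neg_div_neg_eq]
  congr 1 <;> ring

end Combinatorics

/-! ## The expansion over an arbitrary algebra -/

section Scalars

variable {n : ℕ} {K : Type*} [Field K]

/-- The factor relating the parts of neighbouring colours, for arbitrary values of the
variables. -/
def crossScalar (ξ η : Fin n → ℕ) (z : Pos ξ → K) : K :=
  ∏ a : Fin n, ∏ b ∈ Finset.univ.filter (fun b : Fin n => (b : ℕ) = a + 1),
    ∏ i ∈ Finset.univ.filter (fun i : Fin (ξ b) => (i : ℕ) < η b),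
      ∏ j ∈ Finset.univ.filter (fun j : Fin (ξ a) => η a ≤ (j : ℕ)),
        (z ⟨b, i⟩ - z ⟨a, j⟩ + 1) / (z ⟨b, i⟩ - z ⟨a, j⟩)

/-- The product of eigenvalues, for arbitrary eigenvalues. -/
def eigenScalar (ξ η : Fin n → ℕ) (l₁ l₂ : Fin (n + 1) → Pos ξ → K) : K :=
  ∏ a : Fin n,
    ((∏ i ∈ Finset.univ.filter (fun i : Fin (ξ a) => (i : ℕ) < η a), l₂ a.castSucc ⟨a, i⟩)
      * ∏ j ∈ Finset.univ.filter (fun j : Fin (ξ a) => η a ≤ (j : ℕ)), l₁ a.succ ⟨a, j⟩)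

/-- The filter `b = 0` on the remaining colours keeps exactly the second colour, and is empty when
there is none. -/
theorem crossScalar_succ (ξ η : Fin (n + 1) → ℕ) (z : Pos ξ → K) :
    crossScalar ξ η z = (∏ b ∈ Finset.univ.filter (fun b : Fin n => (b : ℕ) = 0),
      ∏ i ∈ Finset.univ.filter (fun i : Fin (ξ b.succ) => (i : ℕ) < η b.succ),
        ∏ j ∈ Finset.univ.filter (fun j : Fin (ξ 0) => η 0 ≤ (j : ℕ)),
          (z (tailPos ξ ⟨b, i⟩) - z (headPos ξ j) + 1) / (z (tailPos ξ ⟨b, i⟩) - z (headPos ξ j)))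
      * crossScalar (fun a => ξ a.succ) (fun a => η a.succ) (z ∘ tailPos ξ) := by
  unfold crossScalar
  rw [Fin.prod_univ_succ]
  congr 1
  · rw [Finset.prod_filter, Fin.prod_univ_succ, Finset.prod_filter]
    simp [headPos, tailPos, -Finset.prod_div_distrib, Finset.prod_filter]
  · refine Finset.prod_congr rfl fun a _ => ?_
    rw [Finset.prod_filter, Fin.prod_univ_succ, Finset.prod_filter]
    simp [tailPos, -Finset.prod_div_distrib, Finset.prod_filter]

theorem eigenScalar_succ (ξ η : Fin (n + 1) → ℕ) (l₁ l₂ : Fin (n + 2) → Pos ξ → K) :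
    eigenScalar ξ η l₁ l₂
      = ((∏ i ∈ Finset.univ.filter (fun i : Fin (ξ 0) => (i : ℕ) < η 0), l₂ 0 (headPos ξ i))
        * ∏ j ∈ Finset.univ.filter (fun j : Fin (ξ 0) => η 0 ≤ (j : ℕ)), l₁ 1 (headPos ξ j))
        * eigenScalar (fun a => ξ a.succ) (fun a => η a.succ) (fun a => l₁ a.succ ∘ tailPos ξ)
          fun a => l₂ a.succ ∘ tailPos ξ :=
  Fin.prod_univ_succ _

/-- Only `l₂` is ever evaluated at label `0`, and only for the first colour; `l₁` occurs at
successor labels alone, so `d` drops out. -/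
theorem eigenScalar_mul (ξ η : Fin n → ℕ) (l₁ l₂ : Fin (n + 1) → Pos ξ → K) (c d : Pos ξ → K) :
    eigenScalar ξ η (fun a p => (if a = 0 then d p else 1) * l₁ a p)
        (fun a p => (if a = 0 then c p else 1) * l₂ a p)
      = (∏ b ∈ Finset.univ.filter (fun b : Fin n => (b : ℕ) = 0),
          ∏ i ∈ Finset.univ.filter (fun i : Fin (ξ b) => (i : ℕ) < η b), c ⟨b, i⟩)
        * eigenScalar ξ η l₁ l₂ := by
  unfold eigenScalar
  rw [Finset.prod_filter, ← Finset.prod_mul_distrib]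
  refine Finset.prod_congr rfl fun a _ => ?_
  have h1 : a.castSucc = 0 ↔ (a : ℕ) = 0 := by
    rw [Fin.ext_iff]
    rfl
  have h2 : a.succ ≠ 0 := Fin.succ_ne_zero a
  simp only [h1, h2, if_false, one_mul]
  split_ifs with h
  · rw [Finset.prod_mul_distrib, mul_assoc]
  · simp only [one_mul]

theorem prod_map_filter_finRange {m : ℕ} (p : Fin m → Bool) (f : Fin m → K) :
    (((List.finRange m).filter p).map f).prod
      = ∏ i ∈ Finset.univ.filter fun i => p i = true, f i := by
  rw [← List.prod_toFinset f ((List.nodup_finRange m).filter _)]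
  congr 1
  ext i
  simp

theorem prod_map_filter_not_imageOf {m : ℕ} (k : ℕ) (σ : Equiv.Perm (Fin m)) (f : Fin m → K) :
    (((List.finRange m).filter fun j => !imageOf k σ j).map f).prod
      = ∏ j ∈ Finset.univ.filter (fun j : Fin m => k ≤ (j : ℕ)), f (σ j) := by
  rw [prod_map_filter_finRange, Finset.prod_filter, Finset.prod_filter, ← Equiv.prod_comp σ]
  simp [imageOf_apply]

theorem prod_castLE {k m : ℕ} (h : k ≤ m) (f : Fin m → K) :
    ∏ i : Fin k, f (Fin.castLE h i)
      = ∏ i ∈ Finset.univ.filter (fun i : Fin m => (i : ℕ) < k), f i := by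
  obtain ⟨k', rfl⟩ := Nat.exists_eq_add_of_le h
  rw [Finset.prod_filter, Fin.prod_univ_add]
  simp
  rfl

end Scalars

/-! ### The induction on the rank -/

section Expansion

/-- The equivalence splitting off the first entry of a bounded sequence. -/
def consIic {n : ℕ} (ξ : Fin (n + 1) → ℕ) :
    Fin (ξ 0 + 1) × Set.Iic (fun a : Fin n => ξ a.succ) ≃ Set.Iic ξ where
  toFun p := ⟨Fin.cons (p.1 : ℕ) p.2.1, by
    intro a
    refine Fin.cases ?_ (fun a => ?_) a
    · exact Nat.lt_succ_iff.1 p.1.2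
    · exact p.2.2 a⟩
  invFun η := (⟨η.1 0, Nat.lt_succ_iff.2 (η.2 0)⟩, ⟨fun a => η.1 a.succ, fun a => η.2 a.succ⟩)
  left_inv p := rfl
  right_inv η := Subtype.ext (Fin.cons_self_tail η.1)

theorem sum_smul_sum_comm {K M S E P : Type*} [Field K] [AddCommGroup M] [Module K M] [Fintype S]
    [Fintype E] [Fintype P] (w : S → K) (c : E → K) (w' : P → K) (X : E → S → P → M) :
    ∑ s, w s • ∑ e, c e • ∑ p, w' p • X e s p
      = ∑ e, c e • ∑ s, ∑ p, (w s * w' p) • X e s p := by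
  simp only [Finset.smul_sum, mul_smul]
  rw [Finset.sum_comm]
  refine Finset.sum_congr rfl fun e _ => Finset.sum_congr rfl fun s _ =>
    Finset.sum_congr rfl fun p _ => ?_
  rw [smul_comm]

theorem permute_injective {n : ℕ} (ξ : Fin n → ℕ) (π : (a : Fin n) → Equiv.Perm (Fin (ξ a))) :
    Function.Injective (permute ξ π) := by
  rintro ⟨a, i⟩ ⟨b, j⟩ h
  have h1 : a = b := congrArg Sigma.fst h
  subst h1
  have h2 := eq_of_heq (Sigma.mk.inj_iff.1 h).2
  exact congrArg (Sigma.mk a) ((π a).injective h2)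

theorem lower_injective {n : ℕ} {ξ η : Fin n → ℕ} (h : η ≤ ξ) : Function.Injective (lower h) := by
  rintro ⟨a, i⟩ ⟨b, j⟩ h'
  have h1 : a = b := congrArg Sigma.fst h'
  subst h1
  have h2 := eq_of_heq (Sigma.mk.inj_iff.1 h').2
  exact congrArg (Sigma.mk a) (Fin.castLE_injective _ h2)

theorem upper_injective {n : ℕ} {ξ η : Fin n → ℕ} (h : η ≤ ξ) : Function.Injective (upper h) := by
  rintro ⟨a, i⟩ ⟨b, j⟩ h'
  have h1 : a = b := congrArg Sigma.fst h'
  subst h1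
  have h2 := eq_of_heq (Sigma.mk.inj_iff.1 h').2
  exact congrArg (Sigma.mk a) (Fin.natAdd_injective _ _ (Fin.cast_injective _ h2))

universe u

/-- The right-hand side of the expansion. -/
def expansion {n : ℕ} {K : Type*} {A : Type u} [Field K] [Ring A] [Algebra K A] (ξ : Fin n → ℕ)
    (z : Pos ξ → K) (T₁ T₂ : Pos ξ → Matrix (Fin (n + 1)) (Fin (n + 1)) A)
    (l₁ l₂ : Fin (n + 1) → Pos ξ → K) (v : A) : A :=
  ∑ η : Set.Iic ξ, (∏ a : Fin n, (1 : K) / ((ξ a - η.1 a)! * (η.1 a)!)) •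
    ∑ π : (a : Fin n) → Equiv.Perm (Fin (ξ a)),
      (∏ a : Fin n, W (ξ a) fun i => z (permute ξ π ⟨a, i⟩)) •
        (crossScalar ξ η.1 (z ∘ permute ξ π)
          * eigenScalar ξ η.1 (fun a => l₁ a ∘ permute ξ π) fun a => l₂ a ∘ permute ξ π) •
        (gB η.1 (T₁ ∘ permute ξ π ∘ lower η.2) (z ∘ permute ξ π ∘ lower η.2)
          * gB (ξ - η.1) (T₂ ∘ permute ξ π ∘ upper η.2) (z ∘ permute ξ π ∘ upper η.2) * v)

variable {n : ℕ} {K : Type*} {A : Type u} [Field K] [CharZero K] [Ring A] [Algebra K A]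

/-- The equivalence attached to a permutation and a splitting of its domain. -/
def splitEquiv {m k : ℕ} (h : k ≤ m) (σ : Equiv.Perm (Fin m)) : Fin k ⊕ Fin (m - k) ≃ Fin m :=
  (finSumFinEquiv.trans (finCongr (Nat.add_sub_cancel' h))).trans σ

/-- One summand of the induction step: the operators reassemble into Bethe functions of the larger
rank, and the scalars of the first colour join those of the other colours. What remains is a
rearrangement of commuting scalars. -/
theorem expansion_term (ξ : Fin (n + 1) → ℕ) (z : Pos ξ → K) (hz : Generic z)
    (T₁ T₂ : Pos ξ → Matrix (Fin (n + 2)) (Fin (n + 2)) A) (h₁ : RTTFamily z T₁)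
    (h₂ : RTTFamily z T₂) (h₁₂ : ∀ p q a b c d, T₂ p a b * T₁ q c d = T₁ q c d * T₂ p a b)
    (v : A) (l₁ l₂ : Fin (n + 2) → Pos ξ → K)
    (hv₂ : ∀ p a b, a < b → T₂ p b a * v = 0)
    (hl₂ : ∀ p a, T₂ p a a * v = l₂ a p • v) (k : Fin (ξ 0 + 1))
    (σ : Equiv.Perm (Fin (ξ 0))) (η : Set.Iic fun a : Fin n => ξ a.succ)
    (π : (a : Fin n) → Equiv.Perm (Fin (ξ a.succ))) (I J : List (Fin (ξ 0)))
    (hI : I = (List.finRange (ξ 0)).filter (imageOf k σ))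
    (hJ : J = (List.finRange (ξ 0)).filter fun j => !imageOf k σ j) :
    (J.map fun j => l₁ 1 (headPos ξ j)).prod •
      (crossScalar (fun a => ξ a.succ) η.1 ((z ∘ tailPos ξ) ∘ permute (fun a => ξ a.succ) π)
        * eigenScalar (fun a => ξ a.succ) η.1
          (fun a => (fun p => (if a = 0 then
            (I.map fun i => 1 + (z (tailPos ξ p) - z (headPos ξ i))⁻¹).prod else 1)
              * l₁ a.succ (tailPos ξ p)) ∘ permute (fun a => ξ a.succ) π)
          fun a => (fun p => (if a = 0 then
            (J.map fun i => 1 + (z (tailPos ξ p) - z (headPos ξ i))⁻¹).prod else 1)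
              * l₂ a.succ (tailPos ξ p)) ∘ permute (fun a => ξ a.succ) π) •
      (((lineProd (I ++ J).reverse (T₂ ∘ headPos ξ) *
            (projZero (n + 1) A (imageOf k σ) *
              (lineProd I.reverse (T₁ ∘ headPos ξ) * succMat (Fin (ξ 0)) (n + 1) A))
          : Matrix (Fin (ξ 0) → Fin (n + 2)) (Fin (ξ 0) → Fin (n + 1)) A) *
          (gB η.1 ((fun p => dressed I (z ∘ headPos ξ) (z (tailPos ξ p))
              ((T₁ (tailPos ξ p)).submatrix Fin.succ Fin.succ)) ∘
                permute (fun a => ξ a.succ) π ∘ lower η.2)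
              ((z ∘ tailPos ξ) ∘ permute (fun a => ξ a.succ) π ∘ lower η.2) *
          gB ((fun a => ξ a.succ) - η.1) ((fun p => dressed J (z ∘ headPos ξ) (z (tailPos ξ p))
              ((T₂ (tailPos ξ p)).submatrix Fin.succ Fin.succ)) ∘
                permute (fun a => ξ a.succ) π ∘ upper η.2)
              ((z ∘ tailPos ξ) ∘ permute (fun a => ξ a.succ) π ∘ upper η.2) *
            vac (Fin (ξ 0)) n v)
          : Matrix (Fin (ξ 0) → Fin (n + 2)) (Fin (ξ 0) → Fin (n + 1)) A)
            (fun _ => 0) (fun _ => 0))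
      = (crossScalar ξ (consIic ξ (k, η)).1 (z ∘ permute ξ (Fin.cons σ π))
          * eigenScalar ξ (consIic ξ (k, η)).1 (fun a => l₁ a ∘ permute ξ (Fin.cons σ π))
            fun a => l₂ a ∘ permute ξ (Fin.cons σ π)) •
        (gB (consIic ξ (k, η)).1 (T₁ ∘ permute ξ (Fin.cons σ π) ∘ lower (consIic ξ (k, η)).2)
            (z ∘ permute ξ (Fin.cons σ π) ∘ lower (consIic ξ (k, η)).2)
          * gB (ξ - (consIic ξ (k, η)).1)
            (T₂ ∘ permute ξ (Fin.cons σ π) ∘ upper (consIic ξ (k, η)).2)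
            (z ∘ permute ξ (Fin.cons σ π) ∘ upper (consIic ξ (k, η)).2) * v) := by
  subst hI hJ
  have hk : (k : ℕ) ≤ ξ 0 := Nat.lt_succ_iff.1 k.2
  have key := separated_eq_gB_mul_gB ξ (consIic ξ (k, η)).1 (ξ - (consIic ξ (k, η)).1)
    (splitEquiv hk σ) (imageOf k σ)
    (fun i => by
      change imageOf k σ (σ (Fin.castLE hk i)) = true
      rw [imageOf_apply]
      exact decide_eq_true i.2)
    (fun i => by
      change imageOf k σ (σ (Fin.cast (Nat.add_sub_cancel' hk) (Fin.natAdd k i))) = false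
      rw [imageOf_apply]
      exact decide_eq_false (Nat.not_lt.2 (Nat.le_add_right _ _)))
    (permute ξ (Fin.cons σ π) ∘ lower (consIic ξ (k, η)).2)
    ((permute_injective _ _).comp (lower_injective _))
    (permute (fun a => ξ a.succ) π ∘ lower η.2) (fun _ => rfl) (fun _ => rfl)
    (permute ξ (Fin.cons σ π) ∘ upper (consIic ξ (k, η)).2)
    ((permute_injective _ _).comp (upper_injective _))
    (permute (fun a => ξ a.succ) π ∘ upper η.2) (fun _ => rfl) (fun _ => rfl)
    z hz T₁ T₂ h₁ h₂ h₁₂ v hv₂ (fun j => l₂ 0 (headPos ξ j)) (fun j => hl₂ _ _)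
  refine (congrArg (fun x => _ • _ • x) key).trans ?_
  rw [smul_smul, smul_smul]
  congr 1
  have e1 : ∏ i : Fin k, l₂ 0 (headPos ξ (splitEquiv hk σ (Sum.inl i)))
      = ∏ i ∈ Finset.univ.filter (fun i : Fin (ξ 0) => (i : ℕ) < k), l₂ 0 (headPos ξ (σ i)) :=
    prod_castLE hk fun i => l₂ 0 (headPos ξ (σ i))
  -- The change of eigenvalue caused by `I` does not matter. The one caused by `J` is the part of
  -- the cross factor between the first and the second colour.
  have e2 := eigenScalar_mul (fun a => ξ a.succ) η.1
    (fun a => (l₁ a.succ ∘ tailPos ξ) ∘ permute (fun a => ξ a.succ) π)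
    (fun a => (l₂ a.succ ∘ tailPos ξ) ∘ permute (fun a => ξ a.succ) π)
    (fun p => (((List.finRange (ξ 0)).filter fun j => !imageOf k σ j).map fun i => 1 +
      (z (tailPos ξ (permute (fun a => ξ a.succ) π p)) - z (headPos ξ i))⁻¹).prod)
    (fun p => (((List.finRange (ξ 0)).filter (imageOf k σ)).map fun i => 1 +
      (z (tailPos ξ (permute (fun a => ξ a.succ) π p)) - z (headPos ξ i))⁻¹).prod)
  rw [crossScalar_succ, eigenScalar_succ]
  refine (congrArg₂ (fun x y => (_ * (_ * x)) * y) e2 e1).trans ?_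
  simp only [prod_map_filter_not_imageOf]
  have e3 : ∀ (p : Pos fun a => ξ a.succ) (j : Fin (ξ 0)),
      1 + (z (tailPos ξ p) - z (headPos ξ j))⁻¹
        = (z (tailPos ξ p) - z (headPos ξ j) + 1) / (z (tailPos ξ p) - z (headPos ξ j)) := by
    intro p j
    rw [add_div, div_self (hz.sub_ne (headPos_ne_tailPos ξ j p).symm), one_div]
  simp only [e3]
  have comm : ∀ a b c d e : K, a * (b * (c * d)) * e = (c * b) * ((e * a) * d) := by
    intros
    ring
  exact comm _ _ _ _ _

/-- The algebra is quantified inside the induction, since the hypothesis is applied to operators on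
the tensor power of the first colour with coefficients in `A`. These form a type in the same
universe as `A`. -/
theorem gB_mul_eq_expansion {n : ℕ} {K : Type*} [Field K] [CharZero K] :
    ∀ {A : Type u} [Ring A] [Algebra K A] (ξ : Fin n → ℕ) (z : Pos ξ → K), Generic z →
    ∀ (T₁ T₂ : Pos ξ → Matrix (Fin (n + 1)) (Fin (n + 1)) A), RTTFamily z T₁ → RTTFamily z T₂ →
    (∀ p q a b c d, T₂ p a b * T₁ q c d = T₁ q c d * T₂ p a b) →
    ∀ (v : A) (l₁ l₂ : Fin (n + 1) → Pos ξ → K), (∀ p a b, a < b → T₁ p b a * v = 0) →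
    (∀ p a b, a < b → T₂ p b a * v = 0) → (∀ p a, T₁ p a a * v = l₁ a p • v) →
    (∀ p a, T₂ p a a * v = l₂ a p • v) →
    gB ξ (fun p => T₂ p * T₁ p) z * v = expansion ξ z T₁ T₂ l₁ l₂ v := by
  induction n with
  | zero =>
    intro A _ _ ξ z _ T₁ T₂ _ _ _ v l₁ l₂ _ _ _ _
    rw [expansion, gB_of_isEmpty, one_mul, Fintype.sum_subsingleton _ (⟨ξ, le_refl ξ⟩ : Set.Iic ξ),
      Fintype.sum_subsingleton _ (fun _ => 1)]
    simp [crossScalar, eigenScalar, gB_of_isEmpty]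
  | succ n ih =>
    intro A _ _ ξ z hz T₁ T₂ h₁ h₂ h₁₂ v l₁ l₂ hv₁ hv₂ hl₁ hl₂
    rw [gB_mul_eq_sum_split ξ z hz T₁ T₂ h₁ h₂ h₁₂ v hv₁ hv₂ (fun j => l₁ 1 (headPos ξ j))
      (fun j => hl₁ _ _)]
    simp only [sortScalar_inv_eq]
    -- From here `k` is the first entry of `η`, `σ` the permutation of the first colour, and `I` the
    -- image of the first `k` indices under `σ`.
    rw [sum_bool_eq_sum_perm _ (fun i j hij => by
      by_contra hne
      exact (hz.sub_ne ((headPos_injective ξ).ne hne)) (sub_eq_zero.2 hij)),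
      expansion, ← Equiv.sum_comp (consIic ξ), Fintype.sum_prod_type]
    refine Finset.sum_congr rfl fun k _ => ?_
    have e1 : ∀ η : Set.Iic fun a : Fin n => ξ a.succ,
        ∏ a, (1 : K) / ((ξ a - (consIic ξ (k, η)).1 a)! * ((consIic ξ (k, η)).1 a)!)
        = (1 / ((ξ 0 - k)! * (k : ℕ)!)) * ∏ a, (1 : K) / ((ξ a.succ - η.1 a)! * (η.1 a)!) :=
      fun η => Fin.prod_univ_succ _
    simp only [e1, mul_smul]
    rw [← Finset.smul_sum]
    congr 1
    have e2 : ∀ F : ((a : Fin (n + 1)) → Equiv.Perm (Fin (ξ a))) → A,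
        ∑ π, F π = ∑ σ : Equiv.Perm (Fin (ξ 0)), ∑ π : (a : Fin n) → Equiv.Perm (Fin (ξ a.succ)),
          F (Fin.cons σ π) := by
      intro F
      rw [← Equiv.sum_comp (Fin.consEquiv fun a => Equiv.Perm (Fin (ξ a))), Fintype.sum_prod_type]
      rfl
    have e3 : ∀ (σ : Equiv.Perm (Fin (ξ 0))) (π : (a : Fin n) → Equiv.Perm (Fin (ξ a.succ))),
        ∏ a : Fin (n + 1), W (ξ a) (fun i => z (permute ξ (Fin.cons σ π) ⟨a, i⟩))
        = W (ξ 0) ((z ∘ headPos ξ) ∘ σ) * ∏ a : Fin n, W (ξ a.succ) fun i =>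
          (z ∘ tailPos ξ) (permute (fun a => ξ a.succ) π ⟨a, i⟩) :=
      fun σ π => Fin.prod_univ_succ _
    simp only [e2, e3]
    rw [← sum_smul_sum_comm]
    refine Finset.sum_congr rfl fun σ _ => ?_
    congr 1
    set I := (List.finRange (ξ 0)).filter (imageOf k σ) with hI
    set J := (List.finRange (ξ 0)).filter fun j => !imageOf k σ j with hJ
    have hIn : I.Nodup := (List.nodup_finRange _).filter _
    have hJn : J.Nodup := (List.nodup_finRange _).filter _
    have hJI : ∀ j ∈ J, j ∉ I := by
      intro j hj hi
      have h1 := (List.mem_filter.1 hj).2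
      have h2 := (List.mem_filter.1 hi).2
      simp [h2] at h1
    have hzx : ∀ p i, z (tailPos ξ p) - (z ∘ headPos ξ) i ≠ 0 :=
      fun p i => hz.sub_ne (headPos_ne_tailPos ξ i p).symm
    -- The two families are the blocks of `T₁` and `T₂` dressed by `I` and `J`, the vector is the
    -- vacuum, and the eigenvalues of label `0` are modified accordingly.
    have key := ih (A := TMat (Fin (ξ 0)) (n + 1) A) (fun a => ξ a.succ) (z ∘ tailPos ξ)
      (hz.comp (tailPos_injective ξ))
      (fun p => dressed I (z ∘ headPos ξ) (z (tailPos ξ p))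
        ((T₁ (tailPos ξ p)).submatrix Fin.succ Fin.succ))
      (fun p => dressed J (z ∘ headPos ξ) (z (tailPos ξ p))
        ((T₂ (tailPos ξ p)).submatrix Fin.succ Fin.succ))
      (fun p q hpq => dressed_rtt I hIn _ (hzx p) (hzx q)
        ((h₁ _ _ ((tailPos_injective ξ).ne hpq)).submatrix Fin.succ))
      (fun p q hpq => dressed_rtt J hJn _ (hzx p) (hzx q)
        ((h₂ _ _ ((tailPos_injective ξ).ne hpq)).submatrix Fin.succ))
      (fun p q a b c d => dressed_comm_dressed hJI _ _ _ (fun _ _ _ _ => h₁₂ _ _ _ _ _ _) a b c d)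
      (vac (Fin (ξ 0)) n v)
      (fun a p => (if a = 0 then
        (I.map fun i => 1 + (z (tailPos ξ p) - z (headPos ξ i))⁻¹).prod else 1)
          * l₁ a.succ (tailPos ξ p))
      (fun a p => (if a = 0 then
        (J.map fun i => 1 + (z (tailPos ξ p) - z (headPos ξ i))⁻¹).prod else 1)
          * l₂ a.succ (tailPos ξ p))
      (fun p a b hab => dressed_mul_vac_eq_zero I hIn _ _ _ v
        (fun a b hab => hv₁ _ _ _ (Fin.succ_lt_succ_iff.2 hab)) a b hab)
      (fun p a b hab => dressed_mul_vac_eq_zero J hJn _ _ _ v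
        (fun a b hab => hv₂ _ _ _ (Fin.succ_lt_succ_iff.2 hab)) a b hab)
      (fun p a => dressed_mul_vac_self I hIn _ _ _ v (fun a => l₁ a.succ (tailPos ξ p))
        (fun a b hab => hv₁ _ _ _ (Fin.succ_lt_succ_iff.2 hab)) (fun a => hl₁ _ _) a)
      (fun p a => dressed_mul_vac_self J hJn _ _ _ v (fun a => l₂ a.succ (tailPos ξ p))
        (fun a b hab => hv₂ _ _ _ (Fin.succ_lt_succ_iff.2 hab)) (fun a => hl₂ _ _) a)
    refine (congrArg (fun x => (J.map fun j => l₁ 1 (headPos ξ j)).prod •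
      (((lineProd (I ++ J).reverse (T₂ ∘ headPos ξ) *
            (projZero (n + 1) A (imageOf k σ) *
              (lineProd I.reverse (T₁ ∘ headPos ξ) * succMat (Fin (ξ 0)) (n + 1) A))
          : Matrix (Fin (ξ 0) → Fin (n + 2)) (Fin (ξ 0) → Fin (n + 1)) A) * x
          : Matrix (Fin (ξ 0) → Fin (n + 2)) (Fin (ξ 0) → Fin (n + 1)) A)
            (fun _ => 0) (fun _ => 0))) key).trans ?_
    rw [expansion]
    simp only [Matrix.mul_sum, Matrix.mul_smul, Matrix.sum_apply, Matrix.smul_apply,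
      Finset.smul_sum]
    refine Finset.sum_congr rfl fun η _ => Finset.sum_congr rfl fun π _ => ?_
    rw [smul_comm, smul_comm (M := K) (N := K) (J.map fun j => l₁ 1 (headPos ξ j)).prod]
    congr 2
    exact (expansion_term ξ z hz T₁ T₂ h₁ h₂ h₁₂ v l₁ l₂ hv₂ hl₂ k σ η π I J hI hJ).trans
      (mul_smul _ _ _)

end Expansion

/-! ## Series in one and in two of the variables -/

section InVar

open Finsupp

variable {σ A : Type*} [Ring A]

theorem coeff_inVar_single (i : σ) (c : ℕ → A) (s : ℕ) :
    MvPowerSeries.coeff (single i s) (inVar i c) = c s := by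
  change inVar i c (single i s) = c s
  unfold inVar
  rw [single_eq_same, if_pos rfl]

theorem coeff_inVar_of_ne (i : σ) (c : ℕ → A) {m : σ →₀ ℕ} (h : m ≠ single i (m i)) :
    MvPowerSeries.coeff m (inVar i c) = 0 :=
  if_neg h

theorem sum_inVar {ι : Type*} (s : Finset ι) (i : σ) (c : ι → ℕ → A) :
    ∑ k ∈ s, inVar i (c k) = inVar i (fun r => ∑ k ∈ s, c k r) := by
  ext m
  rw [map_sum]
  by_cases h : m = single i (m i)
  · rw [h]
    simp only [coeff_inVar_single]
  · simp only [coeff_inVar_of_ne i _ h, Finset.sum_const_zero]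

theorem map_inVar {B : Type*} [Ring B] (f : A →+* B) (i : σ) (c : ℕ → A) :
    MvPowerSeries.map f (inVar i c) = inVar i (f ∘ c) := by
  ext m
  rw [MvPowerSeries.coeff_map]
  by_cases h : m = single i (m i)
  · rw [h, coeff_inVar_single, coeff_inVar_single]
    rfl
  · rw [coeff_inVar_of_ne i _ h, coeff_inVar_of_ne i _ h, map_zero]

theorem inVar_mul_inVar_self (i : σ) (c d : ℕ → A) :
    inVar i c * inVar i d
      = inVar i fun s => ∑ p ∈ Finset.HasAntidiagonal.antidiagonal s, c p.1 * d p.2 := by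
  classical
  ext m
  rw [MvPowerSeries.coeff_mul]
  by_cases h : m = single i (m i)
  · rw [h, coeff_inVar_single, Finsupp.antidiagonal_single, Finset.sum_map]
    refine Finset.sum_congr rfl fun p _ => ?_
    exact congrArg₂ _ (coeff_inVar_single i c p.1) (coeff_inVar_single i d p.2)
  · rw [coeff_inVar_of_ne i _ h]
    refine Finset.sum_eq_zero fun p hp => ?_
    rw [Finset.HasAntidiagonal.mem_antidiagonal] at hp
    by_cases h1 : p.1 = single i (p.1 i)
    · by_cases h2 : p.2 = single i (p.2 i)
      · refine absurd ?_ h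
        rw [← hp, Finsupp.add_apply, Finsupp.single_add, ← h1, ← h2]
      · rw [coeff_inVar_of_ne i _ h2, mul_zero]
    · rw [coeff_inVar_of_ne i _ h1, zero_mul]

open Classical in
/-- The series `∑ F_{rs} t_i^{-r} t_j^{-s}`. -/
def biVar (i j : σ) (F : ℕ → ℕ → A) : MvPowerSeries σ A :=
  fun m => if m = single i (m i) + single j (m j) then F (m i) (m j) else 0

theorem coeff_biVar (i j : σ) (F : ℕ → ℕ → A) {m : σ →₀ ℕ} (h : m = single i (m i) + single j (m j)) :
    MvPowerSeries.coeff m (biVar i j F) = F (m i) (m j) :=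
  if_pos h

theorem coeff_biVar_of_ne (i j : σ) (F : ℕ → ℕ → A) {m : σ →₀ ℕ}
    (h : m ≠ single i (m i) + single j (m j)) : MvPowerSeries.coeff m (biVar i j F) = 0 :=
  if_neg h

theorem biVar_sub (i j : σ) (F G : ℕ → ℕ → A) : biVar i j F - biVar i j G = biVar i j (F - G) := by
  ext m
  rw [map_sub]
  by_cases h : m = single i (m i) + single j (m j)
  · rw [coeff_biVar _ _ _ h, coeff_biVar _ _ _ h, coeff_biVar _ _ _ h]
    rfl
  · rw [coeff_biVar_of_ne _ _ _ h, coeff_biVar_of_ne _ _ _ h, coeff_biVar_of_ne _ _ _ h, sub_zero]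

theorem inVar_mul_inVar {i j : σ} (hij : i ≠ j) (c d : ℕ → A) :
    inVar i c * inVar j d = biVar i j fun r s => c r * d s := by
  classical
  ext m
  rw [MvPowerSeries.coeff_mul]
  by_cases h : m = single i (m i) + single j (m j)
  · rw [coeff_biVar _ _ _ h, Finset.sum_eq_single (single i (m i), single j (m j)),
      coeff_inVar_single, coeff_inVar_single]
    · rintro ⟨p, q⟩ hp hne
      rw [Finset.HasAntidiagonal.mem_antidiagonal] at hp
      by_cases h1 : p = single i (p i)
      · by_cases h2 : q = single j (q j)
        · refine absurd ?_ hne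
          have e1 : m i = p i := by
            rw [← hp]
            change p i + q i = p i
            rw [h2, single_eq_of_ne hij, add_zero]
          have e2 : m j = q j := by
            rw [← hp]
            change p j + q j = q j
            rw [h1, single_eq_of_ne hij.symm, zero_add]
          rw [e1, e2, ← h1, ← h2]
        · rw [coeff_inVar_of_ne j _ h2, mul_zero]
      · rw [coeff_inVar_of_ne i _ h1, zero_mul]
    · intro hn
      rw [Finset.HasAntidiagonal.mem_antidiagonal] at hn
      exact absurd h.symm hn
  · rw [coeff_biVar_of_ne _ _ _ h]
    refine Finset.sum_eq_zero fun p hp => ?_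
    rw [Finset.HasAntidiagonal.mem_antidiagonal] at hp
    by_cases h1 : p.1 = single i (p.1 i)
    · by_cases h2 : p.2 = single j (p.2 j)
      · refine absurd ?_ h
        have e1 : m i = p.1 i := by
          rw [← hp]
          change p.1 i + p.2 i = p.1 i
          rw [h2, single_eq_of_ne hij, add_zero]
        have e2 : m j = p.2 j := by
          rw [← hp]
          change p.1 j + p.2 j = p.2 j
          rw [h1, single_eq_of_ne hij.symm, zero_add]
        rw [e1, e2, ← h1, ← h2, hp]
      · rw [coeff_inVar_of_ne j _ h2, mul_zero]
    · rw [coeff_inVar_of_ne i _ h1, zero_mul]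

theorem biVar_swap (i j : σ) (F : ℕ → ℕ → A) : biVar j i F = biVar i j fun r s => F s r := by
  ext m
  by_cases h : m = single i (m i) + single j (m j)
  · rw [coeff_biVar _ _ _ h, coeff_biVar _ _ _ (h.trans (add_comm _ _))]
  · rw [coeff_biVar_of_ne _ _ _ h, coeff_biVar_of_ne]
    intro h'
    exact h (h'.trans (add_comm _ _))

theorem inVar_mul_inVar' {i j : σ} (hij : i ≠ j) (c d : ℕ → A) :
    inVar j d * inVar i c = biVar i j fun r s => d s * c r := by
  rw [inVar_mul_inVar hij.symm, biVar_swap]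

theorem X_mul_biVar {i j : σ} (hij : i ≠ j) (F : ℕ → ℕ → A) :
    MvPowerSeries.X i * biVar i j F = biVar i j fun r s => if r = 0 then 0 else F (r - 1) s := by
  classical
  ext m
  rw [MvPowerSeries.X_def, MvPowerSeries.coeff_monomial_mul]
  split_ifs with h1
  · obtain ⟨m, rfl⟩ := exists_add_of_le h1
    rw [add_tsub_cancel_left, one_mul]
    have e1 : (single i 1 + m : σ →₀ ℕ) i = m i + 1 := by
      rw [Finsupp.add_apply, single_eq_same, add_comm]
    have e2 : (single i 1 + m : σ →₀ ℕ) j = m j := by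
      rw [Finsupp.add_apply, single_eq_of_ne hij.symm, zero_add]
    have e3 : (single i 1 + m : σ →₀ ℕ)
        = single i ((single i 1 + m : σ →₀ ℕ) i) + single j ((single i 1 + m : σ →₀ ℕ) j)
        ↔ m = single i (m i) + single j (m j) := by
      rw [e1, e2, add_comm (m i), single_add, add_assoc, add_right_inj]
    by_cases h : m = single i (m i) + single j (m j)
    · rw [coeff_biVar _ _ _ h, coeff_biVar _ _ _ (e3.2 h), e1, e2, if_neg (Nat.succ_ne_zero _),
        Nat.add_sub_cancel]
    · rw [coeff_biVar_of_ne _ _ _ h, coeff_biVar_of_ne _ _ _ (fun h' => h (e3.1 h'))]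
  · have h2 : m i = 0 := by
      rw [Finsupp.single_le_iff] at h1
      omega
    by_cases h : m = single i (m i) + single j (m j)
    · rw [coeff_biVar _ _ _ h, if_pos h2]
    · rw [coeff_biVar_of_ne _ _ _ h]

theorem X_mul_biVar' {i j : σ} (hij : i ≠ j) (F : ℕ → ℕ → A) :
    MvPowerSeries.X j * biVar i j F = biVar i j fun r s => if s = 0 then 0 else F r (s - 1) := by
  rw [biVar_swap j i, X_mul_biVar hij.symm, biVar_swap i j]

/-- With `X = t⁻¹` one has `t_i - t_j = (X_j - X_i)/(X_i X_j)`, so this is the RTT relation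
multiplied by `X_i X_j`. Multiplication by a variable shifts one index, and the coefficients give
`SatisfiesRTT`. -/
theorem inVar_rtt {N : ℕ} {t : Fin N → Fin N → ℕ → A} (h0 : ∀ a b, t a b 0 = if a = b then 1 else 0)
    (ht : SatisfiesRTT t) {i j : σ} (hij : i ≠ j) (a b c d : Fin N) :
    (MvPowerSeries.X j - MvPowerSeries.X i) *
        (inVar i (t a b) * inVar j (t c d) - inVar j (t c d) * inVar i (t a b))
      = MvPowerSeries.X i * (MvPowerSeries.X j *
        (inVar j (t c b) * inVar i (t a d) - inVar i (t c b) * inVar j (t a d))) := by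
  rw [inVar_mul_inVar hij, inVar_mul_inVar hij, inVar_mul_inVar' hij, inVar_mul_inVar' hij,
    biVar_sub, biVar_sub, sub_mul, X_mul_biVar hij, X_mul_biVar' hij, X_mul_biVar' hij,
    X_mul_biVar hij, biVar_sub]
  congr 1
  funext r s
  have hc : ∀ (a b : Fin N) (x : A), t a b 0 * x - x * t a b 0 = 0 := by
    intro a b x
    rw [h0]
    split_ifs <;> simp
  have hc' : ∀ (a b : Fin N) (x : A), x * t a b 0 - t a b 0 * x = 0 := by
    intro a b x
    rw [h0]
    split_ifs <;> simp
  -- For `r = 0` or `s = 0` the right side has no coefficient, and what remains on the left is a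
  -- commutator with `T_{ab}^{(0)} = δ_{ab}`.
  rcases r with _ | r <;> rcases s with _ | s
  · simp
  · simp [hc]
  · simp [hc']
  · simpa using ht a b c d r s

end InVar

/-! ## The action on tensor products of localized modules -/

section Action

variable {σ : Type*} {N : ℕ}

theorem algebraMap_X_ne_zero (i : σ) :
    algebraMap (MvPowerSeries σ ℂ) (RatSeries σ) (MvPowerSeries.X i) ≠ 0 := by
  rw [Ne, FaithfulSMul.algebraMap_eq_zero_iff]
  intro h
  have := congrArg (MvPowerSeries.coeff (Finsupp.single i 1)) h
  rw [MvPowerSeries.coeff_index_single_self_X, map_zero] at this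
  exact one_ne_zero this

/-- Either degenerate equation, rewritten in terms of the inverses `X_i`, `X_j` of the variables,
fails at the coefficient of `X_j`. -/
theorem generic_tvar : Generic (tvar : σ → RatSeries σ) := by
  classical
  intro i j hij
  have hi := algebraMap_X_ne_zero i
  have hj := algebraMap_X_ne_zero j
  have hne : (Finsupp.single j 1 : σ →₀ ℕ) ≠ Finsupp.single i 1 := fun h =>
    hij ((Finsupp.single_left_injective one_ne_zero) h).symm
  have h1 : (Finsupp.single i 1 : σ →₀ ℕ) ≠ 0 := by simp
  constructor
  · intro h
    rw [sub_eq_zero, tvar, tvar, inv_inj] at h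
    have h := congrArg (MvPowerSeries.coeff (Finsupp.single j 1))
      (FaithfulSMul.algebraMap_injective (MvPowerSeries σ ℂ) (RatSeries σ) h)
    rw [MvPowerSeries.coeff_X, MvPowerSeries.coeff_X, if_neg hne, if_pos rfl] at h
    exact zero_ne_one h
  · intro h
    -- This is `t_i - t_j + 1 = 0` multiplied by `X_i X_j`.
    have h2 : algebraMap (MvPowerSeries σ ℂ) (RatSeries σ)
        (MvPowerSeries.X j - MvPowerSeries.X i + MvPowerSeries.X i * MvPowerSeries.X j) = 0 := by
      rw [map_add, map_sub, map_mul]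
      rw [tvar, tvar] at h
      field_simp at h
      linear_combination h
    rw [FaithfulSMul.algebraMap_eq_zero_iff] at h2
    have h := congrArg (MvPowerSeries.coeff (Finsupp.single j 1)) h2
    rw [map_add, map_sub, MvPowerSeries.coeff_X, MvPowerSeries.coeff_X, if_neg hne, if_pos rfl,
      MvPowerSeries.X_def, MvPowerSeries.coeff_monomial_mul, if_neg, map_zero] at h
    · norm_num at h
    · intro hle
      have := hle i
      rw [Finsupp.single_eq_same, Finsupp.single_eq_of_ne hij] at this
      omega

theorem X_smul_series (i : σ) (f : MvPowerSeries σ (Yangian N)) :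
    (MvPowerSeries.X i : MvPowerSeries σ ℂ) • f = MvPowerSeries.X i * f := by
  rw [Algebra.smul_def, algebraMap_series, MvPowerSeries.map_X]

theorem inv_sub_inv_smul {F M : Type*} [Field F] [AddCommGroup M] [Module F M] {x y : F}
    (hx : x ≠ 0) (hy : y ≠ 0) {u w : M} (h : y • u - x • u = x • y • w) :
    (x⁻¹ - y⁻¹) • u = w := by
  have e : x⁻¹ - y⁻¹ = (x * y)⁻¹ * (y - x) := by
    field_simp
  rw [e, mul_smul, sub_smul, h, ← mul_smul x y w, inv_smul_smul₀ (mul_ne_zero hx hy)]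

theorem rttFamily_Tmat : RTTFamily (tvar : σ → RatSeries σ) (Tmat N) := by
  intro i j hij a b c d
  have hi := algebraMap_X_ne_zero i
  have hj := algebraMap_X_ne_zero j
  have h := inVar_rtt (σ := σ) (t := Yangian.T (N := N)) Yangian.T_zero Yangian.T_rtt hij a b c d
  rw [← X_smul_series, ← X_smul_series, sub_mul, ← X_smul_series, ← X_smul_series] at h
  have h' := congrArg (fun f => (1 : RatSeries σ) ⊗ₜ[MvPowerSeries σ ℂ] f) h
  simp only [TensorProduct.tmul_sub, TensorProduct.tmul_smul] at h'
  simp only [Tmat, Algebra.TensorProduct.tmul_mul_tmul, mul_one]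
  simp only [← algebraMap_smul (RatSeries σ) (MvPowerSeries.X i : MvPowerSeries σ ℂ),
    ← algebraMap_smul (RatSeries σ) (MvPowerSeries.X j : MvPowerSeries σ ℂ)] at h'
  exact inv_sub_inv_smul hi hj h'

variable {V V₁ V₂ : Type*} [AddCommGroup V] [Module ℂ V] [AddCommGroup V₁] [Module ℂ V₁]
  [AddCommGroup V₂] [Module ℂ V₂]

theorem seriesAct_apply (ρ : Yangian N →ₐ[ℂ] Module.End ℂ V) (f : MvPowerSeries σ (Yangian N))
    (g : VSeries σ V) :
    seriesAct ρ f g = MvPowerSeries.map (ρ : Yangian N →+* Module.End ℂ V) f • g := rfl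

theorem act_tmul (ρ : Yangian N →ₐ[ℂ] Module.End ℂ V) (a : RatSeries σ)
    (f : MvPowerSeries σ (Yangian N)) :
    act ρ (a ⊗ₜ f) = a • (seriesAct ρ f).baseChange (RatSeries σ) := rfl

theorem act_tmul_tmul (ρ : Yangian N →ₐ[ℂ] Module.End ℂ V) (a b : RatSeries σ)
    (f : MvPowerSeries σ (Yangian N)) (g : VSeries σ V) :
    act ρ (a ⊗ₜ f) (b ⊗ₜ g) = (a * b) ⊗ₜ seriesAct ρ f g := by
  rw [act_tmul, LinearMap.smul_apply, LinearMap.baseChange_tmul, TensorProduct.smul_tmul']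
  rfl

theorem pair_tmul_tmul (a b : RatSeries σ) (f : VSeries σ V₁) (g : VSeries σ V₂) :
    pair (a ⊗ₜ f : VRat σ V₁) (b ⊗ₜ g : VRat σ V₂) = (a * b) ⊗ₜ seriesPair V₁ V₂ f g := by
  rw [pair, TensorProduct.AlgebraTensorModule.distribBaseChange_symm_tmul,
    LinearMap.baseChange_tmul, TensorProduct.lift.tmul]

theorem pair_add_left (x x' : VRat σ V₁) (y : VRat σ V₂) : pair (x + x') y = pair x y + pair x' y := by
  simp only [pair, TensorProduct.add_tmul, map_add]

theorem pair_add_right (x : VRat σ V₁) (y y' : VRat σ V₂) : pair x (y + y') = pair x y + pair x y' := by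
  simp only [pair, TensorProduct.tmul_add, map_add]

theorem pair_zero_left (y : VRat σ V₂) : pair (0 : VRat σ V₁) y = 0 := by
  simp only [pair, TensorProduct.zero_tmul, map_zero]

theorem pair_zero_right (x : VRat σ V₁) : pair x (0 : VRat σ V₂) = 0 := by
  simp only [pair, TensorProduct.tmul_zero, map_zero]

/-- The action on the first factor of a tensor product. -/
def leftRep (V₂ : Type*) [AddCommGroup V₂] [Module ℂ V₂] (ρ : Yangian N →ₐ[ℂ] Module.End ℂ V₁) :
    Yangian N →ₐ[ℂ] Module.End ℂ (V₁ ⊗[ℂ] V₂) :=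
  (Module.endTensorEndAlgHom (R := ℂ) (S := ℂ) (A := ℂ) (M := V₁) (N := V₂)).comp
    (Algebra.TensorProduct.includeLeft.comp ρ)

/-- The action on the second factor of a tensor product. -/
def rightRep (V₁ : Type*) [AddCommGroup V₁] [Module ℂ V₁] (ρ : Yangian N →ₐ[ℂ] Module.End ℂ V₂) :
    Yangian N →ₐ[ℂ] Module.End ℂ (V₁ ⊗[ℂ] V₂) :=
  (Module.endTensorEndAlgHom (R := ℂ) (S := ℂ) (A := ℂ) (M := V₁) (N := V₂)).comp
    (Algebra.TensorProduct.includeRight.comp ρ)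

theorem leftRep_tmul (ρ : Yangian N →ₐ[ℂ] Module.End ℂ V₁) (y : Yangian N) (v : V₁) (w : V₂) :
    leftRep V₂ ρ y (v ⊗ₜ w) = ρ y v ⊗ₜ w := rfl

theorem rightRep_tmul (ρ : Yangian N →ₐ[ℂ] Module.End ℂ V₂) (y : Yangian N) (v : V₁) (w : V₂) :
    rightRep V₁ ρ y (v ⊗ₜ w) = v ⊗ₜ ρ y w := rfl

theorem rightRep_mul_leftRep (ρ₁ : Yangian N →ₐ[ℂ] Module.End ℂ V₁)
    (ρ₂ : Yangian N →ₐ[ℂ] Module.End ℂ V₂) (x y : Yangian N) :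
    rightRep V₁ ρ₂ x * leftRep V₂ ρ₁ y = leftRep V₂ ρ₁ y * rightRep V₁ ρ₂ x := by
  refine TensorProduct.ext' fun v w => ?_
  rfl

/-- In `∑_c T_{cb} ⊗ T_{ac}` the inner index joins the second tensor factor to the first. The
coproduct is thus the matrix product of the right action by the left action, in this order. -/
theorem tensorRep_T (ρ₁ : Yangian N →ₐ[ℂ] Module.End ℂ V₁)
    (ρ₂ : Yangian N →ₐ[ℂ] Module.End ℂ V₂) (a b : Fin N) (s : ℕ) :
    tensorRep ρ₁ ρ₂ (Yangian.T a b s) = ∑ c : Fin N, ∑ p ∈ Finset.HasAntidiagonal.antidiagonal s,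
      rightRep V₁ ρ₂ (Yangian.T a c p.1) * leftRep V₂ ρ₁ (Yangian.T c b p.2) := by
  have h : ∀ x y : Yangian N, Module.endTensorEndAlgHom (R := ℂ) (S := ℂ) (A := ℂ) (M := V₁) (N := V₂)
      (ρ₁ x ⊗ₜ ρ₂ y) = rightRep V₁ ρ₂ y * leftRep V₂ ρ₁ x := by
    intro x y
    refine TensorProduct.ext' fun v w => ?_
    rfl
  rw [tensorRep, AlgHom.comp_apply, AlgHom.comp_apply, Yangian.comul, Yangian.lift_T, comulT]
  simp only [map_sum, Algebra.TensorProduct.map_tmul, h]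
  refine Finset.sum_congr rfl fun c _ => ?_
  exact Finset.Nat.sum_antidiagonal_swap
    (f := fun p => rightRep V₁ ρ₂ (Yangian.T a c p.1) * leftRep V₂ ρ₁ (Yangian.T c b p.2))

/-- An instance of the associativity of Cauchy products for compatible pairings. For the other
tensor factor the two series have to be interchanged first. -/
theorem seriesAct_left (ρ : Yangian N →ₐ[ℂ] Module.End ℂ V₁) (f : MvPowerSeries σ (Yangian N))
    (g : VSeries σ V₁) (h : VSeries σ V₂) :
    seriesAct (leftRep V₂ ρ) f (seriesPair V₁ V₂ g h) = seriesPair V₁ V₂ (seriesAct ρ f g) h :=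
  (cauchy_assoc (fun (a : Module.End ℂ V₁) (v : V₁) => a • v) (fun v w => v ⊗ₜ w)
    (fun v w => v ⊗ₜ w) (fun (a : Module.End ℂ V₁) (x : V₁ ⊗[ℂ] V₂) => a.rTensor V₂ x)
    (fun e => TensorProduct.zero_tmul _ e) (fun c c' e => TensorProduct.add_tmul c c' e)
    (fun _ => map_zero _) (fun _ _ _ => map_add _ _ _) (fun _ _ _ => rfl)
    (MvPowerSeries.map (ρ : Yangian N →+* Module.End ℂ V₁) f) g h).symm

theorem cauchy_swap {B C D : Type*} [AddCommMonoid D] (β : B → C → D) (f : (σ →₀ ℕ) → B)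
    (g : (σ →₀ ℕ) → C) : cauchy β f g = cauchy (fun c b => β b c) g f := by
  classical
  funext m
  exact (Finsupp.sum_antidiagonal_swap m fun i j => β (f j) (g i)).symm

theorem seriesAct_right (ρ : Yangian N →ₐ[ℂ] Module.End ℂ V₂) (f : MvPowerSeries σ (Yangian N))
    (g : VSeries σ V₁) (h : VSeries σ V₂) :
    seriesAct (rightRep V₁ ρ) f (seriesPair V₁ V₂ g h) = seriesPair V₁ V₂ g (seriesAct ρ f h) := by
  refine (congrArg (fun x : VSeries σ (V₁ ⊗[ℂ] V₂) => seriesAct (rightRep V₁ ρ) f x)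
    (cauchy_swap (fun (v : V₁) (w : V₂) => v ⊗ₜ[ℂ] w) g h)).trans (Eq.trans ?_
    (cauchy_swap (fun (v : V₁) (w : V₂) => v ⊗ₜ[ℂ] w) g _).symm)
  exact (cauchy_assoc (fun (a : Module.End ℂ V₂) (v : V₂) => a • v) (fun w v => v ⊗ₜ w)
    (fun w v => v ⊗ₜ w) (fun (a : Module.End ℂ V₂) (x : V₁ ⊗[ℂ] V₂) => a.lTensor V₁ x)
    (fun e => TensorProduct.tmul_zero _ e) (fun c c' e => TensorProduct.tmul_add e c c')
    (fun _ => map_zero _) (fun _ _ _ => map_add _ _ _) (fun _ _ _ => rfl)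
    (MvPowerSeries.map (ρ : Yangian N →+* Module.End ℂ V₂) f) h g).symm

theorem act_left (ρ : Yangian N →ₐ[ℂ] Module.End ℂ V₁) (Y : YRat σ N) (x : VRat σ V₁)
    (y : VRat σ V₂) : act (leftRep V₂ ρ) Y (pair x y) = pair (act ρ Y x) y := by
  induction Y using TensorProduct.induction_on with
  | zero => simp only [map_zero, LinearMap.zero_apply, pair_zero_left]
  | add Y Z hY hZ => simp only [map_add, LinearMap.add_apply, hY, hZ, pair_add_left]
  | tmul a f =>
    induction x using TensorProduct.induction_on with
    | zero => simp only [map_zero, pair_zero_left]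
    | add x x' hx hx' => simp only [map_add, pair_add_left, hx, hx']
    | tmul b g =>
      induction y using TensorProduct.induction_on with
      | zero => simp only [map_zero, pair_zero_right]
      | add y y' hy hy' => simp only [map_add, pair_add_right, hy, hy']
      | tmul c h =>
        rw [pair_tmul_tmul, act_tmul_tmul, act_tmul_tmul, pair_tmul_tmul, seriesAct_left, mul_assoc]

theorem act_right (ρ : Yangian N →ₐ[ℂ] Module.End ℂ V₂) (Y : YRat σ N) (x : VRat σ V₁)
    (y : VRat σ V₂) : act (rightRep V₁ ρ) Y (pair x y) = pair x (act ρ Y y) := by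
  induction Y using TensorProduct.induction_on with
  | zero => simp only [map_zero, LinearMap.zero_apply, pair_zero_right]
  | add Y Z hY hZ => simp only [map_add, LinearMap.add_apply, hY, hZ, pair_add_right]
  | tmul a f =>
    induction x using TensorProduct.induction_on with
    | zero => simp only [map_zero, pair_zero_left]
    | add x x' hx hx' => simp only [map_add, pair_add_left, hx, hx']
    | tmul b g =>
      induction y using TensorProduct.induction_on with
      | zero => simp only [map_zero, pair_zero_right]
      | add y y' hy hy' => simp only [map_add, pair_add_right, hy, hy']
      | tmul c h =>
        rw [pair_tmul_tmul, act_tmul_tmul, act_tmul_tmul, pair_tmul_tmul, seriesAct_right,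
          mul_left_comm]

theorem vec_tmul (v₁ : V₁) (v₂ : V₂) :
    (vec (v₁ ⊗ₜ[ℂ] v₂) : VRat σ (V₁ ⊗[ℂ] V₂)) = pair (vec v₁) (vec v₂) := by
  classical
  rw [vec, vec, vec, pair_tmul_tmul, mul_one]
  congr 1
  ext m
  symm
  change cauchy (fun (v : V₁) (w : V₂) => v ⊗ₜ[ℂ] w) (constSeries v₁ : VSeries σ V₁)
    (constSeries v₂ : VSeries σ V₂) m = _
  unfold cauchy constSeries
  split_ifs with h
  · subst h
    rw [Finset.sum_eq_single (0, 0)]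
    · simp
    · rintro ⟨p, q⟩ hp hne
      rw [Finset.HasAntidiagonal.mem_antidiagonal] at hp
      have hp' := add_eq_zero.1 hp
      exact absurd (Prod.ext hp'.1 hp'.2) hne
    · simp
  · refine Finset.sum_eq_zero fun p hp => ?_
    rw [Finset.HasAntidiagonal.mem_antidiagonal] at hp
    by_cases h1 : p.1 = 0
    · by_cases h2 : p.2 = 0
      · rw [h1, h2, add_zero] at hp
        exact absurd hp.symm h
      · simp [h2]
    · simp [h1]

theorem act_Tmat_vec (ρ : Yangian N →ₐ[ℂ] Module.End ℂ V) (v : V) (l : PowerSeries ℂ) (i : σ)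
    (a b : Fin N) (h : ∀ s, ρ (Yangian.T a b s) v = PowerSeries.coeff s l • v) :
    act ρ (Tmat N i a b) (vec v) = evalSeries l i • (vec v : VRat σ V) := by
  classical
  rw [Tmat, vec, act_tmul_tmul, mul_one, evalSeries, algebraMap_smul, ← TensorProduct.tmul_smul,
    seriesAct_apply, map_inVar]
  congr 1
  ext m
  rw [VSeries.smul_apply, VSeries.smul_apply]
  refine Finset.sum_congr rfl fun p _ => ?_
  by_cases h1 : p.1 = Finsupp.single i (p.1 i)
  · rw [h1, coeff_inVar_single, coeff_inVar_single]
    unfold constSeries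
    split_ifs
    · exact h _
    · rw [smul_zero, smul_zero]
  · rw [coeff_inVar_of_ne i _ h1, coeff_inVar_of_ne i _ h1, zero_smul, zero_smul]

theorem seriesAct_comm (ρ ρ' : Yangian N →ₐ[ℂ] Module.End ℂ V)
    (h : ∀ x y, ρ x * ρ' y = ρ' y * ρ x) (f g : MvPowerSeries σ (Yangian N)) (k : VSeries σ V) :
    seriesAct ρ f (seriesAct ρ' g k) = seriesAct ρ' g (seriesAct ρ f k) := by
  classical
  have key : MvPowerSeries.map (ρ : Yangian N →+* Module.End ℂ V) f
        * MvPowerSeries.map (ρ' : Yangian N →+* Module.End ℂ V) g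
      = MvPowerSeries.map (ρ' : Yangian N →+* Module.End ℂ V) g
        * MvPowerSeries.map (ρ : Yangian N →+* Module.End ℂ V) f := by
    ext1 m
    simp only [MvPowerSeries.coeff_mul, MvPowerSeries.coeff_map]
    refine (Finsupp.sum_antidiagonal_swap m fun i j => ρ (MvPowerSeries.coeff j f)
      * ρ' (MvPowerSeries.coeff i g)).symm.trans ?_
    exact Finset.sum_congr rfl fun p _ => h _ _
  simp only [seriesAct_apply]
  rw [← mul_smul, key, mul_smul]

theorem act_comm (ρ ρ' : Yangian N →ₐ[ℂ] Module.End ℂ V)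
    (h : ∀ x y, ρ x * ρ' y = ρ' y * ρ x) (Y Z : YRat σ N) :
    act ρ Y * act ρ' Z = act ρ' Z * act ρ Y := by
  induction Y using TensorProduct.induction_on with
  | zero => simp only [map_zero, zero_mul, mul_zero]
  | add Y Y' hY hY' => simp only [map_add, add_mul, mul_add, hY, hY']
  | tmul a f =>
    induction Z using TensorProduct.induction_on with
    | zero => simp only [map_zero, zero_mul, mul_zero]
    | add Z Z' hZ hZ' => simp only [map_add, add_mul, mul_add, hZ, hZ']
    | tmul b g =>
      refine LinearMap.ext fun x => ?_
      induction x using TensorProduct.induction_on with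
      | zero => simp only [map_zero]
      | add x x' hx hx' => simp only [map_add, hx, hx']
      | tmul c k =>
        simp only [Module.End.mul_apply, act_tmul_tmul]
        rw [mul_left_comm, seriesAct_comm ρ ρ' h]

theorem seriesAct_inVar_eq_sum {ι : Type*} [Fintype ι] (τ ρ ρ' : Yangian N →ₐ[ℂ] Module.End ℂ V)
    (t : ℕ → Yangian N) (x y : ι → ℕ → Yangian N)
    (h : ∀ s, τ (t s)
      = ∑ c, ∑ p ∈ Finset.HasAntidiagonal.antidiagonal s, ρ (x c p.1) * ρ' (y c p.2))
    (i : σ) (k : VSeries σ V) :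
    seriesAct τ (inVar i t) k
      = ∑ c, seriesAct ρ (inVar i (x c)) (seriesAct ρ' (inVar i (y c)) k) := by
  simp only [seriesAct_apply, ← mul_smul, ← Finset.sum_smul, map_inVar, inVar_mul_inVar_self,
    sum_inVar]
  congr 1
  exact congrArg (inVar i) (funext h)

theorem Tmat_map_tensorRep (ρ₁ : Yangian N →ₐ[ℂ] Module.End ℂ V₁)
    (ρ₂ : Yangian N →ₐ[ℂ] Module.End ℂ V₂) (i : σ) :
    (Tmat N i).map (act (tensorRep ρ₁ ρ₂))
      = (Tmat N i).map (act (rightRep V₁ ρ₂)) * (Tmat N i).map (act (leftRep V₂ ρ₁)) := by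
  refine Matrix.ext fun a b => ?_
  rw [Matrix.mul_apply]
  simp only [Matrix.map_apply]
  refine LinearMap.ext fun x => ?_
  rw [LinearMap.sum_apply]
  induction x using TensorProduct.induction_on with
  | zero => simp only [map_zero, Finset.sum_const_zero]
  | add x x' hx hx' => simp only [map_add, hx, hx', Finset.sum_add_distrib]
  | tmul c h =>
    simp only [Module.End.mul_apply, Tmat, act_tmul_tmul, one_mul]
    rw [← TensorProduct.tmul_sum]
    congr 1
    exact seriesAct_inVar_eq_sum _ _ _ _ _ _ (tensorRep_T ρ₁ ρ₂ a b) i h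

end Action

/-! ## The expansion on a vector -/

section Vector

variable {n : ℕ} {K M : Type*} [Field K] [AddCommGroup M] [Module K M]

theorem expansion_mul {A : Type*} [Ring A] [Algebra K A] (ξ : Fin n → ℕ) (z : Pos ξ → K)
    (T₁ T₂ : Pos ξ → Matrix (Fin (n + 1)) (Fin (n + 1)) A) (l₁ l₂ : Fin (n + 1) → Pos ξ → K)
    (v w : A) : expansion ξ z T₁ T₂ l₁ l₂ (v * w) = expansion ξ z T₁ T₂ l₁ l₂ v * w := by
  simp only [expansion, Finset.sum_mul, smul_mul_assoc, mul_assoc]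

/-- The algebraic version speaks of an element of the algebra instead of a vector. A rank one
operator with image spanned by `w` satisfies the same annihilation and eigenvalue conditions and
sends `w` to itself. -/
theorem gB_apply_eq_expansion [CharZero K] (ξ : Fin n → ℕ) (z : Pos ξ → K) (hz : Generic z)
    (T₁ T₂ : Pos ξ → Matrix (Fin (n + 1)) (Fin (n + 1)) (Module.End K M)) (h₁ : RTTFamily z T₁)
    (h₂ : RTTFamily z T₂) (h₁₂ : ∀ p q a b c d, T₂ p a b * T₁ q c d = T₁ q c d * T₂ p a b)
    (w : M) (l₁ l₂ : Fin (n + 1) → Pos ξ → K) (hw₁ : ∀ p a b, a < b → T₁ p b a w = 0)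
    (hw₂ : ∀ p a b, a < b → T₂ p b a w = 0) (hl₁ : ∀ p a, T₁ p a a w = l₁ a p • w)
    (hl₂ : ∀ p a, T₂ p a a w = l₂ a p • w) :
    gB ξ (fun p => T₂ p * T₁ p) z w = expansion ξ z T₁ T₂ l₁ l₂ 1 w := by
  by_cases hw : w = 0
  · rw [hw, map_zero, map_zero]
  -- A functional with `f w = 1`, which exists because `w ≠ 0` over a field.
  · obtain ⟨f, hf⟩ := LinearMap.exists_leftInverse_of_injective (LinearMap.toSpanSingleton K M w)
      (LinearMap.ker_toSpanSingleton K hw)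
    have hfw : f w = 1 := by
      have := LinearMap.congr_fun hf 1
      simpa using this
    have hv : ∀ T : Module.End K M, ∀ x, (T * f.smulRight w) x = f x • T w := by
      intro T x
      rw [Module.End.mul_apply, LinearMap.smulRight_apply, map_smul]
    have key := gB_mul_eq_expansion ξ z hz T₁ T₂ h₁ h₂ h₁₂ (f.smulRight w) l₁ l₂
      (fun p a b hab => LinearMap.ext fun x => by rw [hv, hw₁ p a b hab, smul_zero]; rfl)
      (fun p a b hab => LinearMap.ext fun x => by rw [hv, hw₂ p a b hab, smul_zero]; rfl)
      (fun p a => LinearMap.ext fun x => by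
        rw [hv, hl₁, LinearMap.smul_apply, LinearMap.smulRight_apply, smul_comm])
      (fun p a => LinearMap.ext fun x => by
        rw [hv, hl₂, LinearMap.smul_apply, LinearMap.smulRight_apply, smul_comm])
    have hvw : (f.smulRight w : Module.End K M) w = w := by
      rw [LinearMap.smulRight_apply, hfw, one_smul]
    rw [← one_mul (f.smulRight w : Module.End K M), expansion_mul] at key
    have := LinearMap.congr_fun key w
    rwa [one_mul, Module.End.mul_apply, Module.End.mul_apply, hvw] at this

end Vector

/-! ### Back to modules over the Yangian -/

section Transfer

variable {n : ℕ} {σ V : Type*} [AddCommGroup V] [Module ℂ V]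

theorem act_bethe (ρ : Yangian (n + 1) →ₐ[ℂ] Module.End ℂ V) (ξ : Fin n → ℕ) (τ : Pos ξ → σ) :
    act ρ (bethe ξ τ) = gB ξ (fun p => (Tmat (n + 1) (τ p)).map (act ρ)) fun p => tvar (τ p) := by
  rw [bethe_eq_gB]
  exact map_gB (K := RatSeries σ) (A := YRat σ (n + 1)) (B := Module.End (RatSeries σ) (VRat σ V))
    (act ρ) ξ _ _

theorem charZero_ratSeries (σ : Type*) : CharZero (RatSeries σ) :=
  charZero_of_injective_ringHom
    ((algebraMap (MvPowerSeries σ ℂ) (RatSeries σ)).comp MvPowerSeries.C).injective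

theorem rttFamily_act (ρ : Yangian (n + 1) →ₐ[ℂ] Module.End ℂ V) :
    RTTFamily (tvar : σ → RatSeries σ) fun i => (Tmat (n + 1) i).map (act ρ) := by
  intro i j hij a b c d
  have h := congrArg (act ρ) (rttFamily_Tmat (N := n + 1) i j hij a b c d)
  rw [map_smul, map_sub, map_sub, map_mul, map_mul, map_mul, map_mul] at h
  exact h

theorem IsWeightSingular.leftRep {N : ℕ} {V₁ V₂ : Type*} [AddCommGroup V₁] [Module ℂ V₁]
    [AddCommGroup V₂] [Module ℂ V₂] {ρ : Yangian N →ₐ[ℂ] Module.End ℂ V₁} {v : V₁}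
    {l : Fin N → PowerSeries ℂ} (h : IsWeightSingular ρ v l) (w : V₂) :
    IsWeightSingular (leftRep V₂ ρ) (v ⊗ₜ[ℂ] w) l where
  singular a b hab s := by rw [leftRep_tmul, h.singular a b hab, TensorProduct.zero_tmul]
  eigen a s := by rw [leftRep_tmul, h.eigen, TensorProduct.smul_tmul']

theorem IsWeightSingular.rightRep {N : ℕ} {V₁ V₂ : Type*} [AddCommGroup V₁] [Module ℂ V₁]
    [AddCommGroup V₂] [Module ℂ V₂] {ρ : Yangian N →ₐ[ℂ] Module.End ℂ V₂} {w : V₂}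
    {l : Fin N → PowerSeries ℂ} (h : IsWeightSingular ρ w l) (v : V₁) :
    IsWeightSingular (rightRep V₁ ρ) (v ⊗ₜ[ℂ] w) l where
  singular a b hab s := by rw [rightRep_tmul, h.singular a b hab, TensorProduct.tmul_zero]
  eigen a s := by rw [rightRep_tmul, h.eigen, TensorProduct.tmul_smul]

theorem IsWeightSingular.act_eq_zero {N : ℕ} {ρ : Yangian N →ₐ[ℂ] Module.End ℂ V} {v : V}
    {l : Fin N → PowerSeries ℂ} (h : IsWeightSingular ρ v l) (i : σ) {a b : Fin N} (hab : a < b) :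
    act ρ (Tmat N i b a) (vec v) = 0 := by
  rw [act_Tmat_vec ρ v 0 i b a fun s => by rw [h.singular a b hab, map_zero, zero_smul]]
  have : inVar i (fun s => PowerSeries.coeff s (0 : PowerSeries ℂ)) = 0 := by
    ext m
    by_cases h : m = Finsupp.single i (m i)
    · rw [h, coeff_inVar_single, map_zero, map_zero]
    · rw [coeff_inVar_of_ne i _ h, map_zero]
  rw [evalSeries, this, map_zero, zero_smul]

theorem IsWeightSingular.act_eq_smul {N : ℕ} {ρ : Yangian N →ₐ[ℂ] Module.End ℂ V} {v : V}
    {l : Fin N → PowerSeries ℂ} (h : IsWeightSingular ρ v l) (i : σ) (a : Fin N) :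
    act ρ (Tmat N i a a) (vec v) = evalSeries (l a) i • (vec v : VRat σ V) :=
  act_Tmat_vec ρ v (l a) i a a (h.eigen a)

theorem gB_mul_gB_vec {V₁ V₂ : Type*} [AddCommGroup V₁] [Module ℂ V₁]
    [AddCommGroup V₂] [Module ℂ V₂] (ρ₁ : Yangian (n + 1) →ₐ[ℂ] Module.End ℂ V₁)
    (ρ₂ : Yangian (n + 1) →ₐ[ℂ] Module.End ℂ V₂) (v₁ : V₁) (v₂ : V₂) (η ζ : Fin n → ℕ)
    (τ₁ : Pos η → σ) (τ₂ : Pos ζ → σ) :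
    (gB η (fun p => (Tmat (n + 1) (τ₁ p)).map (act (leftRep V₂ ρ₁))) (fun p => tvar (τ₁ p)) *
        gB ζ (fun p => (Tmat (n + 1) (τ₂ p)).map (act (rightRep V₁ ρ₂))) (fun p => tvar (τ₂ p)))
        (vec (v₁ ⊗ₜ[ℂ] v₂))
      = pair (act ρ₁ (bethe η τ₁) (vec v₁)) (act ρ₂ (bethe ζ τ₂) (vec v₂)) := by
  rw [← act_bethe, ← act_bethe, Module.End.mul_apply, vec_tmul, act_right, act_left]

theorem act_tensorRep_bethe {V₁ V₂ : Type*} [AddCommGroup V₁] [Module ℂ V₁]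
    [AddCommGroup V₂] [Module ℂ V₂] (ρ₁ : Yangian (n + 1) →ₐ[ℂ] Module.End ℂ V₁)
    (ρ₂ : Yangian (n + 1) →ₐ[ℂ] Module.End ℂ V₂) (ξ : Fin n → ℕ) (τ : Pos ξ → σ) :
    act (tensorRep ρ₁ ρ₂) (bethe ξ τ)
      = gB ξ (fun p => (Tmat (n + 1) (τ p)).map (act (rightRep V₁ ρ₂))
          * (Tmat (n + 1) (τ p)).map (act (leftRep V₂ ρ₁))) fun p => tvar (τ p) := by
  rw [act_bethe]
  simp only [Tmat_map_tensorRep]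

theorem expansion_one_apply {K M : Type*} [Field K] [AddCommGroup M] [Module K M] (ξ : Fin n → ℕ)
    (z : Pos ξ → K) (T₁ T₂ : Pos ξ → Matrix (Fin (n + 1)) (Fin (n + 1)) (Module.End K M))
    (l₁ l₂ : Fin (n + 1) → Pos ξ → K) (w : M) :
    expansion ξ z T₁ T₂ l₁ l₂ 1 w = ∑ η : Set.Iic ξ,
      (∏ a : Fin n, (1 : K) / ((ξ a - η.1 a)! * (η.1 a)!)) •
      ∑ π : (a : Fin n) → Equiv.Perm (Fin (ξ a)),
        (∏ a : Fin n, W (ξ a) fun i => z (permute ξ π ⟨a, i⟩)) •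
          (crossScalar ξ η.1 (z ∘ permute ξ π)
            * eigenScalar ξ η.1 (fun a => l₁ a ∘ permute ξ π) fun a => l₂ a ∘ permute ξ π) •
          (gB η.1 (T₁ ∘ permute ξ π ∘ lower η.2) (z ∘ permute ξ π ∘ lower η.2)
            * gB (ξ - η.1) (T₂ ∘ permute ξ π ∘ upper η.2) (z ∘ permute ξ π ∘ upper η.2)) w := by
  simp only [expansion, LinearMap.sum_apply, LinearMap.smul_apply, mul_one]

theorem act_tensorRep_bethe_vec {V₁ V₂ : Type*} [AddCommGroup V₁] [Module ℂ V₁]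
    [AddCommGroup V₂] [Module ℂ V₂] (ρ₁ : Yangian (n + 1) →ₐ[ℂ] Module.End ℂ V₁)
    (ρ₂ : Yangian (n + 1) →ₐ[ℂ] Module.End ℂ V₂) (v₁ : V₁) (v₂ : V₂)
    (l₁ l₂ : Fin (n + 1) → PowerSeries ℂ) (h₁ : IsWeightSingular ρ₁ v₁ l₁)
    (h₂ : IsWeightSingular ρ₂ v₂ l₂) (ξ : Fin n → ℕ) :
    act (tensorRep ρ₁ ρ₂) (bethe ξ id) (vec (v₁ ⊗ₜ[ℂ] v₂))
      = expansion ξ tvar (fun p => (Tmat (n + 1) p).map (act (leftRep V₂ ρ₁)))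
        (fun p => (Tmat (n + 1) p).map (act (rightRep V₁ ρ₂))) (fun a => evalSeries (l₁ a))
        (fun a => evalSeries (l₂ a)) 1 (vec (v₁ ⊗ₜ[ℂ] v₂)) := by
  have := charZero_ratSeries (Pos ξ)
  have hL := h₁.leftRep v₂
  have hR := h₂.rightRep v₁
  rw [act_tensorRep_bethe]
  exact gB_apply_eq_expansion ξ tvar generic_tvar _ _ (rttFamily_act _) (rttFamily_act _)
    (fun p q a b c d => act_comm _ _ (rightRep_mul_leftRep ρ₁ ρ₂) (Tmat (n + 1) p a b)
      (Tmat (n + 1) q c d)) _ _ _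
    (fun p a b hab => hL.act_eq_zero p hab) (fun p a b hab => hR.act_eq_zero p hab)
    (fun p a => hL.act_eq_smul p a) (fun p a => hR.act_eq_smul p a)

end Transfer

end YangianBethe

end

open YangianBethe in
theorem theorem3p5 {n : ℕ} {V₁ V₂ : Type*} [AddCommGroup V₁] [Module ℂ V₁]
    [AddCommGroup V₂] [Module ℂ V₂]
    (ρ₁ : Yangian (n + 1) →ₐ[ℂ] Module.End ℂ V₁) (ρ₂ : Yangian (n + 1) →ₐ[ℂ] Module.End ℂ V₂)
    (v₁ : V₁) (v₂ : V₂) (l₁ l₂ : Fin (n + 1) → PowerSeries ℂ)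
    (h₁ : IsWeightSingular ρ₁ v₁ l₁) (h₂ : IsWeightSingular ρ₂ v₂ l₂) (ξ : Fin n → ℕ) :
    act (tensorRep ρ₁ ρ₂) (bethe ξ id) (vec (v₁ ⊗ₜ[ℂ] v₂))
      = ∑ η : Set.Iic ξ,
          (∏ a : Fin n, (1 : RatSeries (Pos ξ)) / ((ξ a - η.1 a)! * (η.1 a)!)) •
            SymBar ξ fun τ =>
              (crossFactor ξ η.1 τ * eigenFactor ξ η.1 l₁ l₂ τ) •
                pair (act ρ₁ (bethe η.1 (τ ∘ lower η.2)) (vec v₁))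
                  (act ρ₂ (bethe (ξ - η.1) (τ ∘ upper η.2)) (vec v₂)) := by
  rw [act_tensorRep_bethe_vec ρ₁ ρ₂ v₁ v₂ l₁ l₂ h₁ h₂ ξ, expansion_one_apply]
  refine Finset.sum_congr rfl fun η _ => congrArg _ (Finset.sum_congr rfl fun π _ => ?_)
  -- `SymBar`, `crossFactor` and `eigenFactor` unfold to the sums and scalars of `expansion` at the
  -- permuted variables; only the product of Bethe functions has to be recognized as a tensor
  -- product.
  exact congrArg (fun x => _ • _ • x) (gB_mul_gB_vec ρ₁ ρ₂ v₁ v₂ η.1 (ξ - η.1)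
    (permute ξ π ∘ lower η.2) (permute ξ π ∘ upper η.2))
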